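/- **Setting.** A (planar) complex $\mathcal C$ is a finite abstract simplicial complex whose points lie in $\mathbb R^2$; each simplex $\Psi$ (a nonempty finite set of points) is realized by its convex hull $\mathrm{CH}(\Psi)$. Simplices are closed under nonempty subsets and affinely independent, and $\mathrm{CH}(\Psi)\cap\mathrm{CH}(\Upsilon)=\mathrm{CH}(\Psi\cap\Upsilon)$ whenever $\Psi\cap\Upsilon\ne\emptyset$ (simplices without a common vertex may cross). Two simplices are adjacent if one contains the other; $\mathcal C$ is connected if any two simplices are joined by a chain of adjacent ones. $|\mathcal C|$ is the number of simplices. A path in $\mathcal C$ from a vertex $s$ to a vertex $t$ is a continuous curve $\pi:[0,1]\to\mathbb R^2$ together with a function $\varphi$ from $[0,1]$ to the simplices such that $\varphi(0)=\{s\}$, $\varphi(1)=\{t\}$; each $\varphi^{-1}(\Delta)$ is a finite union of open intervals and points; two simplices that are the only values of $\varphi$ on some interval are adjacent; and, for every $\tau$, $\varphi(\tau)$ is a simplex whose hull contains $\pi(\tau)$ while the hull of none of its proper faces does. A motion for $(\mathcal C_i,s_i,t_i)_{i\le k}$ consists of paths $\pi_i$ in $\mathcal C_i$ from $s_i$ to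 $t_i$ and reparameterizations $\rho_i$, i.e. continuous maps $[0,1]\to[0,1]$ with $\rho_i(0)=0$, $\rho_i(1)=1$ (not necessarily injective). Its cost is $$\max_{\tau\in[0,1]}\ \mathrm{perimeter}\bigl(\mathrm{CH}\{\pi_1(\rho_1(\tau)),\dots,\pi_k(\rho_k(\tau))\}\bigr),$$ where the perimeter of a segment is twice its length and that of a point is $0$. **Model of computation.** A program (with possibly recursive procedures) for a random access machine with arrays of natural numbers (addition, truncated subtraction, comparison, indirect addressing) and arrays of reals (copying and comparison), each elementary command or test taking one step. In addition there is a one-step instruction which, given a cell $(\Delta_1,\dots,\Delta_k)\in\mathcal C_1\times\dots\times\mathcal C_k$, returns the minimum of the perimeter of $\mathrm{CH}\{p_1,\dots,p_k\}$ over all $p_i\in\mathrm{CH}(\Delta_i)$, and points $p_i$ attaining it. Complexes are given by numbering their simplices and listing, for each simplex, its proper faces, and for each vertex, its coordinates. **Lemma.** For every $k$ there are a program and a constant $K$ (depending only on $k$) such that for all connected planar complexes $\mathcal C_1,\dots,\mathcal C_k$, with $n=\max_i|\mathcal C_i|$, and all start vertices $s_i$ and end vertices $t_i$ of $\mathcal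 C_i$, the program halts after at most $K n^k$ steps and outputs a motion whose cost is minimum among all motions for $(\mathcal C_i,s_i,t_i)_{i\le k}$. The output consists of polygonal paths with a common number of segments, in synchronized parameterization (the reparameterizations are the identity), together with a simplex of $\mathcal C_i$ carrying each segment of the $i$-th path. -/

import Mathlib

open Set

/-! ## Complexes in the plane -/

/-- The Euclidean plane. -/
abbrev Plane : Type := EuclideanSpace ℝ (Fin 2)

/-- A (finite) planar complex: an abstract simplicial complex whose points lie in the plane, each
simplex being realized by the convex hull of its points. Simplices are nonempty, closed under
taking nonempty subsets (both by `PreAbstractSimplicialComplex`) and affinely independent, and the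
realization is locally consistent. Realizations of simplices without a common vertex may
cross. -/
structure PlaneComplex extends PreAbstractSimplicialComplex Plane where
  finite_faces : faces.Finite
  indep : ∀ Ψ ∈ faces, AffineIndependent ℝ ((↑) : Ψ → Plane)
  locally_consistent : ∀ Ψ ∈ faces, ∀ Υ ∈ faces, ((Ψ : Set Plane) ∩ Υ).Nonempty →
    convexHull ℝ (Ψ : Set Plane) ∩ convexHull ℝ (Υ : Set Plane) =
      convexHull ℝ ((Ψ : Set Plane) ∩ Υ)

/-- Two simplices are adjacent if one of them is a face of the other. -/
def AdjacentSimplices (Ψ Υ : Finset Plane) : Prop := Ψ ⊆ Υ ∨ Υ ⊆ Ψ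

namespace PlaneComplex

/-- The number of simplices. -/
noncomputable def size (C : PlaneComplex) : ℕ := C.faces.ncard

/-- Any two simplices are joined by a sequence of consecutively adjacent simplices. -/
def IsConnected (C : PlaneComplex) : Prop :=
  ∀ Ψ ∈ C.faces, ∀ Υ ∈ C.faces,
    Relation.ReflTransGen (fun A B => A ∈ C.faces ∧ B ∈ C.faces ∧ AdjacentSimplices A B) Ψ Υ

/-- A simplicial path, parameterized over `[0,1]`. -/
structure IsSimplicialPath (C : PlaneComplex) (φ : ℝ → Finset Plane) : Prop where
  mem_faces : ∀ t ∈ Icc (0 : ℝ) 1, φ t ∈ C.faces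
  finite_pieces : ∀ Δ ∈ C.faces, ∃ (I : Finset (ℝ × ℝ)) (S : Finset ℝ),
    {t ∈ Icc (0 : ℝ) 1 | φ t = Δ} = (⋃ J ∈ I, Ioo J.1 J.2) ∪ (S : Set ℝ)
  adjacent : ∀ x y : ℝ, 0 ≤ x → x ≤ y → y ≤ 1 → ∀ Δ Ψ : Finset Plane,
    φ '' Icc x y = {Δ, Ψ} → AdjacentSimplices Δ Ψ

/-- `π` is a curve in the complex from the vertex `s` to the vertex `t` that realizes the
simplicial path `φ`: at each time, `φ` is the simplex that contains the point while none of its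
proper faces does. -/
structure IsPath (C : PlaneComplex) (s t : Plane) (π : ℝ → Plane) (φ : ℝ → Finset Plane) :
    Prop where
  continuousOn : ContinuousOn π (Icc 0 1)
  simplicial : C.IsSimplicialPath φ
  mem_cell : ∀ τ ∈ Icc (0 : ℝ) 1, π τ ∈ convexHull ℝ (φ τ : Set Plane)
  minimal : ∀ τ ∈ Icc (0 : ℝ) 1, ∀ Ψ ∈ C.faces, Ψ ⊂ φ τ → π τ ∉ convexHull ℝ (Ψ : Set Plane)
  start_eq : φ 0 = {s}
  target_eq : φ 1 = {t}

end PlaneComplex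

/-! ## The perimeter of the convex hull -/

/-- Twice the signed area of the triangle `a b c`; positive iff `c` is strictly to the left of the
line directed from `a` to `b`. -/
noncomputable def signedArea₂ (a b c : Plane) : ℝ :=
  (b 0 - a 0) * (c 1 - a 1) - (b 1 - a 1) * (c 0 - a 0)

/-- The segment directed from `a` to `b` is a counterclockwise boundary edge of the convex hull
of `P`: every point of `P` is on the segment or strictly to its left. -/
def IsHullEdge (P : Finset Plane) (a b : Plane) : Prop :=
  ∀ c ∈ P, c ∈ segment ℝ a b ∨ 0 < signedArea₂ a b c

open scoped Classical in
/-- The perimeter of the convex hull of a finite set of points: the sum of the lengths of its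
counterclockwise edges. If the hull is a segment, both orientations of it are edges, so that the
value is twice its length. -/
noncomputable def hullPerimeter (P : Finset Plane) : ℝ :=
  ∑ e ∈ (P ×ˢ P).filter (fun e => IsHullEdge P e.1 e.2), dist e.1 e.2

open scoped Classical in
/-- The perimeter of the convex hull of the positions of `k` agents. -/
noncomputable def configPerimeter {k : ℕ} (p : Fin k → Plane) : ℝ :=
  hullPerimeter (Finset.univ.image p)

/-! ## Motions -/

/-- A reparameterization; it need not be injective, so agents may also walk backwards. -/
structure IsReparam (ρ : ℝ → ℝ) : Prop where
  continuousOn : ContinuousOn ρ (Icc 0 1)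
  mapsTo : MapsTo ρ (Icc 0 1) (Icc 0 1)
  zero : ρ 0 = 0
  one : ρ 1 = 1

/-- A motion of `k` agents, the `i`-th one along the curve `π i` in the complex `C i` from `s i`
to `t i`, with reparameterization `ρ i`. -/
def IsMotion {k : ℕ} (C : Fin k → PlaneComplex) (s t : Fin k → Plane) (π : Fin k → ℝ → Plane)
    (φ : Fin k → ℝ → Finset Plane) (ρ : Fin k → ℝ → ℝ) : Prop :=
  ∀ i, (C i).IsPath (s i) (t i) (π i) (φ i) ∧ IsReparam (ρ i)

/-- The set of values taken by the perimeter during a motion. -/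
def perimeterValues {k : ℕ} (π : Fin k → ℝ → Plane) (ρ : Fin k → ℝ → ℝ) : Set ℝ :=
  (fun τ : ℝ => configPerimeter (fun i => π i (ρ i τ))) '' Icc 0 1

/-- A motion that minimizes the maximum perimeter, among all motions with the given end
vertices. The maximum perimeter `v` of the motion is attained, and every motion attains a perimeter
of at least `v`. -/
def IsOptimalMotion {k : ℕ} (C : Fin k → PlaneComplex) (s t : Fin k → Plane)
    (π : Fin k → ℝ → Plane) (φ : Fin k → ℝ → Finset Plane) (ρ : Fin k → ℝ → ℝ) : Prop :=
  IsMotion C s t π φ ρ ∧ ∃ v, IsGreatest (perimeterValues π ρ) v ∧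
    ∀ π' φ' ρ', IsMotion C s t π' φ' ρ' → ∃ w ∈ perimeterValues π' ρ', v ≤ w

/-! ## The machine

A random access machine whose memory consists of arrays of natural numbers and arrays of real
numbers; a program names finitely many of them. Naturals are added, subtracted (with truncation),
compared and used as indices; reals are only copied and compared. All other work with reals
is done by an instruction that minimizes the perimeter over one cell. -/

/-- Names of the arrays of naturals. The first five hold the input, the next two hold the output,
and the last ones are for free use. -/
inductive NatArray (k : ℕ) : Type
  | size | start | target | faceCount (i : Fin k) | face (i : Fin k)
  | outLength | outCell (i : Fin k)
  | work (j : ℕ)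
  deriving DecidableEq

/-- Names of the arrays of reals: coordinates in the input, coordinates in the output, and arrays
for free use. -/
inductive RealArray (k : ℕ) : Type
  | inX (i : Fin k) | inY (i : Fin k)
  | outX (i : Fin k) | outY (i : Fin k)
  | work (j : ℕ)
  deriving DecidableEq

/-- The contents of the memory. -/
structure Memory (k : ℕ) : Type where
  nat : NatArray k → ℕ → ℕ
  real : RealArray k → ℕ → ℝ

namespace Memory

/-- Write the natural `v` to position `i` of array `a`. -/
def setNat {k : ℕ} (σ : Memory k) (a : NatArray k) (i v : ℕ) : Memory k :=
  { σ with nat := fun b j => if b = a ∧ j = i then v else σ.nat b j }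

/-- Write the real `v` to position `i` of array `a`. -/
def setReal {k : ℕ} (σ : Memory k) (a : RealArray k) (i : ℕ) (v : ℝ) : Memory k :=
  { σ with real := fun b j => if b = a ∧ j = i then v else σ.real b j }

/-- Write the reals `v 0, …, v (k-1)` to the first `k` positions of array `a`. -/
def setBlock {k : ℕ} (σ : Memory k) (a : RealArray k) (v : Fin k → ℝ) : Memory k :=
  { σ with real := fun b j => if h : b = a ∧ j < k then v ⟨j, h.2⟩ else σ.real b j }

end Memory

/-- Expressions with natural values; `get a e` is the entry of array `a` at the index `e`. -/
inductive NatExpr (k : ℕ) : Type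
  | const (n : ℕ)
  | get (a : NatArray k) (e : NatExpr k)
  | add (e f : NatExpr k)
  | sub (e f : NatExpr k)

/-- The value of an expression. -/
def NatExpr.eval {k : ℕ} (σ : Memory k) : NatExpr k → ℕ
  | const n => n
  | get a e => σ.nat a (e.eval σ)
  | add e f => e.eval σ + f.eval σ
  | sub e f => e.eval σ - f.eval σ

/-- Conditions: comparisons of naturals, comparisons of two entries of real arrays, and Boolean
combinations. -/
inductive Cond (k : ℕ) : Type
  | natEq (e f : NatExpr k)
  | natLt (e f : NatExpr k)
  | realLe (a : RealArray k) (e : NatExpr k) (b : RealArray k) (f : NatExpr k)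
  | neg (c : Cond k)
  | conj (c d : Cond k)

/-- The truth of a condition. -/
def Cond.Holds {k : ℕ} (σ : Memory k) : Cond k → Prop
  | natEq e f => e.eval σ = f.eval σ
  | natLt e f => e.eval σ < f.eval σ
  | realLe a e b f => σ.real a (e.eval σ) ≤ σ.real b (f.eval σ)
  | neg c => ¬ c.Holds σ
  | conj c d => c.Holds σ ∧ d.Holds σ

/-- Commands. `copyReal a e b f` sets entry `e` of array `a` to entry `f` of array `b`.
`minimize q x y v` minimizes the perimeter over the cell whose `k` simplex numbers are
stored in array `q`; it writes the minimizing points to arrays `x` and `y` (first and second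
coordinates) and the minimum perimeter to position `0` of array `v`. `call j` runs the `j`-th
procedure of the program. -/
inductive Cmd (k : ℕ) : Type
  | skip
  | setNat (a : NatArray k) (e f : NatExpr k)
  | copyReal (a : RealArray k) (e : NatExpr k) (b : RealArray k) (f : NatExpr k)
  | minimize (q : NatArray k) (x y v : RealArray k)
  | seq (c d : Cmd k)
  | ite (b : Cond k) (c d : Cmd k)
  | while (b : Cond k) (c : Cmd k)
  | call (j : ℕ)

/-- A program: finitely many (parameterless, possibly recursive) procedures and a main command. -/
structure Program (k : ℕ) : Type where
  procs : List (Cmd k)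
  main : Cmd k

/-- A subroutine for single cells: it is given the numbers of `k` simplices and returns `k`
points. -/
abbrev CellSolver (k : ℕ) : Type := (Fin k → ℕ) → Fin k → Plane

/-- The effect of the instruction `minimize q x y v`. -/
noncomputable def Memory.minimize {k : ℕ} (Ω : CellSolver k) (σ : Memory k) (q : NatArray k)
    (x y v : RealArray k) : Memory k :=
  let p := Ω (fun i => σ.nat q i)
  ((σ.setBlock x (fun i => p i 0)).setBlock y (fun i => p i 1)).setReal v 0 (configPerimeter p)

/-- `Exec Ω procs c σ T σ'`: run on the memory `σ`, the command `c` halts after `T` steps with the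
memory `σ'`. Each assignment, test, call and cell minimization is one step. (The expressions in a
fixed program have bounded size, so this counts operations up to a constant factor.) -/
inductive Exec {k : ℕ} (Ω : CellSolver k) (procs : List (Cmd k)) :
    Cmd k → Memory k → ℕ → Memory k → Prop
  | skip (σ) : Exec Ω procs .skip σ 1 σ
  | setNat (σ a e f) : Exec Ω procs (.setNat a e f) σ 1 (σ.setNat a (e.eval σ) (f.eval σ))
  | copyReal (σ a e b f) :
      Exec Ω procs (.copyReal a e b f) σ 1 (σ.setReal a (e.eval σ) (σ.real b (f.eval σ)))
  | minimize (σ q x y v) : Exec Ω procs (.minimize q x y v) σ 1 (σ.minimize Ω q x y v)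
  | seq {c d σ T σ' T' σ''} : Exec Ω procs c σ T σ' → Exec Ω procs d σ' T' σ'' →
      Exec Ω procs (.seq c d) σ (T + T') σ''
  | iteTrue {b c d σ T σ'} : b.Holds σ → Exec Ω procs c σ T σ' →
      Exec Ω procs (.ite b c d) σ (T + 1) σ'
  | iteFalse {b c d σ T σ'} : ¬ b.Holds σ → Exec Ω procs d σ T σ' →
      Exec Ω procs (.ite b c d) σ (T + 1) σ'
  | whileTrue {b c σ T σ' T' σ''} : b.Holds σ → Exec Ω procs c σ T σ' →
      Exec Ω procs (.while b c) σ' T' σ'' → Exec Ω procs (.while b c) σ (T + 1 + T') σ''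
  | whileFalse {b c σ} : ¬ b.Holds σ → Exec Ω procs (.while b c) σ 1 σ
  | call {j c σ T σ'} : procs[j]? = some c → Exec Ω procs c σ T σ' →
      Exec Ω procs (.call j) σ (T + 1) σ'

/-! ## Input and output -/

/-- A numbering of the simplices of each complex. -/
abbrev SimplexNumbering {k : ℕ} (C : Fin k → PlaneComplex) : Type :=
  (i : Fin k) → Fin (C i).size ≃ (C i).faces

/-- The solver is correct on the cells of `C 0 × ⋯ × C (k-1)`: it returns a point of the cell at
which the perimeter is minimum over the cell. -/
def CellSolver.IsCorrect {k : ℕ} (Ω : CellSolver k) (C : Fin k → PlaneComplex)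
    (num : SimplexNumbering C) : Prop :=
  ∀ j : (i : Fin k) → Fin (C i).size,
    IsLeast (configPerimeter '' {p | ∀ i, p i ∈ convexHull ℝ ((num i (j i)).1 : Set Plane)})
      (configPerimeter (Ω (fun i => j i))) ∧
    ∀ i, Ω (fun i => j i) i ∈ convexHull ℝ ((num i (j i)).1 : Set Plane)

/-- The memory holds the input: for each complex the number of its simplices, the numbers of the
start and end vertices, the list of the numbers of the proper faces of each simplex (at most six of
them, without repetition, in any order), and the coordinates of each vertex. The rest of the memory
is arbitrary. -/
structure Memory.HoldsInput {k : ℕ} (σ : Memory k) (C : Fin k → PlaneComplex) (num : SimplexNumbering C)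
    (s t : Fin k → Plane) : Prop where
  size : ∀ i : Fin k, σ.nat .size i = (C i).size
  start : ∀ i : Fin k, ∃ j, σ.nat .start i = j.val ∧ (num i j).1 = {s i}
  target : ∀ i : Fin k, ∃ j, σ.nat .target i = j.val ∧ (num i j).1 = {t i}
  faceCount : ∀ i (j : Fin (C i).size),
    σ.nat (.faceCount i) j = {l | (num i l).1 ⊂ (num i j).1}.ncard
  face : ∀ i (j l : Fin (C i).size), (num i l).1 ⊂ (num i j).1 ↔
    ∃ r < σ.nat (.faceCount i) j, σ.nat (.face i) (6 * j + r) = l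
  coord : ∀ i j v, (num i j).1 = {v} → σ.real (.inX i) j = v 0 ∧ σ.real (.inY i) j = v 1

/-- The polygonal curve over `[0,1]` with vertices `p 0, …, p m`, at times `0, 1/m, …, 1`. -/
noncomputable def polyline (m : ℕ) (p : ℕ → Plane) (τ : ℝ) : Plane :=
  AffineMap.lineMap (p ⌊τ * m⌋₊) (p (⌊τ * m⌋₊ + 1)) (Int.fract (τ * m))

/-- The number of segments of the output motion. -/
def Memory.outLength {k : ℕ} (σ : Memory k) : ℕ := σ.nat .outLength 0

/-- The polygonal path of the `i`-th agent in the output. -/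
noncomputable def Memory.outPath {k : ℕ} (σ : Memory k) (i : Fin k) : ℝ → Plane :=
  polyline σ.outLength (fun j => !₂[σ.real (.outX i) j, σ.real (.outY i) j])

/-- The memory holds an optimal motion: `k` polygonal paths, with a common number of segments, in
synchronized parameterization (so that all reparameterizations are the identity), and for each
segment of each path the number of a simplex along which it runs. -/
def Memory.HoldsOptimalMotion {k : ℕ} (σ : Memory k) (C : Fin k → PlaneComplex) (num : SimplexNumbering C)
    (s t : Fin k → Plane) : Prop :=
  ∃ φ : Fin k → ℝ → Finset Plane,
    IsOptimalMotion C s t σ.outPath φ (fun _ => id) ∧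
    ∀ i, ∀ j < σ.outLength, ∃ l : Fin (C i).size, σ.nat (.outCell i) j = l ∧
      ∀ τ ∈ Icc ((j : ℝ) / σ.outLength) (((j : ℝ) + 1) / σ.outLength), φ i τ ⊆ (num i l).1

/-!
The theorem rests on a reduction to a graph problem. Let the weight of a cell, that is, of a
`k`-tuple of simplices, be the minimum of the perimeter over the cell. A motion whose perimeter is
always less than `v` passes only through cells of weight less than `v`. Near each time, its cells
contain the cell at that time, because of the minimality of the simplices of a path; and since the
time interval is connected, this yields a chain of such cells in which consecutive ones differ by
the replacement of one simplex by a proper face (`IsMotion.cellConn`).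
Conversely, given such a chain of cells, every agent can move along line segments from the optimal
point of one cell to that of the next (`PlaneComplex.exists_isPath_polyline`). Since the perimeter of
the convex hull is a convex function of the configuration, it is maximum at one of the vertices of
this motion (`exists_isGreatest_perimeterValues`). Hence the minimum cost is the least `v` such that
cells of weight at most `v` form a chain from the start to the target. Convexity of the perimeter
follows from Cauchy's formula: it is proportional to the integral of the width over all directions
(`exists_configPerimeter_eq_integral`), and the width is convex (`configPerimeter_lineMap_le`).

A simplex in the plane has at most six proper faces, so the cell graph has at most `n ^ k` nodes and
`6 * k * n ^ k` edges. An edge has the weight of its lower cell, which is the larger one of the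
weights of its ends. What is left is to find a path whose largest edge weight is as small as
possible, and to do so in linear time, although weights can only be compared. The edges are split at
a pivot that leaves a fixed fraction of them on either side. If those on the lower side connect the
start to the target, then the others are discarded, and otherwise those on the lower side are
contracted (`IsBottleneck.of_low`, `IsBottleneck.of_high`); the running times of the rounds form a
geometric series (`bottleneckLoop_runs`). The pivot comes from sorting blocks of edges and repeatedly
discarding every second entry of the merged blocks (`selectPivot_runs`). Finally, a search among the
edges up to the bottleneck edge yields the path of cells that is written to the output.

Cells are coded by the numbers whose digits to the base `n` are the numbers of their simplices.
Because the machine cannot divide, tables of multiples, quotients and remainders are set up first.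
As regards the programs, `Runs Ω c σ B Q` states that `c`, run on the memory `σ`, halts within `B`
steps with a memory that satisfies `Q`, and rules for composition and for loops with a potential
reduce each such statement to the effect of commands without loops.
-/

set_option linter.unusedSimpArgs false

section Perimeter

/-! ### The perimeter of a convex hull as a mean width -/

/-- The level of a point in direction `n`. -/
def level (n c : Plane) : ℝ := c 0 * n 0 + c 1 * n 1

/-- The coordinate of a point along the clockwise normal of `n`. -/
def offset (n c : Plane) : ℝ := c 0 * n 1 - c 1 * n 0

theorem signedArea₂_mul (n a b c : Plane) :
    signedArea₂ a b c * (n 0 ^ 2 + n 1 ^ 2) =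
      (offset n b - offset n a) * (level n c - level n a) -
        (level n b - level n a) * (offset n c - offset n a) := by
  simp only [signedArea₂, offset, level]; ring

theorem level_lineMap (n a b : Plane) (r : ℝ) :
    level n (AffineMap.lineMap a b r) = level n a + r * (level n b - level n a) := by
  simp [level, AffineMap.lineMap_apply]; ring

theorem offset_lineMap (n a b : Plane) (r : ℝ) :
    offset n (AffineMap.lineMap a b r) = offset n a + r * (offset n b - offset n a) := by
  simp [offset, AffineMap.lineMap_apply]; ring

theorem eq_of_level_eq {n a b : Plane} (hn : 0 < n 0 ^ 2 + n 1 ^ 2) (h1 : level n a = level n b)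
    (h2 : offset n a = offset n b) : a = b := by
  have e0 : (a 0 - b 0) * (n 0 ^ 2 + n 1 ^ 2) = 0 := by
    simp only [level, offset] at h1 h2; linear_combination n 0 * h1 + n 1 * h2
  have e1 : (a 1 - b 1) * (n 0 ^ 2 + n 1 ^ 2) = 0 := by
    simp only [level, offset] at h1 h2; linear_combination n 1 * h1 - n 0 * h2
  ext i
  fin_cases i
  · simpa [hn.ne', sub_eq_zero] using e0
  · simpa [hn.ne', sub_eq_zero] using e1

theorem mem_segment_of_level {n a b c : Plane} (hn : 0 < n 0 ^ 2 + n 1 ^ 2)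
    (hab : level n a < level n b) (h1 : level n a ≤ level n c) (h2 : level n c ≤ level n b)
    (h : signedArea₂ a b c = 0) : c ∈ segment ℝ a b := by
  have hpos : 0 < level n b - level n a := by linarith
  rw [segment_eq_image_lineMap]
  refine ⟨(level n c - level n a) / (level n b - level n a),
    ⟨by apply div_nonneg <;> linarith, by rw [div_le_one hpos]; linarith⟩, ?_⟩
  apply eq_of_level_eq hn
  · rw [level_lineMap]; field_simp; ring
  · have := signedArea₂_mul n a b c
    rw [h] at this
    have hne : level n b - level n a ≠ 0 := hpos.ne'
    rw [offset_lineMap]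
    field_simp
    linear_combination -this

theorem level_mem_of_mem_segment {n a b c : Plane} (hab : level n a < level n b)
    (h : c ∈ segment ℝ a b) : level n a ≤ level n c ∧ level n c ≤ level n b := by
  rw [segment_eq_image_lineMap] at h
  obtain ⟨r, ⟨h0, h1⟩, rfl⟩ := h
  rw [level_lineMap]
  constructor <;> nlinarith

theorem signedArea₂_eq_zero_of_mem_segment {a b c : Plane} (h : c ∈ segment ℝ a b) :
    signedArea₂ a b c = 0 := by
  rw [segment_eq_image_lineMap] at h
  obtain ⟨r, -, rfl⟩ := h
  simp [signedArea₂, AffineMap.lineMap_apply]; ring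

theorem IsHullEdge.signedArea₂_nonneg {P : Finset Plane} {a b c : Plane} (h : IsHullEdge P a b)
    (hc : c ∈ P) : 0 ≤ signedArea₂ a b c := by
  rcases h c hc with h | h
  · exact (signedArea₂_eq_zero_of_mem_segment h).ge
  · exact h.le

theorem IsHullEdge.mem_segment {P : Finset Plane} {a b c : Plane} (h : IsHullEdge P a b)
    (hc : c ∈ P) (h0 : signedArea₂ a b c = 0) : c ∈ segment ℝ a b := by
  rcases h c hc with h | h
  · exact h
  · exact absurd h0 h.ne'

/-- The offset at which the line through `a` and `b` crosses the level `l`. -/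
noncomputable def crossing (n : Plane) (l : ℝ) (a b : Plane) : ℝ :=
  offset n a + (l - level n a) / (level n b - level n a) * (offset n b - offset n a)

theorem crossing_sub_crossing (n : Plane) (l : ℝ) {a b a' b' : Plane}
    (h : level n a < level n b) (h' : level n a' < level n b') :
    (crossing n l a b - crossing n l a' b') * ((level n b - level n a) * (level n b' - level n a')) =
      ((level n b' - l) * signedArea₂ a b a' + (l - level n a') * signedArea₂ a b b') *
        (n 0 ^ 2 + n 1 ^ 2) := by
  have hp : level n b - level n a ≠ 0 := by linarith
  have hp' : level n b' - level n a' ≠ 0 := by linarith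
  rw [add_mul, mul_assoc, mul_assoc, signedArea₂_mul, signedArea₂_mul, crossing, crossing]
  field_simp
  ring

/-- A level that is strictly between the levels of two points of `P`, and not the level of a point
of `P`, is crossed upwards by an edge of the hull: the one with the crossing farthest to the
right. -/
theorem exists_hullEdge_crossing {P : Finset Plane} {n : Plane} (hn : 0 < n 0 ^ 2 + n 1 ^ 2) {l : ℝ}
    (hl : ∀ c ∈ P, level n c ≠ l) (hlo : ∃ a ∈ P, level n a < l) (hhi : ∃ b ∈ P, l < level n b) :
    ∃ a ∈ P, ∃ b ∈ P, IsHullEdge P a b ∧ level n a < l ∧ l < level n b := by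
  classical
  obtain ⟨a₀, ha₀, hla₀⟩ := hlo
  obtain ⟨b₀, hb₀, hlb₀⟩ := hhi
  let Q := (P ×ˢ P).filter fun e => level n e.1 < l ∧ l < level n e.2
  obtain ⟨e, he, hemax⟩ := Q.exists_max_image (fun e => crossing n l e.1 e.2)
    ⟨(a₀, b₀), by simp [Q, *]⟩
  -- Among the collinear pairs with this crossing, the longest one is the edge.
  obtain ⟨⟨a, b⟩, hab, habmax⟩ :=
    (Q.filter fun e' => crossing n l e'.1 e'.2 = crossing n l e.1 e.2).exists_max_image
      (fun e => level n e.2 - level n e.1) ⟨e, by simp [he]⟩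
  simp only [Finset.mem_filter, Q, Finset.mem_product, and_imp, Prod.forall] at hab habmax hemax
  obtain ⟨⟨⟨haP, hbP⟩, hla, hlb⟩, hcr⟩ := hab
  have hab : level n a < level n b := hla.trans hlb
  refine ⟨a, haP, b, hbP, fun c hc => ?_, hla, hlb⟩
  rcases lt_or_gt_of_ne (hl c hc) with hlc | hlc
  · have key := crossing_sub_crossing n l hab (hlc.trans hlb)
    rw [signedArea₂_eq_zero_of_mem_segment (right_mem_segment ℝ a b), mul_zero, add_zero] at key
    have hle := hemax c b hc hbP hlc hlb
    rw [← hcr] at hle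
    rcases hle.eq_or_lt with heq | hlt
    · left
      have h0 : signedArea₂ a b c = 0 := by
        rw [heq, sub_self, zero_mul, eq_comm] at key
        simpa [hn.ne', sub_eq_zero, hlb.ne'] using key
      have := habmax c b hc hbP hlc hlb (heq.trans hcr)
      exact mem_segment_of_level hn hab (by linarith) (by linarith) h0
    · right
      have hpos : 0 < (crossing n l a b - crossing n l c b) *
          ((level n b - level n a) * (level n b - level n c)) :=
        mul_pos (by linarith) (mul_pos (by linarith) (by linarith))
      rw [key] at hpos
      exact pos_of_mul_pos_right (pos_of_mul_pos_left hpos hn.le) (by linarith)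
  · have key := crossing_sub_crossing n l hab (hla.trans hlc)
    rw [signedArea₂_eq_zero_of_mem_segment (left_mem_segment ℝ a b), mul_zero, zero_add] at key
    have hle := hemax a c haP hc hla hlc
    rw [← hcr] at hle
    rcases hle.eq_or_lt with heq | hlt
    · left
      have h0 : signedArea₂ a b c = 0 := by
        rw [heq, sub_self, zero_mul, eq_comm] at key
        simpa [hn.ne', sub_eq_zero, hla.ne'] using key
      have := habmax a c haP hc hla hlc (heq.trans hcr)
      exact mem_segment_of_level hn hab (by linarith) (by linarith) h0
    · right
      have hpos : 0 < (crossing n l a b - crossing n l a c) *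
          ((level n b - level n a) * (level n c - level n a)) :=
        mul_pos (by linarith) (mul_pos (by linarith) (by linarith))
      rw [key] at hpos
      exact pos_of_mul_pos_right (pos_of_mul_pos_left hpos hn.le) (by linarith)

/-- A level is crossed upwards by only one edge of the hull: of two such edges, each would be on the
left of the other. -/
theorem IsHullEdge.eq_of_crossing {P : Finset Plane} {n : Plane} (hn : 0 < n 0 ^ 2 + n 1 ^ 2) {l : ℝ}
    {a b a' b' : Plane} (ha : a ∈ P) (hb : b ∈ P) (ha' : a' ∈ P) (hb' : b' ∈ P)
    (h : IsHullEdge P a b) (h' : IsHullEdge P a' b') (hla : level n a < l) (hlb : l < level n b)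
    (hla' : level n a' < l) (hlb' : l < level n b') : a = a' ∧ b = b' := by
  have hab := hla.trans hlb
  have hab' := hla'.trans hlb'
  have k1 := crossing_sub_crossing n l hab hab'
  have k2 := crossing_sub_crossing n l hab' hab
  have s1 := h.signedArea₂_nonneg ha'
  have s2 := h.signedArea₂_nonneg hb'
  have s3 := h'.signedArea₂_nonneg ha
  have s4 := h'.signedArea₂_nonneg hb
  have p1 : 0 < level n b' - l := by linarith
  have p2 : 0 < l - level n a' := by linarith
  have p3 : 0 < level n b - l := by linarith
  have p4 : 0 < l - level n a := by linarith
  have n1 := mul_nonneg p1.le s1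
  have n2 := mul_nonneg p2.le s2
  have n3 := mul_nonneg p3.le s3
  have n4 := mul_nonneg p4.le s4
  -- The two differences of crossings are opposite, so that all four areas vanish.
  have hsum : ((level n b' - l) * signedArea₂ a b a' + (l - level n a') * signedArea₂ a b b') +
      ((level n b - l) * signedArea₂ a' b' a + (l - level n a) * signedArea₂ a' b' b) = 0 := by
    have : (((level n b' - l) * signedArea₂ a b a' + (l - level n a') * signedArea₂ a b b') +
      ((level n b - l) * signedArea₂ a' b' a + (l - level n a) * signedArea₂ a' b' b)) *
        (n 0 ^ 2 + n 1 ^ 2) = 0 := by linear_combination -k1 - k2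
    simpa [hn.ne'] using this
  have z1 : (level n b' - l) * signedArea₂ a b a' = 0 := by linarith
  have z2 : (l - level n a') * signedArea₂ a b b' = 0 := by linarith
  have z3 : (level n b - l) * signedArea₂ a' b' a = 0 := by linarith
  have z4 : (l - level n a) * signedArea₂ a' b' b = 0 := by linarith
  have m1 := h.mem_segment ha' ((mul_eq_zero.1 z1).resolve_left p1.ne')
  have m2 := h.mem_segment hb' ((mul_eq_zero.1 z2).resolve_left p2.ne')
  have m3 := h'.mem_segment ha ((mul_eq_zero.1 z3).resolve_left p3.ne')
  have m4 := h'.mem_segment hb ((mul_eq_zero.1 z4).resolve_left p4.ne')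
  have l1 := level_mem_of_mem_segment hab m1
  have l2 := level_mem_of_mem_segment hab m2
  have l3 := level_mem_of_mem_segment hab' m3
  have l4 := level_mem_of_mem_segment hab' m4
  have ea : level n a = level n a' := le_antisymm l1.1 l3.1
  have eb : level n b = level n b' := le_antisymm l4.2 l2.2
  have key : ∀ c, signedArea₂ a b c = 0 → (level n b - level n a) * (offset n c - offset n a) =
      (offset n b - offset n a) * (level n c - level n a) := by
    intro c hc
    have := signedArea₂_mul n a b c
    rw [hc] at this
    linarith
  have o1 := key a' ((mul_eq_zero.1 z1).resolve_left p1.ne')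
  have o2 := key b' ((mul_eq_zero.1 z2).resolve_left p2.ne')
  have hne : level n b - level n a ≠ 0 := by linarith
  constructor
  · refine eq_of_level_eq hn ea (mul_left_cancel₀ hne ?_)
    rw [← ea] at o1; linarith
  · refine eq_of_level_eq hn eb (mul_left_cancel₀ hne ?_)
    rw [← eb] at o2; linarith

open scoped Classical in
/-- The counterclockwise edges of the hull of `P`. -/
noncomputable def hullEdges (P : Finset Plane) : Finset (Plane × Plane) :=
  (P ×ˢ P).filter fun e => IsHullEdge P e.1 e.2

open MeasureTheory in
/-- The rises of the upward edges of the hull add up to its width: each level is crossed by exactly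
one of them. -/
theorem sum_hullEdges_level {P : Finset Plane} (hP : P.Nonempty) (n : Plane) :
    ∑ e ∈ hullEdges P, max (level n e.2 - level n e.1) 0 =
      P.sup' hP (level n) - P.inf' hP (level n) := by
  classical
  rcases eq_or_lt_of_le (by positivity : 0 ≤ n 0 ^ 2 + n 1 ^ 2) with hn | hn
  · have h0 : n 0 = 0 := by nlinarith [sq_nonneg (n 0), sq_nonneg (n 1)]
    have h1 : n 1 = 0 := by nlinarith [sq_nonneg (n 0), sq_nonneg (n 1)]
    have hL : level n = fun _ => 0 := by
      ext c
      simp [level, h0, h1]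
    simp [hL]
  let F : Set ℝ := (P.image (level n) : Finset ℝ)
  have hF : volume F = 0 := (Finset.finite_toSet _).measure_zero _
  have hvol : ∀ x y : ℝ, volume (Ioo x y \ F) = ENNReal.ofReal (y - x) := fun x y => by
    rw [measure_sdiff_null hF, Real.volume_Ioo]
  have hU : (⋃ e ∈ hullEdges P, Ioo (level n e.1) (level n e.2) \ F) =
      Ioo (P.inf' hP (level n)) (P.sup' hP (level n)) \ F := by
    ext l
    simp only [mem_iUnion, mem_sdiff, mem_Ioo, exists_prop, Finset.inf'_lt_iff, Finset.lt_sup'_iff]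
    constructor
    · rintro ⟨e, he, ⟨h1, h2⟩, h3⟩
      simp only [hullEdges, Finset.mem_filter, Finset.mem_product] at he
      exact ⟨⟨⟨_, he.1.1, h1⟩, ⟨_, he.1.2, h2⟩⟩, h3⟩
    · rintro ⟨⟨h1, h2⟩, h3⟩
      obtain ⟨a, ha, b, hb, h4, h5, h6⟩ := exists_hullEdge_crossing hn (l := l)
        (fun c hc h => h3 (by simp only [F, Finset.coe_image]; exact ⟨c, hc, h⟩)) h1 h2
      exact ⟨(a, b), by simp [hullEdges, *], ⟨h5, h6⟩, h3⟩
  have hd : (hullEdges P : Set (Plane × Plane)).PairwiseDisjoint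
      fun e => Ioo (level n e.1) (level n e.2) \ F := by
    intro e he e' he' hne
    rw [Function.onFun, Set.disjoint_left]
    rintro l ⟨⟨h1, h2⟩, -⟩ ⟨⟨h3, h4⟩, -⟩
    simp only [hullEdges, Finset.coe_filter, Finset.mem_product] at he he'
    exact hne (Prod.ext_iff.2 (IsHullEdge.eq_of_crossing hn he.1.1 he.1.2 he'.1.1 he'.1.2 he.2 he'.2
      h1 h2 h3 h4))
  have hsum := measure_biUnion_finset (μ := volume) hd
    fun e _ => measurableSet_Ioo.diff (Finset.measurableSet _)
  rw [hU, hvol] at hsum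
  simp only [hvol] at hsum
  have hle : P.inf' hP (level n) ≤ P.sup' hP (level n) := by
    obtain ⟨c, hc⟩ := hP
    exact (Finset.inf'_le _ hc).trans (Finset.le_sup' _ hc)
  have := congrArg ENNReal.toReal hsum
  rw [ENNReal.toReal_sum (by simp), ENNReal.toReal_ofReal (by linarith)] at this
  rw [this]
  refine Finset.sum_congr rfl fun e _ => ?_
  rw [ENNReal.toReal_ofReal']

open MeasureTheory

theorem level_eq_inner (n c : Plane) : level n c = inner ℝ c n := by
  simp [level, EuclideanSpace.inner_eq_star_dotProduct, dotProduct, Fin.sum_univ_two, mul_comm]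

/-- The integral of the positive part of `⟪d, n⟫` over the unit ball is proportional to the length
of `d`. -/
theorem exists_integral_inner_eq : ∃ κ > 0, ∀ d : Plane,
    ∫ n in Metric.ball (0 : Plane) 1, max (inner ℝ d n) 0 = κ * ‖d‖ := by
  let G : Plane → ℝ := fun d => ∫ n in Metric.ball (0 : Plane) 1, max (inner ℝ d n) 0
  have hrot : ∀ (e : Plane ≃ₗᵢ[ℝ] Plane) d, G (e d) = G d := by
    intro e d
    have := (e.measurePreserving.restrict_preimage (s := Metric.ball (0 : Plane) 1)
      Metric.isOpen_ball.measurableSet).integral_comp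
      e.toHomeomorph.measurableEmbedding (fun n => max (inner ℝ (e d) n) 0)
    simp only [G]
    rw [← this]
    simp
  have heq : ∀ d d', ‖d‖ = ‖d'‖ → G d = G d' := by
    intro d d' h
    rw [← Submodule.reflection_sub h, hrot]
  have hsmul : ∀ (r : ℝ) d, 0 ≤ r → G (r • d) = r * G d := by
    intro r d hr
    simp only [G]
    rw [← integral_const_mul]
    congr 1
    ext n
    rw [real_inner_smul_left, mul_max_of_nonneg _ _ hr, mul_zero]
  let u : Plane := EuclideanSpace.single 0 1
  have hu : ‖u‖ = 1 := by simp [u]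
  refine ⟨G u, ?_, fun d => ?_⟩
  · have hcont : Continuous fun n : Plane => max (inner ℝ u n) 0 := by fun_prop
    have hint : IntegrableOn (fun n : Plane => max (inner ℝ u n) 0) (Metric.ball (0 : Plane) 1) :=
      (hcont.continuousOn.integrableOn_compact (isCompact_closedBall (0 : Plane) 1)).mono_set
        Metric.ball_subset_closedBall
    refine (setIntegral_pos_iff_support_of_nonneg_ae (.of_forall fun n => le_max_right _ _) hint).2 ?_
    have hopen : IsOpen (Function.support (fun n : Plane => max (inner ℝ u n) 0) ∩
        Metric.ball (0 : Plane) 1) := by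
      refine IsOpen.inter ?_ Metric.isOpen_ball
      exact isOpen_compl_singleton.preimage hcont
    refine hopen.measure_pos _ ⟨(1 / 2 : ℝ) • u, ?_, ?_⟩
    · simp [real_inner_smul_right, real_inner_self_eq_norm_sq, hu]
    · simp [norm_smul, hu]; norm_num
  · change G d = _
    rw [heq d (‖d‖ • u) (by simp [norm_smul, hu]), hsmul _ _ (norm_nonneg _), mul_comm]

/-- The width of a configuration in direction `n`. -/
noncomputable def configWidth {k : ℕ} [NeZero k] (p : Fin k → Plane) (n : Plane) : ℝ :=
  Finset.univ.sup' Finset.univ_nonempty (fun i => level n (p i)) -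
    Finset.univ.inf' Finset.univ_nonempty (fun i => level n (p i))

/-- Cauchy's formula: up to a constant, the perimeter is the integral of the width. -/
theorem exists_configPerimeter_eq_integral (k : ℕ) [NeZero k] : ∃ κ > 0, ∀ p : Fin k → Plane,
    IntegrableOn (configWidth p) (Metric.ball (0 : Plane) 1) ∧
      ∫ n in Metric.ball (0 : Plane) 1, configWidth p n = κ * configPerimeter p := by
  classical
  obtain ⟨κ, hκ, h⟩ := exists_integral_inner_eq
  refine ⟨κ, hκ, fun p => ?_⟩
  have hw : configWidth p = fun n => ∑ e ∈ hullEdges (Finset.univ.image p),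
      max (inner ℝ (e.2 - e.1) n) 0 := by
    ext n
    simp only [inner_sub_left, ← level_eq_inner]
    rw [sum_hullEdges_level (Finset.univ_nonempty.image p), Finset.sup'_image, Finset.inf'_image]
    rfl
  have hint : ∀ d : Plane, IntegrableOn (fun n : Plane => max (inner ℝ d n) 0)
      (Metric.ball (0 : Plane) 1) := fun d =>
    ((by fun_prop : Continuous fun n : Plane => max (inner ℝ d n) 0).continuousOn.integrableOn_compact
      (isCompact_closedBall (0 : Plane) 1)).mono_set Metric.ball_subset_closedBall
  rw [hw]
  refine ⟨integrable_finsetSum _ fun e _ => hint _, ?_⟩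
  rw [integral_finsetSum _ fun e _ => hint _, configPerimeter, hullPerimeter, Finset.mul_sum]
  refine Finset.sum_congr ?_ fun e _ => ?_
  · simp only [hullEdges]
  · rw [h, dist_comm, dist_eq_norm]

/-- The perimeter is a convex function of the configuration, since in each direction the width is:
it is a maximum minus a minimum of affine functions. -/
theorem configPerimeter_lineMap_le {k : ℕ} (p q : Fin k → Plane) {r : ℝ} (h0 : 0 ≤ r) (h1 : r ≤ 1) :
    configPerimeter (fun i => AffineMap.lineMap (p i) (q i) r) ≤
      (1 - r) * configPerimeter p + r * configPerimeter q := by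
  rcases Nat.eq_zero_or_pos k with rfl | hk
  · simp [configPerimeter, hullPerimeter]
  have : NeZero k := ⟨hk.ne'⟩
  obtain ⟨κ, hκ, h⟩ := exists_configPerimeter_eq_integral k
  refine le_of_mul_le_mul_left ?_ hκ
  rw [mul_add, mul_left_comm, mul_left_comm κ r, ← (h p).2, ← (h q).2, ← (h _).2,
    ← integral_const_mul, ← integral_const_mul,
    ← integral_add ((h p).1.const_mul _) ((h q).1.const_mul _)]
  refine integral_mono (h _).1 (((h p).1.const_mul _).add ((h q).1.const_mul _)) fun n => ?_
  have hP1 : ∀ i, level n (p i) ≤ Finset.univ.sup' Finset.univ_nonempty (fun i => level n (p i)) :=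
    fun i => Finset.le_sup' (fun i => level n (p i)) (Finset.mem_univ i)
  have hQ1 : ∀ i, level n (q i) ≤ Finset.univ.sup' Finset.univ_nonempty (fun i => level n (q i)) :=
    fun i => Finset.le_sup' (fun i => level n (q i)) (Finset.mem_univ i)
  have hP2 : ∀ i, Finset.univ.inf' Finset.univ_nonempty (fun i => level n (p i)) ≤ level n (p i) :=
    fun i => Finset.inf'_le (fun i => level n (p i)) (Finset.mem_univ i)
  have hQ2 : ∀ i, Finset.univ.inf' Finset.univ_nonempty (fun i => level n (q i)) ≤ level n (q i) :=
    fun i => Finset.inf'_le (fun i => level n (q i)) (Finset.mem_univ i)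
  simp only [configWidth]
  have A : Finset.univ.sup' Finset.univ_nonempty
      (fun i => level n (AffineMap.lineMap (p i) (q i) r)) ≤
      (1 - r) * Finset.univ.sup' Finset.univ_nonempty (fun i => level n (p i)) +
        r * Finset.univ.sup' Finset.univ_nonempty (fun i => level n (q i)) := by
    refine Finset.sup'_le _ _ fun i _ => ?_
    rw [level_lineMap]
    nlinarith [hP1 i, hQ1 i]
  have B : (1 - r) * Finset.univ.inf' Finset.univ_nonempty (fun i => level n (p i)) +
        r * Finset.univ.inf' Finset.univ_nonempty (fun i => level n (q i)) ≤
      Finset.univ.inf' Finset.univ_nonempty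
        (fun i => level n (AffineMap.lineMap (p i) (q i) r)) := by
    refine Finset.le_inf' _ _ fun i _ => ?_
    rw [level_lineMap]
    nlinarith [hP2 i, hQ2 i]
  linarith

end Perimeter

section Cells

open Filter Topology

/-! ### From motions to chains of cells -/

/-- A filter that decides all comparisons with constants, such as that of the one-sided
neighbourhoods of a point, decides membership in a finite union of intervals and points. -/
theorem eventually_or_of_pieces {l : Filter ℝ} (hl : ∀ c, (∀ᶠ x in l, c < x) ∨ ∀ᶠ x in l, x < c)
    (I : Finset (ℝ × ℝ)) (S : Finset ℝ) :
    (∀ᶠ x in l, x ∈ (⋃ J ∈ I, Ioo J.1 J.2) ∪ (S : Set ℝ)) ∨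
      ∀ᶠ x in l, x ∉ (⋃ J ∈ I, Ioo J.1 J.2) ∪ (S : Set ℝ) := by
  have hIoo : ∀ a b, (∀ᶠ x in l, x ∈ Ioo a b) ∨ ∀ᶠ x in l, x ∉ Ioo a b := by
    intro a b
    rcases hl a with h | h
    · rcases hl b with h' | h'
      · exact Or.inr (h'.mono fun x hx hx' => lt_asymm hx hx'.2)
      · exact Or.inl (h.and h')
    · exact Or.inr (h.mono fun x hx hx' => lt_asymm hx hx'.1)
  by_cases hI : ∃ J ∈ I, ∀ᶠ x in l, x ∈ Ioo J.1 J.2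
  · obtain ⟨J, hJ, h⟩ := hI
    exact Or.inl (h.mono fun x hx => Or.inl (mem_biUnion hJ hx))
  · right
    have h1 : ∀ᶠ x in l, ∀ J ∈ I, x ∉ Ioo J.1 J.2 :=
      (eventually_all_finset I).2 fun J hJ =>
        (hIoo J.1 J.2).resolve_left fun h => hI ⟨J, hJ, h⟩
    have h2 : ∀ᶠ x in l, ∀ c ∈ S, x ≠ c := (eventually_all_finset S).2 fun c _ =>
      (hl c).elim (fun h => h.mono fun x hx => hx.ne') fun h => h.mono fun x hx => hx.ne
    filter_upwards [h1, h2] with x h1 h2 h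
    rcases h with h | h
    · simp only [mem_iUnion] at h
      obtain ⟨J, hJ, h⟩ := h
      exact h1 J hJ h
    · exact h2 x h rfl

namespace PlaneComplex

variable {C : PlaneComplex} {s t : Plane} {π : ℝ → Plane} {φ : ℝ → Finset Plane}

/-- On each side of a time, a simplicial path is constant for a short while. -/
theorem IsSimplicialPath.eventually_const (h : C.IsSimplicialPath φ) {l : Filter ℝ} [l.NeBot]
    (hl : ∀ c, (∀ᶠ x in l, c < x) ∨ ∀ᶠ x in l, x < c) (hl' : ∀ᶠ x in l, x ∈ Icc (0 : ℝ) 1) :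
    ∃ Δ ∈ C.faces, ∀ᶠ x in l, φ x = Δ := by
  by_contra! hcon
  have key : ∀ Δ ∈ C.finite_faces.toFinset, ∀ᶠ x in l, ¬ (x ∈ Icc (0 : ℝ) 1 ∧ φ x = Δ) := by
    intro Δ hΔ
    rw [Finite.mem_toFinset] at hΔ
    obtain ⟨I, S, hIS⟩ := h.finite_pieces Δ hΔ
    rcases eventually_or_of_pieces hl I S with h1 | h1
    · rw [← hIS] at h1
      exact absurd (h1.mono fun x hx => hx.2) (not_eventually.2 (hcon Δ hΔ))
    · rw [← hIS] at h1
      exact h1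
  obtain ⟨x, hx, hx'⟩ := (((eventually_all_finset _).2 key).and hl').exists
  exact hx (φ x) (by simpa using h.mem_faces x hx') ⟨hx', rfl⟩

/-- A simplex entered on one side of the time `x` is a coface of the one at `x`: it is adjacent to
it, and contains the point, so that by minimality it is no proper face. -/
theorem IsPath.eventually_subset_side (h : C.IsPath s t π φ) {x : ℝ} (hx : x ∈ Icc (0 : ℝ) 1)
    {l : Filter ℝ} [l.NeBot] (hl : ∀ c, (∀ᶠ x in l, c < x) ∨ ∀ᶠ x in l, x < c)
    (hl' : l ≤ 𝓝[Icc 0 1] x)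
    (hadj : ∀ Δ, (∀ᶠ y in l, φ y = Δ) → AdjacentSimplices (φ x) Δ) :
    ∀ᶠ y in l, φ x ⊆ φ y := by
  have hIcc : ∀ᶠ y in l, y ∈ Icc (0 : ℝ) 1 := hl' self_mem_nhdsWithin
  obtain ⟨Δ, hΔ, hconst⟩ := h.simplicial.eventually_const hl hIcc
  refine hconst.mono fun y hy => ?_
  rw [hy]
  rcases hadj Δ hconst with h' | h'
  · exact h'
  · by_contra hne
    have hss : Δ ⊂ φ x := ⟨h', hne⟩
    refine h.minimal x hx Δ hΔ hss ?_
    refine (Δ.finite_toSet.isClosed_convexHull ℝ).mem_of_tendsto ((h.continuousOn x hx).mono_left hl') ?_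
    filter_upwards [hconst, hIcc] with z hz hz'
    rw [← hz]
    exact h.mem_cell z hz'

/-- The simplices of a path are lower semicontinuous. -/
theorem IsPath.eventually_subset (h : C.IsPath s t π φ) {x : ℝ} (hx : x ∈ Icc (0 : ℝ) 1) :
    ∀ᶠ y in 𝓝[Icc 0 1] x, φ x ⊆ φ y := by
  rw [eventually_nhdsWithin_iff, ← nhdsNE_sup_pure, ← nhdsLT_sup_nhdsGT, eventually_sup, eventually_sup]
  refine ⟨⟨?_, ?_⟩, by simp⟩
  · rcases hx.1.eq_or_lt with rfl | hx0
    · filter_upwards [self_mem_nhdsWithin] with y hy hy'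
      exact absurd hy'.1 (not_le.2 hy)
    · have hle : 𝓝[<] x ≤ 𝓝[Icc 0 1] x := by
        refine le_inf nhdsWithin_le_nhds (le_principal_iff.2 ?_)
        filter_upwards [Ioo_mem_nhdsLT hx0] with y hy
        exact ⟨hy.1.le, hy.2.le.trans hx.2⟩
      refine (h.eventually_subset_side hx (fun c => ?_) hle fun Δ hΔ => ?_).mono fun y hy _ => hy
      · rcases lt_or_ge c x with hc | hc
        · exact Or.inl (mem_of_superset (Ioo_mem_nhdsLT hc) fun y hy => hy.1)
        · exact Or.inr (mem_of_superset self_mem_nhdsWithin fun y hy => lt_of_lt_of_le hy hc)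
      · obtain ⟨u, hu, hsub⟩ := mem_nhdsLT_iff_exists_Ioo_subset.1 hΔ
        obtain ⟨y, hy⟩ := exists_between (max_lt hu hx0)
        refine h.simplicial.adjacent y x ((le_max_right _ _).trans hy.1.le) hy.2.le hx.2 _ _ ?_
        ext Ψ
        simp only [mem_image, mem_insert_iff, mem_singleton_iff]
        constructor
        · rintro ⟨z, hz, rfl⟩
          rcases hz.2.eq_or_lt with rfl | hzx
          · exact Or.inl rfl
          · exact Or.inr (hsub ⟨((le_max_left _ _).trans_lt hy.1).trans_le hz.1, hzx⟩)
        · rintro (rfl | rfl)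
          · exact ⟨x, ⟨hy.2.le, le_rfl⟩, rfl⟩
          · exact ⟨y, ⟨le_rfl, hy.2.le⟩, hsub ⟨(le_max_left _ _).trans_lt hy.1, hy.2⟩⟩
  · rcases hx.2.eq_or_lt with rfl | hx1
    · filter_upwards [self_mem_nhdsWithin] with y hy hy'
      exact absurd hy'.2 (not_le.2 hy)
    · have hle : 𝓝[>] x ≤ 𝓝[Icc 0 1] x := by
        refine le_inf nhdsWithin_le_nhds (le_principal_iff.2 ?_)
        filter_upwards [Ioo_mem_nhdsGT hx1] with y hy
        exact ⟨hx.1.trans hy.1.le, hy.2.le⟩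
      refine (h.eventually_subset_side hx (fun c => ?_) hle fun Δ hΔ => ?_).mono fun y hy _ => hy
      · rcases lt_or_ge x c with hc | hc
        · exact Or.inr (mem_of_superset (Ioo_mem_nhdsGT hc) fun y hy => hy.2)
        · exact Or.inl (mem_of_superset self_mem_nhdsWithin fun y hy => lt_of_le_of_lt hc hy)
      · obtain ⟨u, hu, hsub⟩ := mem_nhdsGT_iff_exists_Ioo_subset.1 hΔ
        obtain ⟨y, hy⟩ := exists_between (lt_min hu hx1)
        refine h.simplicial.adjacent x y hx.1 hy.1.le (hy.2.le.trans (min_le_right _ _)) _ _ ?_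
        ext Ψ
        simp only [mem_image, mem_insert_iff, mem_singleton_iff]
        constructor
        · rintro ⟨z, hz, rfl⟩
          rcases hz.1.eq_or_lt with rfl | hzx
          · exact Or.inl rfl
          · exact Or.inr (hsub ⟨hzx, hz.2.trans_lt (hy.2.trans_le (min_le_left _ _))⟩)
        · rintro (rfl | rfl)
          · exact ⟨x, ⟨le_rfl, hy.1.le⟩, rfl⟩
          · exact ⟨y, ⟨hy.1.le, le_rfl⟩, hsub ⟨hy.1, hy.2.trans_le (min_le_left _ _)⟩⟩

end PlaneComplex

variable {k : ℕ} {C : Fin k → PlaneComplex} {B : (Fin k → Finset Plane) → Prop}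

/-- The cell `a` arises from the cell `b` by replacing one simplex by a proper face, and satisfies
`B`. -/
def CellStep (C : Fin k → PlaneComplex) (B : (Fin k → Finset Plane) → Prop)
    (a b : Fin k → Finset Plane) : Prop :=
  (∀ i, b i ∈ (C i).faces) ∧ B a ∧
    ∃ i, ∃ Ψ ∈ (C i).faces, Ψ ⊂ b i ∧ a = Function.update b i Ψ

/-- Two cells are joined by a chain of cells of which consecutive ones differ by a step whose lower
cell satisfies `B`. -/
def CellConn (C : Fin k → PlaneComplex) (B : (Fin k → Finset Plane) → Prop) :
    (Fin k → Finset Plane) → (Fin k → Finset Plane) → Prop :=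
  Relation.ReflTransGen fun a b => CellStep C B a b ∨ CellStep C B b a

theorem CellConn.symm {a b : Fin k → Finset Plane} (h : CellConn C B a b) : CellConn C B b a := by
  induction h with
  | refl => exact .refl
  | tail _ h ih => exact .head h.symm ih

theorem cellConn_of_subset {a b : Fin k → Finset Plane} (ha : ∀ i, a i ∈ (C i).faces)
    (hb : ∀ i, b i ∈ (C i).faces) (hab : ∀ i, a i ⊆ b i)
    (hB : ∀ c : Fin k → Finset Plane, (∀ i, c i ∈ (C i).faces) → (∀ i, a i ⊆ c i) → B c) :
    CellConn C B a b := by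
  classical
  have key : ∀ S : Finset (Fin k), CellConn C B a (S.piecewise b a) := by
    intro S
    have hface : ∀ S : Finset (Fin k), ∀ i, S.piecewise b a i ∈ (C i).faces := fun S i => by
      by_cases hi : i ∈ S <;> simp [hi, ha, hb]
    induction S using Finset.induction_on with
    | empty => rw [Finset.piecewise_empty]; exact .refl
    | insert i S hi ih =>
      rcases (hab i).eq_or_ssubset with heq | hss
      · have : (insert i S).piecewise b a = S.piecewise b a := by
          rw [Finset.piecewise_insert, ← heq]
          exact Function.update_eq_self_iff.2 (by simp [hi])
        rwa [this]
      · refine ih.tail (Or.inl ⟨hface _, hB _ (hface S) fun j => ?_, i, a i, ha i, ?_, ?_⟩)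
        · by_cases hj : j ∈ S <;> simp [hj, hab j]
        · simpa using hss
        · rw [Finset.piecewise_insert, Function.update_idem, eq_comm]
          exact Function.update_eq_self_iff.2 (by simp [hi])
  have := key Finset.univ
  rwa [Finset.piecewise_univ] at this

/-- Some configuration in the cell has perimeter less than `v`. -/
def CellBelow (v : ℝ) (c : Fin k → Finset Plane) : Prop :=
  ∃ p : Fin k → Plane, (∀ i, p i ∈ convexHull ℝ (c i : Set Plane)) ∧ configPerimeter p < v

theorem CellBelow.mono {v : ℝ} {a b : Fin k → Finset Plane} (h : CellBelow v a)
    (hab : ∀ i, a i ⊆ b i) : CellBelow v b := by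
  obtain ⟨p, hp, hv⟩ := h
  exact ⟨p, fun i => convexHull_mono (by exact_mod_cast hab i) (hp i), hv⟩

/-- A motion with all perimeters less than `v` passes through a chain of cells with minimum
perimeter less than `v`. -/
theorem IsMotion.cellConn {s t : Fin k → Plane} {π : Fin k → ℝ → Plane}
    {φ : Fin k → ℝ → Finset Plane} {ρ : Fin k → ℝ → ℝ} (h : IsMotion C s t π φ ρ) {v : ℝ}
    (hv : ∀ w ∈ perimeterValues π ρ, w < v) :
    CellBelow v (fun i => {s i}) ∧ CellConn C (CellBelow v) (fun i => {s i}) (fun i => {t i}) := by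
  have hmem : ∀ τ ∈ Icc (0 : ℝ) 1, ∀ i, φ i (ρ i τ) ∈ (C i).faces := fun τ hτ i =>
    (h i).1.simplicial.mem_faces _ ((h i).2.mapsTo hτ)
  have hbelow : ∀ τ ∈ Icc (0 : ℝ) 1, CellBelow v fun i => φ i (ρ i τ) := fun τ hτ =>
    ⟨fun i => π i (ρ i τ), fun i => (h i).1.mem_cell _ ((h i).2.mapsTo hτ),
      hv _ ⟨τ, hτ, rfl⟩⟩
  have hev : ∀ τ ∈ Icc (0 : ℝ) 1, ∀ᶠ τ' in 𝓝[Icc 0 1] τ, ∀ i, φ i (ρ i τ) ⊆ φ i (ρ i τ') := by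
    intro τ hτ
    refine eventually_all.2 fun i => ?_
    have := (h i).1.eventually_subset ((h i).2.mapsTo hτ)
    exact (tendsto_nhdsWithin_iff.2 ⟨(h i).2.continuousOn τ hτ,
      eventually_mem_of_tendsto_nhdsWithin tendsto_id |>.mono fun x hx => (h i).2.mapsTo hx⟩).eventually this
  have key := isPreconnected_Icc.induction₂ (s := Icc (0 : ℝ) 1)
    (fun τ τ' => CellConn C (CellBelow v) (fun i => φ i (ρ i τ)) (fun i => φ i (ρ i τ')))
    (fun τ hτ => by
      filter_upwards [hev τ hτ, self_mem_nhdsWithin] with τ' h1 h2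
      exact cellConn_of_subset (hmem τ hτ) (hmem τ' h2) h1 fun c _ hc => (hbelow τ hτ).mono hc)
    (fun _ _ _ _ _ _ h1 h2 => h1.trans h2) (fun _ _ _ _ h1 => h1.symm)
    (left_mem_Icc.2 zero_le_one) (right_mem_Icc.2 zero_le_one)
  have hb0 := hbelow 0 (left_mem_Icc.2 zero_le_one)
  simp only [(h _).2.zero, (h _).2.one, (h _).1.start_eq, (h _).1.target_eq] at key hb0
  exact ⟨hb0, key⟩

theorem cellConn_of_isConnected {a b : Fin k → Finset Plane} (hC : ∀ i, (C i).IsConnected)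
    (ha : ∀ i, a i ∈ (C i).faces) (hb : ∀ i, b i ∈ (C i).faces) :
    CellConn C (fun _ => True) a b := by
  classical
  have step : ∀ (c : Fin k → Finset Plane) (i : Fin k), (∀ j, c j ∈ (C j).faces) →
      ∀ Ψ ∈ (C i).faces, CellConn C (fun _ => True) c (Function.update c i Ψ) := by
    intro c i hc Ψ hΨ
    have hface : ∀ Υ ∈ (C i).faces, ∀ j, Function.update c i Υ j ∈ (C j).faces := by
      intro Υ hΥ j
      by_cases hj : j = i
      · subst hj; simpa using hΥ
      · simpa [hj] using hc j
    have hmono : ∀ Υ Υ' : Finset Plane, Υ ⊆ Υ' →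
        ∀ j, Function.update c i Υ j ⊆ Function.update c i Υ' j := by
      intro Υ Υ' hs j
      by_cases hj : j = i
      · subst hj; simpa using hs
      · simp [hj]
    have hchain := hC i (c i) (hc i) Ψ hΨ
    clear hΨ
    induction hchain with
    | refl => rw [Function.update_eq_self]; exact .refl
    | tail _ h ih =>
      obtain ⟨h1, h2, h3 | h3⟩ := h
      · exact ih.trans (cellConn_of_subset (hface _ h1) (hface _ h2) (hmono _ _ h3)
          fun _ _ _ => trivial)
      · exact ih.trans (cellConn_of_subset (hface _ h2) (hface _ h1) (hmono _ _ h3)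
          fun _ _ _ => trivial).symm
  have key : ∀ S : Finset (Fin k), CellConn C (fun _ => True) a (S.piecewise b a) := by
    intro S
    induction S using Finset.induction_on with
    | empty => rw [Finset.piecewise_empty]; exact .refl
    | insert i S hi ih =>
      rw [Finset.piecewise_insert]
      refine ih.trans (step _ i (fun j => ?_) _ (hb i))
      by_cases hj : j ∈ S <;> simp [hj, ha, hb]
  have := key Finset.univ
  rwa [Finset.piecewise_univ] at this

end Cells

section Polylines

open Filter Topology

/-! ### From chains of cells to motions -/

/-- A face of a simplex is an extreme subset. -/
theorem AffineIndependent.isExtreme_face {Ψ Θ : Finset Plane}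
    (hΨ : AffineIndependent ℝ ((↑) : Ψ → Plane)) (hΘ : Θ ⊆ Ψ) :
    IsExtreme ℝ (convexHull ℝ (Ψ : Set Plane)) (convexHull ℝ (Θ : Set Plane)) := by
  classical
  refine ⟨convexHull_mono (by exact_mod_cast hΘ), fun x hx y hy z hz hzxy => ?_⟩
  rw [Finset.mem_convexHull'] at hx hy hz ⊢
  obtain ⟨u, hu0, hu1, hux⟩ := hx
  obtain ⟨v, hv0, hv1, hvy⟩ := hy
  obtain ⟨w, hw0, hw1, hwz⟩ := hz
  obtain ⟨a, b, ha, hb, hab, hz'⟩ := hzxy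
  -- The weights of `z` as a point of `Ψ` vanish outside `Θ`.
  have hwΨ : ∑ c ∈ Ψ, (if c ∈ Θ then w c else 0) = 1 := by
    rw [← Finset.sum_filter, Finset.filter_mem_eq_inter, Finset.inter_eq_right.2 hΘ, hw1]
  have hwΨ' : ∑ c ∈ Ψ, (if c ∈ Θ then w c else 0) • c = z := by
    simp only [ite_smul, zero_smul]
    rw [← Finset.sum_filter, Finset.filter_mem_eq_inter, Finset.inter_eq_right.2 hΘ, hwz]
  have h0 := hΨ.eq_zero_of_sum_eq_zero_subtype
    (w := fun c => a * u c + b * v c - if c ∈ Θ then w c else 0)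
    (by rw [Finset.sum_sub_distrib, Finset.sum_add_distrib, ← Finset.mul_sum, ← Finset.mul_sum, hu1,
          hv1, hwΨ]; linarith)
    (by simp only [sub_smul, add_smul, mul_smul, Finset.sum_sub_distrib, Finset.sum_add_distrib,
          ← Finset.smul_sum]
        rw [hux, hvy, hwΨ', hz', sub_self])
  have hu : ∀ c ∈ Ψ, c ∉ Θ → u c = 0 := by
    intro c hc hc'
    have h1 := h0 c hc
    simp only [hc', if_false, sub_zero] at h1
    have h2 := mul_nonneg ha.le (hu0 c hc)
    have h3 := mul_nonneg hb.le (hv0 c hc)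
    have h4 : a * u c = 0 := by linarith
    exact (mul_eq_zero.1 h4).resolve_left ha.ne'
  refine ⟨u, fun c hc => hu0 c (hΘ hc), ?_, ?_⟩
  · rw [Finset.sum_subset hΘ fun c hc hc' => hu c hc hc', hu1]
  · rw [Finset.sum_subset hΘ fun c hc hc' => by rw [hu c hc hc', zero_smul], hux]

open scoped Classical in
/-- The carrier of a point in a simplex: its least face that contains the point. -/
noncomputable def carrier (Ψ : Finset Plane) (x : Plane) : Finset Plane :=
  Ψ.filter fun v => ∀ Θ ⊆ Ψ, x ∈ convexHull ℝ (Θ : Set Plane) → v ∈ Θ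

theorem carrier_subset (Ψ : Finset Plane) (x : Plane) : carrier Ψ x ⊆ Ψ := by
  classical
  exact Finset.filter_subset _ _

theorem carrier_subset_of_mem {Ψ Θ : Finset Plane} {x : Plane} (h : Θ ⊆ Ψ)
    (hx : x ∈ convexHull ℝ (Θ : Set Plane)) : carrier Ψ x ⊆ Θ := by
  classical
  intro v hv
  exact (Finset.mem_filter.1 hv).2 Θ h hx

theorem mem_convexHull_carrier {Ψ : Finset Plane} (hΨ : AffineIndependent ℝ ((↑) : Ψ → Plane))
    {x : Plane} (hx : x ∈ convexHull ℝ (Ψ : Set Plane)) :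
    x ∈ convexHull ℝ (carrier Ψ x : Set Plane) := by
  classical
  obtain ⟨Θ, hΘ, hmin⟩ := (Ψ.powerset.filter fun Θ : Finset Plane => x ∈ convexHull ℝ (Θ : Set Plane))
    |>.exists_min_image Finset.card ⟨Ψ, by simp [hx]⟩
  simp only [Finset.mem_filter, Finset.mem_powerset, and_imp] at hΘ hmin
  have heq : carrier Ψ x = Θ := by
    refine (carrier_subset_of_mem hΘ.1 hΘ.2).antisymm fun v hv => ?_
    refine Finset.mem_filter.2 ⟨hΘ.1 hv, fun Θ' hΘ' hx' => ?_⟩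
    have hint : x ∈ convexHull ℝ ((Θ ∩ Θ' : Finset Plane) : Set Plane) := by
      rw [Finset.coe_inter, hΨ.convexHull_inter hΘ.1 hΘ']
      exact ⟨hΘ.2, hx'⟩
    have hcard := hmin (Θ ∩ Θ') (Finset.inter_subset_left.trans hΘ.1) hint
    have := Finset.eq_of_subset_of_card_le Finset.inter_subset_left hcard
    rw [← this] at hv
    exact Finset.mem_of_mem_inter_right hv
  rw [heq]
  exact hΘ.2

theorem carrier_eq_of_subset {Ψ Θ : Finset Plane} (hΨ : AffineIndependent ℝ ((↑) : Ψ → Plane))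
    {x : Plane} (h : Θ ⊆ Ψ) (hx : x ∈ convexHull ℝ (Θ : Set Plane)) :
    carrier Ψ x = carrier Θ x := by
  have hΘ : AffineIndependent ℝ ((↑) : Θ → Plane) :=
    hΨ.mono (s := (Θ : Set Plane)) (t := (Ψ : Set Plane)) (by exact_mod_cast h)
  refine Finset.Subset.antisymm ?_ ?_
  · exact carrier_subset_of_mem ((carrier_subset Θ x).trans h) (mem_convexHull_carrier hΘ hx)
  · exact carrier_subset_of_mem (carrier_subset_of_mem h hx)
      (mem_convexHull_carrier hΨ (convexHull_mono (by exact_mod_cast h) hx))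

/-- The carrier is constant on an open segment. -/
theorem carrier_congr_openSegment {Ψ : Finset Plane} (hΨ : AffineIndependent ℝ ((↑) : Ψ → Plane))
    {x y z z' : Plane} (hx : x ∈ convexHull ℝ (Ψ : Set Plane))
    (hy : y ∈ convexHull ℝ (Ψ : Set Plane)) (hz : z ∈ openSegment ℝ x y)
    (hz' : z' ∈ openSegment ℝ x y) : carrier Ψ z ⊆ carrier Ψ z' := by
  have hzΨ' := (convex_convexHull ℝ (Ψ : Set Plane)).openSegment_subset hx hy hz'
  have hsub := carrier_subset Ψ z'
  have hmem := mem_convexHull_carrier hΨ hzΨ'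
  have hE := hΨ.isExtreme_face hsub
  exact carrier_subset_of_mem hsub ((convex_convexHull ℝ _).openSegment_subset
    (hE.left_mem_of_mem_openSegment hx hy hmem hz')
    (hE.right_mem_of_mem_openSegment hx hy hmem hz') hz)

theorem polyline_eq {m : ℕ} (hm : 0 < m) (p : ℕ → Plane) {j : ℕ} {τ : ℝ}
    (h : τ ∈ Icc ((j : ℝ) / m) (((j : ℝ) + 1) / m)) :
    polyline m p τ = AffineMap.lineMap (p j) (p (j + 1)) (τ * m - j) := by
  have hm' : (0 : ℝ) < m := by exact_mod_cast hm
  obtain ⟨h1, h2⟩ := h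
  rw [div_le_iff₀ hm'] at h1
  rw [le_div_iff₀ hm'] at h2
  rcases h2.eq_or_lt with h2 | h2
  · rw [polyline, h2]
    have hf : ⌊(j : ℝ) + 1⌋₊ = j + 1 := by exact_mod_cast Nat.floor_natCast (R := ℝ) (j + 1)
    have hr : Int.fract ((j : ℝ) + 1) = 0 := by
      have := Int.fract_natCast (R := ℝ) (j + 1)
      push_cast at this
      exact this
    rw [hf, hr]
    simp
  · have hf : ⌊τ * m⌋₊ = j :=
      (Nat.floor_eq_iff ((Nat.cast_nonneg j).trans h1)).2 ⟨h1, h2⟩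
    have hr : Int.fract (τ * m) = τ * m - j := by
      rw [Int.fract_eq_iff]
      exact ⟨by linarith, by linarith, j, by simp⟩
    rw [polyline, hf, hr]

theorem polyline_vertex {m : ℕ} (hm : 0 < m) (p : ℕ → Plane) (j : ℕ) :
    polyline m p ((j : ℝ) / m) = p j := by
  have hm' : (0 : ℝ) < m := by exact_mod_cast hm
  rw [polyline_eq hm p (j := j) ⟨le_rfl, by gcongr; linarith⟩, div_mul_cancel₀ _ hm'.ne', sub_self,
    AffineMap.lineMap_apply_zero]

theorem exists_piece {m : ℕ} (hm : 0 < m) {τ : ℝ} (hτ : τ ∈ Icc (0 : ℝ) 1) :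
    ∃ j < m, τ ∈ Icc ((j : ℝ) / m) (((j : ℝ) + 1) / m) := by
  have hm' : (0 : ℝ) < m := by exact_mod_cast hm
  rcases hτ.2.eq_or_lt with rfl | h1
  · refine ⟨m - 1, by omega, ?_⟩
    have : ((m - 1 : ℕ) : ℝ) = m - 1 := by rw [Nat.cast_sub hm]; simp
    rw [mem_Icc, div_le_iff₀ hm', le_div_iff₀ hm', this]
    constructor <;> linarith
  · have h0 : 0 ≤ τ * m := mul_nonneg hτ.1 hm'.le
    refine ⟨⌊τ * m⌋₊, ?_, ?_⟩
    · rw [Nat.floor_lt h0]; nlinarith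
    · rw [mem_Icc, div_le_iff₀ hm', le_div_iff₀ hm']
      exact ⟨Nat.floor_le h0, (Nat.lt_floor_add_one _).le⟩

theorem piece_subset {m j : ℕ} (hj : j < m) :
    Icc ((j : ℝ) / m) (((j : ℝ) + 1) / m) ⊆ Icc (0 : ℝ) 1 := by
  have hm' : (0 : ℝ) < m := by exact_mod_cast (by omega : 0 < m)
  refine Icc_subset_Icc (by positivity) ?_
  rw [div_le_one hm']
  exact_mod_cast hj

theorem continuousOn_polyline {m : ℕ} (hm : 0 < m) (p : ℕ → Plane) :
    ContinuousOn (polyline m p) (Icc 0 1) := by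
  have h : ContinuousOn (polyline m p)
      (⋃ j : Fin m, Icc ((j : ℝ) / m) (((j : ℝ) + 1) / m)) := by
    refine (locallyFinite_of_finite _).continuousOn_iUnion (fun j => isClosed_Icc) fun j => ?_
    refine ContinuousOn.congr (f := fun τ : ℝ => AffineMap.lineMap (p j) (p (j + 1))
      (τ * m - (j : ℕ) : ℝ)) ?_
      fun τ hτ => polyline_eq hm p hτ
    exact (AffineMap.lineMap_continuous.comp (by fun_prop)).continuousOn
  refine h.mono fun τ hτ => ?_
  obtain ⟨j, hj, h⟩ := exists_piece hm hτ
  exact mem_iUnion.2 ⟨⟨j, hj⟩, h⟩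

/-- A chain of vertices is realized by a path along simplices which contain consecutive vertices:
the simplex at each time is the carrier of the point. -/
theorem PlaneComplex.exists_isPath_polyline (C : PlaneComplex) {m : ℕ} (hm : 0 < m)
    (p : ℕ → Plane) (c L : ℕ → Finset Plane) {s t : Plane} (hc : ∀ j ≤ m, c j ∈ C.faces)
    (hL : ∀ j < m, L j ∈ C.faces) (hl : ∀ j < m, c j ⊆ L j) (hr : ∀ j < m, c (j + 1) ⊆ L j)
    (hp : ∀ j ≤ m, p j ∈ convexHull ℝ (c j : Set Plane)) (h0 : c 0 = {s}) (h1 : c m = {t}) :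
    ∃ φ, C.IsPath s t (polyline m p) φ ∧
      ∀ j < m, ∀ τ ∈ Icc ((j : ℝ) / m) (((j : ℝ) + 1) / m), φ τ ⊆ L j := by
  classical
  have hm' : (0 : ℝ) < m := by exact_mod_cast hm
  set π := polyline m p with hπ
  let φ : ℝ → Finset Plane := fun τ =>
    if h : τ ∈ Icc (0 : ℝ) 1 then carrier (L (exists_piece hm h).choose) (π τ) else ∅
  have hseg : ∀ j < m, ∀ τ ∈ Icc ((j : ℝ) / m) (((j : ℝ) + 1) / m),
      π τ ∈ convexHull ℝ (L j : Set Plane) := by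
    intro j hj τ hτ
    rw [hπ, polyline_eq hm p hτ]
    rw [mem_Icc, div_le_iff₀ hm', le_div_iff₀ hm'] at hτ
    refine (convex_convexHull ℝ _).lineMap_mem
      (convexHull_mono (by exact_mod_cast hl j hj) (hp j hj.le))
      (convexHull_mono (by exact_mod_cast hr j hj) (hp (j + 1) hj)) ⟨by linarith, by linarith⟩
  -- The carrier of the point does not depend on the choice of the piece.
  have hstep : ∀ i < m, ∀ j < m, ∀ τ, i < j → τ ∈ Icc ((i : ℝ) / m) (((i : ℝ) + 1) / m) →
      τ ∈ Icc ((j : ℝ) / m) (((j : ℝ) + 1) / m) →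
      carrier (L i) (π τ) = carrier (L j) (π τ) := by
    intro i hi j hj τ hij hτi hτj
    have hτi' := hτi
    have hτj' := hτj
    rw [mem_Icc, div_le_iff₀ hm', le_div_iff₀ hm'] at hτi' hτj'
    have hji : (i : ℝ) + 1 ≤ j := by exact_mod_cast hij
    have hτ : τ * m = j := by linarith
    obtain rfl : j = i + 1 := by
      have : (j : ℝ) ≤ i + 1 := by linarith
      have : j ≤ i + 1 := by exact_mod_cast this
      omega
    have hπτ : π τ = p (i + 1) := by
      rw [hπ, polyline_eq hm p hτj, hτ, sub_self, AffineMap.lineMap_apply_zero]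
    have hmem := hp (i + 1) hi
    rw [← hπτ] at hmem
    rw [carrier_eq_of_subset (C.indep _ (hL i hi)) (hr i hi) hmem,
      carrier_eq_of_subset (C.indep _ (hL _ hj)) (hl _ hj) hmem]
  have hφ : ∀ j < m, ∀ τ ∈ Icc ((j : ℝ) / m) (((j : ℝ) + 1) / m), φ τ = carrier (L j) (π τ) := by
    intro j hj τ hτ
    have hτ1 := piece_subset hj hτ
    obtain ⟨hi, hτi⟩ := (exists_piece hm hτ1).choose_spec
    simp only [φ, hτ1, dif_pos]
    rcases lt_trichotomy (exists_piece hm hτ1).choose j with h | h | h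
    · exact hstep _ hi j hj τ h hτi hτ
    · rw [h]
    · exact (hstep j hj _ hi τ h hτ hτi).symm
  have hcell : ∀ τ ∈ Icc (0 : ℝ) 1, π τ ∈ convexHull ℝ (φ τ : Set Plane) := by
    intro τ hτ
    obtain ⟨j, hj, h⟩ := exists_piece hm hτ
    rw [hφ j hj τ h]
    exact mem_convexHull_carrier (C.indep _ (hL j hj)) (hseg j hj τ h)
  have hfaces : ∀ τ ∈ Icc (0 : ℝ) 1, φ τ ∈ C.faces := by
    intro τ hτ
    have hne : (φ τ).Nonempty := by
      rw [← Finset.coe_nonempty, ← convexHull_nonempty_iff (𝕜 := ℝ)]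
      exact ⟨_, hcell τ hτ⟩
    obtain ⟨j, hj, h⟩ := exists_piece hm hτ
    refine C.isRelLowerSet_faces.mem_of_le (hL j hj) ?_ hne
    rw [hφ j hj τ h]
    exact carrier_subset _ _
  have hcont := continuousOn_polyline hm p
  -- At nearby times the point is on a common piece, so that its carrier can only grow.
  have hlsc : ∀ τ ∈ Icc (0 : ℝ) 1, ∀ᶠ τ' in 𝓝[Icc 0 1] τ, φ τ ⊆ φ τ' := by
    intro τ hτ
    have e1 : ∀ᶠ τ' in 𝓝[Icc 0 1] τ, ∀ j ∈ Finset.range m,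
        τ' ∈ Icc ((j : ℝ) / m) (((j : ℝ) + 1) / m) →
          τ ∈ Icc ((j : ℝ) / m) (((j : ℝ) + 1) / m) := by
      refine (eventually_all_finset _).2 fun j _ => ?_
      by_cases h : τ ∈ Icc ((j : ℝ) / m) (((j : ℝ) + 1) / m)
      · exact .of_forall fun _ _ => h
      · filter_upwards [nhdsWithin_le_nhds (isClosed_Icc.isOpen_compl.mem_nhds h)] with τ' h' h''
        exact absurd h'' h'
    have e2 : ∀ᶠ τ' in 𝓝[Icc 0 1] τ, ∀ Θ ∈ C.finite_faces.toFinset,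
        π τ' ∈ convexHull ℝ (Θ : Set Plane) → π τ ∈ convexHull ℝ (Θ : Set Plane) := by
      refine (eventually_all_finset _).2 fun Θ _ => ?_
      by_cases h : π τ ∈ convexHull ℝ (Θ : Set Plane)
      · exact .of_forall fun _ _ => h
      · filter_upwards [(hcont τ hτ).eventually
          ((Θ.finite_toSet.isClosed_convexHull ℝ).isOpen_compl.mem_nhds h)] with τ' h' h''
        exact absurd h'' h'
    filter_upwards [e1, e2, self_mem_nhdsWithin] with τ' h1 h2 h3
    obtain ⟨j, hj, hτ'⟩ := exists_piece hm h3
    rw [hφ j hj τ (h1 j (Finset.mem_range.2 hj) hτ')]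
    refine carrier_subset_of_mem ?_ (h2 _ (by simpa using hfaces τ' h3) (hcell τ' h3))
    rw [hφ j hj τ' hτ']
    exact carrier_subset _ _
  have hsing : ∀ j ≤ m, ∀ v, c j = {v} → φ ((j : ℝ) / m) = {v} := by
    intro j hj v hv
    have hτ : (j : ℝ) / m ∈ Icc (0 : ℝ) 1 :=
      ⟨by positivity, by rw [div_le_one hm']; exact_mod_cast hj⟩
    have hx : π ((j : ℝ) / m) = v := by
      have := hp j hj
      rw [hv] at this
      rw [hπ, polyline_vertex hm]
      simpa using this
    have hne := (hfaces _ hτ)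
    obtain ⟨i, hi, hiL⟩ : ∃ i < m, (j : ℝ) / m ∈ Icc ((i : ℝ) / m) (((i : ℝ) + 1) / m) ∧
        c j ⊆ L i := by
      rcases hj.eq_or_lt with rfl | hj
      · refine ⟨j - 1, by omega, ⟨by gcongr; omega, ?_⟩, ?_⟩
        · gcongr
          rw [Nat.cast_sub hm]; simp
        · have := hr (j - 1) (by omega)
          rwa [Nat.sub_add_cancel hm] at this
      · exact ⟨j, hj, ⟨le_rfl, by gcongr; linarith⟩, hl j hj⟩
    have hsub : φ ((j : ℝ) / m) ⊆ {v} := by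
      rw [hφ i hi _ hiL.1, hx]
      exact carrier_subset_of_mem (hv ▸ hiL.2) (by simp)
    exact (Finset.subset_singleton_iff.1 hsub).resolve_left
      (C.isRelLowerSet_faces.prop_of_mem hne).ne_empty
  refine ⟨φ, ⟨hcont, ⟨hfaces, fun Δ hΔ => ?_, ?_⟩, hcell, ?_, ?_, ?_⟩, ?_⟩
  · -- On the interior of each piece the carrier is constant.
    let mid : ℕ → ℝ := fun j => ((j : ℝ) + 1 / 2) / m
    have hopen : ∀ j < m, ∀ τ ∈ Ioo ((j : ℝ) / m) (((j : ℝ) + 1) / m), φ τ = φ (mid j) := by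
      intro j hj τ hτ
      have hmid : mid j ∈ Ioo ((j : ℝ) / m) (((j : ℝ) + 1) / m) := by
        constructor <;> simp only [mid] <;> gcongr <;> linarith
      have hx := convexHull_mono (𝕜 := ℝ) (by exact_mod_cast hl j hj) (hp j hj.le)
      have hy := convexHull_mono (𝕜 := ℝ) (by exact_mod_cast hr j hj) (hp (j + 1) hj)
      have hos : ∀ τ ∈ Ioo ((j : ℝ) / m) (((j : ℝ) + 1) / m),
          π τ ∈ openSegment ℝ (p j) (p (j + 1)) := by
        intro τ hτ
        rw [hπ, polyline_eq hm p (Ioo_subset_Icc_self hτ), openSegment_eq_image_lineMap]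
        rw [mem_Ioo, div_lt_iff₀ hm', lt_div_iff₀ hm'] at hτ
        exact ⟨_, ⟨by linarith, by linarith⟩, rfl⟩
      rw [hφ j hj τ (Ioo_subset_Icc_self hτ), hφ j hj _ (Ioo_subset_Icc_self hmid)]
      exact (carrier_congr_openSegment (C.indep _ (hL j hj)) hx hy (hos τ hτ) (hos _ hmid)).antisymm
        (carrier_congr_openSegment (C.indep _ (hL j hj)) hx hy (hos _ hmid) (hos τ hτ))
    refine ⟨((Finset.range m).filter fun j : ℕ => φ (mid j) = Δ).image
      fun j : ℕ => ((j : ℝ) / m, ((j : ℝ) + 1) / m),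
      ((Finset.range (m + 1)).image fun j : ℕ => (j : ℝ) / m).filter fun τ => φ τ = Δ, ?_⟩
    ext τ
    simp only [Finset.mem_image, Finset.mem_filter, Finset.mem_range, mem_union, mem_iUnion,
      Finset.coe_filter, mem_ofPred_eq, exists_prop]
    constructor
    · rintro ⟨hτ, rfl⟩
      obtain ⟨j, hj, h⟩ := exists_piece hm hτ
      rcases h.1.eq_or_lt with h2 | h2
      · exact Or.inr ⟨⟨j, by omega, h2⟩, rfl⟩
      · rcases h.2.eq_or_lt with h3 | h3
        · exact Or.inr ⟨⟨j + 1, by omega, by rw [h3]; push_cast; rfl⟩, rfl⟩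
        · exact Or.inl ⟨_, ⟨j, ⟨hj, (hopen j hj τ ⟨h2, h3⟩).symm⟩, rfl⟩, h2, h3⟩
    · rintro (⟨_, ⟨j, ⟨hj, rfl⟩, rfl⟩, hτ⟩ | ⟨⟨j, hj, rfl⟩, rfl⟩)
      · exact ⟨piece_subset hj (Ioo_subset_Icc_self hτ), hopen j hj τ hτ⟩
      · exact ⟨⟨by positivity, by rw [div_le_one hm']; exact_mod_cast (by omega : j ≤ m)⟩, rfl⟩
  · -- Between incomparable simplices there is no transition.
    intro x y hx hxy hy Δ Ψ himg
    by_contra hadj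
    have hsub : Icc x y ⊆ Icc 0 1 := Icc_subset_Icc hx hy
    have hval : ∀ τ ∈ Icc x y, φ τ = Δ ∨ φ τ = Ψ := by
      intro τ hτ
      have : φ τ ∈ φ '' Icc x y := ⟨τ, hτ, rfl⟩
      rwa [himg] at this
    have hconst : ∀ τ ∈ Icc x y, ∀ τ' ∈ Icc x y, φ τ = φ τ' := by
      intro τ hτ τ' hτ'
      refine isPreconnected_Icc.induction₂ (fun τ τ' => φ τ = φ τ') (fun τ hτ => ?_)
        (fun _ _ _ _ _ _ h1 h2 => h1.trans h2) (fun _ _ _ _ h => h.symm) hτ hτ'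
      filter_upwards [nhdsWithin_mono τ hsub (hlsc τ (hsub hτ)), self_mem_nhdsWithin]
        with τ' h1 h2
      rcases hval τ hτ with h3 | h3 <;> rcases hval τ' h2 with h4 | h4
      · rw [h3, h4]
      · exact absurd (Or.inl (h3 ▸ h4 ▸ h1)) hadj
      · exact absurd (Or.inr (h3 ▸ h4 ▸ h1)) hadj
      · rw [h3, h4]
    have h1 : Δ ∈ φ '' Icc x y := by rw [himg]; simp
    have h2 : Ψ ∈ φ '' Icc x y := by rw [himg]; simp
    obtain ⟨τ, hτ, rfl⟩ := h1
    obtain ⟨τ', hτ', rfl⟩ := h2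
    exact hadj (Or.inl (hconst τ hτ τ' hτ').subset)
  · intro τ hτ Θ hΘ hlt hmem
    obtain ⟨j, hj, h⟩ := exists_piece hm hτ
    rw [hφ j hj τ h] at hlt
    exact hlt.2 (carrier_subset_of_mem (hlt.1.trans (carrier_subset _ _)) hmem)
  · simpa using hsing 0 (by omega) s h0
  · simpa [hm'.ne'] using hsing m le_rfl t h1
  · intro j hj τ hτ
    rw [hφ j hj τ hτ]
    exact carrier_subset _ _

/-- During a synchronized motion along polygonal paths the perimeter is maximum at some vertex, by
convexity. -/
theorem exists_isGreatest_perimeterValues {k m : ℕ} (hm : 0 < m) (p : Fin k → ℕ → Plane) :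
    ∃ j ≤ m, IsGreatest (perimeterValues (fun i => polyline m (p i)) fun _ => id)
      (configPerimeter fun i => p i j) := by
  have hm' : (0 : ℝ) < m := by exact_mod_cast hm
  obtain ⟨j, hj, hmax⟩ := (Finset.range (m + 1)).exists_max_image
    (fun j => configPerimeter fun i => p i j) ⟨0, by simp⟩
  simp only [Finset.mem_range] at hj hmax
  refine ⟨j, by omega, ⟨(j : ℝ) / m, ⟨by positivity, ?_⟩, ?_⟩, ?_⟩
  · rw [div_le_one hm']; exact_mod_cast (by omega : j ≤ m)
  · simp [polyline_vertex hm]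
  · rintro _ ⟨τ, hτ, rfl⟩
    obtain ⟨l, hl, h⟩ := exists_piece hm hτ
    simp only [id_eq, polyline_eq hm _ h]
    rw [mem_Icc, div_le_iff₀ hm', le_div_iff₀ hm'] at h
    have h0 : 0 ≤ τ * m - l := by linarith
    have h1 : τ * m - l ≤ 1 := by linarith
    refine (configPerimeter_lineMap_le (fun i => p i l) (fun i => p i (l + 1)) h0 h1).trans ?_
    have a1 := hmax l (by omega)
    have a2 := hmax (l + 1) (by omega)
    nlinarith

end Polylines

/-! ### Programs without loops, and a calculus of running times -/

section Machine

variable {k : ℕ}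

namespace Cmd

/-- A command without loops and procedure calls. -/
def LoopFree : Cmd k → Prop
  | .skip => True
  | .setNat _ _ _ => True
  | .copyReal _ _ _ _ => True
  | .minimize _ _ _ _ => True
  | .seq c d => c.LoopFree ∧ d.LoopFree
  | .ite _ c d => c.LoopFree ∧ d.LoopFree
  | .while _ _ => False
  | .call _ => False

open scoped Classical in
/-- The effect of a loop-free command, as a function on memories (loops and calls are given the
identity as a default value). -/
noncomputable def step (Ω : CellSolver k) : Cmd k → Memory k → Memory k
  | .skip, σ => σ
  | .setNat a e f, σ => σ.setNat a (e.eval σ) (f.eval σ)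
  | .copyReal a e b f, σ => σ.setReal a (e.eval σ) (σ.real b (f.eval σ))
  | .minimize q x y v, σ => σ.minimize Ω q x y v
  | .seq c d, σ => d.step Ω (c.step Ω σ)
  | .ite b c d, σ => if b.Holds σ then c.step Ω σ else d.step Ω σ
  | .while _ _, σ => σ
  | .call _, σ => σ

/-- An upper bound for the running time of a loop-free command. -/
def cost : Cmd k → ℕ
  | .skip => 1
  | .setNat _ _ _ => 1
  | .copyReal _ _ _ _ => 1
  | .minimize _ _ _ _ => 1
  | .seq c d => c.cost + d.cost
  | .ite _ c d => max c.cost d.cost + 1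
  | .while _ _ => 0
  | .call _ => 0

/-- The command contains no procedure call and no assignment to the array `a` of naturals. -/
def KeepsNat (a : NatArray k) : Cmd k → Prop
  | .skip => True
  | .setNat b _ _ => a ≠ b
  | .copyReal _ _ _ _ => True
  | .minimize _ _ _ _ => True
  | .seq c d => c.KeepsNat a ∧ d.KeepsNat a
  | .ite _ c d => c.KeepsNat a ∧ d.KeepsNat a
  | .while _ c => c.KeepsNat a
  | .call _ => False

/-- The command contains no procedure call and no assignment to the array `a` of reals. -/
def KeepsReal (a : RealArray k) : Cmd k → Prop
  | .skip => True
  | .setNat _ _ _ => True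
  | .copyReal b _ _ _ => a ≠ b
  | .minimize _ x y v => a ≠ x ∧ a ≠ y ∧ a ≠ v
  | .seq c d => c.KeepsReal a ∧ d.KeepsReal a
  | .ite _ c d => c.KeepsReal a ∧ d.KeepsReal a
  | .while _ c => c.KeepsReal a
  | .call _ => False

end Cmd

theorem Exec.keepsNat {Ω : CellSolver k} {ps : List (Cmd k)} {c : Cmd k} {σ σ' : Memory k} {T : ℕ}
    (h : Exec Ω ps c σ T σ') (a : NatArray k) (ha : c.KeepsNat a) : σ'.nat a = σ.nat a := by
  induction h with
  | skip => rfl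
  | setNat σ b e f =>
    funext j
    simp only [Memory.setNat]
    rw [if_neg]
    exact fun h => ha h.1
  | copyReal => rfl
  | minimize => rfl
  | seq _ _ ih1 ih2 => rw [ih2 ha.2, ih1 ha.1]
  | iteTrue _ _ ih => exact ih ha.1
  | iteFalse _ _ ih => exact ih ha.2
  | whileTrue _ _ _ ih1 ih2 => rw [ih2 ha, ih1 ha]
  | whileFalse => rfl
  | call => exact ha.elim

theorem Exec.keepsReal {Ω : CellSolver k} {ps : List (Cmd k)} {c : Cmd k} {σ σ' : Memory k}
    {T : ℕ} (h : Exec Ω ps c σ T σ') (a : RealArray k) (ha : c.KeepsReal a) :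
    σ'.real a = σ.real a := by
  induction h with
  | skip => rfl
  | setNat σ b e f => rfl
  | copyReal σ b e d f =>
    funext j
    simp only [Memory.setReal]
    rw [if_neg]
    exact fun h => ha h.1
  | minimize σ q x y v =>
    funext j
    obtain ⟨h1, h2, h3⟩ := ha
    simp [Memory.minimize, Memory.setReal, Memory.setBlock, h1, h2, h3]
  | seq _ _ ih1 ih2 => rw [ih2 ha.2, ih1 ha.1]
  | iteTrue _ _ ih => exact ih ha.1
  | iteFalse _ _ ih => exact ih ha.2
  | whileTrue _ _ _ ih1 ih2 => rw [ih2 ha, ih1 ha]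
  | whileFalse => rfl
  | call => exact ha.elim

/-- The memories `σ` and `τ` agree on the arrays to which `c` does not write. -/
structure Frame (c : Cmd k) (σ τ : Memory k) : Prop where
  nat : ∀ a, c.KeepsNat a → τ.nat a = σ.nat a
  real : ∀ a, c.KeepsReal a → τ.real a = σ.real a

theorem Frame.rfl' {c : Cmd k} {σ : Memory k} : Frame c σ σ := ⟨fun _ _ => rfl, fun _ _ => rfl⟩

/-- Run on `σ`, the command `c` halts after at most `B` steps, with a memory that satisfies `Q`. -/
def Runs (Ω : CellSolver k) (c : Cmd k) (σ : Memory k) (B : ℕ) (Q : Memory k → Prop) : Prop :=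
  ∃ T σ', Exec Ω [] c σ T σ' ∧ T ≤ B ∧ Q σ'

variable {Ω : CellSolver k}

theorem Cmd.LoopFree.exec {c : Cmd k} (hc : c.LoopFree) (σ : Memory k) :
    ∃ T ≤ c.cost, Exec Ω [] c σ T (c.step Ω σ) := by
  induction c generalizing σ with
  | skip => exact ⟨1, le_rfl, .skip σ⟩
  | setNat a e f => exact ⟨1, le_rfl, .setNat σ a e f⟩
  | copyReal a e b f => exact ⟨1, le_rfl, .copyReal σ a e b f⟩
  | minimize q x y v => exact ⟨1, le_rfl, .minimize σ q x y v⟩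
  | seq c d ihc ihd =>
    obtain ⟨T, hT, h⟩ := ihc hc.1 σ
    obtain ⟨T', hT', h'⟩ := ihd hc.2 (c.step Ω σ)
    exact ⟨T + T', Nat.add_le_add hT hT', .seq h h'⟩
  | ite b c d ihc ihd =>
    by_cases hb : b.Holds σ
    · obtain ⟨T, hT, h⟩ := ihc hc.1 σ
      refine ⟨T + 1, Nat.add_le_add_right (hT.trans (le_max_left _ _)) 1, ?_⟩
      simp only [step, if_pos hb]
      exact .iteTrue hb h
    · obtain ⟨T, hT, h⟩ := ihd hc.2 σ
      refine ⟨T + 1, Nat.add_le_add_right (hT.trans (le_max_right _ _)) 1, ?_⟩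
      simp only [step, if_neg hb]
      exact .iteFalse hb h
  | _ => exact hc.elim

theorem Cmd.LoopFree.frame {c : Cmd k} (hc : c.LoopFree) (σ : Memory k) :
    Frame c σ (c.step Ω σ) := by
  obtain ⟨T, -, h⟩ := hc.exec (Ω := Ω) σ
  exact ⟨fun a ha => h.keepsNat a ha, fun a ha => h.keepsReal a ha⟩

theorem Runs.mono {c : Cmd k} {σ : Memory k} {B B' : ℕ} {Q Q' : Memory k → Prop}
    (h : Runs Ω c σ B Q) (hB : B ≤ B') (hQ : ∀ τ, Frame c σ τ → Q τ → Q' τ) :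
    Runs Ω c σ B' Q' := by
  obtain ⟨T, τ, h1, h2, h3⟩ := h
  exact ⟨T, τ, h1, h2.trans hB,
    hQ τ ⟨fun a ha => h1.keepsNat a ha, fun a ha => h1.keepsReal a ha⟩ h3⟩

theorem Runs.of_loopFree {c : Cmd k} {σ : Memory k} {B : ℕ} {Q : Memory k → Prop}
    (hc : c.LoopFree) (hB : c.cost ≤ B) (hQ : Q (c.step Ω σ)) : Runs Ω c σ B Q := by
  obtain ⟨T, hT, h⟩ := hc.exec (Ω := Ω) σ
  exact ⟨T, _, h, hT.trans hB, hQ⟩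

theorem Runs.seq {c d : Cmd k} {σ : Memory k} {B₁ B₂ B : ℕ} {Q₁ Q : Memory k → Prop}
    (hc : Runs Ω c σ B₁ Q₁) (hB : B₁ + B₂ ≤ B)
    (hd : ∀ τ, Frame c σ τ → Q₁ τ → Runs Ω d τ B₂ Q) : Runs Ω (.seq c d) σ B Q := by
  obtain ⟨T, τ, h1, h2, h3⟩ := hc
  obtain ⟨T', τ', h4, h5, h6⟩ :=
    hd τ ⟨fun a ha => h1.keepsNat a ha, fun a ha => h1.keepsReal a ha⟩ h3
  exact ⟨T + T', τ', .seq h1 h4, (Nat.add_le_add h2 h5).trans hB, h6⟩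

theorem Runs.ite {b : Cond k} {c d : Cmd k} {σ : Memory k} {B : ℕ} {Q : Memory k → Prop}
    (hc : b.Holds σ → Runs Ω c σ B Q) (hd : ¬ b.Holds σ → Runs Ω d σ B Q) :
    Runs Ω (.ite b c d) σ (B + 1) Q := by
  by_cases hb : b.Holds σ
  · obtain ⟨T, τ, h1, h2, h3⟩ := hc hb
    exact ⟨T + 1, τ, .iteTrue hb h1, by omega, h3⟩
  · obtain ⟨T, τ, h1, h2, h3⟩ := hd hb
    exact ⟨T + 1, τ, .iteFalse hb h1, by omega, h3⟩

/-- A loop runs within the time given by a potential `Φ` if `Φ` drops in each pass by at least the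
time of that pass. -/
theorem Runs.while {b : Cond k} {c : Cmd k} {σ : Memory k} (Inv : Memory k → Prop)
    (Φ : Memory k → ℕ) (h0 : Inv σ)
    (hstep : ∀ τ, Frame c σ τ → Inv τ → b.Holds τ →
      ∃ B, Runs Ω c τ B (fun τ' => Inv τ' ∧ B + 1 + Φ τ' ≤ Φ τ)) :
    Runs Ω (.while b c) σ (Φ σ + 1) (fun τ => Inv τ ∧ ¬ b.Holds τ) := by
  suffices H : ∀ N τ, Frame c σ τ → Inv τ → Φ τ ≤ N →
      Runs Ω (.while b c) τ (Φ τ + 1) (fun τ => Inv τ ∧ ¬ b.Holds τ) from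
    H (Φ σ) σ Frame.rfl' h0 le_rfl
  intro N
  induction N with
  | zero =>
    intro τ hF hI hN
    by_cases hb : b.Holds τ
    · obtain ⟨B, T, τ', h1, h2, h3, h4⟩ := hstep τ hF hI hb
      omega
    · exact ⟨1, τ, .whileFalse hb, by omega, hI, hb⟩
  | succ N ih =>
    intro τ hF hI hN
    by_cases hb : b.Holds τ
    · obtain ⟨B, T, τ', h1, h2, h3, h4⟩ := hstep τ hF hI hb
      have hF' : Frame c σ τ' :=
        ⟨fun a ha => (h1.keepsNat a ha).trans (hF.nat a ha),
          fun a ha => (h1.keepsReal a ha).trans (hF.real a ha)⟩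
      obtain ⟨T', τ'', h5, h6, h7⟩ := ih τ' hF' h3 (by omega)
      exact ⟨T + 1 + T', τ'', .whileTrue hb h1 h5, by omega, h7⟩
    · exact ⟨1, τ, .whileFalse hb, by omega, hI, hb⟩

/-- The rule for loops with a loop-free body: each pass decreases the potential. -/
theorem Runs.while_loopFree {b : Cond k} {c : Cmd k} {σ : Memory k} (hc : c.LoopFree)
    (Inv : Memory k → Prop) (Φ : Memory k → ℕ) (h0 : Inv σ)
    (hstep : ∀ τ, Frame c σ τ → Inv τ → b.Holds τ →
      Inv (c.step Ω τ) ∧ Φ (c.step Ω τ) < Φ τ) :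
    Runs Ω (.while b c) σ ((c.cost + 1) * Φ σ + 1) (fun τ => Inv τ ∧ ¬ b.Holds τ) := by
  refine Runs.while Inv (fun τ => (c.cost + 1) * Φ τ) h0 ?_
  intro τ hF hI hb
  obtain ⟨h1, h2⟩ := hstep τ hF hI hb
  refine ⟨c.cost, Runs.of_loopFree hc le_rfl ⟨h1, ?_⟩⟩
  calc c.cost + 1 + (c.cost + 1) * Φ (c.step Ω τ) = (c.cost + 1) * (Φ (c.step Ω τ) + 1) := by ring
    _ ≤ (c.cost + 1) * Φ τ := Nat.mul_le_mul_left _ h2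

/-! ### Notation for programs -/

/-- The scalar variable kept at position `0` of an array. -/
abbrev NatExpr.val (a : NatArray k) : NatExpr k := .get a (.const 0)

/-- Assignment to a scalar variable. -/
abbrev Cmd.assign (a : NatArray k) (e : NatExpr k) : Cmd k := .setNat a (.const 0) e

/-- Assignment of `a + e` to the scalar variable `a`. -/
abbrev Cmd.incr (a : NatArray k) (e : NatExpr k) : Cmd k := .assign a (.add (.val a) e)

/-- Sequential composition of a list of commands. -/
def Cmd.block : List (Cmd k) → Cmd k
  | [] => .skip
  | [c] => c
  | c :: d :: l => .seq c (Cmd.block (d :: l))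

/-- Disjunction of conditions. -/
abbrev Cond.disj (c d : Cond k) : Cond k := .neg (.conj (.neg c) (.neg d))

end Machine

section Machine

variable {k : ℕ} {Ω : CellSolver k}

@[simp] theorem Memory.nat_setNat_same (σ : Memory k) (a : NatArray k) (i v : ℕ) :
    (σ.setNat a i v).nat a = Function.update (σ.nat a) i v := by
  funext j
  simp [Memory.setNat, Function.update_apply]

theorem Memory.nat_setNat_of_ne (σ : Memory k) {a b : NatArray k} (h : b ≠ a) (i v : ℕ) :
    (σ.setNat a i v).nat b = σ.nat b := by
  funext j
  simp [Memory.setNat, h]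

@[simp] theorem Memory.real_setNat (σ : Memory k) (a : NatArray k) (i v : ℕ) :
    (σ.setNat a i v).real = σ.real := rfl

@[simp] theorem Memory.nat_setReal (σ : Memory k) (a : RealArray k) (i : ℕ) (v : ℝ) :
    (σ.setReal a i v).nat = σ.nat := rfl

@[simp] theorem Memory.real_setReal_same (σ : Memory k) (a : RealArray k) (i : ℕ) (v : ℝ) :
    (σ.setReal a i v).real a = Function.update (σ.real a) i v := by
  funext j
  simp [Memory.setReal, Function.update_apply]

theorem Memory.real_setReal_of_ne (σ : Memory k) {a b : RealArray k} (h : b ≠ a) (i : ℕ) (v : ℝ) :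
    (σ.setReal a i v).real b = σ.real b := by
  funext j
  simp [Memory.setReal, h]

@[simp] theorem Memory.nat_minimize (σ : Memory k) (q : NatArray k) (x y v : RealArray k) :
    (σ.minimize Ω q x y v).nat = σ.nat := rfl

/-! ### Names of variables and arrays -/

/-- The common radix of the cell codes: the largest number of simplices. -/
abbrev vRadix : NatArray k := .work 0
/-- The table of the multiples of the radix. -/
abbrev tMul : NatArray k := .work 1
/-- The table of quotients by the radix. -/
abbrev tDiv : NatArray k := .work 2
/-- The table of remainders modulo the radix. -/
abbrev tMod : NatArray k := .work 3
/-- The number of cell codes. -/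
abbrev vTotal : NatArray k := .work 4
/-- The code of the current cell. -/
abbrev vCell : NatArray k := .work 5
/-- The tuple of simplex numbers of the current cell. -/
abbrev aTuple : NatArray k := .work 6
/-- The number of edges. -/
abbrev vEdges : NatArray k := .work 7
/-- The first end of each edge of the cell graph. -/
abbrev aFst : NatArray k := .work 8
/-- The second end of each edge of the cell graph. -/
abbrev aSnd : NatArray k := .work 9
/-- The first end of each edge of the contracted graph. -/
abbrev aSrc : NatArray k := .work 10
/-- The second end of each edge of the contracted graph. -/
abbrev aDst : NatArray k := .work 11
/-- The active edges. -/
abbrev aAct : NatArray k := .work 12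
/-- The number of active edges. -/
abbrev vAct : NatArray k := .work 13
/-- The start node of the contracted graph. -/
abbrev vSrc : NatArray k := .work 14
/-- The target node of the contracted graph. -/
abbrev vDst : NatArray k := .work 15
/-- The pivot edge. -/
abbrev vPivot : NatArray k := .work 16
/-- The array of edges to be merged. -/
abbrev aX : NatArray k := .work 17
/-- The array of merged edges. -/
abbrev aZ : NatArray k := .work 18
/-- The number of edges to be merged. -/
abbrev vLen : NatArray k := .work 19
/-- The length of the sorted blocks. -/
abbrev vBlk : NatArray k := .work 20
/-- Half the length of the sorted blocks after each pass. -/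
abbrev vHalf : NatArray k := .work 21
/-- The reading position in the left block. -/
abbrev vI : NatArray k := .work 22
/-- The reading position in the right block. -/
abbrev vJ : NatArray k := .work 23
/-- The end of the left block. -/
abbrev vMid : NatArray k := .work 24
/-- The end of the right block. -/
abbrev vHi : NatArray k := .work 25
/-- The writing position. -/
abbrev vOut : NatArray k := .work 26
/-- The active edges up to the pivot. -/
abbrev aLow : NatArray k := .work 27
/-- The number of active edges up to the pivot. -/
abbrev vLow : NatArray k := .work 28
/-- The active edges after the pivot. -/
abbrev aHigh : NatArray k := .work 29
/-- The number of active edges after the pivot. -/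
abbrev vHigh : NatArray k := .work 30
/-- The nodes from which the search is started. -/
abbrev aRoot : NatArray k := .work 31
/-- The number of nodes from which the search is started. -/
abbrev vRoot : NatArray k := .work 32
/-- The label of a node: `0` for a node not yet reached. -/
abbrev aLab : NatArray k := .work 33
/-- One plus the next half-edge leaving a node, or `0`. -/
abbrev aHead : NatArray k := .work 34
/-- The tail of each half-edge. -/
abbrev aTail : NatArray k := .work 35
/-- The tip of each half-edge. -/
abbrev aTip : NatArray k := .work 36
/-- One plus the next half-edge with the same tail, or `0`. -/
abbrev aNext : NatArray k := .work 37
/-- The number of half-edges. -/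
abbrev vHalfEdges : NatArray k := .work 38
/-- The parent of a node in the search forest. -/
abbrev aPar : NatArray k := .work 39
/-- The queue of the search. -/
abbrev aQueue : NatArray k := .work 40
/-- The head of the queue. -/
abbrev vFront : NatArray k := .work 41
/-- The end of the queue. -/
abbrev vBack : NatArray k := .work 42
/-- The number of starting nodes already examined. -/
abbrev vRootPos : NatArray k := .work 43
/-- The current half-edge. -/
abbrev vHalfEdge : NatArray k := .work 44
/-- A loop counter. -/
abbrev vCount : NatArray k := .work 45
/-- An accumulator. -/
abbrev vAcc : NatArray k := .work 46
/-- The next cell of the output path. -/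
abbrev vNext : NatArray k := .work 47
/-- A flag that ends the output loop. -/
abbrev vFlag : NatArray k := .work 48
/-- A second accumulator. -/
abbrev vAcc' : NatArray k := .work 49
/-- The weights of the edges. -/
abbrev rW : RealArray k := .work 0
/-- The first coordinates of the points that minimize the perimeter over a cell. -/
abbrev rX : RealArray k := .work 1
/-- The second coordinates of the points that minimize the perimeter over a cell. -/
abbrev rY : RealArray k := .work 2
/-- The minimum perimeter over a cell. -/
abbrev rV : RealArray k := .work 3

/-! ### The order of the edges -/

/-- Edges are ordered by weight, and edges of equal weight by their numbers. -/
def KeyLe (W : ℕ → ℝ) (e f : ℕ) : Prop := W e ≤ W f ∧ ¬ (W f ≤ W e ∧ f < e)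

theorem KeyLe.refl (W : ℕ → ℝ) (e : ℕ) : KeyLe W e e := ⟨le_rfl, fun h => lt_irrefl _ h.2⟩

theorem KeyLe.trans {W : ℕ → ℝ} {e f g : ℕ} (h : KeyLe W e f) (h' : KeyLe W f g) :
    KeyLe W e g := by
  refine ⟨h.1.trans h'.1, fun hh => ?_⟩
  by_cases h1 : f < e
  · exact h.2 ⟨h'.1.trans hh.1, h1⟩
  · exact h'.2 ⟨hh.1.trans h.1, by omega⟩

theorem KeyLe.antisymm {W : ℕ → ℝ} {e f : ℕ} (h : KeyLe W e f) (h' : KeyLe W f e) : e = f := by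
  by_contra hne
  rcases lt_or_gt_of_ne hne with h1 | h1
  · exact h'.2 ⟨h.1, h1⟩
  · exact h.2 ⟨h'.1, h1⟩

theorem KeyLe.of_not {W : ℕ → ℝ} {e f : ℕ} (h : ¬ KeyLe W e f) : KeyLe W f e := by
  unfold KeyLe at *
  by_cases h1 : W e ≤ W f
  · have h2 := not_and_not_right.1 (fun hh => h hh) h1
    exact ⟨h2.1, fun h3 => by omega⟩
  · exact ⟨(not_le.1 h1).le, fun h2 => h1 h2.1⟩

/-- The test whether the edge `e` is at most the edge `f`. -/
def keyLeCond (e f : NatExpr k) : Cond k :=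
  .conj (.realLe rW e rW f) (.neg (.conj (.realLe rW f rW e) (.natLt f e)))

@[simp] theorem keyLeCond_holds (σ : Memory k) (e f : NatExpr k) :
    (keyLeCond e f).Holds σ ↔ KeyLe (σ.real rW) (e.eval σ) (f.eval σ) := Iff.rfl

/-! ### Counting -/

open scoped Classical in
/-- The number of positions below `n` at which the sequence `f` satisfies `P`. -/
noncomputable def cnt (P : ℕ → Prop) (f : ℕ → ℕ) (n : ℕ) : ℕ := Nat.count (fun i => P (f i)) n

theorem cnt_zero (P : ℕ → Prop) (f : ℕ → ℕ) : cnt P f 0 = 0 := by simp [cnt]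

open scoped Classical in
theorem cnt_succ (P : ℕ → Prop) (f : ℕ → ℕ) (n : ℕ) :
    cnt P f (n + 1) = cnt P f n + if P (f n) then 1 else 0 := by
  simp [cnt, Nat.count_succ]

theorem cnt_congr {P : ℕ → Prop} {f g : ℕ → ℕ} {n : ℕ} (h : ∀ i < n, f i = g i) :
    cnt P f n = cnt P g n := by
  induction n with
  | zero => simp [cnt_zero]
  | succ n ih => rw [cnt_succ, cnt_succ, ih fun i hi => h i (by omega), h n (by omega)]

theorem cnt_mono (P : ℕ → Prop) (f : ℕ → ℕ) {m n : ℕ} (h : m ≤ n) : cnt P f m ≤ cnt P f n :=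
  open scoped Classical in Nat.count_monotone _ h

theorem cnt_le (P : ℕ → Prop) (f : ℕ → ℕ) (n : ℕ) : cnt P f n ≤ n :=
  open scoped Classical in Nat.count_le _

theorem cnt_update_of_le (P : ℕ → Prop) (f : ℕ → ℕ) {n o : ℕ} (h : n ≤ o) (v : ℕ) :
    cnt P (Function.update f o v) n = cnt P f n :=
  cnt_congr fun i hi => Function.update_of_ne (by omega) _ _

theorem cnt_add_cnt_not (P : ℕ → Prop) (f : ℕ → ℕ) (n : ℕ) :
    cnt P f n + cnt (fun x => ¬ P x) f n = n := by
  induction n with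
  | zero => simp [cnt_zero]
  | succ n ih =>
    rw [cnt_succ, cnt_succ]
    by_cases h : P (f n) <;> simp [h] <;> omega

/-! ### Merging sorted blocks -/

/-- The sequence `f` is sorted within each of the consecutive blocks of length `b` of its first `n`
entries. -/
def BlockSorted (W : ℕ → ℝ) (f : ℕ → ℕ) (b n : ℕ) : Prop :=
  ∀ q x y, b * q ≤ x → x ≤ y → y < b * q + b → y < n → KeyLe W (f x) (f y)

/-- A stage in the merging of the block of `X` from `lo` to `mid` with the block from `mid` to
`hi`: the entries up to `i` and those from `mid` to `j` have been moved to `Z`, as have all entries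
before `lo`. -/
structure MergeState (W : ℕ → ℝ) (X : ℕ → ℕ) (b : ℕ) (Z : ℕ → ℕ) (q i j mid hi o : ℕ) : Prop where
  mid_eq : mid = 2 * b * q + b
  hi_eq : hi = 2 * b * q + 2 * b
  lo_le : 2 * b * q ≤ i
  i_le : i ≤ mid
  mid_le : mid ≤ j
  j_le : j ≤ hi
  out_eq : o + mid = i + j
  count : ∀ P, cnt P Z o + cnt P X mid = cnt P X i + cnt P X j
  sorted : BlockSorted W Z (2 * b) o
  below : ∀ x, 2 * b * q ≤ x → x < o → ∀ y, (i ≤ y ∧ y < mid ∨ j ≤ y ∧ y < hi) →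
    KeyLe W (Z x) (X y)

theorem BlockSorted.update {W : ℕ → ℝ} {Z : ℕ → ℕ} {B o v q : ℕ} (h : BlockSorted W Z B o)
    (hq : B * q ≤ o) (hq' : o < B * q + B) (hv : ∀ x, B * q ≤ x → x < o → KeyLe W (Z x) v) :
    BlockSorted W (Function.update Z o v) B (o + 1) := by
  intro q' x y h1 h2 h3 h4
  rcases Nat.lt_or_ge y o with hy | hy
  · rw [Function.update_of_ne (by omega), Function.update_of_ne (by omega)]
    exact h q' x y h1 h2 h3 hy
  · have hyo : y = o := by omega
    have hqq : q' = q := by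
      subst hyo
      rcases lt_trichotomy q' q with h5 | h5 | h5
      · have : B * (q' + 1) ≤ B * q := Nat.mul_le_mul_left _ h5
        rw [Nat.mul_succ] at this
        omega
      · exact h5
      · have : B * (q + 1) ≤ B * q' := Nat.mul_le_mul_left _ h5
        rw [Nat.mul_succ] at this
        omega
    subst hqq
    subst hyo
    rw [Function.update_self]
    rcases Nat.lt_or_ge x y with hx | hx
    · rw [Function.update_of_ne (by omega)]
      exact hv x h1 hx
    · have : x = y := by omega
      subst this
      rw [Function.update_self]
      exact KeyLe.refl W v

theorem MergeState.left {W : ℕ → ℝ} {X : ℕ → ℕ} {b len : ℕ} {Z : ℕ → ℕ} {q i j mid hi o : ℕ}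
    (hX : BlockSorted W X b len) (hlen : hi ≤ len) (h : MergeState W X b Z q i j mid hi o)
    (hi' : i < mid) (hij : j < hi → KeyLe W (X i) (X j)) :
    MergeState W X b (Function.update Z o (X i)) q (i + 1) j mid hi (o + 1) := by
  have e1 := h.mid_eq
  have e2 := h.hi_eq
  have e3 := h.lo_le
  have e4 := h.out_eq
  have e5 := h.j_le
  have e6 := h.mid_le
  have e7 : b * (2 * q) = 2 * b * q := by ring
  have e8 : b * (2 * q + 1) = 2 * b * q + b := by ring
  refine ⟨e1, e2, by omega, by omega, e6, e5, by omega, fun P => ?_, ?_, ?_⟩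
  · rw [cnt_succ, cnt_succ, cnt_update_of_le _ _ le_rfl, Function.update_self]
    have := h.count P
    omega
  · exact h.sorted.update (q := q) (by omega) (by omega)
      fun x hx hx' => h.below x hx hx' i (Or.inl ⟨le_rfl, hi'⟩)
  · intro x hx hx' y hy
    rcases Nat.lt_or_ge x o with hxo | hxo
    · rw [Function.update_of_ne (by omega)]
      exact h.below x hx hxo y (by omega)
    · have : x = o := by omega
      subst this
      rw [Function.update_self]
      rcases hy with hy | hy
      · exact hX (2 * q) i y (by omega) (by omega) (by omega) (by omega)
      · exact (hij (by omega)).trans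
          (hX (2 * q + 1) j y (by omega) (by omega) (by omega) (by omega))

theorem MergeState.right {W : ℕ → ℝ} {X : ℕ → ℕ} {b len : ℕ} {Z : ℕ → ℕ} {q i j mid hi o : ℕ}
    (hX : BlockSorted W X b len) (hlen : hi ≤ len) (h : MergeState W X b Z q i j mid hi o)
    (hj : j < hi) (hij : i < mid → KeyLe W (X j) (X i)) :
    MergeState W X b (Function.update Z o (X j)) q i (j + 1) mid hi (o + 1) := by
  have e1 := h.mid_eq
  have e2 := h.hi_eq
  have e3 := h.lo_le
  have e4 := h.out_eq
  have e5 := h.i_le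
  have e6 := h.mid_le
  have e7 : b * (2 * q) = 2 * b * q := by ring
  have e8 : b * (2 * q + 1) = 2 * b * q + b := by ring
  refine ⟨e1, e2, by omega, by omega, by omega, by omega, by omega, fun P => ?_, ?_, ?_⟩
  · rw [cnt_succ, cnt_succ, cnt_update_of_le _ _ le_rfl, Function.update_self]
    have := h.count P
    omega
  · exact h.sorted.update (q := q) (by omega) (by omega)
      fun x hx hx' => h.below x hx hx' j (Or.inr ⟨le_rfl, hj⟩)
  · intro x hx hx' y hy
    rcases Nat.lt_or_ge x o with hxo | hxo
    · rw [Function.update_of_ne (by omega)]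
      exact h.below x hx hxo y (by omega)
    · have : x = o := by omega
      subst this
      rw [Function.update_self]
      rcases hy with hy | hy
      · exact (hij (by omega)).trans
          (hX (2 * q) i y (by omega) (by omega) (by omega) (by omega))
      · exact hX (2 * q + 1) j y (by omega) (by omega) (by omega) (by omega)

theorem MergeState.next {W : ℕ → ℝ} {X : ℕ → ℕ} {b : ℕ} {Z : ℕ → ℕ} {q i j mid hi : ℕ}
    (h : MergeState W X b Z q i j mid hi hi) :
    MergeState W X b Z (q + 1) hi (hi + b) (hi + b) (hi + b + b) hi := by
  have e1 := h.mid_eq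
  have e2 := h.hi_eq
  have e4 := h.out_eq
  have e5 := h.i_le
  have e6 := h.j_le
  have e7 : 2 * b * (q + 1) = 2 * b * q + 2 * b := by ring
  have ei : i = mid := by omega
  have ej : j = hi := by omega
  refine ⟨by omega, by omega, by omega, by omega, le_rfl, by omega, by omega, fun P => ?_,
    h.sorted, fun x hx hx' => by omega⟩
  have := h.count P
  subst ei ej
  omega

/-- The next entry to be moved is taken from the left block. -/
def takeLeft : Cond k :=
  .conj (.natLt (.val vI) (.val vMid)) (.neg (.conj (.natLt (.val vJ) (.val vHi))
    (.neg (keyLeCond (.get aX (.val vI)) (.get aX (.val vJ))))))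

/-- One step of the merging loop. -/
def mergeStep : Cmd k :=
  .block [
    .ite takeLeft
      (.block [.setNat aZ (.val vOut) (.get aX (.val vI)), .incr vI (.const 1)])
      (.block [.setNat aZ (.val vOut) (.get aX (.val vJ)), .incr vJ (.const 1)]),
    .incr vOut (.const 1),
    .ite (.natEq (.val vOut) (.val vHi))
      (.block [.assign vI (.val vHi), .assign vMid (.add (.val vHi) (.val vBlk)),
        .assign vJ (.val vMid), .assign vHi (.add (.val vMid) (.val vBlk))])
      .skip]

/-- Merges the sorted blocks of `aX` in pairs, into `aZ`. -/
def mergePass : Cmd k :=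
  .seq (.block [.assign vI (.const 0), .assign vMid (.val vBlk), .assign vJ (.val vBlk),
      .assign vHi (.add (.val vBlk) (.val vBlk)), .assign vOut (.const 0)])
    (.while (.natLt (NatExpr.val vOut) (.val vLen)) mergeStep)

/-- Merging the blocks in pairs takes linear time, doubles the length of the sorted blocks, and
permutes the entries, which is expressed by counting. -/
theorem mergePass_runs (σ : Memory k) (b len g : ℕ) (hb : 0 < b) (hblk : σ.nat vBlk 0 = b)
    (hlen : σ.nat vLen 0 = len) (hg : len = 2 * b * g)
    (hX : BlockSorted (σ.real rW) (σ.nat aX) b len) :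
    Runs Ω mergePass σ (10 * len + 6) (fun τ =>
      BlockSorted (σ.real rW) (τ.nat aZ) (2 * b) len ∧
      ∀ P, cnt P (τ.nat aZ) len = cnt P (σ.nat aX) len) := by
  set W := σ.real rW with hW
  refine Runs.seq (B₁ := 5) (B₂ := 10 * len + 1) (Q₁ := fun τ => MergeState W (σ.nat aX) b
      (τ.nat aZ) 0 (τ.nat vI 0) (τ.nat vJ 0) (τ.nat vMid 0) (τ.nat vHi 0) (τ.nat vOut 0) ∧
      τ.nat vOut 0 = 0 ∧ τ.nat vHi 0 = b + b)
    (.of_loopFree (by simp [Cmd.block, Cmd.LoopFree]) (by simp [Cmd.block, Cmd.cost]) ?_)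
    (by omega) ?_
  · simp [Cmd.block, Cmd.step, NatExpr.eval, Memory.nat_setNat_of_ne, hblk]
    refine ⟨by omega, by omega, by omega, by omega, by omega, by omega, by omega, fun P => ?_,
      fun q x y _ _ _ _ => by omega, fun x _ _ => by omega⟩
    simp [cnt_zero]
  intro τ hF hτ
  have hx : τ.nat aX = σ.nat aX := hF.nat _ (by simp [Cmd.block, Cmd.KeepsNat])
  have hw : τ.real rW = W := hF.real _ (by simp [Cmd.block, Cmd.KeepsReal])
  have hl : τ.nat vLen 0 = len := by rw [hF.nat _ (by simp [Cmd.block, Cmd.KeepsNat]), hlen]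
  have hbl : τ.nat vBlk 0 = b := by rw [hF.nat _ (by simp [Cmd.block, Cmd.KeepsNat]), hblk]
  refine (Runs.while_loopFree (by simp [mergeStep, Cmd.block, Cmd.LoopFree])
    (fun υ => ∃ q, MergeState W (σ.nat aX) b
      (υ.nat aZ) q (υ.nat vI 0) (υ.nat vJ 0) (υ.nat vMid 0) (υ.nat vHi 0) (υ.nat vOut 0) ∧
      υ.nat vOut 0 < υ.nat vHi 0 ∧ υ.nat vOut 0 ≤ len) (fun υ => len - υ.nat vOut 0)
      ⟨0, hτ.1, by omega, by omega⟩ ?_).mono ?_ ?_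
  · rintro υ hG ⟨q, hM, hlt, hle⟩ hcond
    have hx' : υ.nat aX = σ.nat aX := by
      rw [← hx]; exact hG.nat _ (by simp [mergeStep, Cmd.block, Cmd.KeepsNat])
    have hw' : υ.real rW = W := by
      rw [← hw]; exact hG.real _ (by simp [mergeStep, Cmd.block, Cmd.KeepsReal])
    have hl' : υ.nat vLen 0 = len := by
      rw [hG.nat _ (by simp [mergeStep, Cmd.block, Cmd.KeepsNat]), hl]
    have hbl' : υ.nat vBlk 0 = b := by
      rw [hG.nat _ (by simp [mergeStep, Cmd.block, Cmd.KeepsNat]), hbl]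
    simp only [Cond.Holds, NatExpr.eval, hl'] at hcond
    have hhi : υ.nat vHi 0 ≤ len := by
      have e1 := hM.hi_eq
      have e2 := hM.mid_eq
      have e3 := hM.out_eq
      have e4 := hM.lo_le
      have e5 := hM.mid_le
      have hqg : q < g := by
        by_contra hge
        have : 2 * b * g ≤ 2 * b * q := Nat.mul_le_mul_left _ (by omega)
        omega
      have : 2 * b * (q + 1) ≤ 2 * b * g := Nat.mul_le_mul_left _ hqg
      rw [Nat.mul_succ] at this
      omega
    by_cases hc : υ.nat vI 0 < υ.nat vMid 0 ∧ (υ.nat vJ 0 < υ.nat vHi 0 →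
        KeyLe W (σ.nat aX (υ.nat vI 0)) (σ.nat aX (υ.nat vJ 0)))
    · have hM' := hM.left hX hhi hc.1 hc.2
      have hc' : takeLeft.Holds υ :=
        ⟨hc.1, fun h => h.2 (by simpa [NatExpr.eval, hw', hx'] using hc.2 h.1)⟩
      by_cases hw2 : υ.nat vOut 0 + 1 = υ.nat vHi 0
      · rw [hw2] at hM'
        have hM'' := hM'.next
        refine ⟨⟨q + 1, ?_, ?_, ?_⟩, ?_⟩ <;>
        simp [mergeStep, Cmd.block, Cmd.step, Cond.Holds, NatExpr.eval, Memory.nat_setNat_of_ne,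
          hx', hbl', hc', hw2] <;>
        first | exact hM'' | omega
      · refine ⟨⟨q, ?_, ?_, ?_⟩, ?_⟩ <;>
        simp [mergeStep, Cmd.block, Cmd.step, Cond.Holds, NatExpr.eval, Memory.nat_setNat_of_ne,
          hx', hbl', hc', hw2] <;>
        first | exact hM' | omega
    · have hj : υ.nat vJ 0 < υ.nat vHi 0 := by
        by_contra hj
        have e3 := hM.out_eq
        have e4 := hM.i_le
        have e5 := hM.j_le
        exact hc ⟨by omega, fun h => absurd h hj⟩
      have hM' := hM.right hX hhi hj fun hlt' => by
        by_contra hn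
        exact hc ⟨hlt', fun _ => KeyLe.of_not hn⟩
      have hc' : ¬ takeLeft.Holds υ := fun h => hc ⟨h.1, fun h' => by
        by_contra hn
        exact h.2 ⟨h', by simpa [Cond.Holds, NatExpr.eval, hw', hx'] using hn⟩⟩
      by_cases hw2 : υ.nat vOut 0 + 1 = υ.nat vHi 0
      · rw [hw2] at hM'
        have hM'' := hM'.next
        refine ⟨⟨q + 1, ?_, ?_, ?_⟩, ?_⟩ <;>
        simp [mergeStep, Cmd.block, Cmd.step, Cond.Holds, NatExpr.eval, Memory.nat_setNat_of_ne,
          hx', hbl', hc', hw2] <;>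
        first | exact hM'' | omega
      · refine ⟨⟨q, ?_, ?_, ?_⟩, ?_⟩ <;>
        simp [mergeStep, Cmd.block, Cmd.step, Cond.Holds, NatExpr.eval, Memory.nat_setNat_of_ne,
          hx', hbl', hc', hw2] <;>
        first | exact hM' | omega
  · have h0 : τ.nat vOut 0 = 0 := hτ.2.1
    simp [mergeStep, Cmd.block, Cmd.cost, h0]
  · rintro υ hG ⟨⟨q, hM, hlt, hle⟩, hcond⟩
    have hl' : υ.nat vLen 0 = len := by
      rw [hG.nat _ (by simp [mergeStep, Cmd.block, Cmd.KeepsNat]), hl]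
    simp only [Cond.Holds, NatExpr.eval, hl'] at hcond
    have ho : υ.nat vOut 0 = len := by omega
    rw [ho] at hM
    refine ⟨hM.sorted, fun P => ?_⟩
    have e0 := hM.count P
    have e1 := hM.hi_eq
    have e2 := hM.mid_eq
    have e3 := hM.out_eq
    have e4 := hM.lo_le
    have e5 := hM.i_le
    have e6 := hM.mid_le
    -- The writing position is at the end of a block, hence nothing of the next pair is moved yet.
    have hqg : g = q := by
      rw [ho] at hlt
      rcases lt_trichotomy g q with h5 | h5 | h5
      · have : 2 * b * (g + 1) ≤ 2 * b * q := Nat.mul_le_mul_left _ h5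
        rw [Nat.mul_succ] at this
        omega
      · exact h5
      · have : 2 * b * (q + 1) ≤ 2 * b * g := Nat.mul_le_mul_left _ h5
        rw [Nat.mul_succ] at this
        omega
    subst hqg
    have ei : υ.nat vI 0 = len := by omega
    have ej : υ.nat vJ 0 = υ.nat vMid 0 := by omega
    rw [ei, ej] at e0
    omega

end Machine

section Machine

variable {k : ℕ} {Ω : CellSolver k}

/-! ### Counting loops -/

/-- Runs the command `c` for all values of `v` below that of `w`. -/
def Cmd.for (v w : NatArray k) (c : Cmd k) : Cmd k :=
  .seq (.assign v (.const 0)) (.while (.natLt (.val v) (.val w)) (.seq c (.incr v (.const 1))))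

theorem Runs.for {v w : NatArray k} {c : Cmd k} {σ : Memory k} (n : ℕ) (hn : σ.nat w 0 = n)
    (hc : c.LoopFree) (hv : c.KeepsNat v) (hw : c.KeepsNat w) (hvw : w ≠ v)
    (Inv : ℕ → Memory k → Prop) (h0 : Inv 0 (σ.setNat v 0 0))
    (hstep : ∀ i < n, ∀ τ, Frame (.for v w c) σ τ → τ.nat v 0 = i → Inv i τ →
      Inv (i + 1) ((c.step Ω τ).setNat v 0 (i + 1))) :
    Runs Ω (.for v w c) σ ((c.cost + 2) * n + 2) (Inv n) := by
  refine Runs.seq (B₁ := 1) (B₂ := (c.cost + 2) * n + 1) (Q₁ := fun τ => τ = σ.setNat v 0 0)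
    (.of_loopFree trivial le_rfl rfl) (by omega) ?_
  rintro τ - rfl
  have hwhile := Runs.while_loopFree (Ω := Ω) (b := .natLt (.val v) (.val w))
    (c := .seq c (.incr v (.const 1))) (σ := σ.setNat v 0 0)
    ⟨hc, trivial⟩ (fun τ => τ.nat v 0 ≤ n ∧ Inv (τ.nat v 0) τ)
    (fun τ => n - τ.nat v 0) ⟨by simp, by simpa using h0⟩ ?_
  · refine hwhile.mono (by simp [Cmd.cost]) ?_
    rintro τ hF ⟨⟨h1, h2⟩, h3⟩
    have hwn : τ.nat w 0 = n := by
      rw [hF.nat w ⟨hw, hvw⟩, Memory.nat_setNat_of_ne _ hvw, hn]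
    simp only [Cond.Holds, NatExpr.eval, hwn] at h3
    rwa [show τ.nat v 0 = n by omega] at h2
  · rintro τ hF ⟨h1, h2⟩ h3
    have hwn : τ.nat w 0 = n := by
      rw [hF.nat w ⟨hw, hvw⟩, Memory.nat_setNat_of_ne _ hvw, hn]
    simp only [Cond.Holds, NatExpr.eval, hwn] at h3
    have hv' : (c.step Ω τ).nat v 0 = τ.nat v 0 := by rw [(hc.frame τ).nat v hv]
    have hF' : Frame (.for v w c) σ τ := by
      refine ⟨fun a ha => ?_, fun a ha => ?_⟩
      · rw [hF.nat a ha.2, Memory.nat_setNat_of_ne _ ha.1]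
      · rw [hF.real a ha.2, Memory.real_setNat]
    have := hstep _ h3 τ hF' rfl h2
    have e : (Cmd.seq c (.incr v (.const 1))).step Ω τ =
        (c.step Ω τ).setNat v 0 (τ.nat v 0 + 1) := by
      simp [Cmd.step, NatExpr.eval, hv']
    rw [e]
    simp only [Memory.nat_setNat_same, Function.update_self]
    exact ⟨⟨by omega, this⟩, by omega⟩

theorem Cmd.keepsNat_for {v w a : NatArray k} {c : Cmd k} (ha : a ≠ v) (hc : c.KeepsNat a) :
    (Cmd.for v w c).KeepsNat a := ⟨ha, hc, ha⟩

/-! ### An approximate median -/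

open scoped Classical in
/-- If every second entry of a sequence that is sorted in blocks is kept, then half of the entries
below any threshold are kept, up to an error of one entry for each block. -/
theorem cnt_thin {W : ℕ → ℝ} {Z : ℕ → ℕ} {b n : ℕ} (hZ : BlockSorted W Z (2 * b) (2 * b * n))
    (x : ℕ) :
    2 * cnt (KeyLe W · x) (fun i => Z (2 * i + 1)) (b * n) ≤ cnt (KeyLe W · x) Z (2 * b * n) ∧
    cnt (KeyLe W · x) Z (2 * b * n) ≤
      2 * cnt (KeyLe W · x) (fun i => Z (2 * i + 1)) (b * n) + n := by
  induction n with
  | zero => simp [cnt_zero]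
  | succ n ih =>
    have ih' := ih fun q s t h1 h2 h3 h4 => hZ q s t h1 h2 h3 (by
      rw [Nat.mul_succ]; omega)
    set P : ℕ → Prop := (KeyLe W · x)
    set Z' : ℕ → ℕ := fun i => Z (2 * i + 1)
    have e1 : 2 * b * n = 2 * (b * n) := by ring
    have key : ∀ j ≤ b, cnt P Z (2 * (b * n + j)) + 2 * cnt P Z' (b * n) =
        cnt P Z (2 * (b * n)) + 2 * cnt P Z' (b * n + j) ∨
        cnt P Z (2 * (b * n + j)) + 2 * cnt P Z' (b * n) =
          cnt P Z (2 * (b * n)) + 2 * cnt P Z' (b * n + j) + 1 ∧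
        ∀ y, 2 * (b * n + j) ≤ y → y < 2 * (b * n) + 2 * b → ¬ P (Z y) := by
      intro j
      induction j with
      | zero => intro _; left; simp
      | succ j ihj =>
        intro hj
        have c1 : cnt P Z (2 * (b * n + (j + 1))) = cnt P Z (2 * (b * n + j)) +
            (if P (Z (2 * (b * n + j))) then 1 else 0) +
            (if P (Z (2 * (b * n + j) + 1)) then 1 else 0) := by
          rw [← cnt_succ, ← cnt_succ]; rfl
        have c2 : cnt P Z' (b * n + (j + 1)) = cnt P Z' (b * n + j) +
            (if P (Z (2 * (b * n + j) + 1)) then 1 else 0) := by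
          rw [← add_assoc, cnt_succ]
        have hsort : ∀ s t, 2 * (b * n) ≤ s → s ≤ t → t < 2 * (b * n) + 2 * b →
            P (Z t) → P (Z s) := by
          intro s t hs hst ht hPt
          exact (hZ n s t (by omega) hst (by omega) (by rw [Nat.mul_succ]; omega)).trans hPt
        rcases ihj (by omega) with h | ⟨h, h'⟩
        · by_cases p1 : P (Z (2 * (b * n + j) + 1))
          · have p0 := hsort (2 * (b * n + j)) _ (by omega) (by omega) (by omega) p1
            simp only [if_pos p1, if_pos p0] at c1 c2
            left; omega
          · simp only [if_neg p1] at c1 c2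
            by_cases p0 : P (Z (2 * (b * n + j)))
            · simp only [if_pos p0] at c1
              right
              refine ⟨by omega, fun y hy hy' hP => p1 ?_⟩
              exact hsort _ y (by omega) (by omega) hy' hP
            · simp only [if_neg p0] at c1
              left; omega
        · have p0 := h' (2 * (b * n + j)) le_rfl (by omega)
          have p1 := h' (2 * (b * n + j) + 1) (by omega) (by omega)
          simp only [if_neg p0, if_neg p1] at c1 c2
          right
          exact ⟨by omega, fun y hy hy' => h' y (by omega) hy'⟩
    have e2 : 2 * b * (n + 1) = 2 * (b * n + b) := by ring
    have e3 : b * (n + 1) = b * n + b := by ring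
    change 2 * cnt P Z' _ ≤ cnt P Z _ ∧ cnt P Z _ ≤ 2 * cnt P Z' _ + _
    rw [e2, e3]
    rw [e1] at ih'
    rcases key b le_rfl with h | ⟨h, -⟩ <;> omega

open scoped Classical in
theorem cnt_thin_le (P : ℕ → Prop) (Z : ℕ → ℕ) (n : ℕ) :
    cnt P (fun i => Z (2 * i + 1)) n ≤ cnt P Z (2 * n) := by
  induction n with
  | zero => simp [cnt_zero]
  | succ n ih =>
    have : cnt P Z (2 * (n + 1)) = cnt P Z (2 * n) + (if P (Z (2 * n)) then 1 else 0) +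
        (if P (Z (2 * n + 1)) then 1 else 0) := by
      rw [← cnt_succ, ← cnt_succ]; rfl
    rw [cnt_succ, this]
    omega

theorem cnt_eq_zero {P : ℕ → Prop} {f : ℕ → ℕ} {n : ℕ} (h : ∀ i < n, ¬ P (f i)) :
    cnt P f n = 0 := by
  induction n with
  | zero => exact cnt_zero P f
  | succ n ih => rw [cnt_succ, ih fun i hi => h i (by omega), if_neg (h n (by omega))]

theorem cnt_eq_le_one_iff {f : ℕ → ℕ} {n : ℕ} :
    (∀ x, cnt (· = x) f n ≤ 1) ↔ ∀ i < n, ∀ j < n, f i = f j → i = j := by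
  constructor
  · intro h
    have key : ∀ i j, i < j → j < n → f i ≠ f j := by
      intro i j hij hj heq
      have h1 := cnt_mono (· = f j) f (show i + 1 ≤ j from hij)
      have h2 := cnt_mono (· = f j) f (show j + 1 ≤ n from hj)
      have h3 := h (f j)
      rw [cnt_succ, if_pos heq] at h1
      rw [cnt_succ, if_pos rfl] at h2
      omega
    intro i hi j hj heq
    rcases lt_trichotomy i j with h1 | h1 | h1
    · exact absurd heq (key i j h1 hj)
    · exact h1
    · exact absurd heq.symm (key j i h1 hi)
  · intro h x
    induction n with
    | zero => simp [cnt_zero]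
    | succ n ih =>
      rw [cnt_succ]
      split_ifs with hx
      · rw [cnt_eq_zero]
        intro i hi hix
        have := h i (by omega) n (by omega) (hix.trans hx.symm)
        omega
      · exact ih fun i hi j hj => h i (by omega) j (by omega)

/-- In a sorted sequence without repetitions, the number of entries up to the `h`-th one is `h`. -/
theorem cnt_sorted {W : ℕ → ℝ} {f : ℕ → ℕ} {n h : ℕ}
    (hs : ∀ x y, x ≤ y → y < n → KeyLe W (f x) (f y))
    (hinj : ∀ i < n, ∀ j < n, f i = f j → i = j) (hh : h < n) :
    cnt (KeyLe W · (f h)) f n = h + 1 := by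
  have h1 : ∀ m ≤ h + 1, cnt (KeyLe W · (f h)) f m = m := by
    intro m
    induction m with
    | zero => simp [cnt_zero]
    | succ m ih =>
      intro hm
      rw [cnt_succ, ih (by omega), if_pos (hs m h (by omega) hh)]
  have h2 : ∀ d, h + 1 + d ≤ n → cnt (KeyLe W · (f h)) f (h + 1 + d) = h + 1 := by
    intro d
    induction d with
    | zero => intro _; exact h1 _ le_rfl
    | succ d ih =>
      intro hd
      rw [← add_assoc, cnt_succ, ih (by omega), if_neg]
      intro hk
      have := hinj _ (by omega) _ hh (hk.antisymm (hs h (h + 1 + d) (by omega) (by omega)))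
      omega
  have := h2 (n - (h + 1)) (by omega)
  rwa [show h + 1 + (n - (h + 1)) = n by omega] at this

end Machine

section Machine

variable {k : ℕ} {Ω : CellSolver k}

/-- Copies the first entries of `aAct` to `aX`. -/
def copyActive : Cmd k := .for vCount vLen (.setNat aX (.val vCount) (.get aAct (.val vCount)))

/-- Copies the first entries of `aZ` to `aX`. -/
def copyBack : Cmd k := .for vCount vLen (.setNat aX (.val vCount) (.get aZ (.val vCount)))

theorem copyActive_runs (σ : Memory k) (len : ℕ) (hlen : σ.nat vLen 0 = len) :
    Runs Ω copyActive σ (3 * len + 2) (fun τ => ∀ i < len, τ.nat aX i = σ.nat aAct i) := by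
  refine (Runs.for len hlen (by trivial) (by simp [Cmd.KeepsNat]) (by simp [Cmd.KeepsNat]) (by simp)
    (fun n τ => ∀ i < n, τ.nat aX i = σ.nat aAct i) (by simp) ?_).mono (by simp [Cmd.cost])
    fun τ _ h => h
  intro i _ τ hF hv hI j hj
  have hA : τ.nat aAct = σ.nat aAct := hF.nat _ (by simp [Cmd.for, Cmd.KeepsNat])
  simp only [Cmd.step, NatExpr.eval, hv, hA]
  rw [Memory.nat_setNat_of_ne _ (by simp), Memory.nat_setNat_same]
  rcases Nat.lt_or_ge j i with h | h
  · rw [Function.update_of_ne (by omega), hI j h]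
  · rw [show j = i by omega, Function.update_self]

theorem copyBack_runs (σ : Memory k) (len : ℕ) (hlen : σ.nat vLen 0 = len) :
    Runs Ω copyBack σ (3 * len + 2) (fun τ => ∀ i < len, τ.nat aX i = σ.nat aZ i) := by
  refine (Runs.for len hlen (by trivial) (by simp [Cmd.KeepsNat]) (by simp [Cmd.KeepsNat]) (by simp)
    (fun n τ => ∀ i < n, τ.nat aX i = σ.nat aZ i) (by simp) ?_).mono (by simp [Cmd.cost])
    fun τ _ h => h
  intro i _ τ hF hv hI j hj
  have hA : τ.nat aZ = σ.nat aZ := hF.nat _ (by simp [Cmd.for, Cmd.KeepsNat])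
  simp only [Cmd.step, NatExpr.eval, hv, hA]
  rw [Memory.nat_setNat_of_ne _ (by simp), Memory.nat_setNat_same]
  rcases Nat.lt_or_ge j i with h | h
  · rw [Function.update_of_ne (by omega), hI j h]
  · rw [show j = i by omega, Function.update_self]

/-- Copies every second entry of `aZ` to `aX`, and halves the length. -/
def thinPass : Cmd k :=
  .seq (.assign vCount (.const 0))
    (.seq
      (.while (.natLt (.add (.val vCount) (.add (.val vCount) (.const 1))) (.val vLen))
        (.seq (.setNat aX (.val vCount)
            (.get aZ (.add (.val vCount) (.add (.val vCount) (.const 1)))))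
          (.incr vCount (.const 1))))
      (.assign vLen (.val vCount)))

theorem thinPass_runs (σ : Memory k) (l : ℕ) (hlen : σ.nat vLen 0 = 2 * l) :
    Runs Ω thinPass σ (3 * l + 3) (fun τ =>
      (∀ i < l, τ.nat aX i = σ.nat aZ (2 * i + 1)) ∧ τ.nat vLen 0 = l) := by
  refine Runs.seq (B₁ := 1) (B₂ := 3 * l + 2) (Q₁ := fun τ => τ = σ.setNat vCount 0 0)
    (.of_loopFree trivial le_rfl rfl) (by omega) ?_
  rintro τ - rfl
  refine Runs.seq (B₁ := 3 * l + 1) (B₂ := 1) (Q₁ := fun τ =>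
    (∀ i < l, τ.nat aX i = σ.nat aZ (2 * i + 1)) ∧ τ.nat vCount 0 = l) ?_ (by omega) ?_
  · refine (Runs.while_loopFree (by simp [Cmd.LoopFree])
      (fun τ => (∀ i < τ.nat vCount 0, τ.nat aX i = σ.nat aZ (2 * i + 1)) ∧ τ.nat vCount 0 ≤ l)
      (fun τ => l - τ.nat vCount 0) (by simp) ?_).mono (by simp [Cmd.cost]) ?_
    · rintro τ hF ⟨h1, h2⟩ h3
      have hA : τ.nat aZ = σ.nat aZ := by
        rw [hF.nat aZ (by simp [Cmd.KeepsNat]), Memory.nat_setNat_of_ne _ (by simp)]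
      have hl : τ.nat vLen 0 = 2 * l := by
        rw [hF.nat vLen (by simp [Cmd.KeepsNat]), Memory.nat_setNat_of_ne _ (by simp), hlen]
      simp only [Cond.Holds, NatExpr.eval, hl] at h3
      simp only [Cmd.step, NatExpr.eval, hA, Memory.nat_setNat_same,
        Memory.nat_setNat_of_ne _ (show (aX : NatArray k) ≠ vCount by simp),
        Memory.nat_setNat_of_ne _ (show (vCount : NatArray k) ≠ aX by simp), Function.update_self]
      refine ⟨⟨fun j hj => ?_, by omega⟩, by omega⟩
      rcases Nat.lt_or_ge j (τ.nat vCount 0) with h | h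
      · rw [Function.update_of_ne (by omega), h1 j h]
      · rw [show j = τ.nat vCount 0 by omega, Function.update_self]
        congr 1; omega
    · rintro τ hF ⟨⟨h1, h2⟩, h3⟩
      have hl : τ.nat vLen 0 = 2 * l := by
        rw [hF.nat vLen (by simp [Cmd.KeepsNat]), Memory.nat_setNat_of_ne _ (by simp), hlen]
      simp only [Cond.Holds, NatExpr.eval, hl] at h3
      have : τ.nat vCount 0 = l := by omega
      rw [this] at h1
      exact ⟨h1, this⟩
  · rintro τ - ⟨h1, h2⟩
    refine .of_loopFree trivial le_rfl ?_
    simp only [Cmd.step, NatExpr.eval, Memory.nat_setNat_same, Function.update_self,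
      Memory.nat_setNat_of_ne _ (show (aX : NatArray k) ≠ vLen by simp)]
    exact ⟨h1, h2⟩

theorem BlockSorted.congr {W : ℕ → ℝ} {f g : ℕ → ℕ} {b n : ℕ} (h : BlockSorted W f b n)
    (hfg : ∀ i < n, g i = f i) : BlockSorted W g b n := by
  intro q x y h1 h2 h3 h4
  rw [hfg x (by omega), hfg y h4]
  exact h q x y h1 h2 h3 h4

/-- Merges the blocks in groups of four and keeps every second entry. -/
def levelPass : Cmd k :=
  .seq mergePass (.seq copyBack (.seq (.incr vBlk (.val vBlk)) (.seq mergePass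
    (.seq thinPass (.incr vHalf (.val vHalf))))))

theorem mergePass_keepsNat {a : NatArray k} (h : ∀ b ∈ [aZ, vI, vJ, vMid, vHi, vOut], a ≠ b) :
    (mergePass : Cmd k).KeepsNat a := by
  simp at h
  simp [mergePass, mergeStep, Cmd.block, Cmd.KeepsNat, h]

theorem mergePass_keepsReal {a : RealArray k} : (mergePass : Cmd k).KeepsReal a := by
  simp [mergePass, mergeStep, Cmd.block, Cmd.KeepsReal]

theorem copyBack_keepsNat {a : NatArray k} (h : ∀ b ∈ [aX, vCount], a ≠ b) :
    (copyBack : Cmd k).KeepsNat a := by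
  simp at h
  simp [copyBack, Cmd.for, Cmd.KeepsNat, h]

theorem thinPass_keepsNat {a : NatArray k} (h : ∀ b ∈ [aX, vCount, vLen], a ≠ b) :
    (thinPass : Cmd k).KeepsNat a := by
  simp at h
  simp [thinPass, Cmd.KeepsNat, h]

/-- A pass over `g` groups of four blocks of length `b` leaves `g` blocks of length `2 * b`. Each
entry that is kept stands for two, so that twice a count of kept entries differs from the count of
all entries by at most one for each of the `g` blocks that are thinned. -/
theorem levelPass_runs (σ : Memory k) (b g : ℕ) (hb : 0 < b) (hblk : σ.nat vBlk 0 = b)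
    (hlen : σ.nat vLen 0 = 4 * b * g) (hX : BlockSorted (σ.real rW) (σ.nat aX) b (4 * b * g)) :
    Runs Ω levelPass σ (100 * b * g + 19) (fun τ =>
      τ.nat vBlk 0 = 2 * b ∧ τ.nat vLen 0 = 2 * b * g ∧ τ.nat vHalf 0 = 2 * σ.nat vHalf 0 ∧
      BlockSorted (σ.real rW) (τ.nat aX) (2 * b) (2 * b * g) ∧
      (∀ x, 2 * cnt (KeyLe (σ.real rW) · x) (τ.nat aX) (2 * b * g) ≤
          cnt (KeyLe (σ.real rW) · x) (σ.nat aX) (4 * b * g) ∧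
        cnt (KeyLe (σ.real rW) · x) (σ.nat aX) (4 * b * g) ≤
          2 * cnt (KeyLe (σ.real rW) · x) (τ.nat aX) (2 * b * g) + g) ∧
      ∀ P, cnt P (τ.nat aX) (2 * b * g) ≤ cnt P (σ.nat aX) (4 * b * g)) := by
  have e4 : 4 * b * g = 4 * (b * g) := by ring
  have e100 : 100 * b * g = 100 * (b * g) := by ring
  have e2 : 2 * b * g = 2 * (b * g) := by ring
  refine Runs.seq (B₂ := 60 * (b * g) + 13)
    (mergePass_runs σ b (4 * b * g) (2 * g) hb hblk hlen (by ring) hX) (by omega) ?_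
  rintro τ₁ hF₁ ⟨hs₁, hc₁⟩
  have hl₁ : τ₁.nat vLen 0 = 4 * b * g := by rw [hF₁.nat _ (mergePass_keepsNat (by simp)), hlen]
  have hb₁ : τ₁.nat vBlk 0 = b := by rw [hF₁.nat _ (mergePass_keepsNat (by simp)), hblk]
  have hh₁ : τ₁.nat vHalf 0 = σ.nat vHalf 0 := by
    rw [hF₁.nat _ (mergePass_keepsNat (by simp))]
  have hw₁ : τ₁.real rW = σ.real rW := hF₁.real _ mergePass_keepsReal
  refine Runs.seq (B₂ := 48 * (b * g) + 11) (copyBack_runs τ₁ (4 * b * g) hl₁) (by omega) ?_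
  intro τ₂ hF₂ hx₂
  have hl₂ : τ₂.nat vLen 0 = 4 * b * g := by rw [hF₂.nat _ (copyBack_keepsNat (by simp)), hl₁]
  have hb₂ : τ₂.nat vBlk 0 = b := by rw [hF₂.nat _ (copyBack_keepsNat (by simp)), hb₁]
  have hh₂ : τ₂.nat vHalf 0 = σ.nat vHalf 0 := by
    rw [hF₂.nat _ (copyBack_keepsNat (by simp)), hh₁]
  have hw₂ : τ₂.real rW = σ.real rW := by
    rw [hF₂.real _ (by simp [copyBack, Cmd.for, Cmd.KeepsReal]), hw₁]
  refine Runs.seq (B₁ := 1) (B₂ := 48 * (b * g) + 10)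
    (Q₁ := fun τ => τ = τ₂.setNat vBlk 0 (2 * b))
    (.of_loopFree trivial le_rfl (by simp [Cmd.step, NatExpr.eval, hb₂]; congr 1; omega))
    (by omega) ?_
  rintro τ₃ - rfl
  refine Runs.seq (B₂ := 8 * (b * g) + 4)
    (mergePass_runs (τ₂.setNat vBlk 0 (2 * b)) (2 * b) (4 * b * g) g (by omega) (by simp)
      (by rw [Memory.nat_setNat_of_ne _ (by simp), hl₂]) (by ring) ?_) (by omega) ?_
  · rw [Memory.real_setNat, hw₂, Memory.nat_setNat_of_ne _ (by simp)]
    exact hs₁.congr hx₂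
  rintro τ₄ hF₄ ⟨hs₄, hc₄⟩
  rw [Memory.real_setNat, hw₂] at hs₄
  have hl₄ : τ₄.nat vLen 0 = 4 * b * g := by
    rw [hF₄.nat _ (mergePass_keepsNat (by simp)), Memory.nat_setNat_of_ne _ (by simp), hl₂]
  have hb₄ : τ₄.nat vBlk 0 = 2 * b := by
    rw [hF₄.nat _ (mergePass_keepsNat (by simp))]; simp
  have hh₄ : τ₄.nat vHalf 0 = σ.nat vHalf 0 := by
    rw [hF₄.nat _ (mergePass_keepsNat (by simp)), Memory.nat_setNat_of_ne _ (by simp), hh₂]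
  have hc : ∀ P, cnt P (τ₄.nat aZ) (4 * b * g) = cnt P (σ.nat aX) (4 * b * g) := by
    intro P
    rw [hc₄, Memory.nat_setNat_of_ne _ (by simp), cnt_congr hx₂, hc₁]
  refine Runs.seq (B₂ := 1) (thinPass_runs τ₄ (2 * b * g) (by rw [hl₄]; ring)) (by omega) ?_
  rintro τ₅ hF₅ ⟨hx₅, hl₅⟩
  have hb₅ : τ₅.nat vBlk 0 = 2 * b := by rw [hF₅.nat _ (thinPass_keepsNat (by simp)), hb₄]
  have hh₅ : τ₅.nat vHalf 0 = σ.nat vHalf 0 := by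
    rw [hF₅.nat _ (thinPass_keepsNat (by simp)), hh₄]
  refine .of_loopFree trivial le_rfl ?_
  simp only [Cmd.step, NatExpr.eval, Memory.nat_setNat_same, Function.update_self,
    Memory.nat_setNat_of_ne _ (show (aX : NatArray k) ≠ vHalf by simp),
    Memory.nat_setNat_of_ne _ (show (vLen : NatArray k) ≠ vHalf by simp),
    Memory.nat_setNat_of_ne _ (show (vBlk : NatArray k) ≠ vHalf by simp)]
  refine ⟨hb₅, hl₅, by rw [hh₅]; ring, ?_, fun x => ?_, fun P => ?_⟩
  · intro q x y h1 h2 h3 h4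
    rw [hx₅ x (by omega), hx₅ y h4]
    refine hs₄ q _ _ ?_ (by omega) ?_ ?_
    · have : 2 * (2 * b) * q = 2 * (2 * b * q) := by ring
      omega
    · have : 2 * (2 * b) * q = 2 * (2 * b * q) := by ring
      omega
    · omega
  · have := cnt_thin (b := 2 * b) (n := g) (W := σ.real rW) (Z := τ₄.nat aZ)
      (by rw [show 2 * (2 * b) * g = 4 * b * g by ring]; exact hs₄) x
    rw [show 2 * (2 * b) * g = 4 * b * g by ring, hc, ← cnt_congr hx₅] at this
    exact this
  · rw [cnt_congr hx₅, ← hc P, show 4 * b * g = 2 * (2 * b * g) by ring]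
    exact cnt_thin_le P _ _

/-- Sets the pivot to an active edge that is neither among the first eighth nor among the last
sixteenth of the active edges. -/
def selectPivot : Cmd k :=
  .seq (.assign vLen (.const 2))
  (.seq (.while (.neg (.natLt (.val vAct)
      (.add (.add (.val vLen) (.val vLen)) (.add (.val vLen) (.val vLen)))))
      (.assign vLen (.add (.add (.val vLen) (.val vLen)) (.add (.val vLen) (.val vLen)))))
  (.seq copyActive
  (.seq (.assign vBlk (.const 1))
  (.seq mergePass
  (.seq copyBack
  (.seq (.block [.assign vBlk (.const 2), .assign vHalf (.const 1)])
  (.seq (.while (.natLt (.val vBlk) (.val vLen)) levelPass)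
  (.assign vPivot (.get aX (.sub (.val vHalf) (.const 1)))))))))))

theorem levelPass_keepsReal {a : RealArray k} : (levelPass : Cmd k).KeepsReal a := by
  simp [levelPass, mergePass, mergeStep, copyBack, thinPass, Cmd.for, Cmd.block, Cmd.KeepsReal]

/-- The invariant of the passes of the selection of a pivot among the first `2 * 4 ^ L` entries of
the sequence `A`: after passes that give each entry the weight `w`, the counts of the entries up to
a threshold have the stated accuracy. -/
structure LevelState (W : ℕ → ℝ) (A : ℕ → ℕ) (L : ℕ) (X : ℕ → ℕ) (b half len w j : ℕ) : Prop where
  half_pos : 0 < half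
  blk : b = 2 * half
  len_eq : len = b * 4 ^ j
  weight : w * len = 2 * 4 ^ L
  sorted : BlockSorted W X b len
  nodup : ∀ x, cnt (· = x) X len ≤ 1
  lower : ∀ x, w * cnt (KeyLe W · x) X len ≤ cnt (KeyLe W · x) A (2 * 4 ^ L)
  upper : ∀ x, 4 * cnt (KeyLe W · x) A (2 * 4 ^ L) + 2 * (w * 4 ^ j) ≤
    4 * (w * cnt (KeyLe W · x) X len) + 2 * 4 ^ L

theorem LevelState.next {W : ℕ → ℝ} {A X X' : ℕ → ℕ} {L b half len w j : ℕ}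
    (h : LevelState W A L X b half len w (j + 1))
    (hs : BlockSorted W X' (2 * b) (2 * b * 4 ^ j))
    (hx : ∀ x, 2 * cnt (KeyLe W · x) X' (2 * b * 4 ^ j) ≤ cnt (KeyLe W · x) X len ∧
      cnt (KeyLe W · x) X len ≤ 2 * cnt (KeyLe W · x) X' (2 * b * 4 ^ j) + 4 ^ j)
    (hP : ∀ P, cnt P X' (2 * b * 4 ^ j) ≤ cnt P X len) :
    LevelState W A L X' (2 * b) (2 * half) (2 * b * 4 ^ j) (2 * w) j := by
  have e := h.len_eq
  have e1 := h.weight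
  refine ⟨by have := h.half_pos; omega, by rw [h.blk], rfl, ?_, hs,
    fun x => (hP _).trans (h.nodup x), fun x => ?_, fun x => ?_⟩
  · rw [← e1, e]; ring
  · refine le_trans ?_ (h.lower x)
    calc 2 * w * cnt (KeyLe W · x) X' (2 * b * 4 ^ j) =
        w * (2 * cnt (KeyLe W · x) X' (2 * b * 4 ^ j)) := by ring
      _ ≤ _ := Nat.mul_le_mul_left _ (hx x).1
  · have h1 := h.upper x
    have h2 := Nat.mul_le_mul_left w (hx x).2
    rw [pow_succ] at h1
    nlinarith

/-- The pivot is found in linear time, since the number of entries is halved by each pass. It is the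
middle entry of the block that remains in the end. Since all errors together are at most a quarter
of the number `2 * 4 ^ L` of the entries that are considered, at least one half and at most three
quarters of these are up to the pivot; and `2 * 4 ^ L` exceeds a quarter of the number of active
edges. -/
theorem selectPivot_runs (σ : Memory k) (m : ℕ) (hm : 2 ≤ m) (hact : σ.nat vAct 0 = m)
    (hinj : ∀ i < m, ∀ j < m, σ.nat aAct i = σ.nat aAct j → i = j) :
    Runs Ω selectPivot σ (150 * m) (fun τ =>
      m ≤ 8 * cnt (KeyLe (σ.real rW) · (τ.nat vPivot 0)) (σ.nat aAct) m ∧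
      m ≤ 16 * cnt (fun e => ¬ KeyLe (σ.real rW) e (τ.nat vPivot 0)) (σ.nat aAct) m) := by
  set W := σ.real rW with hW
  set A := σ.nat aAct with hA
  refine Runs.seq (B₁ := 1) (B₂ := 149 * m) (Q₁ := fun τ => τ = σ.setNat vLen 0 2)
    (.of_loopFree trivial le_rfl rfl) (by omega) ?_
  rintro τ₀ - rfl
  refine Runs.seq (B₁ := 2 * m + 1) (B₂ := 146 * m) (Q₁ := fun τ => ∃ L,
    τ.nat vLen 0 = 2 * 4 ^ L ∧ 2 * 4 ^ L ≤ m ∧ m < 4 * (2 * 4 ^ L)) ?_ (by omega) ?_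
  · refine (Runs.while_loopFree (by trivial) (fun τ => ∃ L, τ.nat vLen 0 = 2 * 4 ^ L ∧ 2 * 4 ^ L ≤ m)
      (fun τ => m - τ.nat vLen 0) ⟨0, by simp, by omega⟩ ?_).mono ?_ ?_
    · rintro τ hF ⟨L, h1, h2⟩ h3
      have ha : τ.nat vAct 0 = m := by
        rw [hF.nat _ (by simp [Cmd.KeepsNat]), Memory.nat_setNat_of_ne _ (by simp), hact]
      simp only [Cond.Holds, NatExpr.eval, ha, h1] at h3
      simp only [Cmd.step, NatExpr.eval, Memory.nat_setNat_same, Function.update_self, h1]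
      have : 0 < 4 ^ L := by positivity
      refine ⟨⟨L + 1, by ring, by rw [pow_succ]; omega⟩, by omega⟩
    · simp [Cmd.cost]
    · rintro τ hF ⟨⟨L, h1, h2⟩, h3⟩
      have ha : τ.nat vAct 0 = m := by
        rw [hF.nat _ (by simp [Cmd.KeepsNat]), Memory.nat_setNat_of_ne _ (by simp), hact]
      simp only [Cond.Holds, NatExpr.eval, ha, h1] at h3
      exact ⟨L, h1, h2, by omega⟩
  rintro τ₁ hF₁ ⟨L, hl₁, hLm, hmL⟩
  have hA₁ : τ₁.nat aAct = A := by
    rw [hF₁.nat _ (by simp [Cmd.KeepsNat]), Memory.nat_setNat_of_ne _ (by simp)]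
  have hw₁ : τ₁.real rW = W := by rw [hF₁.real _ (by simp [Cmd.KeepsReal]), Memory.real_setNat]
  set m' := 2 * 4 ^ L with hm'
  have hm'2 : 2 ≤ m' := by
    have : 0 < 4 ^ L := by positivity
    omega
  refine Runs.seq (B₂ := 142 * m) (copyActive_runs τ₁ m' hl₁) (by omega) ?_
  intro τ₂ hF₂ hx₂
  rw [hA₁] at hx₂
  have hw₂ : τ₂.real rW = W := by
    rw [hF₂.real _ (by simp [copyActive, Cmd.for, Cmd.KeepsReal]), hw₁]
  have hl₂ : τ₂.nat vLen 0 = m' := by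
    rw [hF₂.nat _ (by simp [copyActive, Cmd.for, Cmd.KeepsNat]), hl₁]
  refine Runs.seq (B₁ := 1) (B₂ := 141 * m) (Q₁ := fun τ => τ = τ₂.setNat vBlk 0 1)
    (.of_loopFree trivial le_rfl rfl) (by omega) ?_
  rintro _ - rfl
  refine Runs.seq (B₂ := 128 * m) (mergePass_runs (τ₂.setNat vBlk 0 1) 1 m' (4 ^ L)
    (by omega) (by simp) (by rw [Memory.nat_setNat_of_ne _ (by simp), hl₂]) (by ring)
    (fun q x y h1 h2 h3 _ => by rw [show x = y by omega]; exact KeyLe.refl _ _)) (by omega) ?_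
  rintro τ₃ hF₃ ⟨hs₃, hc₃⟩
  rw [Memory.real_setNat, hw₂] at hs₃
  have hw₃ : τ₃.real rW = W := by rw [hF₃.real _ mergePass_keepsReal, Memory.real_setNat, hw₂]
  have hl₃ : τ₃.nat vLen 0 = m' := by
    rw [hF₃.nat _ (mergePass_keepsNat (by simp)), Memory.nat_setNat_of_ne _ (by simp), hl₂]
  refine Runs.seq (B₂ := 124 * m) (copyBack_runs τ₃ m' hl₃) (by omega) ?_
  intro τ₄ hF₄ hx₄
  have hw₄ : τ₄.real rW = W := by
    rw [hF₄.real _ (by simp [copyBack, Cmd.for, Cmd.KeepsReal]), hw₃]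
  have hl₄ : τ₄.nat vLen 0 = m' := by rw [hF₄.nat _ (copyBack_keepsNat (by simp)), hl₃]
  have hc₄ : ∀ P, cnt P (τ₄.nat aX) m' = cnt P A m' := by
    intro P
    rw [cnt_congr hx₄, hc₃, Memory.nat_setNat_of_ne _ (by simp), cnt_congr hx₂]
  refine Runs.seq (B₁ := 2) (B₂ := 123 * m) (Q₁ := fun τ => LevelState W A L (τ.nat aX)
    (τ.nat vBlk 0) (τ.nat vHalf 0) (τ.nat vLen 0) 1 L ∧ τ.nat vLen 0 = m' ∧ τ.real rW = W)
    (.of_loopFree (by simp [Cmd.block, Cmd.LoopFree]) (by simp [Cmd.block, Cmd.cost]) ?_)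
    (by omega) ?_
  · simp only [Cmd.block, Cmd.step, NatExpr.eval, Memory.nat_setNat_same, Function.update_self,
      Memory.nat_setNat_of_ne _ (show (aX : NatArray k) ≠ vHalf by simp),
      Memory.nat_setNat_of_ne _ (show (vLen : NatArray k) ≠ vHalf by simp),
      Memory.nat_setNat_of_ne _ (show (vBlk : NatArray k) ≠ vHalf by simp),
      Memory.nat_setNat_of_ne _ (show (aX : NatArray k) ≠ vBlk by simp),
      Memory.nat_setNat_of_ne _ (show (vLen : NatArray k) ≠ vBlk by simp), Memory.real_setNat,
      hw₄, hl₄, and_true]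
    refine ⟨by omega, by omega, by omega, by omega, hs₃.congr hx₄, fun x => ?_, fun x => ?_,
      fun x => ?_⟩
    · rw [hc₄]
      exact cnt_eq_le_one_iff.2 (fun i hi j hj => hinj i (by omega) j (by omega)) x
    · rw [hc₄, one_mul]
    · rw [hc₄]
      rw [← hm']
      omega
  rintro τ₅ - ⟨hS₅, hl₅, hw₅⟩
  refine Runs.seq (B₁ := 100 * m + 1) (B₂ := 1) (Q₁ := fun τ => ∃ w, LevelState W A L (τ.nat aX)
    (τ.nat vBlk 0) (τ.nat vHalf 0) (τ.nat vLen 0) w 0) ?_ (by omega) ?_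
  · refine (Runs.while (fun τ => ∃ w j, LevelState W A L (τ.nat aX)
      (τ.nat vBlk 0) (τ.nat vHalf 0) (τ.nat vLen 0) w j) (fun τ => 100 * τ.nat vLen 0)
      ⟨1, L, hS₅⟩ ?_).mono (by simp only [hl₅]; omega) ?_
    · rintro τ hF ⟨w, j, hS⟩ hcond
      simp only [Cond.Holds, NatExpr.eval] at hcond
      have hb := hS.half_pos
      have hb' := hS.blk
      have hwτ : τ.real rW = W := by rw [hF.real _ levelPass_keepsReal, hw₅]
      obtain ⟨j, rfl⟩ : ∃ j', j = j' + 1 := by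
        rcases j with _ | j
        · have := hS.len_eq
          simp at this
          omega
        · exact ⟨j, rfl⟩
      have hl : τ.nat vLen 0 = 4 * τ.nat vBlk 0 * 4 ^ j := by rw [hS.len_eq]; ring
      refine ⟨_, (levelPass_runs τ (τ.nat vBlk 0) (4 ^ j) (by omega) rfl hl (by
        rw [hwτ, ← hl]; exact hS.sorted)).mono le_rfl ?_⟩
      rintro υ - ⟨h1, h2, h3, h4, h5, h6⟩
      rw [hwτ] at h4 h5
      refine ⟨⟨2 * w, j, ?_⟩, ?_⟩
      · rw [h1, h2, h3]
        exact hS.next h4 (fun x => by rw [hl]; exact h5 x) (fun P => by rw [hl]; exact h6 P)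
      · rw [h2, hl]
        have e : ∀ c, c * τ.nat vBlk 0 * 4 ^ j = c * (τ.nat vBlk 0 * 4 ^ j) :=
          fun c => by ring
        have : 1 * 1 ≤ τ.nat vBlk 0 * 4 ^ j :=
          Nat.mul_le_mul (by omega) (Nat.one_le_pow _ _ (by norm_num))
        rw [e, e, e]
        omega
    · rintro τ hF ⟨⟨w, j, hS⟩, hcond⟩
      simp only [Cond.Holds, NatExpr.eval] at hcond
      refine ⟨w, ?_⟩
      rcases j with _ | j
      · exact hS
      · exfalso
        have h1 := hS.half_pos
        have h2 := hS.blk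
        have h3 := hS.len_eq
        have : 4 ≤ 4 ^ (j + 1) := by
          rw [pow_succ]
          have : 0 < 4 ^ j := by positivity
          omega
        have := Nat.mul_le_mul_left (τ.nat vBlk 0) this
        omega
  rintro τ₆ - ⟨w, hS⟩
  refine .of_loopFree trivial le_rfl ?_
  simp only [Cmd.step, NatExpr.eval, Memory.nat_setNat_same, Function.update_self]
  set p := τ₆.nat aX (τ₆.nat vHalf 0 - 1) with hp
  have h1 := hS.half_pos
  have h2 := hS.blk
  have h3 := hS.len_eq
  rw [pow_zero, mul_one] at h3
  have h4 : cnt (KeyLe W · p) (τ₆.nat aX) (τ₆.nat vLen 0) = τ₆.nat vHalf 0 := by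
    rw [hp, cnt_sorted (fun x y hxy hy => hS.sorted 0 x y (by omega) hxy (by omega) hy)
      (cnt_eq_le_one_iff.1 hS.nodup) (by omega)]
    omega
  have h5 := hS.lower p
  have h6 := hS.upper p
  have h7 := hS.weight
  rw [h4] at h5 h6
  rw [h3, h2, ← hm'] at h7
  rw [← hm'] at h5 h6
  have h8 : 2 * (w * τ₆.nat vHalf 0) = m' := by rw [← h7]; ring
  have h9 := cnt_add_cnt_not (KeyLe W · p) A m'
  have h10 := cnt_mono (KeyLe W · p) A hLm
  have h11 := cnt_mono (fun e => ¬ KeyLe W e p) A hLm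
  constructor <;> omega

end Machine

section Graphs

/-! ### Connectivity by a set of edges -/

/-- The nodes `u` and `v` are the ends of an edge of `E`, where `f e` and `g e` are the ends of the
edge `e`. -/
def EdgeRel (f g : ℕ → ℕ) (E : Set ℕ) (u v : ℕ) : Prop :=
  ∃ e ∈ E, f e = u ∧ g e = v ∨ f e = v ∧ g e = u

/-- The nodes `u` and `v` are connected by edges of `E`. -/
def Conn (f g : ℕ → ℕ) (E : Set ℕ) : ℕ → ℕ → Prop := Relation.ReflTransGen (EdgeRel f g E)

theorem EdgeRel.symm {f g : ℕ → ℕ} {E : Set ℕ} {u v : ℕ} (h : EdgeRel f g E u v) :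
    EdgeRel f g E v u := by
  obtain ⟨e, he, h⟩ := h
  exact ⟨e, he, h.symm⟩

theorem Conn.refl {f g : ℕ → ℕ} {E : Set ℕ} (u : ℕ) : Conn f g E u u := Relation.ReflTransGen.refl

theorem Conn.trans {f g : ℕ → ℕ} {E : Set ℕ} {u v w : ℕ} (h : Conn f g E u v)
    (h' : Conn f g E v w) : Conn f g E u w := Relation.ReflTransGen.trans h h'

theorem Conn.symm {f g : ℕ → ℕ} {E : Set ℕ} {u v : ℕ} (h : Conn f g E u v) : Conn f g E v u := by
  induction h with
  | refl => exact .refl _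
  | tail _ h ih => exact Relation.ReflTransGen.head h.symm ih

theorem Conn.of_edge {f g : ℕ → ℕ} {E : Set ℕ} {u v : ℕ} (h : EdgeRel f g E u v) :
    Conn f g E u v := Relation.ReflTransGen.single h

theorem Conn.mono {f g : ℕ → ℕ} {E F : Set ℕ} (hEF : E ⊆ F) {u v : ℕ} (h : Conn f g E u v) :
    Conn f g F u v :=
  Relation.ReflTransGen.mono (fun _ _ ⟨e, he, h⟩ => ⟨e, hEF he, h⟩) _ _ h

theorem Conn.congr {f g f' g' : ℕ → ℕ} {E : Set ℕ} (hf : ∀ e ∈ E, f' e = f e)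
    (hg : ∀ e ∈ E, g' e = g e) {u v : ℕ} (h : Conn f g E u v) : Conn f' g' E u v :=
  Relation.ReflTransGen.mono
    (fun _ _ ⟨e, he, h⟩ => ⟨e, he, by rwa [hf e he, hg e he]⟩) _ _ h

/-! ### Breadth-first search -/

/-- `p` is zero, or one plus the last half-edge below `n` with tail `u`; it is zero only if there is
no such half-edge. -/
structure IsLastOf (tail : ℕ → ℕ) (u n p : ℕ) : Prop where
  le : p ≤ n
  tail_eq : p ≠ 0 → tail (p - 1) = u
  ne : ∀ h, p ≤ h → h < n → tail h ≠ u

/-- A list of half-edges, in which each half-edge points to the previous one with the same tail,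
together with a list of nodes that contains all their ends. Each half-edge occurs in both
directions. -/
structure SearchGraph (root : ℕ → ℕ) (R : ℕ) (tail tip next : ℕ → ℕ) (H : ℕ) : Prop where
  symm : ∀ h < H, ∃ h' < H, tail h' = tip h ∧ tip h' = tail h
  mem : ∀ h < H, ∃ j < R, root j = tail h
  next : ∀ h < H, IsLastOf tail (tail h) h (next h)

/-- The number of half-edges not yet examined by the search. -/
def remaining (tail head : ℕ → ℕ) (H : ℕ) : ℕ :=
  ((Finset.range H).filter fun h => h < head (tail h)).card

theorem remaining_le (tail head : ℕ → ℕ) (H : ℕ) : remaining tail head H ≤ H :=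
  (Finset.card_filter_le _ _).trans (by simp)

theorem remaining_update_lt {tail head : ℕ → ℕ} {H h p : ℕ} (hh : h < H)
    (hp : head (tail h) = h + 1) (hle : p ≤ h) :
    remaining tail (Function.update head (tail h) p) H < remaining tail head H := by
  apply Finset.card_lt_card
  rw [Finset.ssubset_iff_of_subset]
  · exact ⟨h, by simp [hh, hp], by simp [hle]⟩
  · intro x hx
    simp only [Finset.mem_filter, Finset.mem_range] at hx ⊢
    refine ⟨hx.1, ?_⟩
    by_cases hxu : tail x = tail h
    · rw [hxu, Function.update_self] at hx
      rw [hxu, hp]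
      omega
    · rw [Function.update_of_ne hxu] at hx
      exact hx.2

/-- The invariant of the search: `lab` assigns to each node that is reached one plus the node from
which its component was entered, `head` points to the first half-edge not yet examined, `par` is
the parent in the search forest, and `q` is the queue, whose entries from `front` to `back` are yet
to be processed. -/
structure SearchState (root : ℕ → ℕ) (R : ℕ) (tail tip : ℕ → ℕ) (H : ℕ) (lab head par q : ℕ → ℕ)
    (front back pos : ℕ) : Prop where
  front_le : front ≤ back
  pos_le : pos ≤ R
  mem : ∀ i < back, (∃ j < R, root j = q i) ∧ lab (q i) ≠ 0
  reached : ∀ j < R, lab (root j) ≠ 0 → ∃ i < back, q i = root j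
  sound : ∀ i < back, ∃ r, lab (q i) = r + 1 ∧ Conn tail tip (Iio H) r (q i)
  done : ∀ i < front, head (q i) = 0
  ptr_le : ∀ j < R, head (root j) ≤ H
  ptr_tail : ∀ j < R, head (root j) ≠ 0 → tail (head (root j) - 1) = root j
  examined : ∀ h < H, head (tail h) ≤ h → lab (tail h) ≠ 0 ∧ lab (tip h) = lab (tail h)
  same : ∀ i, front ≤ i → i < back → lab (q i) = lab (q front)
  parent : ∀ i < back, par (q i) = q i ∧ lab (q i) = q i + 1 ∨
    ∃ i' < i, par (q i) = q i' ∧ EdgeRel tail tip (Iio H) (q i') (q i)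
  roots : ∀ j < pos, lab (root j) ≠ 0
  empty : pos = 0 → back = 0
  first : 0 < pos → 0 < back ∧ q 0 = root 0 ∧ par (q 0) = q 0 ∧ lab (q 0) = q 0 + 1

namespace SearchState

variable {root : ℕ → ℕ} {R : ℕ} {tail tip next : ℕ → ℕ} {H : ℕ} {lab head par q : ℕ → ℕ}
  {front back pos : ℕ}

theorem pop (h : SearchState root R tail tip H lab head par q front back pos)
    (hlt : front < back) (h0 : head (q front) = 0) :
    SearchState root R tail tip H lab head par q (front + 1) back pos :=
  { h with
    front_le := hlt
    done := fun i hi => by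
      rcases Nat.lt_or_ge i front with h1 | h1
      · exact h.done i h1
      · rwa [show i = front by omega]
    same := fun i h1 h2 => by
      rw [h.same i (by omega) h2, h.same (front + 1) (by omega) (by omega)] }

/-- Examining a half-edge. -/
theorem advance (hG : SearchGraph root R tail tip next H)
    (h : SearchState root R tail tip H lab head par q front back pos)
    (hlt : front < back) {e : ℕ} (he : head (q front) = e + 1)
    (htip : lab (tip e) = lab (q front)) :
    SearchState root R tail tip H lab (Function.update head (q front) (next e)) par q
      front back pos ∧ tail e = q front ∧ e < H ∧
      remaining tail (Function.update head (q front) (next e)) H < remaining tail head H := by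
  obtain ⟨⟨j, hj, hjq⟩, hlab⟩ := h.mem front hlt
  have heH : e < H := by
    have := h.ptr_le j hj
    rw [hjq, he] at this
    omega
  have het : tail e = q front := by
    have := h.ptr_tail j hj
    rw [hjq, he] at this
    exact this (by omega)
  have hnext := hG.next e heH
  have hrem : remaining tail (Function.update head (q front) (next e)) H <
      remaining tail head H := by
    rw [← het]
    exact remaining_update_lt heH (by rw [het, he]) hnext.le
  refine ⟨{ h with
    done := fun i hi => ?_
    ptr_le := fun j' hj' => ?_
    ptr_tail := fun j' hj' => ?_
    examined := fun x hx => ?_ }, het, heH, hrem⟩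
  · have := h.done i hi
    rw [Function.update_of_ne]
    · exact this
    · intro heq
      rw [heq] at this
      omega
  · by_cases hq : root j' = q front
    · rw [hq, Function.update_self]
      exact hnext.le.trans heH.le
    · rw [Function.update_of_ne hq]
      exact h.ptr_le j' hj'
  · by_cases hq : root j' = q front
    · rw [hq, Function.update_self]
      intro hne
      rw [hnext.tail_eq hne, het]
    · rw [Function.update_of_ne hq]
      exact h.ptr_tail j' hj'
  · by_cases hq : tail x = q front
    · rw [hq, Function.update_self]
      intro hle
      rcases lt_trichotomy x e with h1 | h1 | h1
      · exact absurd (hq.trans het.symm) (hnext.ne x hle h1)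
      · subst h1
        exact ⟨hlab, htip⟩
      · have := h.examined x hx (by rw [hq, he]; omega)
        rwa [hq] at this
    · rw [Function.update_of_ne hq]
      exact h.examined x hx

/-- A half-edge that leads to a node reached before stays within the current component. -/
theorem tip_eq (hG : SearchGraph root R tail tip next H)
    (h : SearchState root R tail tip H lab head par q front back pos)
    (hlt : front < back) {e : ℕ} (he : head (q front) = e + 1) (htip : lab (tip e) ≠ 0) :
    lab (tip e) = lab (q front) := by
  obtain ⟨⟨j, hj, hjq⟩, hlab⟩ := h.mem front hlt
  have heH : e < H := by
    have := h.ptr_le j hj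
    rw [hjq, he] at this
    omega
  have het : tail e = q front := by
    have := h.ptr_tail j hj
    rw [hjq, he] at this
    exact this (by omega)
  obtain ⟨e', he', h1, h2⟩ := hG.symm e heH
  obtain ⟨j', hj', hj'q⟩ := hG.mem e' he'
  rw [h1] at hj'q
  obtain ⟨i, hi, hiq⟩ := h.reached j' hj' (by rwa [hj'q])
  rw [hj'q] at hiq
  rcases Nat.lt_or_ge i front with h3 | h3
  · have := h.examined e' he' (by rw [h1, ← hiq, h.done i h3]; omega)
    rw [h1, h2, het] at this
    exact this.2.symm
  · rw [← hiq]
    exact h.same i h3 hi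

/-- Appending a new node to the queue. -/
theorem push (h : SearchState root R tail tip H lab head par q front back pos) {w v l pos' : ℕ}
    (hw : ∃ j < R, root j = w) (h0 : lab w = 0)
    (hl : ∃ r, l = r + 1 ∧ Conn tail tip (Iio H) r w)
    (hsame : front < back → l = lab (q front))
    (hpar : v = w ∧ l = w + 1 ∨ ∃ i < back, v = q i ∧ EdgeRel tail tip (Iio H) (q i) w)
    (hfirst : back = 0 → w = root 0 ∧ v = w ∧ l = w + 1) (hpos : 0 < pos') (hpos' : pos' ≤ R)
    (hroots : ∀ j, pos ≤ j → j < pos' → root j = w) :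
    SearchState root R tail tip H (Function.update lab w l) head (Function.update par w v)
      (Function.update q back w) front (back + 1) pos' := by
  have hl0 : l ≠ 0 := by obtain ⟨r, hr, -⟩ := hl; omega
  have hne : ∀ i < back, q i ≠ w := fun i hi heq => (h.mem i hi).2 (by rw [heq, h0])
  have hq : ∀ i < back, Function.update q back w i = q i :=
    fun i hi => Function.update_of_ne (by omega) _ _
  have hlabne : ∀ x, lab x ≠ 0 → Function.update lab w l x = lab x := by
    intro x hx
    rw [Function.update_of_ne]
    rintro rfl
    exact hx h0
  refine
    { front_le := by have := h.front_le; omega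
      pos_le := hpos'
      mem := fun i hi => ?_
      reached := fun j hj hlab => ?_
      sound := fun i hi => ?_
      done := fun i hi => ?_
      ptr_le := h.ptr_le
      ptr_tail := h.ptr_tail
      examined := fun x hx hle => ?_
      same := fun i h1 h2 => ?_
      parent := fun i hi => ?_
      roots := fun j hj => ?_
      empty := fun h => by omega
      first := fun _ => ?_ }
  · rcases Nat.lt_or_ge i back with h1 | h1
    · rw [hq i h1, hlabne _ (h.mem i h1).2]
      exact h.mem i h1
    · rw [show i = back by omega, Function.update_self, Function.update_self]
      exact ⟨hw, hl0⟩
  · by_cases hjw : root j = w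
    · exact ⟨back, by omega, by rw [Function.update_self, hjw]⟩
    · rw [Function.update_of_ne hjw] at hlab
      obtain ⟨i, hi, hiq⟩ := h.reached j hj hlab
      exact ⟨i, by omega, by rw [hq i hi, hiq]⟩
  · rcases Nat.lt_or_ge i back with h1 | h1
    · rw [hq i h1, hlabne _ (h.mem i h1).2]
      exact h.sound i h1
    · rw [show i = back by omega, Function.update_self, Function.update_self]
      exact hl
  · have := h.front_le
    rw [hq i (by omega)]
    exact h.done i hi
  · obtain ⟨h1, h2⟩ := h.examined x hx hle
    rw [hlabne _ h1, hlabne _ (by rwa [h2])]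
    exact ⟨h1, h2⟩
  · have hfl := h.front_le
    rcases Nat.lt_or_ge front back with hfb | hfb
    · rw [hq front hfb, hlabne _ (h.mem front hfb).2]
      rcases Nat.lt_or_ge i back with h3 | h3
      · rw [hq i h3, hlabne _ (h.mem i h3).2]
        exact h.same i h1 h3
      · rw [show i = back by omega, Function.update_self, Function.update_self]
        exact hsame hfb
    · rw [show i = front by omega]
  · rcases Nat.lt_or_ge i back with h1 | h1
    · rw [hq i h1, hlabne _ (h.mem i h1).2, Function.update_of_ne (hne i h1)]
      rcases h.parent i h1 with h2 | ⟨i', hi', h2⟩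
      · exact Or.inl h2
      · refine Or.inr ⟨i', hi', ?_⟩
        rwa [hq i' (by omega)]
    · rw [show i = back by omega, Function.update_self, Function.update_self,
        Function.update_self]
      rcases hpar with h2 | ⟨i', hi', h2⟩
      · exact Or.inl h2
      · refine Or.inr ⟨i', hi', ?_⟩
        rwa [hq i' hi']
  · rcases Nat.lt_or_ge j pos with h1 | h1
    · rw [hlabne _ (h.roots j h1)]
      exact h.roots j h1
    · rw [hroots j h1 hj, Function.update_self]
      exact hl0
  · rcases Nat.eq_zero_or_pos back with hb | hb
    · obtain ⟨h1, h2, h3⟩ := hfirst hb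
      subst hb
      simp only [Function.update_self]
      exact ⟨by omega, h1, h2, h3⟩
    · obtain ⟨h1, h2, h3, h4⟩ := h.first (Nat.pos_of_ne_zero fun h0 => by
        have := h.empty h0
        omega)
      rw [hq 0 h1, Function.update_of_ne (hne 0 h1), hlabne _ (h.mem 0 h1).2]
      exact ⟨by omega, h2, h3, h4⟩

/-- Passing to the next starting node, if it is already reached. -/
theorem skip_root (h : SearchState root R tail tip H lab head par q front back pos)
    (hpos : pos < R) (hlab : lab (root pos) ≠ 0) :
    SearchState root R tail tip H lab head par q front back (pos + 1) :=
  { h with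
    pos_le := hpos
    roots := fun j hj => by
      rcases Nat.lt_or_ge j pos with h1 | h1
      · exact h.roots j h1
      · rwa [show j = pos by omega]
    empty := fun h => by omega
    first := fun _ => by
      rcases Nat.eq_zero_or_pos pos with h0 | h0
      · obtain ⟨i, hi, -⟩ := h.reached pos hpos hlab
        have := h.empty h0
        omega
      · exact h.first h0 }

/-- Passing to the next starting node, if it is not yet reached. -/
theorem push_root (h : SearchState root R tail tip H lab head par q front back pos)
    (hfb : front = back) (hpos : pos < R) (h0 : lab (root pos) = 0) :
    SearchState root R tail tip H (Function.update lab (root pos) (root pos + 1)) head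
      (Function.update par (root pos) (root pos)) (Function.update q back (root pos)) front
      (back + 1) (pos + 1) := by
  refine h.push ⟨pos, hpos, rfl⟩ h0 ⟨_, rfl, .refl _⟩ (fun hlt => by omega) (Or.inl ⟨rfl, rfl⟩)
    (fun hb => ⟨?_, rfl, rfl⟩) (by omega) hpos (fun j h1 h2 => by rw [show j = pos by omega])
  rcases Nat.eq_zero_or_pos pos with hp | hp
  · rw [hp]
  · have := (h.first hp).1
    omega

/-- The state before the search. -/
theorem init (hlab : ∀ j < R, lab (root j) = 0)
    (hG : SearchGraph root R tail tip next H)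
    (hhead : ∀ j < R, IsLastOf tail (root j) H (head (root j))) :
    SearchState root R tail tip H lab head par q 0 0 0 where
  front_le := le_rfl
  pos_le := Nat.zero_le _
  mem := fun i hi => by omega
  reached := fun j hj h => absurd (hlab j hj) h
  sound := fun i hi => by omega
  done := fun i hi => by omega
  ptr_le := fun j hj => (hhead j hj).le
  ptr_tail := fun j hj => (hhead j hj).tail_eq
  examined := fun h hh hle => by
    obtain ⟨j, hj, hjh⟩ := hG.mem h hh
    rw [← hjh] at hle
    exact absurd hjh.symm ((hhead j hj).ne h hle hh)
  same := fun i _ hi => by omega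
  parent := fun i hi => by omega
  roots := fun j hj => by omega
  empty := fun _ => rfl
  first := fun h => by omega

/-- After the search, two nodes have equal labels iff they are connected. -/
theorem lab_eq_iff (hG : SearchGraph root R tail tip next H)
    (h : SearchState root R tail tip H lab head par q back back R) {i j : ℕ} (hi : i < R)
    (hj : j < R) :
    lab (root i) = lab (root j) ↔ Conn tail tip (Iio H) (root i) (root j) := by
  have hexam : ∀ e < H, lab (tip e) = lab (tail e) := by
    intro e he
    obtain ⟨j, hj, hje⟩ := hG.mem e he
    obtain ⟨i, hi, hie⟩ := h.reached j hj (h.roots j hj)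
    refine (h.examined e he ?_).2
    rw [← hje, ← hie, h.done i hi]
    omega
  constructor
  · intro heq
    obtain ⟨a, ha, hai⟩ := h.reached i hi (h.roots i hi)
    obtain ⟨b, hb, hbj⟩ := h.reached j hj (h.roots j hj)
    obtain ⟨r, hr, hr'⟩ := h.sound a ha
    obtain ⟨s, hs, hs'⟩ := h.sound b hb
    rw [hai] at hr hr'
    rw [hbj] at hs hs'
    obtain rfl : r = s := by omega
    exact hr'.symm.trans hs'
  · intro hc
    generalize root i = u at hc
    generalize root j = v at hc
    induction hc with
    | refl => rfl
    | tail _ h2 ih =>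
      obtain ⟨e, he, ⟨h3, h4⟩ | ⟨h3, h4⟩⟩ := h2
      · rw [ih, ← h3, ← h4, hexam e he]
      · rw [ih, ← h3, ← h4, hexam e he]

end SearchState

end Graphs

section Machine

variable {k : ℕ} {Ω : CellSolver k}

/-! ### The search on the machine -/

/-- The list of the first `n` values of a sequence. -/
def seg (f : ℕ → ℕ) (n : ℕ) : List ℕ := (List.range n).map f

@[simp] theorem seg_zero (f : ℕ → ℕ) : seg f 0 = [] := rfl

theorem seg_succ (f : ℕ → ℕ) (n : ℕ) : seg f (n + 1) = seg f n ++ [f n] := by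
  simp [seg, List.range_succ]

@[simp] theorem length_seg (f : ℕ → ℕ) (n : ℕ) : (seg f n).length = n := by simp [seg]

theorem mem_seg {f : ℕ → ℕ} {n x : ℕ} : x ∈ seg f n ↔ ∃ i < n, f i = x := by simp [seg]

theorem seg_congr {f g : ℕ → ℕ} {n : ℕ} (h : ∀ i < n, f i = g i) : seg f n = seg g n := by
  exact List.map_congr_left fun i hi => h i (List.mem_range.1 hi)

theorem seg_update (f : ℕ → ℕ) (n v : ℕ) : seg (Function.update f n v) (n + 1) = seg f n ++ [v] := by
  rw [seg_succ, Function.update_self]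
  congr 1
  exact seg_congr fun i hi => Function.update_of_ne (by omega) _ _

theorem nodup_seg {f : ℕ → ℕ} {n : ℕ} :
    (seg f n).Nodup ↔ ∀ i < n, ∀ j < n, f i = f j → i = j := by
  rw [seg, List.nodup_map_iff_inj_on List.nodup_range]
  simp only [List.mem_range]

open scoped Classical in
/-- The entries of `l` that are at most `p`. -/
noncomputable def lowPart (W : ℕ → ℝ) (p : ℕ) (l : List ℕ) : List ℕ :=
  l.filter fun e => KeyLe W e p

open scoped Classical in
/-- The entries of `l` that are not at most `p`. -/
noncomputable def highPart (W : ℕ → ℝ) (p : ℕ) (l : List ℕ) : List ℕ :=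
  l.filter fun e => ¬ KeyLe W e p

theorem mem_lowPart {W : ℕ → ℝ} {p e : ℕ} {l : List ℕ} :
    e ∈ lowPart W p l ↔ e ∈ l ∧ KeyLe W e p := by simp [lowPart]

theorem mem_highPart {W : ℕ → ℝ} {p e : ℕ} {l : List ℕ} :
    e ∈ highPart W p l ↔ e ∈ l ∧ ¬ KeyLe W e p := by simp [highPart]

theorem length_lowPart_seg (W : ℕ → ℝ) (p : ℕ) (f : ℕ → ℕ) (n : ℕ) :
    (lowPart W p (seg f n)).length = cnt (KeyLe W · p) f n := by
  induction n with
  | zero => simp [cnt_zero, lowPart]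
  | succ n ih =>
    rw [seg_succ, cnt_succ, ← ih]
    by_cases h : KeyLe W (f n) p <;> simp [lowPart, h]

theorem length_highPart_seg (W : ℕ → ℝ) (p : ℕ) (f : ℕ → ℕ) (n : ℕ) :
    (highPart W p (seg f n)).length = cnt (fun e => ¬ KeyLe W e p) f n := by
  induction n with
  | zero => simp [cnt_zero, highPart]
  | succ n ih =>
    rw [seg_succ, cnt_succ, ← ih]
    by_cases h : KeyLe W (f n) p <;> simp [highPart, h]

/-- The test whether the current active edge is at most the pivot. -/
def belowPivot : Cond k := keyLeCond (.get aAct (.val vCount)) (.val vPivot)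

/-- Splits the active edges at the pivot. -/
def partitionActive : Cmd k :=
  .seq (.block [.assign vLow (.const 0), .assign vHigh (.const 0)])
    (.for vCount vAct (.ite belowPivot
      (.block [.setNat aLow (.val vLow) (.get aAct (.val vCount)), .incr vLow (.const 1)])
      (.block [.setNat aHigh (.val vHigh) (.get aAct (.val vCount)), .incr vHigh (.const 1)])))

theorem partitionActive_runs (σ : Memory k) (m : ℕ) (hm : σ.nat vAct 0 = m) :
    Runs Ω partitionActive σ (5 * m + 4) (fun τ =>
      seg (τ.nat aLow) (τ.nat vLow 0) =
        lowPart (σ.real rW) (σ.nat vPivot 0) (seg (σ.nat aAct) m) ∧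
      seg (τ.nat aHigh) (τ.nat vHigh 0) =
        highPart (σ.real rW) (σ.nat vPivot 0) (seg (σ.nat aAct) m)) := by
  set W := σ.real rW with hW
  set p := σ.nat vPivot 0 with hp
  refine Runs.seq (B₁ := 2) (B₂ := 5 * m + 2)
    (Q₁ := fun τ => τ = (σ.setNat vLow 0 0).setNat vHigh 0 0)
    (.of_loopFree (by simp [Cmd.block, Cmd.LoopFree]) le_rfl rfl) (by omega) ?_
  rintro τ - rfl
  refine (Runs.for m (by simp [Memory.nat_setNat_of_ne, hm]) (by simp [Cmd.block, Cmd.LoopFree])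
    (by simp [Cmd.block, Cmd.KeepsNat]) (by simp [Cmd.block, Cmd.KeepsNat]) (by simp)
    (fun i τ => seg (τ.nat aLow) (τ.nat vLow 0) = lowPart W p (seg (σ.nat aAct) i) ∧
      seg (τ.nat aHigh) (τ.nat vHigh 0) = highPart W p (seg (σ.nat aAct) i))
    (by simp [Memory.nat_setNat_of_ne, lowPart, highPart]) ?_).mono
    (by simp [Cmd.block, Cmd.cost]) fun τ _ h => h
  rintro i hi τ hF hv ⟨h1, h2⟩
  have hA : τ.nat aAct = σ.nat aAct := by
    rw [hF.nat _ (by simp [Cmd.for, Cmd.block, Cmd.KeepsNat])]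
    simp [Memory.nat_setNat_of_ne]
  have hw : τ.real rW = W := by
    rw [hF.real _ (by simp [Cmd.for, Cmd.block, Cmd.KeepsReal])]
    simp [hW]
  have hpv : τ.nat vPivot 0 = p := by
    rw [hF.nat _ (by simp [Cmd.for, Cmd.block, Cmd.KeepsNat])]
    simp [Memory.nat_setNat_of_ne, hp]
  have hiff : belowPivot.Holds τ ↔ KeyLe W (σ.nat aAct i) p := by
    simp only [belowPivot, keyLeCond_holds, NatExpr.eval, hA, hw, hpv, hv]
  rw [seg_succ]
  by_cases hc : KeyLe W (σ.nat aAct i) p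
  · have hc' := hiff.2 hc
    simp only [Cmd.step, if_pos hc', Cmd.block, NatExpr.eval]
    constructor
    · simp [Memory.nat_setNat_of_ne, hA, hv, seg_update, h1]
      simp [lowPart, hc]
    · simp [Memory.nat_setNat_of_ne, hA, hv, h2]
      simp [highPart, hc]
  · have hc' : ¬ belowPivot.Holds τ := fun h => hc (hiff.1 h)
    simp only [Cmd.step, if_neg hc', Cmd.block, NatExpr.eval]
    constructor
    · simp [Memory.nat_setNat_of_ne, hA, hv, h1]
      simp [lowPart, hc]
    · simp [Memory.nat_setNat_of_ne, hA, hv, seg_update, h2]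
      simp [highPart, hc]

/-- Adds a node to the list of starting nodes, and prepares it for the search. -/
def addRoot (e : NatExpr k) : Cmd k :=
  .block [.setNat aRoot (.val vRoot) e, .setNat aLab (.get aRoot (.val vRoot)) (.const 0),
    .setNat aHead (.get aRoot (.val vRoot)) (.const 0), .incr vRoot (.const 1)]

/-- The list of starting nodes is `l`, and these nodes are prepared for the search. -/
structure RootState (σ : Memory k) (l : List ℕ) : Prop where
  size : σ.nat vRoot 0 = l.length
  root : seg (σ.nat aRoot) l.length = l
  lab : ∀ u ∈ l, σ.nat aLab u = 0
  head : ∀ u ∈ l, σ.nat aHead u = 0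

theorem RootState.addRoot {σ : Memory k} {l : List ℕ} (h : RootState σ l) (e : NatExpr k) :
    RootState ((addRoot e).step Ω σ) (l ++ [e.eval σ]) := by
  have e1 := h.size
  have h2 := h.root
  refine ⟨?_, ?_, ?_, ?_⟩
  · simp [_root_.addRoot, Cmd.block, Cmd.step, NatExpr.eval, Memory.nat_setNat_of_ne, e1]
  · simp [_root_.addRoot, Cmd.block, Cmd.step, NatExpr.eval, Memory.nat_setNat_of_ne, e1,
      seg_update, h2]
  · intro u hu
    simp [_root_.addRoot, Cmd.block, Cmd.step, NatExpr.eval, Memory.nat_setNat_of_ne, e1]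
    simp only [List.mem_append, List.mem_singleton] at hu
    rw [Function.update_apply]
    split_ifs with h3
    · rfl
    · exact h.lab u (hu.resolve_right h3)
  · intro u hu
    simp [_root_.addRoot, Cmd.block, Cmd.step, NatExpr.eval, Memory.nat_setNat_of_ne, e1]
    simp only [List.mem_append, List.mem_singleton] at hu
    rw [Function.update_apply]
    split_ifs with h3
    · rfl
    · exact h.head u (hu.resolve_right h3)

theorem addRoot_keepsNat {a : NatArray k} {e : NatExpr k}
    (h : ∀ b ∈ [aRoot, aLab, aHead, vRoot], a ≠ b) : (addRoot e).KeepsNat a := by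
  simp at h
  simp [addRoot, Cmd.block, Cmd.KeepsNat, h]

theorem addRoot_nat {σ : Memory k} {a : NatArray k} {e : NatExpr k}
    (h : ∀ b ∈ [aRoot, aLab, aHead, vRoot], a ≠ b) : ((addRoot e).step Ω σ).nat a = σ.nat a :=
  (Cmd.LoopFree.frame (Ω := Ω) (c := addRoot e) (by simp [addRoot, Cmd.block, Cmd.LoopFree]) σ).nat
    a (addRoot_keepsNat h)

theorem RootState.congr {σ τ : Memory k} {l : List ℕ} (h : RootState σ l)
    (h1 : τ.nat vRoot = σ.nat vRoot) (h2 : τ.nat aRoot = σ.nat aRoot)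
    (h3 : τ.nat aLab = σ.nat aLab) (h4 : τ.nat aHead = σ.nat aHead) : RootState τ l :=
  ⟨by rw [h1, h.size], by rw [h2, h.root], by rw [h3]; exact h.lab, by rw [h4]; exact h.head⟩

/-- Collects the two distinguished nodes and the ends of the active edges as starting nodes. -/
def collectRoots : Cmd k :=
  .seq (.block [.assign vRoot (.const 0), addRoot (.val vDst), addRoot (.val vSrc)])
    (.for vCount vAct (.seq (addRoot (.get aSrc (.get aAct (.val vCount))))
      (addRoot (.get aDst (.get aAct (.val vCount))))))

/-- The list of starting nodes. -/
def rootList (f g : ℕ → ℕ) (s t : ℕ) (l : List ℕ) : List ℕ := t :: s :: l.flatMap fun e => [f e, g e]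

theorem length_rootList (f g : ℕ → ℕ) (s t : ℕ) (l : List ℕ) :
    (rootList f g s t l).length = 2 * l.length + 2 := by
  simp [rootList, List.length_flatMap]
  omega

theorem mem_rootList {f g : ℕ → ℕ} {s t u : ℕ} {l : List ℕ} :
    u ∈ rootList f g s t l ↔ u = t ∨ u = s ∨ ∃ e ∈ l, u = f e ∨ u = g e := by
  simp [rootList]

theorem collectRoots_runs (σ : Memory k) (m : ℕ) (hm : σ.nat vAct 0 = m) :
    Runs Ω collectRoots σ (10 * m + 11) (fun τ => RootState τ
      (rootList (σ.nat aSrc) (σ.nat aDst) (σ.nat vSrc 0) (σ.nat vDst 0) (seg (σ.nat aAct) m))) := by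
  refine Runs.seq (B₁ := 9) (B₂ := 10 * m + 2)
    (Q₁ := fun τ => RootState τ [σ.nat vDst 0, σ.nat vSrc 0])
    (.of_loopFree (by simp [Cmd.block, Cmd.LoopFree, addRoot])
      (by simp [Cmd.block, Cmd.cost, addRoot]) ?_) (by omega) ?_
  · have h0 : RootState (σ.setNat vRoot 0 0) [] := ⟨by simp, by simp, by simp, by simp⟩
    have := (h0.addRoot (Ω := Ω) (.val vDst)).addRoot (Ω := Ω) (.val vSrc)
    simp only [NatExpr.eval] at this
    rw [addRoot_nat (by simp), Memory.nat_setNat_of_ne _ (by simp),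
      Memory.nat_setNat_of_ne _ (by simp)] at this
    exact this
  intro τ hF hτ
  have hk : ∀ a, (∀ b ∈ [aRoot, aLab, aHead, vRoot], a ≠ b) → τ.nat a = σ.nat a := by
    intro a ha
    refine hF.nat a ?_
    have := ha
    simp at this
    simp [Cmd.block, Cmd.KeepsNat, addRoot_keepsNat ha, this]
  refine (Runs.for m (by rw [hk _ (by simp), hm]) (by simp [addRoot, Cmd.block, Cmd.LoopFree])
    (by exact ⟨addRoot_keepsNat (by simp), addRoot_keepsNat (by simp)⟩)
    (by exact ⟨addRoot_keepsNat (by simp), addRoot_keepsNat (by simp)⟩) (by simp)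
    (fun i τ => RootState τ (rootList (σ.nat aSrc) (σ.nat aDst) (σ.nat vSrc 0) (σ.nat vDst 0)
      (seg (σ.nat aAct) i))) ?_ ?_).mono (by simp [addRoot, Cmd.block, Cmd.cost]) fun τ _ h => h
  · exact hτ.congr (by simp [Memory.nat_setNat_of_ne]) (by simp [Memory.nat_setNat_of_ne])
      (by simp [Memory.nat_setNat_of_ne]) (by simp [Memory.nat_setNat_of_ne])
  · intro i hi υ hG hv hI
    have hk' : ∀ a, (∀ b ∈ [aRoot, aLab, aHead, vRoot, vCount], a ≠ b) → υ.nat a = σ.nat a := by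
      intro a ha
      have ha' : ∀ b ∈ [aRoot, aLab, aHead, vRoot], a ≠ b := by
        simp at ha; simp [ha]
      rw [hG.nat a (Cmd.keepsNat_for (by simp at ha; simp [ha])
        ⟨addRoot_keepsNat ha', addRoot_keepsNat ha'⟩), hk a ha']
    have := (hI.addRoot (Ω := Ω) (.get aSrc (.get aAct (.val vCount)))).addRoot (Ω := Ω)
      (.get aDst (.get aAct (.val vCount)))
    simp only [NatExpr.eval] at this
    rw [addRoot_nat (by simp), addRoot_nat (by simp), addRoot_nat (by simp), hk' aSrc (by simp),
      hk' aDst (by simp), hk' aAct (by simp), hv] at this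
    have e : rootList (σ.nat aSrc) (σ.nat aDst) (σ.nat vSrc 0) (σ.nat vDst 0)
        (seg (σ.nat aAct) (i + 1)) = rootList (σ.nat aSrc) (σ.nat aDst) (σ.nat vSrc 0)
        (σ.nat vDst 0) (seg (σ.nat aAct) i) ++ [σ.nat aSrc (σ.nat aAct i)] ++
        [σ.nat aDst (σ.nat aAct i)] := by
      simp [rootList, seg_succ]
    rw [e]
    exact this.congr (by simp [Memory.nat_setNat_of_ne, Cmd.step])
      (by simp [Memory.nat_setNat_of_ne, Cmd.step]) (by simp [Memory.nat_setNat_of_ne, Cmd.step])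
      (by simp [Memory.nat_setNat_of_ne, Cmd.step])

/-- Adds a half-edge. -/
def addHalfEdge (x y : NatExpr k) : Cmd k :=
  .block [.setNat aTail (.val vHalfEdges) x, .setNat aTip (.val vHalfEdges) y,
    .setNat aNext (.val vHalfEdges) (.get aHead (.get aTail (.val vHalfEdges))),
    .setNat aHead (.get aTail (.val vHalfEdges)) (.add (.val vHalfEdges) (.const 1)),
    .incr vHalfEdges (.const 1)]

/-- The half-edges listed by the memory are those of `l`, and `aHead` and `aNext` link the
half-edges with the same tail, for all tails in `X`. -/
structure HalfEdgeState (X : Set ℕ) (σ : Memory k) (l : List (ℕ × ℕ)) : Prop where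
  size : σ.nat vHalfEdges 0 = l.length
  list : (List.range l.length).map (fun h => (σ.nat aTail h, σ.nat aTip h)) = l
  next : ∀ h < l.length, IsLastOf (σ.nat aTail) (σ.nat aTail h) h (σ.nat aNext h)
  head : ∀ u ∈ X, IsLastOf (σ.nat aTail) u l.length (σ.nat aHead u)

theorem IsLastOf.congr {tail tail' : ℕ → ℕ} {u n p : ℕ} (h : IsLastOf tail u n p)
    (ht : ∀ i < n, tail' i = tail i) : IsLastOf tail' u n p :=
  ⟨h.le, fun hp => by rw [ht _ (by have := h.le; omega)]; exact h.tail_eq hp,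
    fun i h1 h2 => by rw [ht i h2]; exact h.ne i h1 h2⟩

theorem HalfEdgeState.add {X : Set ℕ} {σ : Memory k} {l : List (ℕ × ℕ)}
    (h : HalfEdgeState X σ l) (x y : NatExpr k) (hx : x.eval σ ∈ X)
    (hy : y.eval (σ.setNat aTail l.length (x.eval σ)) = y.eval σ) :
    HalfEdgeState X ((addHalfEdge x y).step Ω σ) (l ++ [(x.eval σ, y.eval σ)]) := by
  have e1 := h.size
  have htail : ((addHalfEdge x y).step Ω σ).nat aTail =
      Function.update (σ.nat aTail) l.length (x.eval σ) := by
    simp [addHalfEdge, Cmd.block, Cmd.step, NatExpr.eval, Memory.nat_setNat_of_ne, e1]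
  have htip : ((addHalfEdge x y).step Ω σ).nat aTip =
      Function.update (σ.nat aTip) l.length (y.eval σ) := by
    simp [addHalfEdge, Cmd.block, Cmd.step, NatExpr.eval, Memory.nat_setNat_of_ne, e1, hy]
  have hnext : ((addHalfEdge x y).step Ω σ).nat aNext =
      Function.update (σ.nat aNext) l.length (σ.nat aHead (x.eval σ)) := by
    simp [addHalfEdge, Cmd.block, Cmd.step, NatExpr.eval, Memory.nat_setNat_of_ne, e1]
  have hhead : ((addHalfEdge x y).step Ω σ).nat aHead =
      Function.update (σ.nat aHead) (x.eval σ) (l.length + 1) := by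
    simp [addHalfEdge, Cmd.block, Cmd.step, NatExpr.eval, Memory.nat_setNat_of_ne, e1]
  have hsame : ∀ i < l.length,
      Function.update (σ.nat aTail) l.length (x.eval σ) i = σ.nat aTail i :=
    fun i hi => Function.update_of_ne (by omega) _ _
  have hlen : (l ++ [(x.eval σ, y.eval σ)]).length = l.length + 1 := by simp
  refine ⟨?_, ?_, ?_, ?_⟩
  · simp [addHalfEdge, Cmd.block, Cmd.step, NatExpr.eval, Memory.nat_setNat_of_ne, e1]
  · rw [hlen, List.range_succ, List.map_append, htail, htip]
    congr 1
    · conv_rhs => rw [← h.list]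
      refine List.map_congr_left fun i hi => ?_
      have hi' := List.mem_range.1 hi
      rw [hsame i hi', Function.update_of_ne (by omega)]
    · simp
  · intro i hi
    rw [hlen] at hi
    rw [htail, hnext]
    rcases Nat.lt_or_ge i l.length with h1 | h1
    · rw [hsame i h1, Function.update_of_ne (by omega)]
      exact (h.next i h1).congr fun j hj => hsame j (by omega)
    · rw [show i = l.length by omega, Function.update_self, Function.update_self]
      exact (h.head _ hx).congr hsame
  · intro u hu
    rw [hlen, htail, hhead]
    by_cases hux : u = x.eval σ
    · subst hux
      rw [Function.update_self]
      exact ⟨le_rfl, fun _ => by simp, fun i h1 h2 => by omega⟩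
    · rw [Function.update_of_ne hux]
      have hu' := h.head u hu
      refine ⟨by have := hu'.le; omega, fun hp => ?_, fun i h1 h2 => ?_⟩
      · rw [hsame _ (by have := hu'.le; omega)]
        exact hu'.tail_eq hp
      · rcases Nat.lt_or_ge i l.length with h3 | h3
        · rw [hsame i h3]
          exact hu'.ne i h1 h3
        · rw [show i = l.length by omega, Function.update_self]
          exact Ne.symm hux

theorem addHalfEdge_keepsNat {a : NatArray k} {x y : NatExpr k}
    (h : ∀ b ∈ [aTail, aTip, aNext, aHead, vHalfEdges], a ≠ b) :
    (addHalfEdge x y).KeepsNat a := by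
  simp at h
  simp [addHalfEdge, Cmd.block, Cmd.KeepsNat, h]

theorem addHalfEdge_nat {σ : Memory k} {a : NatArray k} {x y : NatExpr k}
    (h : ∀ b ∈ [aTail, aTip, aNext, aHead, vHalfEdges], a ≠ b) :
    ((addHalfEdge x y).step Ω σ).nat a = σ.nat a :=
  (Cmd.LoopFree.frame (Ω := Ω) (c := addHalfEdge x y)
    (by simp [addHalfEdge, Cmd.block, Cmd.LoopFree]) σ).nat a (addHalfEdge_keepsNat h)

theorem HalfEdgeState.congr {X : Set ℕ} {σ τ : Memory k} {l : List (ℕ × ℕ)}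
    (h : HalfEdgeState X σ l)
    (hk : ∀ a ∈ [aTail, aTip, aNext, aHead, vHalfEdges], τ.nat a = σ.nat a) :
    HalfEdgeState X τ l := by
  simp only [List.mem_cons, List.not_mem_nil, or_false, forall_eq_or_imp, forall_eq] at hk
  obtain ⟨h1, h2, h3, h4, h5⟩ := hk
  exact ⟨by rw [h5, h.size], by rw [h1, h2, h.list], by rw [h1, h3]; exact h.next,
    by rw [h1, h4]; exact h.head⟩

/-- Links the half-edges of the edges up to the pivot. -/
def linkHalfEdges : Cmd k :=
  .seq (.assign vHalfEdges (.const 0))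
    (.for vCount vLow (.seq
      (addHalfEdge (.get aSrc (.get aLow (.val vCount))) (.get aDst (.get aLow (.val vCount))))
      (addHalfEdge (.get aDst (.get aLow (.val vCount))) (.get aSrc (.get aLow (.val vCount))))))

/-- The half-edges of a list of edges. -/
def halfEdgeList (f g : ℕ → ℕ) (l : List ℕ) : List (ℕ × ℕ) :=
  l.flatMap fun e => [(f e, g e), (g e, f e)]

theorem length_halfEdgeList (f g : ℕ → ℕ) (l : List ℕ) :
    (halfEdgeList f g l).length = 2 * l.length := by
  simp [halfEdgeList, List.length_flatMap]
  omega

theorem mem_halfEdgeList {f g : ℕ → ℕ} {l : List ℕ} {x y : ℕ} :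
    (x, y) ∈ halfEdgeList f g l ↔ EdgeRel f g {e | e ∈ l} x y := by
  simp only [halfEdgeList, List.mem_flatMap, List.mem_cons, List.not_mem_nil, or_false,
    Prod.mk.injEq, EdgeRel, mem_ofPred_eq]
  refine exists_congr fun e => and_congr_right fun _ => ?_
  constructor <;> (rintro (⟨rfl, rfl⟩ | ⟨rfl, rfl⟩) <;> simp)

theorem linkHalfEdges_runs (X : Set ℕ) (σ : Memory k) (l : List ℕ)
    (hm : σ.nat vLow 0 = l.length) (hl : seg (σ.nat aLow) l.length = l)
    (hX : ∀ e ∈ l, σ.nat aSrc e ∈ X ∧ σ.nat aDst e ∈ X) (hhead : ∀ u ∈ X, σ.nat aHead u = 0) :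
    Runs Ω linkHalfEdges σ (12 * l.length + 3) (fun τ =>
      HalfEdgeState X τ (halfEdgeList (σ.nat aSrc) (σ.nat aDst) l)) := by
  refine Runs.seq (B₁ := 1) (B₂ := 12 * l.length + 2)
    (Q₁ := fun τ => τ = σ.setNat vHalfEdges 0 0) (.of_loopFree trivial le_rfl rfl) (by omega) ?_
  rintro τ - rfl
  refine (Runs.for l.length (by simp [Memory.nat_setNat_of_ne, hm])
    (by simp [addHalfEdge, Cmd.block, Cmd.LoopFree])
    (by exact ⟨addHalfEdge_keepsNat (by simp), addHalfEdge_keepsNat (by simp)⟩)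
    (by exact ⟨addHalfEdge_keepsNat (by simp), addHalfEdge_keepsNat (by simp)⟩) (by simp)
    (fun i τ => HalfEdgeState X τ (halfEdgeList (σ.nat aSrc) (σ.nat aDst) (seg (σ.nat aLow) i)))
    ?_ ?_).mono (by simp [addHalfEdge, Cmd.block, Cmd.cost]) fun τ _ h => ?_
  · refine ⟨?_, ?_, ?_, ?_⟩
    · simp [Memory.nat_setNat_of_ne, halfEdgeList]
    · simp [halfEdgeList]
    · simp [halfEdgeList]
    · intro u hu
      simp only [halfEdgeList, seg_zero, List.flatMap_nil, List.length_nil]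
      have e : ((σ.setNat vHalfEdges 0 0).setNat vCount 0 0).nat aHead = σ.nat aHead := by
        simp [Memory.nat_setNat_of_ne]
      rw [e, hhead u hu]
      exact ⟨le_rfl, fun h => absurd rfl h, fun h _ h2 => by omega⟩
  · intro i hi υ hG hv hI
    have hk' : ∀ a, (∀ b ∈ [aTail, aTip, aNext, aHead, vHalfEdges, vCount], a ≠ b) →
        υ.nat a = σ.nat a := by
      intro a ha
      have ha' : ∀ b ∈ [aTail, aTip, aNext, aHead, vHalfEdges], a ≠ b := by
        simp at ha; simp [ha]
      rw [hG.nat a (Cmd.keepsNat_for (by simp at ha; simp [ha])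
        ⟨addHalfEdge_keepsNat ha', addHalfEdge_keepsNat ha'⟩), Memory.nat_setNat_of_ne]
      simp at ha; simp [ha]
    have hmem : σ.nat aLow i ∈ l := by
      rw [← hl]
      exact mem_seg.2 ⟨i, hi, rfl⟩
    have h1 := hI.add (Ω := Ω) (.get aSrc (.get aLow (.val vCount)))
      (.get aDst (.get aLow (.val vCount)))
      (by simpa [NatExpr.eval, hk', hv] using (hX _ hmem).1)
      (by simp [NatExpr.eval, Memory.nat_setNat_of_ne])
    have h2 := h1.add (Ω := Ω) (.get aDst (.get aLow (.val vCount)))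
      (.get aSrc (.get aLow (.val vCount)))
      (by simpa [NatExpr.eval, hk', hv, addHalfEdge_nat] using (hX _ hmem).2)
      (by simp [NatExpr.eval, Memory.nat_setNat_of_ne])
    have e : halfEdgeList (σ.nat aSrc) (σ.nat aDst) (seg (σ.nat aLow) (i + 1)) =
        halfEdgeList (σ.nat aSrc) (σ.nat aDst) (seg (σ.nat aLow) i) ++
        [(σ.nat aSrc (σ.nat aLow i), σ.nat aDst (σ.nat aLow i))] ++
        [(σ.nat aDst (σ.nat aLow i), σ.nat aSrc (σ.nat aLow i))] := by
      simp [halfEdgeList, seg_succ]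
    rw [e]
    simp only [NatExpr.eval] at h2
    rw [addHalfEdge_nat (by simp), addHalfEdge_nat (by simp), addHalfEdge_nat (by simp),
      addHalfEdge_nat (by simp), hk' aSrc (by simp), hk' aDst (by simp), hk' aLow (by simp),
      hv] at h2
    refine h2.congr fun a ha => ?_
    rw [Memory.nat_setNat_of_ne]
    · rfl
    · rintro rfl
      simp at ha
  · rwa [hl] at h

end Machine

section Machine

variable {k : ℕ} {Ω : CellSolver k}

/-- The first node in the queue. -/
def frontNode : NatExpr k := .get aQueue (.val vFront)

/-- The tip of the current half-edge. -/
def tipNode : NatExpr k := .get aTip (.val vHalfEdge)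

/-- The next starting node. -/
def rootNode : NatExpr k := .get aRoot (.val vRootPos)

/-- Appends to the queue the node `w`, with label `l` and parent `v`. -/
def pushNode (w l v : NatExpr k) : Cmd k :=
  .block [.setNat aLab w l, .setNat aPar w v, .setNat aQueue (.val vBack) w,
    .incr vBack (.const 1)]

/-- Examines the next half-edge at the first node of the queue. -/
def examineHalfEdge : Cmd k :=
  .seq (.assign vHalfEdge (.sub (.get aHead frontNode) (.const 1)))
  (.seq (.setNat aHead frontNode (.get aNext (.val vHalfEdge)))
  (.ite (.natEq (.get aLab tipNode) (.const 0))
    (pushNode tipNode (.get aLab frontNode) frontNode) .skip))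

/-- Examines the next starting node. -/
def examineRoot : Cmd k :=
  .seq (.ite (.natEq (.get aLab rootNode) (.const 0))
    (pushNode rootNode (.add rootNode (.const 1)) rootNode) .skip)
  (.incr vRootPos (.const 1))

/-- One step of the search. -/
def searchStep : Cmd k :=
  .ite (.natLt (.val vFront) (.val vBack))
    (.ite (.natEq (.get aHead frontNode) (.const 0)) (.incr vFront (.const 1)) examineHalfEdge)
    examineRoot

/-- Searches the graph of the half-edges from all starting nodes. -/
def searchLoop : Cmd k :=
  .seq (.block [.assign vFront (.const 0), .assign vBack (.const 0), .assign vRootPos (.const 0)])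
    (.while (.disj (.natLt (.val vFront) (.val vBack)) (.natLt (.val vRootPos) (.val vRoot)))
      searchStep)

/-- Each step of the search examines a half-edge or a starting node, or removes a node from the
queue. A half-edge or starting node is weighted by three in the potential, since examining it may
append a node to the queue. -/
theorem searchLoop_runs (σ : Memory k) (R H : ℕ) (hR : σ.nat vRoot 0 = R)
    (hG : SearchGraph (σ.nat aRoot) R (σ.nat aTail) (σ.nat aTip) (σ.nat aNext) H)
    (hlab : ∀ j < R, σ.nat aLab (σ.nat aRoot j) = 0)
    (hhead : ∀ j < R, IsLastOf (σ.nat aTail) (σ.nat aRoot j) H (σ.nat aHead (σ.nat aRoot j))) :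
    Runs Ω searchLoop σ (30 * H + 30 * R + 4) (fun τ => ∃ n,
      SearchState (σ.nat aRoot) R (σ.nat aTail) (σ.nat aTip) H (τ.nat aLab) (τ.nat aHead)
        (τ.nat aPar) (τ.nat aQueue) n n R ∧ n ≤ R + H) := by
  set root := σ.nat aRoot with hroot
  set tail := σ.nat aTail with htail
  set tip := σ.nat aTip with htip
  refine Runs.seq (B₁ := 3) (B₂ := 30 * H + 30 * R + 1)
    (Q₁ := fun τ => τ = ((σ.setNat vFront 0 0).setNat vBack 0 0).setNat vRootPos 0 0)
    (.of_loopFree (by simp [Cmd.block, Cmd.LoopFree]) le_rfl rfl) (by omega) ?_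
  rintro τ - rfl
  refine (Runs.while_loopFree
    (by simp [searchStep, examineHalfEdge, examineRoot, pushNode, Cmd.block, Cmd.LoopFree])
    (fun τ => SearchState root R tail tip H (τ.nat aLab) (τ.nat aHead)
        (τ.nat aPar) (τ.nat aQueue) (τ.nat vFront 0) (τ.nat vBack 0) (τ.nat vRootPos 0) ∧
      τ.nat vBack 0 + remaining tail (τ.nat aHead) H ≤ τ.nat vRootPos 0 + H)
    (fun τ => 3 * remaining tail (τ.nat aHead) H + 3 * (R - τ.nat vRootPos 0) +
      (τ.nat vBack 0 - τ.nat vFront 0))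
    ?_ ?_).mono ?_ ?_
  · have := SearchState.init (par := σ.nat aPar) (q := σ.nat aQueue) hlab hG hhead
    have hrem := remaining_le tail (σ.nat aHead) H
    simpa [Memory.nat_setNat_of_ne, hrem] using this
  · rintro τ hF ⟨hS, hcount⟩ hcond
    have hk : ∀ a, (∀ b ∈ [vFront, vBack, vRootPos, vHalfEdge, aHead, aLab, aPar, aQueue],
        a ≠ b) → τ.nat a = σ.nat a := by
      intro a ha
      simp at ha
      rw [hF.nat a (by simp [searchStep, examineHalfEdge, examineRoot, pushNode, Cmd.block,
        Cmd.KeepsNat, ha])]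
      simp [Memory.nat_setNat_of_ne, ha]
    have hR' : τ.nat vRoot 0 = R := by rw [hk _ (by simp), hR]
    have hroot' : τ.nat aRoot = root := hk _ (by simp)
    have htip' : τ.nat aTip = tip := hk _ (by simp)
    have hnext' : τ.nat aNext = σ.nat aNext := hk _ (by simp)
    by_cases hq : τ.nat vFront 0 < τ.nat vBack 0
    · by_cases h0 : τ.nat aHead (τ.nat aQueue (τ.nat vFront 0)) = 0
      · have hS' := hS.pop hq h0
        have e : searchStep.step Ω τ = τ.setNat vFront 0 (τ.nat vFront 0 + 1) := by
          simp [searchStep, frontNode, Cmd.step, Cond.Holds, NatExpr.eval, hq, h0]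
        rw [e]
        simp only [Memory.nat_setNat_same, Function.update_self,
          Memory.nat_setNat_of_ne _ (show (vBack : NatArray k) ≠ vFront by simp),
          Memory.nat_setNat_of_ne _ (show (vRootPos : NatArray k) ≠ vFront by simp),
          Memory.nat_setNat_of_ne _ (show (aHead : NatArray k) ≠ vFront by simp),
          Memory.nat_setNat_of_ne _ (show (aLab : NatArray k) ≠ vFront by simp),
          Memory.nat_setNat_of_ne _ (show (aPar : NatArray k) ≠ vFront by simp),
          Memory.nat_setNat_of_ne _ (show (aQueue : NatArray k) ≠ vFront by simp)]
        exact ⟨⟨hS', by omega⟩, by omega⟩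
      · obtain ⟨e, he⟩ : ∃ e, τ.nat aHead (τ.nat aQueue (τ.nat vFront 0)) = e + 1 :=
          ⟨_, (Nat.succ_pred_eq_of_ne_zero h0).symm⟩
        by_cases ht : τ.nat aLab (tip e) = 0
        · -- The half-edge leads to a new node.
          obtain ⟨⟨j, hj, hjq⟩, hlabq⟩ := hS.mem _ hq
          have heH : e < H := by
            have := hS.ptr_le j hj
            rw [hjq, he] at this
            omega
          have het : tail e = τ.nat aQueue (τ.nat vFront 0) := by
            have := hS.ptr_tail j hj
            rw [hjq, he] at this
            exact this (by omega)
          have hedge : EdgeRel tail tip (Iio H) (τ.nat aQueue (τ.nat vFront 0)) (tip e) :=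
            ⟨e, heH, Or.inl ⟨het, rfl⟩⟩
          obtain ⟨r, hr, hrc⟩ := hS.sound _ hq
          have hw : ∃ j < R, root j = tip e := by
            obtain ⟨e', he', h1, -⟩ := hG.symm e heH
            obtain ⟨j', hj', h2⟩ := hG.mem e' he'
            exact ⟨j', hj', by rw [h2, h1]⟩
          have hrem : remaining tail (Function.update (τ.nat aHead)
              (τ.nat aQueue (τ.nat vFront 0)) (σ.nat aNext e)) H <
              remaining tail (τ.nat aHead) H := by
            rw [← het]
            exact remaining_update_lt heH (by rw [het, he]) (hG.next e heH).le
          have hne : tip e ≠ τ.nat aQueue (τ.nat vFront 0) := fun h => hlabq (by rw [← h, ht])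
          have hpush := hS.push (w := tip e) (v := τ.nat aQueue (τ.nat vFront 0))
            (l := τ.nat aLab (τ.nat aQueue (τ.nat vFront 0))) (pos' := τ.nat vRootPos 0)
            hw ht ⟨r, hr, hrc.trans (.of_edge hedge)⟩ (fun _ => rfl)
            (Or.inr ⟨τ.nat vFront 0, hq, rfl, hedge⟩) (fun h => by omega)
            (Nat.pos_of_ne_zero fun h => by have := hS.empty h; omega) hS.pos_le
            (fun j h1 h2 => by omega)
          have hq' : Function.update (τ.nat aQueue) (τ.nat vBack 0) (tip e) (τ.nat vFront 0) =
              τ.nat aQueue (τ.nat vFront 0) := Function.update_of_ne (by omega) _ _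
          have hadv := hpush.advance hG (by omega) (e := e) (by rw [hq', he])
            (by rw [hq', Function.update_self, Function.update_of_ne hne.symm])
          rw [hq'] at hadv
          have es : ∀ a, (searchStep.step Ω τ).nat a =
              ((pushNode tipNode (.get aLab frontNode) frontNode).step Ω
                ((τ.setNat vHalfEdge 0 e).setNat aHead (τ.nat aQueue (τ.nat vFront 0))
                  (σ.nat aNext e))).nat a := by
            intro a
            simp [searchStep, examineHalfEdge, frontNode, tipNode, Cmd.step, Cond.Holds,
              NatExpr.eval, hq, he, htip', hnext', ht, Memory.nat_setNat_of_ne]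
          simp only [es]
          simp [pushNode, frontNode, tipNode, Cmd.block, Cmd.step, NatExpr.eval,
            Memory.nat_setNat_of_ne, htip']
          exact ⟨⟨hadv.1, by omega⟩, by omega⟩
        · have htq := hS.tip_eq hG hq he ht
          obtain ⟨hadv, -, -, hrem⟩ := hS.advance hG hq he htq
          have es : ∀ a, (searchStep.step Ω τ).nat a =
              ((τ.setNat vHalfEdge 0 e).setNat aHead (τ.nat aQueue (τ.nat vFront 0))
                  (σ.nat aNext e)).nat a := by
            intro a
            simp [searchStep, examineHalfEdge, frontNode, tipNode, Cmd.step, Cond.Holds,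
              NatExpr.eval, hq, he, htip', hnext', ht, Memory.nat_setNat_of_ne]
          simp only [es]
          simp [Memory.nat_setNat_of_ne]
          exact ⟨⟨hadv, by omega⟩, by omega⟩
    · have hpos : τ.nat vRootPos 0 < R := by
        simp only [Cond.Holds, NatExpr.eval, hR'] at hcond
        tauto
      have hfb : τ.nat vFront 0 = τ.nat vBack 0 := by have := hS.front_le; omega
      by_cases ht : τ.nat aLab (root (τ.nat vRootPos 0)) = 0
      · have hS' := hS.push_root hfb hpos ht
        have es : ∀ a, (searchStep.step Ω τ).nat a =
            (((pushNode rootNode (.add rootNode (.const 1)) rootNode).step Ω τ).setNat vRootPos 0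
              (τ.nat vRootPos 0 + 1)).nat a := by
          intro a
          simp [searchStep, examineRoot, rootNode, Cmd.step, Cond.Holds,
            NatExpr.eval, hq, hroot', ht, Memory.nat_setNat_of_ne, pushNode, Cmd.block]
        simp only [es]
        simp [pushNode, rootNode, Cmd.block, Cmd.step, NatExpr.eval, Memory.nat_setNat_of_ne,
          hroot']
        exact ⟨⟨hS', by omega⟩, by omega⟩
      · have hS' := hS.skip_root hpos ht
        have es : ∀ a, (searchStep.step Ω τ).nat a =
            (τ.setNat vRootPos 0 (τ.nat vRootPos 0 + 1)).nat a := by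
          intro a
          simp [searchStep, examineRoot, rootNode, Cmd.step, Cond.Holds,
            NatExpr.eval, hq, hroot', ht, Memory.nat_setNat_of_ne]
        simp only [es]
        simp [Memory.nat_setNat_of_ne]
        exact ⟨⟨hS', by omega⟩, by omega⟩
  · have := remaining_le tail (σ.nat aHead) H
    simp [searchStep, examineHalfEdge, examineRoot, pushNode, Cmd.block, Cmd.cost,
      Memory.nat_setNat_of_ne]
    omega
  · rintro τ hF ⟨⟨hS, hcount⟩, hcond⟩
    have hR' : τ.nat vRoot 0 = R := by
      rw [hF.nat _ (by simp [searchStep, examineHalfEdge, examineRoot, pushNode, Cmd.block,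
        Cmd.KeepsNat])]
      simp [Memory.nat_setNat_of_ne, hR]
    simp only [Cond.Holds, NatExpr.eval, hR'] at hcond
    have h1 := hS.front_le
    have h2 := hS.pos_le
    have e1 : τ.nat vFront 0 = τ.nat vBack 0 := by omega
    have e2 : τ.nat vRootPos 0 = R := by omega
    rw [e1, e2] at hS
    exact ⟨_, hS, by omega⟩

/-- Splits the active edges at the pivot and searches the graph of those up to the pivot. -/
def searchActive : Cmd k :=
  .seq partitionActive (.seq collectRoots (.seq linkHalfEdges searchLoop))

/-- The outcome of the search of the graph with edges `low`, where the nodes are the ends of the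
edges in `all`, the start `s` and the target `t`. -/
structure SearchResult (f g : ℕ → ℕ) (s t : ℕ) (all low : List ℕ) (lab par : ℕ → ℕ) : Prop where
  lab_eq_iff : ∀ u ∈ rootList f g s t all, ∀ v ∈ rootList f g s t all,
    lab u = lab v ↔ Conn f g {e | e ∈ low} u v
  forest : ∃ (q : ℕ → ℕ) (n : ℕ), n ≤ 4 * all.length + 2 ∧ q 0 = t ∧ par t = t ∧ lab t = t + 1 ∧
    (∀ u ∈ rootList f g s t all, ∃ i < n, q i = u) ∧
    ∀ i < n, par (q i) = q i ∧ lab (q i) = q i + 1 ∨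
      ∃ i' < i, par (q i) = q i' ∧ EdgeRel f g {e | e ∈ low} (q i') (q i)

theorem searchActive_keepsNat {a : NatArray k}
    (h : ∀ b ∈ [vLow, vHigh, vCount, aLow, aHigh, vRoot, aRoot, aLab, aHead, aTail, aTip, aNext,
      vHalfEdges, vFront, vBack, vRootPos, vHalfEdge, aPar, aQueue], a ≠ b) :
    (searchActive : Cmd k).KeepsNat a := by
  simp at h
  simp [searchActive, partitionActive, collectRoots, addRoot, linkHalfEdges, addHalfEdge,
    searchLoop, searchStep, examineHalfEdge, examineRoot, pushNode, Cmd.for, Cmd.block,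
    Cmd.KeepsNat, h]

theorem searchActive_keepsReal {a : RealArray k} : (searchActive : Cmd k).KeepsReal a := by
  simp [searchActive, partitionActive, collectRoots, addRoot, linkHalfEdges, addHalfEdge,
    searchLoop, searchStep, examineHalfEdge, examineRoot, pushNode, Cmd.for, Cmd.block,
    Cmd.KeepsReal]

/-- The search takes linear time in the number of active edges, since only the ends of active edges,
and not all nodes of the graph, are prepared for it. -/
theorem searchActive_runs (σ : Memory k) (m : ℕ) (hm : σ.nat vAct 0 = m) :
    Runs Ω searchActive σ (200 * m + 100) (fun τ =>
      seg (τ.nat aLow) (τ.nat vLow 0) =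
        lowPart (σ.real rW) (σ.nat vPivot 0) (seg (σ.nat aAct) m) ∧
      seg (τ.nat aHigh) (τ.nat vHigh 0) =
        highPart (σ.real rW) (σ.nat vPivot 0) (seg (σ.nat aAct) m) ∧
      SearchResult (σ.nat aSrc) (σ.nat aDst) (σ.nat vSrc 0) (σ.nat vDst 0) (seg (σ.nat aAct) m)
        (lowPart (σ.real rW) (σ.nat vPivot 0) (seg (σ.nat aAct) m))
        (τ.nat aLab) (τ.nat aPar)) := by
  set f := σ.nat aSrc with hf
  set g := σ.nat aDst with hg
  set s := σ.nat vSrc 0 with hs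
  set t := σ.nat vDst 0 with ht
  set A := seg (σ.nat aAct) m with hA
  set lo := lowPart (σ.real rW) (σ.nat vPivot 0) A with hlo
  have hlolen : lo.length ≤ m := by
    rw [hlo, hA, length_lowPart_seg]
    exact cnt_le _ _ _
  refine Runs.seq (B₂ := 195 * m + 96) (partitionActive_runs σ m hm) (by omega) ?_
  rintro τ₁ hF₁ ⟨hlow₁, hhigh₁⟩
  have hk₁ : ∀ a, (∀ b ∈ [vLow, vHigh, vCount, aLow, aHigh], a ≠ b) → τ₁.nat a = σ.nat a := by
    intro a ha
    simp at ha
    exact hF₁.nat a (by simp [partitionActive, Cmd.for, Cmd.block, Cmd.KeepsNat, ha])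
  refine Runs.seq (B₂ := 185 * m + 85) (collectRoots_runs τ₁ m (by rw [hk₁ _ (by simp), hm]))
    (by omega) ?_
  intro τ₂ hF₂ hR₂
  rw [hk₁ _ (by simp), hk₁ _ (by simp), hk₁ _ (by simp), hk₁ _ (by simp), hk₁ _ (by simp)] at hR₂
  change RootState τ₂ (rootList f g s t A) at hR₂
  have hk₂ : ∀ a, (∀ b ∈ [vRoot, aRoot, aLab, aHead, vCount], a ≠ b) →
      τ₂.nat a = τ₁.nat a := by
    intro a ha
    simp at ha
    exact hF₂.nat a (by simp [collectRoots, addRoot, Cmd.for, Cmd.block, Cmd.KeepsNat, ha])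
  have hlow₂ : τ₂.nat vLow 0 = lo.length := by
    rw [hk₂ _ (by simp), hlo, ← hlow₁, length_seg]
  have hsrc₂ : τ₂.nat aSrc = f := by rw [hk₂ _ (by simp), hk₁ _ (by simp)]
  have hdst₂ : τ₂.nat aDst = g := by rw [hk₂ _ (by simp), hk₁ _ (by simp)]
  have hseg₂ : seg (τ₂.nat aLow) lo.length = lo := by
    rw [← hlow₂, hk₂ _ (by simp), hk₂ _ (by simp), hlow₁]
  refine Runs.seq (B₂ := 173 * m + 82)
    (linkHalfEdges_runs {u | u ∈ rootList f g s t A} τ₂ lo hlow₂ hseg₂ ?_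
      (fun u hu => hR₂.head u hu)) (by omega) ?_
  · intro e he
    have he' : e ∈ A := (mem_lowPart.1 he).1
    rw [hsrc₂, hdst₂]
    exact ⟨mem_rootList.2 (Or.inr (Or.inr ⟨e, he', Or.inl rfl⟩)),
      mem_rootList.2 (Or.inr (Or.inr ⟨e, he', Or.inr rfl⟩))⟩
  intro τ₃ hF₃ hH₃
  rw [hsrc₂, hdst₂] at hH₃
  have hk₃ : ∀ a, (∀ b ∈ [vCount, aTail, aTip, aNext, aHead, vHalfEdges], a ≠ b) →
      τ₃.nat a = τ₂.nat a := by
    intro a ha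
    simp at ha
    exact hF₃.nat a (by simp [linkHalfEdges, addHalfEdge, Cmd.for, Cmd.block, Cmd.KeepsNat, ha])
  set R := (rootList f g s t A).length with hR
  set H := (halfEdgeList f g lo).length with hH
  have hRm : R = 2 * m + 2 := by rw [hR, length_rootList, hA, length_seg]
  have hHm : H = 2 * lo.length := by rw [hH, length_halfEdgeList]
  have hAlen : A.length = m := by rw [hA, length_seg]
  have hroot₃ : seg (τ₃.nat aRoot) R = rootList f g s t A := by
    rw [hk₃ _ (by simp), hR₂.root]
  have hrootmem : ∀ u, u ∈ rootList f g s t A ↔ ∃ j < R, τ₃.nat aRoot j = u := by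
    intro u
    rw [← hroot₃, mem_seg]
  have hhalf : ∀ x y, (∃ h < H, τ₃.nat aTail h = x ∧ τ₃.nat aTip h = y) ↔
      EdgeRel f g {e | e ∈ lo} x y := by
    intro x y
    rw [← mem_halfEdgeList, ← hH₃.list]
    simp [hH]
  have hedge : ∀ x y, EdgeRel (τ₃.nat aTail) (τ₃.nat aTip) (Iio H) x y ↔
      EdgeRel f g {e | e ∈ lo} x y := by
    intro x y
    constructor
    · rintro ⟨h, hh, h1 | h1⟩
      · exact (hhalf x y).1 ⟨h, hh, h1⟩
      · exact ((hhalf y x).1 ⟨h, hh, h1⟩).symm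
    · intro h
      obtain ⟨h, hh, h1⟩ := (hhalf x y).2 h
      exact ⟨h, hh, Or.inl h1⟩
  have hG : SearchGraph (τ₃.nat aRoot) R (τ₃.nat aTail) (τ₃.nat aTip) (τ₃.nat aNext) H := by
    refine ⟨fun h hh => ?_, fun h hh => ?_, hH₃.next⟩
    · obtain ⟨h', hh', h1, h2⟩ := (hhalf _ _).2 ((hhalf _ _).1 ⟨h, hh, rfl, rfl⟩).symm
      exact ⟨h', hh', h1, h2⟩
    · rw [← hrootmem, mem_rootList]
      obtain ⟨e, he, ⟨h1, h2⟩ | ⟨h1, h2⟩⟩ := (hhalf _ _).1 ⟨h, hh, rfl, rfl⟩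
      · exact Or.inr (Or.inr ⟨e, (mem_lowPart.1 he).1, Or.inl h1.symm⟩)
      · exact Or.inr (Or.inr ⟨e, (mem_lowPart.1 he).1, Or.inr h2.symm⟩)
  refine (searchLoop_runs τ₃ R H (by rw [hk₃ _ (by simp), hR₂.size]) hG (fun j hj => ?_)
    (fun j hj => ?_)).mono (by omega) ?_
  · rw [hk₃ aLab (by simp)]
    exact hR₂.lab _ ((hrootmem _).2 ⟨j, hj, rfl⟩)
  · exact hH₃.head _ ((hrootmem _).2 ⟨j, hj, rfl⟩)
  rintro τ₄ hF₄ ⟨n, hS, hcount⟩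
  have hk₄ : ∀ a, (∀ b ∈ [vFront, vBack, vRootPos, vHalfEdge, aHead, aLab, aPar, aQueue],
      a ≠ b) → τ₄.nat a = τ₃.nat a := by
    intro a ha
    simp at ha
    exact hF₄.nat a (by simp [searchLoop, searchStep, examineHalfEdge, examineRoot, pushNode,
      Cmd.block, Cmd.KeepsNat, ha])
  refine ⟨?_, ?_, ?_, ?_⟩
  · rw [hk₄ _ (by simp), hk₄ _ (by simp), hk₃ _ (by simp), hk₃ _ (by simp), hk₂ _ (by simp),
      hk₂ _ (by simp), hlow₁]
  · rw [hk₄ _ (by simp), hk₄ _ (by simp), hk₃ _ (by simp), hk₃ _ (by simp), hk₂ _ (by simp),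
      hk₂ _ (by simp), hhigh₁]
  · intro u hu v hv
    obtain ⟨i, hi, rfl⟩ := (hrootmem u).1 hu
    obtain ⟨j, hj, rfl⟩ := (hrootmem v).1 hv
    rw [hS.lab_eq_iff hG hi hj]
    constructor
    · exact fun h => Relation.ReflTransGen.mono (fun x y => (hedge x y).1) _ _ h
    · exact fun h => Relation.ReflTransGen.mono (fun x y => (hedge x y).2) _ _ h
  · have hroot0 : τ₃.nat aRoot 0 = t := by
      have h1 : (seg (τ₃.nat aRoot) R)[0]? = (rootList f g s t A)[0]? := by rw [hroot₃]
      have h2 : 0 < R := by omega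
      simpa [seg, rootList, h2] using h1
    obtain ⟨h1, h2, h3, h4⟩ := hS.first (by omega)
    rw [hroot0] at h2
    rw [h2] at h3 h4
    refine ⟨τ₄.nat aQueue, n, ?_, h2, h3, h4, fun u hu => ?_, fun i hi => ?_⟩
    · omega
    · obtain ⟨i, hi, rfl⟩ := (hrootmem u).1 hu
      exact hS.reached i hi (hS.roots i hi)
    · rcases hS.parent i hi with h | ⟨i', hi', h5, h6⟩
      · exact Or.inl h
      · exact Or.inr ⟨i', hi', h5, (hedge _ _).1 h6⟩

end Machine

section Graphs

/-! ### Bottleneck edges -/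

/-- The edge `e` of `E` is the least one such that the edges up to `e` connect `s` and `t`. -/
def IsBottleneck (W : ℕ → ℝ) (f g : ℕ → ℕ) (s t : ℕ) (E : Set ℕ) (e : ℕ) : Prop :=
  e ∈ E ∧ Conn f g {x | x ∈ E ∧ KeyLe W x e} s t ∧
    ¬ Conn f g {x | x ∈ E ∧ KeyLe W x e ∧ x ≠ e} s t

theorem IsBottleneck.of_low {W : ℕ → ℝ} {f g : ℕ → ℕ} {s t p e : ℕ} {E : Set ℕ}
    (h : IsBottleneck W f g s t {x | x ∈ E ∧ KeyLe W x p} e) : IsBottleneck W f g s t E e := by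
  obtain ⟨h1, h2, h3⟩ := h
  refine ⟨h1.1, Conn.mono ?_ h2, fun hc => h3 (Conn.mono ?_ hc)⟩
  · rintro x ⟨hx, hxe⟩
    exact ⟨hx.1, hxe⟩
  · rintro x ⟨hx, hxe⟩
    exact ⟨⟨hx, hxe.1.trans h1.2⟩, hxe⟩

/-- Contraction: if `lab` identifies exactly the nodes connected by `E`, then the nodes connected by
`E ∪ F` are those whose images are connected by the images of the edges of `F`. -/
theorem conn_union_iff {f g f' g' lab : ℕ → ℕ} {E F X : Set ℕ} {s t : ℕ} (hs : s ∈ X) (ht : t ∈ X)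
    (hX : ∀ x ∈ F, f x ∈ X ∧ g x ∈ X)
    (hlab : ∀ u ∈ X, ∀ v ∈ X, lab u = lab v ↔ Conn f g E u v)
    (hf' : ∀ x ∈ F, f' x = lab (f x)) (hg' : ∀ x ∈ F, g' x = lab (g x)) :
    Conn f g (E ∪ F) s t ↔ Conn f' g' F (lab s) (lab t) := by
  have hEF : ∀ {u v}, Conn f g E u v → Conn f g (E ∪ F) u v := fun h => h.mono subset_union_left
  constructor
  · intro h
    have key : ∀ v, Conn f g (E ∪ F) s v →
        ∃ y ∈ X, Conn f g E y v ∧ Conn f' g' F (lab s) (lab y) := by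
      intro v hv
      induction hv with
      | refl => exact ⟨s, hs, .refl _, .refl _⟩
      | @tail v w _ hvw ih =>
        obtain ⟨y, hy, h1, h2⟩ := ih
        obtain ⟨x, hx | hx, h3⟩ := hvw
        · exact ⟨y, hy, h1.trans (.of_edge ⟨x, hx, h3⟩), h2⟩
        · have hvX : v ∈ X ∧ w ∈ X := by
            rcases h3 with ⟨rfl, rfl⟩ | ⟨rfl, rfl⟩
            · exact hX x hx
            · exact (hX x hx).symm
          refine ⟨w, hvX.2, .refl _, h2.trans (.of_edge ⟨x, hx, ?_⟩)⟩
          rw [hf' x hx, hg' x hx, (hlab y hy v hvX.1).2 h1]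
          rcases h3 with ⟨rfl, rfl⟩ | ⟨rfl, rfl⟩ <;> simp
    obtain ⟨y, hy, h1, h2⟩ := key t h
    rwa [(hlab y hy t ht).2 h1] at h2
  · intro h
    have key : ∀ z, Conn f' g' F (lab s) z → ∃ y ∈ X, lab y = z ∧ Conn f g (E ∪ F) s y := by
      intro z hz
      induction hz with
      | refl => exact ⟨s, hs, rfl, .refl _⟩
      | tail _ hvw ih =>
        obtain ⟨y, hy, rfl, h2⟩ := ih
        obtain ⟨x, hx, h3⟩ := hvw
        obtain ⟨hfX, hgX⟩ := hX x hx
        rw [hf' x hx, hg' x hx] at h3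
        rcases h3 with ⟨h3, h4⟩ | ⟨h3, h4⟩
        · exact ⟨g x, hgX, h4, (h2.trans (hEF ((hlab _ hy _ hfX).1 h3.symm))).trans
            (.of_edge ⟨x, Or.inr hx, Or.inl ⟨rfl, rfl⟩⟩)⟩
        · exact ⟨f x, hfX, h3, (h2.trans (hEF ((hlab _ hy _ hgX).1 h4.symm))).trans
            (.of_edge ⟨x, Or.inr hx, Or.inr ⟨rfl, rfl⟩⟩)⟩
    obtain ⟨y, hy, h1, h2⟩ := key _ h
    exact h2.trans (hEF ((hlab y hy t ht).1 h1))

theorem IsBottleneck.of_high {W : ℕ → ℝ} {f g f' g' lab : ℕ → ℕ} {s t p e : ℕ} {E X : Set ℕ}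
    (hs : s ∈ X) (ht : t ∈ X) (hX : ∀ x ∈ E, f x ∈ X ∧ g x ∈ X)
    (hlab : ∀ u ∈ X, ∀ v ∈ X, lab u = lab v ↔ Conn f g {x | x ∈ E ∧ KeyLe W x p} u v)
    (hf' : ∀ x ∈ E, ¬ KeyLe W x p → f' x = lab (f x))
    (hg' : ∀ x ∈ E, ¬ KeyLe W x p → g' x = lab (g x))
    (h : IsBottleneck W f' g' (lab s) (lab t) {x | x ∈ E ∧ ¬ KeyLe W x p} e) :
    IsBottleneck W f g s t E e := by
  obtain ⟨h1, h2, h3⟩ := h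
  have hpe : KeyLe W p e := .of_not h1.2
  refine ⟨h1.1, ?_, fun hc => h3 ?_⟩
  · refine Conn.mono ?_ ((conn_union_iff hs ht (fun x hx => hX x hx.1.1) hlab
      (fun x hx => hf' x hx.1.1 hx.1.2) (fun x hx => hg' x hx.1.1 hx.1.2)).2 h2)
    rintro x (hx | hx)
    · exact ⟨hx.1, hx.2.trans hpe⟩
    · exact ⟨hx.1.1, hx.2⟩
  · refine (conn_union_iff hs ht (fun x hx => hX x hx.1.1) hlab
      (fun x hx => hf' x hx.1.1 hx.1.2) (fun x hx => hg' x hx.1.1 hx.1.2)).1 (hc.mono ?_)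
    intro x hx
    by_cases hxp : KeyLe W x p
    · exact Or.inl ⟨hx.1, hxp⟩
    · exact Or.inr ⟨⟨hx.1, hxp⟩, hx.2⟩

end Graphs

section Machine

variable {k : ℕ} {Ω : CellSolver k}

/-! ### The bottleneck edge on the machine -/

/-- Makes the edges up to the pivot the active ones. -/
def keepLow : Cmd k :=
  .seq (.for vCount vLow (.setNat aAct (.val vCount) (.get aLow (.val vCount))))
    (.assign vAct (.val vLow))

/-- Contracts the edges up to the pivot, and makes the other edges the active ones. -/
def contractLow : Cmd k :=
  .seq (.for vCount vHigh (.block [.setNat aAct (.val vCount) (.get aHigh (.val vCount)),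
      .setNat aSrc (.get aHigh (.val vCount)) (.get aLab (.get aSrc (.get aHigh (.val vCount)))),
      .setNat aDst (.get aHigh (.val vCount)) (.get aLab (.get aDst (.get aHigh (.val vCount))))]))
    (.block [.assign vAct (.val vHigh), .assign vSrc (.get aLab (.val vSrc)),
      .assign vDst (.get aLab (.val vDst))])

theorem keepLow_runs (σ : Memory k) (a : ℕ) (ha : σ.nat vLow 0 = a) :
    Runs Ω keepLow σ (3 * a + 3) (fun τ =>
      τ.nat vAct 0 = a ∧ seg (τ.nat aAct) a = seg (σ.nat aLow) a) := by
  refine Runs.seq (B₁ := 3 * a + 2) (B₂ := 1)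
    (Q₁ := fun τ => seg (τ.nat aAct) a = seg (σ.nat aLow) a) ?_ (by omega) ?_
  · refine (Runs.for a ha (by trivial) (by simp [Cmd.KeepsNat]) (by simp [Cmd.KeepsNat]) (by simp)
      (fun n τ => seg (τ.nat aAct) n = seg (σ.nat aLow) n) (by simp) ?_).mono (by simp [Cmd.cost])
      fun τ _ h => h
    intro i _ τ hF hv hI
    have hA : τ.nat aLow = σ.nat aLow := hF.nat _ (by simp [Cmd.for, Cmd.KeepsNat])
    simp only [Cmd.step, NatExpr.eval, hv, hA]
    rw [Memory.nat_setNat_of_ne _ (by simp), Memory.nat_setNat_same, seg_update, hI, seg_succ]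
  · intro τ hF hτ
    have hA : τ.nat vLow = σ.nat vLow := hF.nat _ (by simp [Cmd.for, Cmd.KeepsNat])
    refine .of_loopFree trivial le_rfl ?_
    simp [Cmd.step, NatExpr.eval, Memory.nat_setNat_of_ne, hA, ha, hτ]

theorem contractLow_runs (σ : Memory k) (b : ℕ) (hb : σ.nat vHigh 0 = b)
    (hnodup : (seg (σ.nat aHigh) b).Nodup) :
    Runs Ω contractLow σ (5 * b + 5) (fun τ =>
      τ.nat vAct 0 = b ∧ seg (τ.nat aAct) b = seg (σ.nat aHigh) b ∧
      τ.nat vSrc 0 = σ.nat aLab (σ.nat vSrc 0) ∧ τ.nat vDst 0 = σ.nat aLab (σ.nat vDst 0) ∧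
      ∀ e ∈ seg (σ.nat aHigh) b, τ.nat aSrc e = σ.nat aLab (σ.nat aSrc e) ∧
        τ.nat aDst e = σ.nat aLab (σ.nat aDst e)) := by
  refine Runs.seq (B₁ := 5 * b + 2) (B₂ := 3)
    (Q₁ := fun τ => seg (τ.nat aAct) b = seg (σ.nat aHigh) b ∧
      ∀ e ∈ seg (σ.nat aHigh) b, τ.nat aSrc e = σ.nat aLab (σ.nat aSrc e) ∧
        τ.nat aDst e = σ.nat aLab (σ.nat aDst e)) ?_ (by omega) ?_
  · refine (Runs.for b hb (by simp [Cmd.block, Cmd.LoopFree]) (by simp [Cmd.block, Cmd.KeepsNat])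
      (by simp [Cmd.block, Cmd.KeepsNat]) (by simp)
      (fun n τ => seg (τ.nat aAct) n = seg (σ.nat aHigh) n ∧
        (∀ e ∈ seg (σ.nat aHigh) n, τ.nat aSrc e = σ.nat aLab (σ.nat aSrc e) ∧
          τ.nat aDst e = σ.nat aLab (σ.nat aDst e)) ∧
        ∀ e, e ∉ seg (σ.nat aHigh) n → τ.nat aSrc e = σ.nat aSrc e ∧
          τ.nat aDst e = σ.nat aDst e)
      (by simp [Memory.nat_setNat_of_ne]) ?_).mono (by simp [Cmd.cost, Cmd.block])
      fun τ _ h => ⟨h.1, h.2.1⟩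
    rintro i hi τ hF hv ⟨h1, h2, h3⟩
    have hA : τ.nat aHigh = σ.nat aHigh :=
      hF.nat _ (by simp [Cmd.for, Cmd.block, Cmd.KeepsNat])
    have hL : τ.nat aLab = σ.nat aLab :=
      hF.nat _ (by simp [Cmd.for, Cmd.block, Cmd.KeepsNat])
    -- The edges are distinct, so that this edge is not relabelled before.
    have hnew : σ.nat aHigh i ∉ seg (σ.nat aHigh) i := by
      intro hmem
      obtain ⟨j, hj, hji⟩ := mem_seg.1 hmem
      have := nodup_seg.1 hnodup j (by omega) i hi hji
      omega
    obtain ⟨h4, h5⟩ := h3 _ hnew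
    simp only [mem_seg, not_exists, not_and] at h2 h3 ⊢
    simp only [mem_seg, not_exists, not_and] at hnew
    simp [Cmd.block, Cmd.step, NatExpr.eval, Memory.nat_setNat_of_ne, hA, hL, hv, h4, h5]
    refine ⟨?_, ?_, ?_⟩
    · rw [seg_update, h1, seg_succ]
    · rintro j hj
      rcases Nat.lt_or_eq_of_le hj with hj | rfl
      · rw [Function.update_of_ne (hnew j hj), Function.update_of_ne (hnew j hj)]
        exact h2 _ ⟨j, hj, rfl⟩
      · simp
    · intro e he
      have hne : e ≠ σ.nat aHigh i := fun h => he i (by omega) h.symm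
      rw [Function.update_of_ne hne, Function.update_of_ne hne]
      exact h3 e fun j hj => he j (by omega)
  · rintro τ hF ⟨h1, h2⟩
    have hA : ∀ a, (∀ b ∈ [vCount, aAct, aSrc, aDst], a ≠ b) → τ.nat a = σ.nat a := by
      intro a ha
      simp at ha
      exact hF.nat _ (by simp [Cmd.for, Cmd.block, Cmd.KeepsNat, ha])
    refine .of_loopFree (by simp [Cmd.block, Cmd.LoopFree]) (by simp [Cmd.block, Cmd.cost]) ?_
    simp [Cmd.block, Cmd.step, NatExpr.eval, Memory.nat_setNat_of_ne, hA, hb, h1]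
    exact h2

/-- The two distinguished nodes are connected by edges up to the pivot. -/
def connectedLow : Cond k := .natEq (.get aLab (.val vSrc)) (.get aLab (.val vDst))

/-- One round of the search for the bottleneck edge. -/
def bottleneckRound : Cmd k :=
  .seq selectPivot (.seq searchActive (.ite connectedLow keepLow contractLow))

/-- The active graph: its `m` edges are distinct, and connect the two distinguished nodes, which are
different. -/
structure ActiveGraph (σ : Memory k) (m : ℕ) : Prop where
  size : σ.nat vAct 0 = m
  nodup : (seg (σ.nat aAct) m).Nodup
  ne : σ.nat vSrc 0 ≠ σ.nat vDst 0
  conn : Conn (σ.nat aSrc) (σ.nat aDst) {e | e ∈ seg (σ.nat aAct) m} (σ.nat vSrc 0) (σ.nat vDst 0)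

/-- The edge `e` is the bottleneck edge of the active graph. -/
def ActiveBottleneck (σ : Memory k) (m e : ℕ) : Prop :=
  IsBottleneck (σ.real rW) (σ.nat aSrc) (σ.nat aDst) (σ.nat vSrc 0) (σ.nat vDst 0)
    {e | e ∈ seg (σ.nat aAct) m} e

theorem selectPivot_keepsNat {a : NatArray k}
    (h : ∀ b ∈ [aX, aZ, vI, vJ, vMid, vHi, vOut, vCount, vLen, vBlk, vHalf, vPivot], a ≠ b) :
    (selectPivot : Cmd k).KeepsNat a := by
  simp at h
  simp [selectPivot, copyActive, levelPass, mergePass, mergeStep, copyBack, thinPass, Cmd.for,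
    Cmd.block, Cmd.KeepsNat, h]

theorem selectPivot_keepsReal {a : RealArray k} : (selectPivot : Cmd k).KeepsReal a := by
  simp [selectPivot, copyActive, levelPass, mergePass, mergeStep, copyBack, thinPass, Cmd.for,
    Cmd.block, Cmd.KeepsReal]

/-- A round takes linear time, keeps the bottleneck edge, and removes at least a sixteenth of the
active edges: by the choice of the pivot, neither side of it holds more than fifteen sixteenths of
them. -/
theorem bottleneckRound_runs (σ : Memory k) (m : ℕ) (hm : 2 ≤ m) (hG : ActiveGraph σ m) :
    Runs Ω bottleneckRound σ (499 * m) (fun τ => τ.real rW = σ.real rW ∧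
      ∃ m', 16 * m' ≤ 15 * m ∧ ActiveGraph τ m' ∧
        ∀ e, ActiveBottleneck τ m' e → ActiveBottleneck σ m e) := by
  refine Runs.seq (B₂ := 349 * m) (selectPivot_runs σ m hm hG.size (nodup_seg.1 hG.nodup))
    (by omega) ?_
  rintro τ₁ hF₁ ⟨hlow, hhigh⟩
  have hk₁ : ∀ a, (∀ b ∈ [aX, aZ, vI, vJ, vMid, vHi, vOut, vCount, vLen, vBlk, vHalf, vPivot],
      a ≠ b) → τ₁.nat a = σ.nat a := fun a ha => hF₁.nat a (selectPivot_keepsNat ha)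
  have hw₁ : τ₁.real rW = σ.real rW := hF₁.real _ selectPivot_keepsReal
  refine Runs.seq (B₂ := 99 * m) (searchActive_runs τ₁ m (by rw [hk₁ _ (by simp), hG.size]))
    (by omega) ?_
  rintro τ₂ hF₂ ⟨hlo, hhi, hS⟩
  rw [hw₁, hk₁ aAct (by simp)] at hlo hhi hS
  rw [hk₁ aSrc (by simp), hk₁ aDst (by simp), hk₁ vSrc (by simp), hk₁ vDst (by simp)] at hS
  set p := τ₁.nat vPivot 0 with hp
  set W := σ.real rW with hW
  set A := seg (σ.nat aAct) m with hA
  set f := σ.nat aSrc with hf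
  set g := σ.nat aDst with hg
  set s := σ.nat vSrc 0 with hs
  set t := σ.nat vDst 0 with ht
  have hk₂ : ∀ a, (∀ b ∈ [vLow, vHigh, vCount, aLow, aHigh, vRoot, aRoot, aLab, aHead, aTail,
      aTip, aNext, vHalfEdges, vFront, vBack, vRootPos, vHalfEdge, aPar, aQueue], a ≠ b) →
      τ₂.nat a = τ₁.nat a := fun a ha => hF₂.nat a (searchActive_keepsNat ha)
  have hw₂ : τ₂.real rW = W := by rw [hF₂.real _ searchActive_keepsReal, hw₁]
  have hf₂ : τ₂.nat aSrc = f := by rw [hk₂ _ (by simp), hk₁ _ (by simp)]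
  have hg₂ : τ₂.nat aDst = g := by rw [hk₂ _ (by simp), hk₁ _ (by simp)]
  have hs₂ : τ₂.nat vSrc 0 = s := by rw [hk₂ _ (by simp), hk₁ _ (by simp)]
  have ht₂ : τ₂.nat vDst 0 = t := by rw [hk₂ _ (by simp), hk₁ _ (by simp)]
  have ha : τ₂.nat vLow 0 = cnt (KeyLe W · p) (σ.nat aAct) m := by
    rw [← length_lowPart_seg, ← hA, ← hlo, length_seg]
  have hb : τ₂.nat vHigh 0 = cnt (fun e => ¬ KeyLe W e p) (σ.nat aAct) m := by
    rw [← length_highPart_seg, ← hA, ← hhi, length_seg]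
  have hsum := cnt_add_cnt_not (KeyLe W · p) (σ.nat aAct) m
  have hsmem : s ∈ rootList f g s t A := mem_rootList.2 (by simp)
  have htmem : t ∈ rootList f g s t A := mem_rootList.2 (by simp)
  have hst := hS.lab_eq_iff s hsmem t htmem
  have hlowset : {e | e ∈ lowPart W p A} = {e | e ∈ {e | e ∈ A} ∧ KeyLe W e p} := by
    ext e; exact mem_lowPart
  have hhighset : {e | e ∈ highPart W p A} = {e | e ∈ {e | e ∈ A} ∧ ¬ KeyLe W e p} := by
    ext e; exact mem_highPart
  refine (Runs.ite (B := 10 * m) (fun hc => ?_) (fun hc => ?_)).mono (by omega)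
    (fun τ _ h => h)
  · refine (keepLow_runs τ₂ _ rfl).mono (by omega) ?_
    rintro τ hF ⟨h1, h2⟩
    have hk : ∀ a, (∀ b ∈ [vCount, aAct, vAct], a ≠ b) → τ.nat a = τ₂.nat a := by
      intro a ha
      simp at ha
      exact hF.nat _ (by simp [keepLow, Cmd.for, Cmd.KeepsNat, ha])
    have hw : τ.real rW = W := by
      rw [hF.real _ (by simp [keepLow, Cmd.for, Cmd.KeepsReal]), hw₂]
    have hseg : seg (τ.nat aAct) (τ₂.nat vLow 0) = lowPart W p A := by rw [h2, hlo]
    refine ⟨hw, τ₂.nat vLow 0, by omega, ⟨h1, ?_, ?_, ?_⟩, ?_⟩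
    · rw [hseg]
      exact hG.nodup.filter _
    · rw [hk vSrc (by simp), hk vDst (by simp), hs₂, ht₂]
      exact hG.ne
    · rw [hseg, hk vSrc (by simp), hk vDst (by simp), hk aSrc (by simp), hk aDst (by simp), hs₂,
        ht₂, hf₂, hg₂, ← hst]
      simpa [connectedLow, Cond.Holds, NatExpr.eval, hs₂, ht₂] using hc
    · intro e he
      unfold ActiveBottleneck at he
      rw [hseg, hk vSrc (by simp), hk vDst (by simp), hk aSrc (by simp), hk aDst (by simp), hs₂,
        ht₂, hf₂, hg₂, hw, hlowset] at he
      exact he.of_low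
  · refine (contractLow_runs τ₂ _ rfl (by rw [hhi]; exact hG.nodup.filter _)).mono
      (by omega) ?_
    rintro τ hF ⟨h1, h2, h3, h4, h5⟩
    have hw : τ.real rW = W := by
      rw [hF.real _ (by simp [contractLow, Cmd.for, Cmd.block, Cmd.KeepsReal]), hw₂]
    rw [hhi, hf₂, hg₂] at h5
    rw [hs₂] at h3
    rw [ht₂] at h4
    have hne : τ₂.nat aLab s ≠ τ₂.nat aLab t := by
      simpa [connectedLow, Cond.Holds, NatExpr.eval, hs₂, ht₂] using hc
    have hseg : seg (τ.nat aAct) (τ₂.nat vHigh 0) = highPart W p A := by rw [h2, hhi]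
    have hX : ∀ x ∈ {e | e ∈ A},
        f x ∈ {u | u ∈ rootList f g s t A} ∧ g x ∈ {u | u ∈ rootList f g s t A} := by
      intro e he
      exact ⟨mem_rootList.2 (Or.inr (Or.inr ⟨e, he, Or.inl rfl⟩)),
        mem_rootList.2 (Or.inr (Or.inr ⟨e, he, Or.inr rfl⟩))⟩
    have hlab : ∀ u ∈ {u | u ∈ rootList f g s t A}, ∀ v ∈ {u | u ∈ rootList f g s t A},
        τ₂.nat aLab u = τ₂.nat aLab v ↔ Conn f g {e | e ∈ {e | e ∈ A} ∧ KeyLe W e p} u v := by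
      intro u hu v hv
      rw [← hlowset]
      exact hS.lab_eq_iff u hu v hv
    refine ⟨hw, τ₂.nat vHigh 0, by omega, ⟨h1, ?_, ?_, ?_⟩, ?_⟩
    · rw [hseg]
      exact hG.nodup.filter _
    · rw [h3, h4]
      exact hne
    · rw [hseg, h3, h4, hhighset]
      refine (conn_union_iff (E := {e | e ∈ {e | e ∈ A} ∧ KeyLe W e p}) hsmem htmem
        (fun x hx => hX x hx.1) hlab
        (fun x hx => (h5 x (mem_highPart.2 hx)).1)
        (fun x hx => (h5 x (mem_highPart.2 hx)).2)).1 (hG.conn.mono fun x hx => ?_)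
      by_cases hxp : KeyLe W x p
      · exact Or.inl ⟨hx, hxp⟩
      · exact Or.inr ⟨hx, hxp⟩
    · intro e he
      unfold ActiveBottleneck at he
      rw [hseg, h3, h4, hw, hhighset] at he
      exact he.of_high hsmem htmem hX hlab
        (fun x hx hxp => (h5 x (mem_highPart.2 ⟨hx, hxp⟩)).1)
        (fun x hx hxp => (h5 x (mem_highPart.2 ⟨hx, hxp⟩)).2)

/-- Reduces the active graph to its bottleneck edge. -/
def bottleneckLoop : Cmd k := .while (.natLt (.const 1) (.val vAct)) bottleneckRound

theorem bottleneckRound_keepsNat {a : NatArray k}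
    (h : ∀ b ∈ [aX, aZ, vI, vJ, vMid, vHi, vOut, vCount, vLen, vBlk, vHalf, vPivot,
      vLow, vHigh, aLow, aHigh, vRoot, aRoot, aLab, aHead, aTail, aTip, aNext,
      vHalfEdges, vFront, vBack, vRootPos, vHalfEdge, aPar, aQueue, aAct, aSrc, aDst, vAct, vSrc,
      vDst], a ≠ b) : (bottleneckRound : Cmd k).KeepsNat a := by
  refine ⟨selectPivot_keepsNat ?_, searchActive_keepsNat ?_, ?_, ?_⟩ <;> simp at h
  · simp [h]
  · simp [h]
  · simp [keepLow, Cmd.for, Cmd.KeepsNat, h]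
  · simp [contractLow, Cmd.for, Cmd.block, Cmd.KeepsNat, h]

theorem bottleneckRound_keepsReal {a : RealArray k} : (bottleneckRound : Cmd k).KeepsReal a := by
  refine ⟨selectPivot_keepsReal, searchActive_keepsReal, ?_, ?_⟩
  · simp [keepLow, Cmd.for, Cmd.KeepsReal]
  · simp [contractLow, Cmd.for, Cmd.block, Cmd.KeepsReal]

/-- The rounds form a geometric series: a round on `m` edges takes at most `499 * m` steps, and
lowers the potential `8000 * m` by at least a sixteenth. -/
theorem bottleneckLoop_runs (σ : Memory k) (m : ℕ) (hG : ActiveGraph σ m) :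
    Runs Ω bottleneckLoop σ (8000 * m + 1) (fun τ => ActiveBottleneck σ m (τ.nat aAct 0)) := by
  refine (Runs.while (fun τ => τ.real rW = σ.real rW ∧ ∃ m', ActiveGraph τ m' ∧
    ∀ e, ActiveBottleneck τ m' e → ActiveBottleneck σ m e) (fun τ => 8000 * τ.nat vAct 0)
    ⟨rfl, m, hG, fun e he => he⟩ ?_).mono (by simp only [hG.size]; omega) ?_
  · rintro τ hF ⟨hw, m', hG', h⟩ hcond
    have hsize := hG'.size
    simp only [Cond.Holds, NatExpr.eval, hsize] at hcond
    refine ⟨_, (bottleneckRound_runs τ m' hcond hG').mono le_rfl ?_⟩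
    rintro υ - ⟨hw', m'', h1, h2, h3⟩
    refine ⟨⟨hw'.trans hw, m'', h2, fun e he => h e (h3 e he)⟩, ?_⟩
    rw [hsize, h2.size]
    omega
  · rintro τ hF ⟨⟨hw, m', hG', h⟩, hcond⟩
    have hsize := hG'.size
    simp only [Cond.Holds, NatExpr.eval, hsize] at hcond
    apply h
    rcases Nat.lt_or_ge m' 1 with h0 | h0
    · exfalso
      obtain rfl : m' = 0 := by omega
      have hc := hG'.conn
      rw [Conn, Relation.ReflTransGen.cases_head_iff] at hc
      rcases hc with hc | ⟨_, ⟨e, he, -⟩, -⟩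
      · exact hG'.ne hc
      · simp at he
    · obtain rfl : m' = 1 := by omega
      have hset : {e | e ∈ seg (τ.nat aAct) 1} = {τ.nat aAct 0} := by
        ext e; simp [seg]
      refine ⟨by simp [seg], hG'.conn.mono ?_, fun hc => ?_⟩
      · rw [hset]
        rintro x rfl
        exact ⟨rfl, KeyLe.refl _ _⟩
      · rw [Conn, Relation.ReflTransGen.cases_head_iff] at hc
        rcases hc with hc | ⟨_, ⟨e, he, -⟩, -⟩
        · exact hG'.ne hc
        · rw [hset] at he
          exact he.2.2 he.1

end Machine

section Codes

/-! ### Codes of cells -/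

/-- The digit of `c` at position `i` to the base `n`. -/
def digit (n c i : ℕ) : ℕ := c / n ^ i % n

/-- The number with the digits `d 0, …, d (k-1)` to the base `n`. -/
def code (n k : ℕ) (d : ℕ → ℕ) : ℕ := ∑ i ∈ Finset.range k, d i * n ^ i

theorem code_succ (n k : ℕ) (d : ℕ → ℕ) :
    code n (k + 1) d = d 0 + n * code n k (fun i => d (i + 1)) := by
  rw [code, code, Finset.sum_range_succ', Finset.mul_sum, add_comm]
  simp only [pow_zero, mul_one]
  congr 1
  refine Finset.sum_congr rfl fun i _ => ?_
  ring

theorem code_congr {n k : ℕ} {d d' : ℕ → ℕ} (h : ∀ i < k, d i = d' i) : code n k d = code n k d' :=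
  Finset.sum_congr rfl fun i hi => by rw [h i (Finset.mem_range.1 hi)]

theorem code_lt {n k : ℕ} {d : ℕ → ℕ} (h : ∀ i < k, d i < n) : code n k d < n ^ k := by
  induction k generalizing d with
  | zero => simp [code]
  | succ k ih =>
    have h1 := ih (d := fun i => d (i + 1)) fun i hi => h (i + 1) (by omega)
    have h0 := h 0 (by omega)
    rw [code_succ, pow_succ]
    have h2 := Nat.mul_le_mul_left n (Nat.succ_le_of_lt h1)
    rw [Nat.mul_succ] at h2
    rw [mul_comm (n ^ k)]
    omega

theorem digit_code {n k : ℕ} {d : ℕ → ℕ} (h : ∀ i < k, d i < n) {i : ℕ} (hi : i < k) :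
    digit n (code n k d) i = d i := by
  induction k generalizing d i with
  | zero => omega
  | succ k ih =>
    have h0 := h 0 (by omega)
    rw [code_succ]
    cases i with
    | zero => simp [digit, Nat.add_mul_mod_self_left, Nat.mod_eq_of_lt h0]
    | succ i =>
      rw [← ih (d := fun i => d (i + 1)) (fun i hi => h (i + 1) (by omega)) (by omega : i < k)]
      rw [digit, digit, pow_succ', ← Nat.div_div_eq_div_mul, Nat.add_mul_div_left _ _ (by omega),
        Nat.div_eq_of_lt h0, zero_add]

theorem code_digit {n k c : ℕ} (hc : c < n ^ k) : code n k (digit n c) = c := by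
  induction k generalizing c with
  | zero => simp only [pow_zero] at hc; simp [code]; omega
  | succ k ih =>
    have hn : 0 < n := by
      rcases Nat.eq_zero_or_pos n with rfl | h
      · simp at hc
      · exact h
    have h1 : c / n < n ^ k := by
      rw [Nat.div_lt_iff_lt_mul hn, ← pow_succ]; exact hc
    have h2 : ∀ i, digit n c (i + 1) = digit n (c / n) i := by
      intro i
      rw [digit, digit, pow_succ', Nat.div_div_eq_div_mul]
    rw [code_succ, code_congr fun i _ => h2 i, ih h1]
    simp only [digit, pow_zero, Nat.div_one]
    exact Nat.mod_add_div c n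

end Codes

section Machine

variable {k : ℕ} {Ω : CellSolver k}

/-! ### Unrolled loops -/

/-- Runs the commands `f a` for the entries `a` of a fixed list. -/
def Cmd.forEach {α : Type*} (l : List α) (f : α → Cmd k) : Cmd k :=
  l.foldr (fun a c => .seq (f a) c) .skip

@[simp] theorem Cmd.keepsNat_forEach {α : Type*} (l : List α) (f : α → Cmd k) (a : NatArray k) :
    (Cmd.forEach l f).KeepsNat a ↔ ∀ x ∈ l, (f x).KeepsNat a := by
  induction l with
  | nil => simp [Cmd.forEach, Cmd.KeepsNat]
  | cons b l ih =>
    rw [Cmd.forEach] at ih ⊢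
    simp [Cmd.KeepsNat, ih]

@[simp] theorem Cmd.keepsReal_forEach {α : Type*} (l : List α) (f : α → Cmd k) (a : RealArray k) :
    (Cmd.forEach l f).KeepsReal a ↔ ∀ x ∈ l, (f x).KeepsReal a := by
  induction l with
  | nil => simp [Cmd.forEach, Cmd.KeepsReal]
  | cons b l ih =>
    rw [Cmd.forEach] at ih ⊢
    simp [Cmd.KeepsReal, ih]

theorem Runs.forEach {α : Type*} {l : List α} {f : α → Cmd k} {σ : Memory k} {B : ℕ}
    (Inv : ℕ → Memory k → Prop) (h0 : Inv 0 σ)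
    (hstep : ∀ j (hj : j < l.length) τ, Frame (.forEach l f) σ τ → Inv j τ →
      Runs Ω (f l[j]) τ B (Inv (j + 1))) :
    Runs Ω (.forEach l f) σ (B * l.length + 1) (Inv l.length) := by
  suffices H : ∀ (l' : List α) (j : ℕ) (_ : l.drop j = l') (τ : Memory k),
      Frame (.forEach l f) σ τ → Inv j τ → j ≤ l.length →
      Runs Ω (.forEach l' f) τ (B * l'.length + 1) (Inv l.length) from
    H l 0 (by simp) σ Frame.rfl' h0 (by omega)
  intro l'
  induction l' with
  | nil =>
    intro j hj τ hF hI hle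
    have : j = l.length := by
      have := List.drop_eq_nil_iff.1 hj
      omega
    exact .of_loopFree trivial (by simp [Cmd.forEach, Cmd.cost]) (by subst this; exact hI)
  | cons a l' ih =>
    intro j hj τ hF hI hle
    have hlt : j < l.length := by
      by_contra h
      rw [List.drop_eq_nil_iff.2 (by omega)] at hj
      simp at hj
    rw [List.drop_eq_getElem_cons hlt, List.cons.injEq] at hj
    obtain ⟨rfl, hj⟩ := hj
    refine Runs.seq (hstep j hlt τ hF hI) (B₂ := B * l'.length + 1)
      (by simp only [List.length_cons]; ring_nf; omega) fun τ' hF' hI' => ?_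
    refine ih (j + 1) hj τ' ⟨fun a ha => ?_, fun a ha => ?_⟩ hI' hlt
    · rw [hF'.nat a ((Cmd.keepsNat_forEach _ _ _).1 ha _ (List.getElem_mem hlt)), hF.nat a ha]
    · rw [hF'.real a ((Cmd.keepsReal_forEach _ _ _).1 ha _ (List.getElem_mem hlt)), hF.real a ha]

/-- The rule for counting loops of which the body may contain loops. -/
theorem Runs.for_runs {v w : NatArray k} {c : Cmd k} {σ : Memory k} {B : ℕ} (n : ℕ)
    (hn : σ.nat w 0 = n) (hv : c.KeepsNat v) (hw : c.KeepsNat w) (hvw : w ≠ v)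
    (Inv : ℕ → Memory k → Prop) (h0 : Inv 0 (σ.setNat v 0 0))
    (hstep : ∀ i < n, ∀ τ, Frame (.for v w c) σ τ → τ.nat v 0 = i → Inv i τ →
      Runs Ω c τ B (fun τ' => Inv (i + 1) (τ'.setNat v 0 (i + 1)))) :
    Runs Ω (.for v w c) σ ((B + 2) * n + 2) (Inv n) := by
  refine Runs.seq (B₁ := 1) (B₂ := (B + 2) * n + 1) (Q₁ := fun τ => τ = σ.setNat v 0 0)
    (.of_loopFree trivial le_rfl rfl) (by omega) ?_
  rintro τ - rfl
  have hwhile := Runs.while (Ω := Ω) (b := .natLt (.val v) (.val w))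
    (c := .seq c (.incr v (.const 1))) (σ := σ.setNat v 0 0)
    (fun τ => τ.nat v 0 ≤ n ∧ Inv (τ.nat v 0) τ)
    (fun τ => (B + 2) * (n - τ.nat v 0)) ⟨by simp, by simpa using h0⟩ ?_
  · refine hwhile.mono (by simp) ?_
    rintro τ hF ⟨⟨h1, h2⟩, h3⟩
    have hwn : τ.nat w 0 = n := by
      rw [hF.nat w ⟨hw, hvw⟩, Memory.nat_setNat_of_ne _ hvw, hn]
    simp only [Cond.Holds, NatExpr.eval, hwn] at h3
    rwa [show τ.nat v 0 = n by omega] at h2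
  · rintro τ hF ⟨h1, h2⟩ h3
    have hwn : τ.nat w 0 = n := by
      rw [hF.nat w ⟨hw, hvw⟩, Memory.nat_setNat_of_ne _ hvw, hn]
    simp only [Cond.Holds, NatExpr.eval, hwn] at h3
    have hF' : Frame (.for v w c) σ τ := by
      refine ⟨fun a ha => ?_, fun a ha => ?_⟩
      · rw [hF.nat a ha.2, Memory.nat_setNat_of_ne _ ha.1]
      · rw [hF.real a ha.2, Memory.real_setNat]
    refine ⟨B + 1, Runs.seq (hstep _ h3 τ hF' rfl h2) le_rfl fun τ' hF'' hI => ?_⟩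
    refine .of_loopFree trivial le_rfl ?_
    have hv' : τ'.nat v 0 = τ.nat v 0 := by rw [hF''.nat v hv]
    have e : (Cmd.incr v (.const 1)).step Ω τ' = τ'.setNat v 0 (τ.nat v 0 + 1) := by
      simp [Cmd.step, NatExpr.eval, hv']
    rw [e]
    simp only [Memory.nat_setNat_same, Function.update_self]
    refine ⟨⟨by omega, hI⟩, ?_⟩
    obtain ⟨d, hd⟩ := Nat.exists_eq_add_of_lt h3
    have e1 : n - τ.nat v 0 = d + 1 := by omega
    have e2 : n - (τ.nat v 0 + 1) = d := by omega
    rw [e1, e2]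
    ring_nf
    omega

/-! ### Tables for the codes -/

/-- The code of the target cell. -/
abbrev vGoal : NatArray k := .work 50

/-- Computes the radix. -/
def computeRadix : Cmd k :=
  .seq (.assign vRadix (.const 0)) (.forEach (List.range k) fun i =>
    .ite (.natLt (.val vRadix) (.get .size (.const i))) (.assign vRadix (.get .size (.const i)))
      .skip)

/-- Computes the number of cell codes. -/
def computeTotal : Cmd k :=
  .seq (.assign vTotal (.const 1)) (.forEach (List.range k) fun _ =>
    .seq (.assign vAcc (.const 0)) (.seq (.for vCount vRadix (.incr vAcc (.val vTotal)))
      (.assign vTotal (.val vAcc))))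

/-- The remainder of the current number is the largest one. -/
def lastRemainder : Cond k := .natEq (.add (.get tMod (.val vCount)) (.const 1)) (.val vRadix)

/-- Computes the tables of multiples, quotients and remainders. -/
def computeTables : Cmd k :=
  .seq (.block [.setNat tMul (.const 0) (.const 0), .setNat tDiv (.const 0) (.const 0),
      .setNat tMod (.const 0) (.const 0)])
    (.for vCount vTotal (.seq
      (.setNat tMul (.add (.val vCount) (.const 1)) (.add (.get tMul (.val vCount)) (.val vRadix)))
      (.ite lastRemainder
        (.block [.setNat tDiv (.add (.val vCount) (.const 1))
            (.add (.get tDiv (.val vCount)) (.const 1)),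
          .setNat tMod (.add (.val vCount) (.const 1)) (.const 0)])
        (.block [.setNat tDiv (.add (.val vCount) (.const 1)) (.get tDiv (.val vCount)),
          .setNat tMod (.add (.val vCount) (.const 1))
            (.add (.get tMod (.val vCount)) (.const 1))]))))

/-- Writes the digits of the number in `vAcc` to the tuple. -/
def loadDigits : Cmd k :=
  .forEach (List.range k) fun i =>
    .block [.setNat aTuple (.const i) (.get tMod (.val vAcc)), .assign vAcc (.get tDiv (.val vAcc))]

/-- Writes the code of the tuple to `vAcc`. -/
def encodeTuple : Cmd k :=
  .seq (.assign vAcc (.const 0)) (.forEach (List.range k) fun j =>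
    .assign vAcc (.add (.get tMul (.val vAcc)) (.get aTuple (.const (k - 1 - j)))))

/-- The tables are correct up to the number of codes. -/
structure Tables (τ : Memory k) (n : ℕ) : Prop where
  mul : ∀ x ≤ n ^ k, τ.nat tMul x = x * n
  div : ∀ x ≤ n ^ k, τ.nat tDiv x = x / n
  mod : ∀ x ≤ n ^ k, τ.nat tMod x = x % n

theorem Tables.congr {τ τ' : Memory k} {n : ℕ} (h : Tables τ n) (h1 : τ'.nat tMul = τ.nat tMul)
    (h2 : τ'.nat tDiv = τ.nat tDiv) (h3 : τ'.nat tMod = τ.nat tMod) : Tables τ' n :=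
  ⟨h1 ▸ h.mul, h2 ▸ h.div, h3 ▸ h.mod⟩

theorem computeRadix_runs (σ : Memory k) : Runs Ω computeRadix σ (2 * k + 2) (fun τ =>
    τ.nat vRadix 0 = (Finset.range k).sup (σ.nat .size)) := by
  refine Runs.seq (B₁ := 1) (B₂ := 2 * k + 1)
    (Q₁ := fun τ => τ.nat vRadix 0 = 0 ∧ τ.nat .size = σ.nat .size)
    (.of_loopFree trivial le_rfl (by simp [Cmd.step, NatExpr.eval, Memory.nat_setNat_of_ne]))
    (by omega) ?_
  rintro τ - ⟨h0, hs⟩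
  refine (Runs.forEach (B := 2) (fun j τ' => τ'.nat vRadix 0 = (Finset.range j).sup (σ.nat .size))
    (by simpa using h0) ?_).mono (by simp) (fun τ' _ h => by simpa using h)
  intro j hj τ' hF hI
  have hs' : τ'.nat .size = σ.nat .size := by
    rw [hF.nat .size (by simp [Cmd.KeepsNat]), hs]
  rw [Finset.range_add_one, Finset.sup_insert]
  refine .ite (B := 1) (fun hc => .of_loopFree trivial le_rfl ?_)
    fun hc => .of_loopFree trivial le_rfl ?_
  · simp [Cond.Holds, NatExpr.eval, hs', hI] at hc
    simp [Cmd.step, NatExpr.eval, hs']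
    intro i hi
    exact (Finset.le_sup (f := σ.nat .size) (Finset.mem_range.2 hi)).trans hc.le
  · simp [Cond.Holds, NatExpr.eval, hs', hI] at hc
    simp [Cmd.step, hI, hc]

theorem computeTotal_runs (σ : Memory k) (n : ℕ) (hn : σ.nat vRadix 0 = n) :
    Runs Ω computeTotal σ ((3 * n + 4) * k + 2) (fun τ => τ.nat vTotal 0 = n ^ k) := by
  refine Runs.seq (B₁ := 1) (B₂ := (3 * n + 4) * k + 1)
    (Q₁ := fun τ => τ.nat vTotal 0 = 1 ∧ τ.nat vRadix 0 = n)
    (.of_loopFree trivial le_rfl (by simp [Cmd.step, NatExpr.eval, Memory.nat_setNat_of_ne, hn]))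
    (by omega) ?_
  rintro τ - ⟨h0, hr⟩
  refine (Runs.forEach (B := 3 * n + 4) (fun j τ' => τ'.nat vTotal 0 = n ^ j)
    (by simpa using h0) ?_).mono (by simp) (fun τ' _ h => by simpa using h)
  intro j hj τ' hF hI
  have hr' : τ'.nat vRadix 0 = n := by
    rw [hF.nat vRadix (by simp [Cmd.KeepsNat, Cmd.for]), hr]
  refine Runs.seq (B₁ := 1) (B₂ := 3 * n + 3)
    (Q₁ := fun τ => τ.nat vAcc 0 = 0 ∧ τ.nat vTotal 0 = n ^ j ∧ τ.nat vRadix 0 = n)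
    (.of_loopFree trivial le_rfl
      (by simp [Cmd.step, NatExpr.eval, Memory.nat_setNat_of_ne, hI, hr'])) (by omega) ?_
  rintro τ₁ - ⟨h1, h2, h3⟩
  refine Runs.seq (B₁ := 3 * n + 2) (B₂ := 1) (Q₁ := fun τ => τ.nat vAcc 0 = n * n ^ j) ?_
    (by omega) ?_
  · refine (Runs.for n h3 (by trivial) (by simp [Cmd.KeepsNat]) (by simp [Cmd.KeepsNat]) (by simp)
      (fun i τ => τ.nat vAcc 0 = i * n ^ j) (by simpa [Memory.nat_setNat_of_ne] using h1) ?_).mono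
      (by simp [Cmd.cost]) fun τ _ h => h
    intro i _ τ₂ hF₂ _ hI₂
    have h4 : τ₂.nat vTotal 0 = n ^ j := by
      rw [hF₂.nat vTotal (by simp [Cmd.KeepsNat, Cmd.for]), h2]
    simp [Cmd.step, NatExpr.eval, Memory.nat_setNat_of_ne, hI₂, h4]
    ring
  · intro τ₂ _ h
    refine .of_loopFree trivial le_rfl ?_
    simp [Cmd.step, NatExpr.eval, h, pow_succ']

theorem computeTables_runs (σ : Memory k) (n : ℕ) (hn : σ.nat vRadix 0 = n)
    (hN : σ.nat vTotal 0 = n ^ k) :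
    Runs Ω computeTables σ (6 * n ^ k + 5) (fun τ => Tables τ n) := by
  refine Runs.seq (B₁ := 3) (B₂ := 6 * n ^ k + 2)
    (Q₁ := fun τ => τ.nat tMul 0 = 0 ∧ τ.nat tDiv 0 = 0 ∧ τ.nat tMod 0 = 0 ∧
      τ.nat vRadix 0 = n ∧ τ.nat vTotal 0 = n ^ k)
    (.of_loopFree (by simp [Cmd.block, Cmd.LoopFree]) (by simp [Cmd.block, Cmd.cost])
      (by simp [Cmd.block, Cmd.step, NatExpr.eval, Memory.nat_setNat_of_ne, hn, hN]))
    (by omega) ?_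
  rintro τ - ⟨h1, h2, h3, h4, h5⟩
  refine (Runs.for (n ^ k) h5 (by simp [Cmd.block, Cmd.LoopFree])
    (by simp [Cmd.block, Cmd.KeepsNat]) (by simp [Cmd.block, Cmd.KeepsNat]) (by simp)
    (fun i τ => ∀ x ≤ i, τ.nat tMul x = x * n ∧ τ.nat tDiv x = x / n ∧ τ.nat tMod x = x % n)
    (by simp [Memory.nat_setNat_of_ne, h1, h2, h3]) ?_).mono (by simp [Cmd.cost, Cmd.block])
    fun τ _ h => ⟨fun x hx => (h x hx).1, fun x hx => (h x hx).2.1, fun x hx => (h x hx).2.2⟩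
  intro i hi τ₁ hF hv hI
  have hr : τ₁.nat vRadix 0 = n := by
    rw [hF.nat vRadix (by simp [Cmd.KeepsNat, Cmd.for, Cmd.block]), h4]
  obtain ⟨e1, e2, e3⟩ := hI i le_rfl
  have hdm := Nat.div_add_mod i n
  intro x hx
  by_cases hc : i % n + 1 = n
  · have hc' : lastRemainder.Holds (τ₁.setNat tMul (i + 1) (i * n + n)) := by
      simp [lastRemainder, Cond.Holds, NatExpr.eval, Memory.nat_setNat_of_ne, hr, hv, e3, hc]
    rcases Nat.lt_or_eq_of_le hx with hx | rfl
    · have hne : x ≠ i + 1 := by omega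
      simpa [Cmd.step, Cmd.block, NatExpr.eval, Memory.nat_setNat_of_ne, hv, hr, e1, hc', hne]
        using hI x (by omega)
    · simp [Cmd.step, Cmd.block, NatExpr.eval, Memory.nat_setNat_of_ne, hv, hr, e1, hc', e2, e3]
      have hi1 : i + 1 = n * (i / n + 1) := by rw [Nat.mul_succ]; omega
      refine ⟨by ring, ?_, ?_⟩
      · rw [hi1, Nat.mul_div_cancel_left _ (by omega)]
      · rw [hi1, Nat.mul_mod_right]
  · have hc' : ¬ lastRemainder.Holds (τ₁.setNat tMul (i + 1) (i * n + n)) := by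
      simp [lastRemainder, Cond.Holds, NatExpr.eval, Memory.nat_setNat_of_ne, hr, hv, e3, hc]
    rcases Nat.lt_or_eq_of_le hx with hx | rfl
    · have hne : x ≠ i + 1 := by omega
      simpa [Cmd.step, Cmd.block, NatExpr.eval, Memory.nat_setNat_of_ne, hv, hr, e1, hc', hne]
        using hI x (by omega)
    · simp [Cmd.step, Cmd.block, NatExpr.eval, Memory.nat_setNat_of_ne, hv, hr, e1, hc', e2, e3]
      refine ⟨by ring, ?_⟩
      rcases Nat.eq_zero_or_pos n with rfl | hn0
      · simp
      · have hlt := Nat.mod_lt i hn0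
        have := (Nat.div_mod_unique (a := i + 1) (b := n) (c := i % n + 1) (d := i / n) hn0).2
          ⟨by omega, by omega⟩
        exact ⟨this.1.symm, this.2.symm⟩

theorem loadDigits_runs (σ : Memory k) (n c : ℕ) (hT : Tables σ n) (hc : c ≤ n ^ k)
    (hv : σ.nat vAcc 0 = c) :
    Runs Ω loadDigits σ (2 * k + 1) (fun τ => ∀ i < k, τ.nat aTuple i = digit n c i) := by
  refine (Runs.forEach (B := 2) (fun j τ' => τ'.nat vAcc 0 = c / n ^ j ∧
    ∀ i < j, τ'.nat aTuple i = digit n c i) (by simpa using hv) ?_).mono (by simp)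
    (fun τ' _ h => by simpa using h.2)
  rintro j hj τ hF ⟨h1, h2⟩
  have hT' : Tables τ n := hT.congr (hF.nat _ (by simp [Cmd.KeepsNat, Cmd.block]))
    (hF.nat _ (by simp [Cmd.KeepsNat, Cmd.block])) (hF.nat _ (by simp [Cmd.KeepsNat, Cmd.block]))
  have hle : c / n ^ j ≤ n ^ k := (Nat.div_le_self _ _).trans hc
  refine .of_loopFree (by simp [Cmd.block, Cmd.LoopFree]) (by simp [Cmd.block, Cmd.cost]) ?_
  simp [Cmd.block, Cmd.step, NatExpr.eval, Memory.nat_setNat_of_ne, h1, hT'.div _ hle,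
    hT'.mod _ hle]
  refine ⟨by rw [pow_succ, Nat.div_div_eq_div_mul], fun i hi => ?_⟩
  rcases Nat.lt_or_eq_of_le hi with hi | rfl
  · rw [Function.update_of_ne (by omega), h2 i hi]
  · simp [digit]

/-- Horner's scheme. -/
theorem encodeTuple_runs (σ : Memory k) (n : ℕ) (hT : Tables σ n) (d : ℕ → ℕ)
    (hd : ∀ i < k, σ.nat aTuple i = d i) (hlt : ∀ i < k, d i < n) :
    Runs Ω encodeTuple σ (k + 2) (fun τ => τ.nat vAcc 0 = code n k d) := by
  refine Runs.seq (B₁ := 1) (B₂ := k + 1)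
    (Q₁ := fun τ => τ.nat vAcc 0 = 0 ∧ τ.nat aTuple = σ.nat aTuple ∧ Tables τ n)
    (.of_loopFree trivial le_rfl (by
      simp [Cmd.step, NatExpr.eval, Memory.nat_setNat_of_ne]
      exact hT.congr (by simp [Memory.nat_setNat_of_ne]) (by simp [Memory.nat_setNat_of_ne])
        (by simp [Memory.nat_setNat_of_ne])))
    (by omega) ?_
  rintro τ - ⟨h0, h1, h2⟩
  refine (Runs.forEach (B := 1)
    (fun j τ' => τ'.nat vAcc 0 = code n j fun i => d (i + (k - j))) (by simpa [code] using h0)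
    ?_).mono (by simp) (fun τ' _ h => by simpa using h)
  intro j hj τ' hF hI
  simp only [List.length_range] at hj
  have hT' : Tables τ' n := h2.congr (hF.nat _ (by simp [Cmd.KeepsNat, Cmd.block]))
    (hF.nat _ (by simp [Cmd.KeepsNat, Cmd.block])) (hF.nat _ (by simp [Cmd.KeepsNat, Cmd.block]))
  have hA : τ'.nat aTuple = σ.nat aTuple := by
    rw [hF.nat _ (by simp [Cmd.KeepsNat, Cmd.block]), h1]
  have hle : code n j (fun i => d (i + (k - j))) ≤ n ^ k := by
    have h3 : code n j (fun i => d (i + (k - j))) < n ^ j := code_lt fun i hi => hlt _ (by omega)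
    have h4 : 0 < n := by have := hlt 0 (by omega); omega
    exact h3.le.trans (Nat.pow_le_pow_right h4 hj.le)
  refine .of_loopFree trivial le_rfl ?_
  simp [Cmd.step, NatExpr.eval, hI, hA, hT'.mul _ hle, hd (k - 1 - j) (by omega)]
  rw [code_succ, add_comm, mul_comm]
  congr 2
  · omega
  · refine code_congr fun i hi => ?_
    congr 1; omega

end Machine

section Machine

variable {k : ℕ} {Ω : CellSolver k}

/-! ### Building the cell graph -/

/-- The minimum perimeter over the cell with the code `a`. -/
noncomputable def cellWeight (Ω : CellSolver k) (n a : ℕ) : ℝ :=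
  configPerimeter (Ω fun i => digit n a i)

/-- Stores the minimum perimeter over the cell in the tuple as weight of the next edge, and computes
the code of the cell. -/
def weighTuple : Cmd k :=
  .seq (.block [.minimize aTuple rX rY rV, .copyReal rW (.val vEdges) rV (.const 0)]) encodeTuple

/-- Adds the edge from the cell in the tuple, with the simplex of agent `i` replaced by its `r`-th
proper face, to the current cell. -/
def addFaceEdge (i : Fin k) (r : ℕ) : Cmd k :=
  .ite (.natLt (.const r) (.get (.faceCount i) (.get aTuple (.const i))))
    (.seq (.block [.assign vAcc' (.get aTuple (.const i)),
        .setNat aTuple (.const i) (.get (.face i) (.add (.const r)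
          (.add (.val vAcc') (.add (.val vAcc') (.add (.val vAcc') (.add (.val vAcc')
            (.add (.val vAcc') (.val vAcc'))))))))])
      (.seq weighTuple (.block [.setNat aFst (.val vEdges) (.val vAcc),
        .setNat aSnd (.val vEdges) (.val vCell), .incr vEdges (.const 1),
        .setNat aTuple (.const i) (.val vAcc')])))
    .skip

/-- Clears the flag if all entries of the tuple are numbers of simplices. -/
def checkTuple : Cmd k :=
  .seq (.assign vFlag (.const 0)) (.forEach (List.range k) fun i =>
    .ite (.natLt (.get aTuple (.const i)) (.get .size (.const i))) .skip
      (.assign vFlag (.const 1)))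

/-- The pairs of an agent and a position in a list of proper faces. -/
def facePairs (k : ℕ) : List (Fin k × ℕ) := (List.finRange k).product (List.range 6)

/-- Adds the edges from the current cell to the cells with one simplex replaced by a proper face. -/
def addCellEdges : Cmd k :=
  .seq (.assign vAcc (.val vCell)) (.seq loadDigits (.seq checkTuple
    (.ite (.natEq (.val vFlag) (.const 0)) (.forEach (facePairs k) fun x => addFaceEdge x.1 x.2)
      .skip)))

/-- Adds the edge from the auxiliary node to the start cell. -/
def addStartEdge : Cmd k :=
  .seq (.assign vEdges (.const 0)) (.seq
    (.forEach (List.range k) fun i => .setNat aTuple (.const i) (.get .start (.const i)))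
    (.seq weighTuple (.block [.setNat aFst (.const 0) (.val vTotal),
      .setNat aSnd (.const 0) (.val vAcc), .assign vEdges (.const 1)])))

/-- Computes the code of the target cell. -/
def computeGoal : Cmd k :=
  .seq (.forEach (List.range k) fun i => .setNat aTuple (.const i) (.get .target (.const i)))
    (.seq encodeTuple (.assign vGoal (.val vAcc)))

/-- Builds the tables and the cell graph. -/
def buildGraph : Cmd k :=
  .seq computeRadix (.seq computeTotal (.seq computeTables (.seq addStartEdge
    (.seq computeGoal (.for vCell vTotal addCellEdges)))))

/-- The list of edges in `τ`: edge `0` joins `f₀` to `s₀`, the other edges are exactly the pairs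
related by `R`, there are at most `m` edges, and the weight of an edge is that of its lower end. -/
structure EdgeList (Ω : CellSolver k) (n f₀ s₀ : ℕ) (R : ℕ → ℕ → Prop) (m : ℕ) (τ : Memory k) :
    Prop where
  pos : 1 ≤ τ.nat vEdges 0
  le : τ.nat vEdges 0 ≤ m
  fst_zero : τ.nat aFst 0 = f₀
  snd_zero : τ.nat aSnd 0 = s₀
  weight_zero : τ.real rW 0 = cellWeight Ω n s₀
  sound : ∀ e, 1 ≤ e → e < τ.nat vEdges 0 →
    R (τ.nat aFst e) (τ.nat aSnd e) ∧ τ.real rW e = cellWeight Ω n (τ.nat aFst e)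
  complete : ∀ a b, R a b → ∃ e, 1 ≤ e ∧ e < τ.nat vEdges 0 ∧ τ.nat aFst e = a ∧ τ.nat aSnd e = b

theorem EdgeList.congr {n f₀ s₀ m m' : ℕ} {R R' : ℕ → ℕ → Prop} {τ τ' : Memory k}
    (h : EdgeList Ω n f₀ s₀ R m τ) (hR : ∀ a b, R a b ↔ R' a b) (hm : m ≤ m')
    (h1 : τ'.nat vEdges = τ.nat vEdges) (h2 : τ'.nat aFst = τ.nat aFst)
    (h3 : τ'.nat aSnd = τ.nat aSnd) (h4 : τ'.real rW = τ.real rW) :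
    EdgeList Ω n f₀ s₀ R' m' τ' := by
  obtain rfl : R = R' := by
    funext a b
    exact propext (hR a b)
  obtain ⟨a1, a2, a3, a4, a5, a6, a7⟩ := h
  constructor
  · rwa [h1]
  · rw [h1]; exact a2.trans hm
  · rwa [h2]
  · rwa [h3]
  · rwa [h4]
  · rwa [h1, h2, h3, h4]
  · rwa [h1, h2, h3]

theorem EdgeList.append {n f₀ s₀ m a b : ℕ} {R R' : ℕ → ℕ → Prop} {τ τ' : Memory k}
    (h : EdgeList Ω n f₀ s₀ R m τ) (hR : ∀ a' b', R' a' b' ↔ R a' b' ∨ a' = a ∧ b' = b)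
    (h1 : τ'.nat vEdges 0 = τ.nat vEdges 0 + 1)
    (h2 : τ'.nat aFst = Function.update (τ.nat aFst) (τ.nat vEdges 0) a)
    (h3 : τ'.nat aSnd = Function.update (τ.nat aSnd) (τ.nat vEdges 0) b)
    (h4 : τ'.real rW = Function.update (τ.real rW) (τ.nat vEdges 0) (cellWeight Ω n a)) :
    EdgeList Ω n f₀ s₀ R' (m + 1) τ' := by
  have h0 : (0 : ℕ) ≠ τ.nat vEdges 0 := by have := h.pos; omega
  constructor
  · omega
  · have := h.le; omega
  · rw [h2, Function.update_of_ne h0, h.fst_zero]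
  · rw [h3, Function.update_of_ne h0, h.snd_zero]
  · rw [h4, Function.update_of_ne h0, h.weight_zero]
  · intro e he1 he2
    rcases Nat.lt_or_ge e (τ.nat vEdges 0) with he | he
    · rw [h2, h3, h4, Function.update_of_ne he.ne, Function.update_of_ne he.ne,
        Function.update_of_ne he.ne]
      obtain ⟨h5, h6⟩ := h.sound e he1 he
      exact ⟨(hR _ _).2 (Or.inl h5), h6⟩
    · obtain rfl : e = τ.nat vEdges 0 := by omega
      rw [h2, h3, h4, Function.update_self, Function.update_self, Function.update_self]
      exact ⟨(hR _ _).2 (Or.inr ⟨rfl, rfl⟩), rfl⟩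
  · intro a' b' hab
    rcases (hR a' b').1 hab with hab | ⟨rfl, rfl⟩
    · obtain ⟨e, he1, he2, he3, he4⟩ := h.complete a' b' hab
      refine ⟨e, he1, by omega, ?_, ?_⟩
      · rwa [h2, Function.update_of_ne he2.ne]
      · rwa [h3, Function.update_of_ne he2.ne]
    · refine ⟨τ.nat vEdges 0, h.pos, by omega, ?_, ?_⟩
      · rw [h2, Function.update_self]
      · rw [h3, Function.update_self]

/-- The code `a` is that of the cell `b` with the simplex of agent `i` replaced by the `r`-th of its
proper faces. -/
def IsFaceCode (σ : Memory k) (n b : ℕ) (i : Fin k) (r a : ℕ) : Prop :=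
  r < σ.nat (.faceCount i) (digit n b i) ∧
    a = code n k (Function.update (digit n b) i (σ.nat (.face i) (6 * digit n b i + r)))

/-- The digits of `b` are numbers of simplices. -/
def IsCellCode (σ : Memory k) (n b : ℕ) : Prop := ∀ i < k, digit n b i < σ.nat .size i

/-- The edges of the cell graph, apart from the one at the auxiliary node. -/
def IsCellEdge (σ : Memory k) (n a b : ℕ) : Prop :=
  IsCellCode σ n b ∧ ∃ x ∈ facePairs k, IsFaceCode σ n b x.1 x.2 a

/-- The bounds on the input that are needed to build the cell graph. -/
structure InputBounds (σ : Memory k) (n : ℕ) : Prop where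
  radix : (Finset.range k).sup (σ.nat .size) = n
  face_lt : ∀ i : Fin k, ∀ x < σ.nat .size i, ∀ r < σ.nat (.faceCount i) x,
    σ.nat (.face i) (6 * x + r) < σ.nat .size i
  start_lt : ∀ i < k, σ.nat .start i < σ.nat .size i
  target_lt : ∀ i < k, σ.nat .target i < σ.nat .size i

theorem InputBounds.size_le {σ : Memory k} {n : ℕ} (h : InputBounds σ n) {i : ℕ} (hi : i < k) :
    σ.nat .size i ≤ n := by
  rw [← h.radix]
  exact Finset.le_sup (f := σ.nat .size) (Finset.mem_range.2 hi)

theorem weighTuple_runs (σ : Memory k) (n : ℕ) (hT : Tables σ n) (d : ℕ → ℕ)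
    (hd : ∀ i < k, σ.nat aTuple i = d i) (hlt : ∀ i < k, d i < n) :
    Runs Ω weighTuple σ (k + 4) (fun τ => τ.nat vAcc 0 = code n k d ∧ τ.real rW =
      Function.update (σ.real rW) (σ.nat vEdges 0) (cellWeight Ω n (code n k d))) := by
  refine Runs.seq (B₁ := 2) (B₂ := k + 2) (Q₁ := fun τ => τ.nat = σ.nat ∧ τ.real rW =
      Function.update (σ.real rW) (σ.nat vEdges 0) (cellWeight Ω n (code n k d)))
    (.of_loopFree (by simp [Cmd.block, Cmd.LoopFree]) (by simp [Cmd.block, Cmd.cost]) ?_)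
    (by omega) ?_
  · have hcell : (fun i : Fin k => σ.nat aTuple i) = fun i : Fin k => digit n (code n k d) i := by
      funext i
      rw [hd i i.2, digit_code hlt i.2]
    simp [Cmd.block, Cmd.step, NatExpr.eval]
    simp only [Memory.minimize, Memory.setReal, Memory.setBlock]
    simp [cellWeight, hcell]
  · rintro τ - ⟨h1, h2⟩
    refine (encodeTuple_runs τ n (hT.congr (by rw [h1]) (by rw [h1]) (by rw [h1])) d
      (by rw [h1]; exact hd) hlt).mono le_rfl fun τ' hF h => ⟨h, ?_⟩
    rw [hF.real _ (by simp [encodeTuple, Cmd.KeepsReal]), h2]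

theorem addFaceEdge_runs (σ τ : Memory k) (n c f₀ s₀ m : ℕ) (R : ℕ → ℕ → Prop) (i : Fin k) (r : ℕ)
    (hσ : InputBounds σ n) (hc : IsCellCode σ n c) (hT : Tables τ n)
    (hfc : τ.nat (.faceCount i) = σ.nat (.faceCount i)) (hf : τ.nat (.face i) = σ.nat (.face i))
    (hcell : τ.nat vCell 0 = c) (hd : ∀ i < k, τ.nat aTuple i = digit n c i)
    (hE : EdgeList Ω n f₀ s₀ R m τ) :
    Runs Ω (addFaceEdge i r) τ (k + 11) (fun τ' => (∀ i < k, τ'.nat aTuple i = digit n c i) ∧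
      EdgeList Ω n f₀ s₀ (fun a b => R a b ∨ IsFaceCode σ n c i r a ∧ b = c) (m + 1) τ') := by
  refine .ite (B := k + 10) (fun hr => ?_) fun hr => ?_
  · simp only [Cond.Holds, NatExpr.eval, hd i i.2, hfc] at hr
    have hface := hσ.face_lt i _ (hc i i.2) r hr
    set v := σ.nat (.face i) (6 * digit n c i + r) with hv
    let d := Function.update (digit n c) i v
    refine Runs.seq (B₁ := 2) (B₂ := k + 8) (Q₁ := fun τ' => (∀ j < k, τ'.nat aTuple j = d j) ∧
      τ'.nat vAcc' 0 = digit n c i) (.of_loopFree (by simp [Cmd.block, Cmd.LoopFree])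
        (by simp [Cmd.block, Cmd.cost]) ?_) (by omega) ?_
    · have e6 : ∀ x, r + (x + (x + (x + (x + (x + x))))) = 6 * x + r := fun x => by ring
      simp [Cmd.block, Cmd.step, NatExpr.eval, Memory.nat_setNat_of_ne, hd i i.2, e6, hf, d]
      intro j hj
      by_cases hji : j = i
      · subst hji; simp [hv]
      · rw [Function.update_of_ne hji, Function.update_of_ne hji, hd j hj]
    · rintro τ₁ hF₁ ⟨h1, h2⟩
      have hk₁ : ∀ a, a ≠ vAcc' → a ≠ aTuple → τ₁.nat a = τ.nat a := fun a h h' =>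
        hF₁.nat a (by simp [Cmd.block, Cmd.KeepsNat, h, h'])
      have hw₁ : τ₁.real rW = τ.real rW := hF₁.real _ (by simp [Cmd.block, Cmd.KeepsReal])
      refine Runs.seq (B₂ := 4) (weighTuple_runs τ₁ n (hT.congr (hk₁ _ (by simp) (by simp))
        (hk₁ _ (by simp) (by simp)) (hk₁ _ (by simp) (by simp))) d h1 ?_) (by omega) ?_
      · intro j hj
        by_cases hji : j = i
        · subst hji
          simp only [d, Function.update_self]
          exact hface.trans_le (hσ.size_le i.2)
        · simp only [d, Function.update_of_ne hji]
          exact (hc j hj).trans_le (hσ.size_le hj)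
      · rintro τ₂ hF₂ ⟨h3, h4⟩
        have hk₂ : ∀ a, a ≠ vAcc → τ₂.nat a = τ₁.nat a := fun a h =>
          hF₂.nat a (by simp [weighTuple, encodeTuple, Cmd.block, Cmd.KeepsNat, h])
        refine .of_loopFree (by simp [Cmd.block, Cmd.LoopFree]) (by simp [Cmd.block, Cmd.cost]) ?_
        have hE₂ : τ₂.nat vEdges 0 = τ.nat vEdges 0 := by
          rw [hk₂ _ (by simp), hk₁ _ (by simp) (by simp)]
        have hT₂ : τ₂.nat aTuple = τ₁.nat aTuple := hk₂ _ (by simp)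
        refine ⟨fun j hj => ?_, hE.append (a := code n k d) (b := c) (fun a' b' => ?_) ?_ ?_ ?_ ?_⟩
        · simp [Cmd.block, Cmd.step, NatExpr.eval, Memory.nat_setNat_of_ne, hT₂,
            hk₂ vAcc' (by simp), h2]
          by_cases hji : j = i
          · subst hji; simp
          · rw [Function.update_of_ne hji, h1 j hj]
            simp [d, Function.update_of_ne hji]
        · simp only [IsFaceCode, ← hv, hr, true_and, d]
        · simp [Cmd.block, Cmd.step, NatExpr.eval, Memory.nat_setNat_of_ne, hE₂]
        · simp [Cmd.block, Cmd.step, NatExpr.eval, Memory.nat_setNat_of_ne, hE₂, h3,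
            hk₂ aFst (by simp), hk₁ aFst (by simp) (by simp)]
        · simp [Cmd.block, Cmd.step, NatExpr.eval, Memory.nat_setNat_of_ne, hE₂, hcell,
            hk₂ aSnd (by simp), hk₁ aSnd (by simp) (by simp), hk₂ vCell (by simp),
            hk₁ vCell (by simp) (by simp)]
        · simp [Cmd.block, Cmd.step, NatExpr.eval, h4, hw₁, hk₁ vEdges (by simp) (by simp)]
  · simp only [Cond.Holds, NatExpr.eval, hd i i.2, hfc] at hr
    refine .of_loopFree trivial (by simp [Cmd.cost]) ⟨hd, ?_⟩
    exact hE.congr (fun a b => by simp [IsFaceCode, hr]) (by omega) rfl rfl rfl rfl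

theorem checkTuple_runs (σ τ : Memory k) (hs : τ.nat .size = σ.nat .size) :
    Runs Ω checkTuple τ (2 * k + 2) (fun τ' =>
      τ'.nat vFlag 0 = 0 ↔ ∀ i < k, τ.nat aTuple i < σ.nat .size i) := by
  refine Runs.seq (B₁ := 1) (B₂ := 2 * k + 1)
    (Q₁ := fun τ' => τ'.nat vFlag 0 = 0 ∧ τ'.nat .size = σ.nat .size ∧
      τ'.nat aTuple = τ.nat aTuple)
    (.of_loopFree trivial le_rfl (by simp [Cmd.step, NatExpr.eval, Memory.nat_setNat_of_ne, hs]))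
    (by omega) ?_
  rintro τ₁ - ⟨h0, h1, h2⟩
  refine (Runs.forEach (B := 2)
    (fun j τ' => τ'.nat vFlag 0 = 0 ↔ ∀ i < j, τ.nat aTuple i < σ.nat .size i)
    (by simpa using h0) ?_).mono (by simp) (fun τ' _ h => by simpa using h)
  intro j hj τ₂ hF hI
  have hs₂ : τ₂.nat .size = σ.nat .size := by
    rw [hF.nat .size (by simp [Cmd.KeepsNat]), h1]
  have ha₂ : τ₂.nat aTuple = τ.nat aTuple := by
    rw [hF.nat aTuple (by simp [Cmd.KeepsNat]), h2]
  refine .ite (B := 1) (fun hc => .of_loopFree trivial le_rfl ?_)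
    fun hc => .of_loopFree trivial le_rfl ?_
  · simp [Cond.Holds, NatExpr.eval, hs₂, ha₂] at hc
    simp only [Cmd.step, hI]
    refine ⟨fun h i hi => ?_, fun h i hi => h i (by omega)⟩
    rcases Nat.lt_or_eq_of_le (Nat.lt_succ_iff.1 hi) with hi | rfl
    · exact h i hi
    · exact hc
  · simp only [Cond.Holds, NatExpr.eval, hs₂, ha₂, List.getElem_range] at hc
    simp [Cmd.step, NatExpr.eval]
    exact ⟨j, le_rfl, not_lt.1 hc⟩

theorem addCellEdges_keepsNat {a : NatArray k}
    (h : ∀ b ∈ [vAcc, aTuple, vFlag, vAcc', aFst, aSnd, vEdges], a ≠ b) :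
    (addCellEdges : Cmd k).KeepsNat a := by
  simp at h
  simp [addCellEdges, loadDigits, checkTuple, addFaceEdge, weighTuple, encodeTuple, Cmd.block,
    Cmd.KeepsNat, h]

theorem addCellEdges_runs (σ τ : Memory k) (n c f₀ s₀ : ℕ)
    (hσ : InputBounds σ n) (hT : Tables τ n) (hc : c ≤ n ^ k)
    (hin : ∀ a, (∀ j, a ≠ .work j) → τ.nat a = σ.nat a)
    (hcell : τ.nat vCell 0 = c)
    (hE : EdgeList Ω n f₀ s₀ (fun a b => b < c ∧ IsCellEdge σ n a b) (6 * k * c + 1) τ) :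
    Runs Ω addCellEdges τ (6 * (k + 11) * k + 4 * k + 6) (fun τ' =>
      EdgeList Ω n f₀ s₀ (fun a b => b < c + 1 ∧ IsCellEdge σ n a b) (6 * k * (c + 1) + 1) τ') := by
  refine Runs.seq (B₁ := 1) (B₂ := 6 * (k + 11) * k + 4 * k + 5)
    (Q₁ := fun τ' => τ'.nat vAcc 0 = c)
    (.of_loopFree trivial le_rfl (by simp [Cmd.step, NatExpr.eval, hcell])) (by omega) ?_
  intro τ₁ hF₁ h1
  have hk₁ : ∀ a, a ≠ vAcc → τ₁.nat a = τ.nat a := fun a h => hF₁.nat a h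
  have hT₁ : Tables τ₁ n :=
    hT.congr (hk₁ _ (by simp)) (hk₁ _ (by simp)) (hk₁ _ (by simp))
  refine Runs.seq (B₂ := 6 * (k + 11) * k + 2 * k + 4) (loadDigits_runs τ₁ n c hT₁ hc h1) (by omega) ?_
  intro τ₂ hF₂ h2
  have hk₂ : ∀ a, a ≠ vAcc → a ≠ aTuple → τ₂.nat a = τ.nat a := fun a h h' => by
    rw [hF₂.nat a (by simp [loadDigits, Cmd.block, Cmd.KeepsNat, h, h']), hk₁ a h]
  refine Runs.seq (B₂ := 6 * (k + 11) * k + 2) (checkTuple_runs σ τ₂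
    (by rw [hk₂ _ (by simp) (by simp), hin _ (by simp)])) (by omega) ?_
  intro τ₃ hF₃ h3
  have hk₃ : ∀ a, a ≠ vAcc → a ≠ aTuple → a ≠ vFlag → τ₃.nat a = τ.nat a := fun a h h' h'' => by
    rw [hF₃.nat a (by simp [checkTuple, Cmd.KeepsNat, h'']), hk₂ a h h']
  have hA₃ : τ₃.nat aTuple = τ₂.nat aTuple := hF₃.nat _ (by simp [checkTuple, Cmd.KeepsNat])
  have hw₃ : τ₃.real rW = τ.real rW := by
    rw [hF₃.real _ (by simp [checkTuple, Cmd.KeepsReal]),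
      hF₂.real _ (by simp [loadDigits, Cmd.block, Cmd.KeepsReal]), hF₁.real _ trivial]
  have hflag : τ₃.nat vFlag 0 = 0 ↔ IsCellCode σ n c := by
    rw [h3]
    exact forall₂_congr fun i hi => by rw [h2 i hi]
  have hE₃ : EdgeList Ω n f₀ s₀ (fun a b => b < c ∧ IsCellEdge σ n a b) (6 * k * c + 1) τ₃ :=
    hE.congr (fun _ _ => Iff.rfl) le_rfl (hk₃ _ (by simp) (by simp) (by simp))
      (hk₃ _ (by simp) (by simp) (by simp)) (hk₃ _ (by simp) (by simp) (by simp)) hw₃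
  have hlen : (facePairs k).length = 6 * k := by
    exact (List.length_product _ _).trans (by simp [mul_comm])
  refine .ite (B := 6 * (k + 11) * k + 1) (fun hc' => ?_) fun hc' => ?_
  · have hcode : IsCellCode σ n c := hflag.1 hc'
    refine (Runs.forEach (B := k + 11) (fun j τ' => (∀ i < k, τ'.nat aTuple i = digit n c i) ∧
      EdgeList Ω n f₀ s₀ (fun a b => (b < c ∧ IsCellEdge σ n a b) ∨
        (∃ j' < j, ∃ h : j' < (facePairs k).length,
          IsFaceCode σ n c (facePairs k)[j'].1 (facePairs k)[j'].2 a) ∧ b = c)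
        (6 * k * c + 1 + j) τ') ⟨?_, ?_⟩ ?_).mono ?_ ?_
    · rw [hA₃]; exact h2
    · exact hE₃.congr (fun a b => by simp) (by omega) rfl rfl rfl rfl
    · rintro j hj τ₄ hF₄ ⟨h4, h5⟩
      have hk₄ : ∀ a, (∀ b ∈ [vAcc, aTuple, vFlag, vAcc', aFst, aSnd, vEdges], a ≠ b) →
          τ₄.nat a = τ.nat a := by
        intro a ha
        rw [hF₄.nat a, hk₃ a (ha _ (by simp)) (ha _ (by simp)) (ha _ (by simp))]
        have := (addCellEdges_keepsNat ha).2.2.2.1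
        exact this
      refine (addFaceEdge_runs σ τ₄ n c f₀ s₀ _ _ _ _ hσ hcode (hT.congr (hk₄ _ (by simp))
        (hk₄ _ (by simp)) (hk₄ _ (by simp))) ?_ ?_ ?_ h4 h5).mono le_rfl ?_
      · rw [hk₄ _ (by simp), hin _ (by simp)]
      · rw [hk₄ _ (by simp), hin _ (by simp)]
      · rw [hk₄ _ (by simp), hcell]
      · rintro τ₅ - ⟨h6, h7⟩
        refine ⟨h6, h7.congr (fun a b => ?_) (by omega) rfl rfl rfl rfl⟩
        constructor
        · rintro ((h | ⟨⟨j', hj', h⟩, hb⟩) | ⟨h, hb⟩)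
          · exact Or.inl h
          · exact Or.inr ⟨⟨j', by omega, h⟩, hb⟩
          · exact Or.inr ⟨⟨j, by omega, hj, h⟩, hb⟩
        · rintro (h | ⟨⟨j', hj', hlt, h⟩, hb⟩)
          · exact Or.inl (Or.inl h)
          · rcases Nat.lt_or_eq_of_le (Nat.lt_succ_iff.1 hj') with hj' | rfl
            · exact Or.inl (Or.inr ⟨⟨j', hj', hlt, h⟩, hb⟩)
            · exact Or.inr ⟨h, hb⟩
    · rw [hlen]; ring_nf; omega
    · rintro τ₄ - ⟨-, h⟩
      refine h.congr (fun a b => ?_) (by rw [hlen]; ring_nf; omega) rfl rfl rfl rfl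
      constructor
      · rintro (⟨h1, h2⟩ | ⟨⟨j', -, hlt, h⟩, rfl⟩)
        · exact ⟨by omega, h2⟩
        · exact ⟨by omega, hcode, _, List.getElem_mem hlt, h⟩
      · rintro ⟨h1, hedge⟩
        rcases Nat.lt_or_eq_of_le (Nat.lt_succ_iff.1 h1) with h1 | rfl
        · exact Or.inl ⟨h1, hedge⟩
        · obtain ⟨-, x, hx, h⟩ := hedge
          obtain ⟨j', hlt, rfl⟩ := List.mem_iff_getElem.1 hx
          exact Or.inr ⟨⟨j', hlt, hlt, h⟩, rfl⟩
  · have hcode : ¬ IsCellCode σ n c := fun h => hc' (hflag.2 h)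
    refine .of_loopFree trivial (by simp [Cmd.cost]) ?_
    refine hE₃.congr (fun a b => ⟨fun h => ⟨by omega, h.2⟩, fun h => ⟨?_, h.2⟩⟩)
      (by ring_nf; omega) rfl rfl rfl rfl
    rcases Nat.lt_or_eq_of_le (Nat.lt_succ_iff.1 h.1) with h1 | rfl
    · exact h1
    · exact absurd h.2.1 hcode

theorem addStartEdge_runs (σ τ : Memory k) (n : ℕ) (hσ : InputBounds σ n) (hT : Tables τ n)
    (hin : ∀ a, (∀ j, a ≠ .work j) → τ.nat a = σ.nat a) (R : ℕ → ℕ → Prop)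
    (hR : ∀ a b, ¬ R a b) (hN : τ.nat vTotal 0 = n ^ k) :
    Runs Ω addStartEdge τ (2 * k + 9) (fun τ' =>
      EdgeList Ω n (n ^ k) (code n k (σ.nat .start)) R 1 τ') := by
  refine Runs.seq (B₁ := 1) (B₂ := 2 * k + 8) (Q₁ := fun τ' => τ'.nat vEdges 0 = 0)
    (.of_loopFree trivial le_rfl (by simp [Cmd.step, NatExpr.eval])) (by omega) ?_
  intro τ₁ hF₁ h1
  have hk₁ : ∀ a, a ≠ vEdges → τ₁.nat a = τ.nat a := fun a h => hF₁.nat a h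
  refine Runs.seq (B₁ := k + 1) (B₂ := k + 7)
    (Q₁ := fun τ' => ∀ i < k, τ'.nat aTuple i = σ.nat .start i) ?_ (by omega) ?_
  · refine (Runs.forEach (B := 1) (fun j τ' => ∀ i < j, τ'.nat aTuple i = σ.nat .start i)
      (by simp) ?_).mono (by simp) (fun τ' _ h => by simpa using h)
    intro j hj τ₂ hF₂ hI
    refine .of_loopFree trivial le_rfl fun i hi => ?_
    have hs : τ₂.nat .start = σ.nat .start := by
      rw [hF₂.nat _ (by simp [Cmd.KeepsNat]), hk₁ _ (by simp), hin _ (by simp)]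
    simp [Cmd.step, NatExpr.eval, hs]
    rcases Nat.lt_or_eq_of_le (Nat.lt_succ_iff.1 hi) with hi | rfl
    · rw [Function.update_of_ne (by omega), hI i hi]
    · simp
  · intro τ₂ hF₂ h2
    have hk₂ : ∀ a, a ≠ vEdges → a ≠ aTuple → τ₂.nat a = τ.nat a := fun a h h' => by
      rw [hF₂.nat a (by simp [Cmd.KeepsNat, h']), hk₁ a h]
    have hE₂ : τ₂.nat vEdges 0 = 0 := by rw [hF₂.nat _ (by simp [Cmd.KeepsNat]), h1]
    refine Runs.seq (B₂ := 3) (weighTuple_runs τ₂ n (hT.congr (hk₂ _ (by simp) (by simp))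
      (hk₂ _ (by simp) (by simp)) (hk₂ _ (by simp) (by simp))) _ h2
      fun i hi => (hσ.start_lt i hi).trans_le (hσ.size_le hi)) (by omega) ?_
    rintro τ₃ hF₃ ⟨h3, h4⟩
    have hN₃ : τ₃.nat vTotal 0 = n ^ k := by
      rw [hF₃.nat _ (by simp [weighTuple, encodeTuple, Cmd.block, Cmd.KeepsNat]),
        hk₂ _ (by simp) (by simp), hN]
    rw [hE₂] at h4
    refine .of_loopFree (by simp [Cmd.block, Cmd.LoopFree]) (by simp [Cmd.block, Cmd.cost]) ?_
    constructor <;> simp [Cmd.block, Cmd.step, NatExpr.eval, Memory.nat_setNat_of_ne, h3, h4, hN₃, hR]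
    intro e h5 h6
    omega

theorem computeGoal_runs (σ τ : Memory k) (n : ℕ) (hσ : InputBounds σ n) (hT : Tables τ n)
    (hin : ∀ a, (∀ j, a ≠ .work j) → τ.nat a = σ.nat a) :
    Runs Ω computeGoal τ (2 * k + 4) (fun τ' => τ'.nat vGoal 0 = code n k (σ.nat .target)) := by
  refine Runs.seq (B₁ := k + 1) (B₂ := k + 3)
    (Q₁ := fun τ' => ∀ i < k, τ'.nat aTuple i = σ.nat .target i) ?_ (by omega) ?_
  · refine (Runs.forEach (B := 1) (fun j τ' => ∀ i < j, τ'.nat aTuple i = σ.nat .target i)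
      (by simp) ?_).mono (by simp) (fun τ' _ h => by simpa using h)
    intro j hj τ₂ hF₂ hI
    refine .of_loopFree trivial le_rfl fun i hi => ?_
    have hs : τ₂.nat .target = σ.nat .target := by
      rw [hF₂.nat _ (by simp [Cmd.KeepsNat]), hin _ (by simp)]
    simp [Cmd.step, NatExpr.eval, hs]
    rcases Nat.lt_or_eq_of_le (Nat.lt_succ_iff.1 hi) with hi | rfl
    · rw [Function.update_of_ne (by omega), hI i hi]
    · simp
  · intro τ₂ hF₂ h2
    have hk₂ : ∀ a, a ≠ aTuple → τ₂.nat a = τ.nat a := fun a h =>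
      hF₂.nat a (by simp [Cmd.KeepsNat, h])
    refine Runs.seq (B₂ := 1) (encodeTuple_runs τ₂ n (hT.congr (hk₂ _ (by simp))
      (hk₂ _ (by simp)) (hk₂ _ (by simp))) _ h2
      fun i hi => (hσ.target_lt i hi).trans_le (hσ.size_le hi)) (by omega) ?_
    intro τ₃ _ h3
    exact .of_loopFree trivial le_rfl (by simp [Cmd.step, NatExpr.eval, h3])

/-- The cell graph of the input `σ` is in the memory `τ`. -/
structure CellGraph (Ω : CellSolver k) (σ : Memory k) (n : ℕ) (τ : Memory k) : Prop where
  input : ∀ a, (∀ j, a ≠ .work j) → τ.nat a = σ.nat a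
  tables : Tables τ n
  total : τ.nat vTotal 0 = n ^ k
  goal : τ.nat vGoal 0 = code n k (σ.nat .target)
  edges : EdgeList Ω n (n ^ k) (code n k (σ.nat .start))
    (fun a b => b < n ^ k ∧ IsCellEdge σ n a b) (6 * k * n ^ k + 1) τ

theorem computeRadix_keepsNat {a : NatArray k} (h : a ≠ vRadix) :
    (computeRadix : Cmd k).KeepsNat a := by
  simp [computeRadix, Cmd.KeepsNat, h]

theorem computeTotal_keepsNat {a : NatArray k} (h : ∀ b ∈ [vTotal, vAcc, vCount], a ≠ b) :
    (computeTotal : Cmd k).KeepsNat a := by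
  simp at h
  simp [computeTotal, Cmd.for, Cmd.KeepsNat, h]

theorem computeTables_keepsNat {a : NatArray k} (h : ∀ b ∈ [tMul, tDiv, tMod, vCount], a ≠ b) :
    (computeTables : Cmd k).KeepsNat a := by
  simp at h
  simp [computeTables, Cmd.for, Cmd.block, Cmd.KeepsNat, h]

theorem addStartEdge_keepsNat {a : NatArray k}
    (h : ∀ b ∈ [vEdges, aTuple, vAcc, aFst, aSnd], a ≠ b) :
    (addStartEdge : Cmd k).KeepsNat a := by
  simp at h
  simp [addStartEdge, weighTuple, encodeTuple, Cmd.block, Cmd.KeepsNat, h]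

theorem computeGoal_keepsNat {a : NatArray k} (h : ∀ b ∈ [aTuple, vAcc, vGoal], a ≠ b) :
    (computeGoal : Cmd k).KeepsNat a := by
  simp at h
  simp [computeGoal, encodeTuple, Cmd.block, Cmd.KeepsNat, h]

/-- The cell graph is built in time `O(n ^ k)`, since the codes are decoded by means of the tables
in a time that depends only on `k`. -/
theorem buildGraph_runs (σ : Memory k) (n : ℕ) (hσ : InputBounds σ n) :
    Runs Ω buildGraph σ ((3 * n + 4) * k + (6 * (k + 11) * k + 4 * k + 14) * n ^ k + 6 * k + 24)
      (CellGraph Ω σ n) := by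
  refine Runs.seq (B₂ := (3 * n + 4) * k + (6 * (k + 11) * k + 4 * k + 14) * n ^ k + 4 * k + 22)
    (computeRadix_runs σ) (by omega) ?_
  intro τ₁ hF₁ h1
  rw [hσ.radix] at h1
  have hk₁ : ∀ a, (∀ j, a ≠ .work j) → τ₁.nat a = σ.nat a := fun a h =>
    hF₁.nat a (computeRadix_keepsNat (h _))
  refine Runs.seq (B₂ := (6 * (k + 11) * k + 4 * k + 14) * n ^ k + 4 * k + 20)
    (computeTotal_runs τ₁ n h1) (by omega) ?_
  intro τ₂ hF₂ h2
  have hk₂ : ∀ a, (∀ j, a ≠ .work j) → τ₂.nat a = σ.nat a := fun a h => by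
    rw [hF₂.nat a (computeTotal_keepsNat (by simp [h])), hk₁ a h]
  refine Runs.seq (B₂ := (6 * (k + 11) * k + 4 * k + 8) * n ^ k + 4 * k + 15)
    (computeTables_runs τ₂ n (by rw [hF₂.nat _ (computeTotal_keepsNat (by simp)), h1]) h2)
    (by ring_nf; omega) ?_
  intro τ₃ hF₃ h3
  have hk₃ : ∀ a, (∀ j, a ≠ .work j) → τ₃.nat a = σ.nat a := fun a h => by
    rw [hF₃.nat a (computeTables_keepsNat (by simp [h])), hk₂ a h]
  have hN₃ : τ₃.nat vTotal 0 = n ^ k := by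
    rw [hF₃.nat _ (computeTables_keepsNat (by simp)), h2]
  refine Runs.seq (B₂ := (6 * (k + 11) * k + 4 * k + 8) * n ^ k + 2 * k + 6)
    (addStartEdge_runs σ τ₃ n hσ h3 hk₃ (fun a b => b < 0 ∧ IsCellEdge σ n a b) (by simp) hN₃)
    (by omega) ?_
  intro τ₄ hF₄ h4
  have hk₄ : ∀ a, (∀ b ∈ [vEdges, aTuple, vAcc, aFst, aSnd], a ≠ b) → τ₄.nat a = τ₃.nat a :=
    fun a h => hF₄.nat a (addStartEdge_keepsNat h)
  have hT₄ := h3.congr (hk₄ _ (by simp)) (hk₄ _ (by simp)) (hk₄ _ (by simp))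
  have hin₄ : ∀ a, (∀ j, a ≠ .work j) → τ₄.nat a = σ.nat a := fun a h => by
    rw [hk₄ a (by simp [h]), hk₃ a h]
  refine Runs.seq (B₂ := (6 * (k + 11) * k + 4 * k + 8) * n ^ k + 2)
    (computeGoal_runs σ τ₄ n hσ hT₄ hin₄) (by omega) ?_
  intro τ₅ hF₅ h5
  have hk₅ : ∀ a, (∀ b ∈ [aTuple, vAcc, vGoal], a ≠ b) → τ₅.nat a = τ₄.nat a :=
    fun a h => hF₅.nat a (computeGoal_keepsNat h)
  have hT₅ := hT₄.congr (hk₅ _ (by simp)) (hk₅ _ (by simp)) (hk₅ _ (by simp))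
  have hin₅ : ∀ a, (∀ j, a ≠ .work j) → τ₅.nat a = σ.nat a := fun a h => by
    rw [hk₅ a (by simp [h]), hin₄ a h]
  have hN₅ : τ₅.nat vTotal 0 = n ^ k := by
    rw [hk₅ _ (by simp), hk₄ _ (by simp), hN₃]
  have hw₅ : τ₅.real rW = τ₄.real rW :=
    hF₅.real _ (by simp [computeGoal, encodeTuple, Cmd.block, Cmd.KeepsReal])
  have hkeep : ∀ a, (∀ b ∈ [vAcc, aTuple, vFlag, vAcc', aFst, aSnd, vEdges], a ≠ b) → a ≠ vCell →
      (Cmd.for vCell vTotal (addCellEdges : Cmd k)).KeepsNat a := fun a h h' =>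
    Cmd.keepsNat_for h' (addCellEdges_keepsNat h)
  refine (Runs.for_runs (n ^ k) hN₅ (addCellEdges_keepsNat (by simp)) (addCellEdges_keepsNat (by simp))
    (by simp) (fun c τ => EdgeList Ω n (n ^ k) (code n k (σ.nat .start))
      (fun a b => b < c ∧ IsCellEdge σ n a b) (6 * k * c + 1) τ) ?_ ?_).mono le_rfl ?_
  · refine h4.congr (fun _ _ => Iff.rfl) (by omega) ?_ ?_ ?_ ?_
    · rw [Memory.nat_setNat_of_ne _ (by simp), hk₅ _ (by simp)]
    · rw [Memory.nat_setNat_of_ne _ (by simp), hk₅ _ (by simp)]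
    · rw [Memory.nat_setNat_of_ne _ (by simp), hk₅ _ (by simp)]
    · rw [Memory.real_setNat, hw₅]
  · intro c hc τ hF hv hE
    have hk : ∀ a, (∀ b ∈ [vAcc, aTuple, vFlag, vAcc', aFst, aSnd, vEdges], a ≠ b) → a ≠ vCell →
      τ.nat a = τ₅.nat a := fun a h h' => hF.nat a (hkeep a h h')
    refine (addCellEdges_runs σ τ n c _ _ hσ (hT₅.congr (hk _ (by simp) (by simp))
      (hk _ (by simp) (by simp)) (hk _ (by simp) (by simp))) hc.le (fun a ha => ?_) hv hE).mono
      le_rfl ?_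
    · rw [hk a (by simp [ha]) (ha _), hin₅ a ha]
    · intro τ' _ h
      exact h.congr (fun _ _ => Iff.rfl) le_rfl (Memory.nat_setNat_of_ne _ (by simp) _ _)
        (Memory.nat_setNat_of_ne _ (by simp) _ _) (Memory.nat_setNat_of_ne _ (by simp) _ _) rfl
  · intro τ hF hE
    have hk : ∀ a, (∀ b ∈ [vAcc, aTuple, vFlag, vAcc', aFst, aSnd, vEdges], a ≠ b) → a ≠ vCell →
      τ.nat a = τ₅.nat a := fun a h h' => hF.nat a (hkeep a h h')
    refine ⟨fun a ha => ?_, hT₅.congr (hk _ (by simp) (by simp)) (hk _ (by simp) (by simp))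
      (hk _ (by simp) (by simp)), ?_, ?_, hE⟩
    · rw [hk a (by simp [ha]) (ha _), hin₅ a ha]
    · rw [hk _ (by simp) (by simp), hN₅]
    · rw [hk _ (by simp) (by simp), h5]

end Machine

section Machine

variable {k : ℕ} {Ω : CellSolver k}

/-! ### Writing the output -/

/-- Makes the whole cell graph the active graph. -/
def resetGraph : Cmd k :=
  .seq (.for vCount vEdges (.block [.setNat aAct (.val vCount) (.val vCount),
      .setNat aSrc (.val vCount) (.get aFst (.val vCount)),
      .setNat aDst (.val vCount) (.get aSnd (.val vCount))]))
    (.block [.assign vAct (.val vEdges), .assign vSrc (.val vTotal), .assign vDst (.val vGoal)])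

theorem resetGraph_keepsNat {a : NatArray k}
    (h : ∀ b ∈ [vCount, aAct, aSrc, aDst, vAct, vSrc, vDst], a ≠ b) :
    (resetGraph : Cmd k).KeepsNat a := by
  simp at h
  simp [resetGraph, Cmd.for, Cmd.block, Cmd.KeepsNat, h]

theorem resetGraph_keepsReal {a : RealArray k} : (resetGraph : Cmd k).KeepsReal a := by
  simp [resetGraph, Cmd.for, Cmd.block, Cmd.KeepsReal]

theorem resetGraph_runs (σ : Memory k) (m : ℕ) (hm : σ.nat vEdges 0 = m) :
    Runs Ω resetGraph σ (5 * m + 5) (fun τ =>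
      (τ.nat vAct 0 = m ∧ τ.nat vSrc 0 = σ.nat vTotal 0 ∧ τ.nat vDst 0 = σ.nat vGoal 0) ∧
      ∀ e < m, τ.nat aAct e = e ∧ τ.nat aSrc e = σ.nat aFst e ∧ τ.nat aDst e = σ.nat aSnd e) := by
  refine Runs.seq (B₁ := 5 * m + 2) (B₂ := 3) (Q₁ := fun τ =>
    ∀ e < m, τ.nat aAct e = e ∧ τ.nat aSrc e = σ.nat aFst e ∧ τ.nat aDst e = σ.nat aSnd e) ?_
    (by omega) ?_
  · refine (Runs.for m hm (by simp [Cmd.block, Cmd.LoopFree]) (by simp [Cmd.block, Cmd.KeepsNat])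
      (by simp [Cmd.block, Cmd.KeepsNat]) (by simp) (fun n τ => ∀ e < n, τ.nat aAct e = e ∧
        τ.nat aSrc e = σ.nat aFst e ∧ τ.nat aDst e = σ.nat aSnd e) (by simp) ?_).mono
      (by simp [Cmd.cost, Cmd.block]) fun τ _ h => h
    intro i _ τ hF hv hI e he
    have h1 : τ.nat aFst = σ.nat aFst := hF.nat _ (by simp [Cmd.for, Cmd.block, Cmd.KeepsNat])
    have h2 : τ.nat aSnd = σ.nat aSnd := hF.nat _ (by simp [Cmd.for, Cmd.block, Cmd.KeepsNat])
    simp [Cmd.block, Cmd.step, NatExpr.eval, Memory.nat_setNat_of_ne, hv, h1, h2]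
    rcases Nat.lt_or_eq_of_le (Nat.lt_succ_iff.1 he) with he | rfl
    · simp [Function.update_of_ne he.ne, hI e he]
    · simp
  · intro τ hF hτ
    have hk : ∀ a, (∀ b ∈ [vCount, aAct, aSrc, aDst], a ≠ b) → τ.nat a = σ.nat a := by
      intro a h
      simp at h
      exact hF.nat a (by simp [Cmd.for, Cmd.block, Cmd.KeepsNat, h])
    refine .of_loopFree (by simp [Cmd.block, Cmd.LoopFree]) (by simp [Cmd.block, Cmd.cost]) ?_
    simp [Cmd.block, Cmd.step, NatExpr.eval, Memory.nat_setNat_of_ne, hk vEdges (by simp),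
      hk vTotal (by simp), hk vGoal (by simp), hm]
    exact hτ

/-- Writes the points that minimize the perimeter over the cell in the tuple to the output. -/
def emitPoint : Cmd k :=
  .seq (.minimize aTuple rX rY rV) (.forEach (List.finRange k) fun i =>
    .block [.copyReal (.outX i) (.val vCount) rX (.const i),
      .copyReal (.outY i) (.val vCount) rY (.const i)])

/-- Writes the tuple to the output as simplices of the current segment. -/
def emitCell : Cmd k :=
  .forEach (List.finRange k) fun i => .setNat (.outCell i) (.val vCount) (.get aTuple (.const i))

/-- Replaces the simplices of the current segment by those in the tuple with more proper faces. -/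
def enlargeCell : Cmd k :=
  .forEach (List.finRange k) fun i =>
    .ite (.natLt (.get (.faceCount i) (.get (.outCell i) (.val vCount)))
        (.get (.faceCount i) (.get aTuple (.const i))))
      (.setNat (.outCell i) (.val vCount) (.get aTuple (.const i))) .skip

/-- Moves to the parent of the current cell, and writes the segment to it. -/
def emitSegment : Cmd k :=
  .seq (.block [.assign vNext (.get aPar (.val vCell)), .assign vAcc (.val vCell)])
    (.seq loadDigits (.seq emitCell (.seq (.assign vAcc (.val vNext)) (.seq loadDigits
      (.seq enlargeCell (.seq (.incr vCount (.const 1)) (.seq emitPoint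
        (.seq (.ite (.natEq (.val vNext) (.val vGoal)) (.assign vFlag (.const 1)) .skip)
          (.assign vCell (.val vNext))))))))))

/-- Writes the path from the start cell to the target cell in the search tree. -/
def writePath : Cmd k :=
  .seq (.block [.assign vCell (.get aPar (.val vTotal)), .assign vAcc (.val vCell),
      .assign vCount (.const 0), .assign vFlag (.const 0)])
    (.seq loadDigits (.seq emitPoint (.seq (.while (.natEq (.val vFlag) (.const 0)) emitSegment)
      (.setNat .outLength (.const 0) (.val vCount)))))

theorem emitPoint_runs (σ : Memory k) (n c J : ℕ) (hJ : σ.nat vCount 0 = J)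
    (hc : ∀ i < k, σ.nat aTuple i = digit n c i) :
    Runs Ω emitPoint σ (2 * k + 2) (fun τ => ∀ i : Fin k,
      τ.real (.outX i) = Function.update (σ.real (.outX i)) J (Ω (fun i => digit n c i) i 0) ∧
      τ.real (.outY i) = Function.update (σ.real (.outY i)) J (Ω (fun i => digit n c i) i 1)) := by
  have hcell : (fun i : Fin k => σ.nat aTuple i) = fun i : Fin k => digit n c i := by
    funext i
    exact hc i i.2
  refine Runs.seq (B₁ := 1) (B₂ := 2 * k + 1) (Q₁ := fun τ => τ.nat vCount 0 = J ∧
    (∀ i : Fin k, τ.real rX i = Ω (fun i => digit n c i) i 0 ∧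
      τ.real rY i = Ω (fun i => digit n c i) i 1) ∧
    ∀ i : Fin k, τ.real (.outX i) = σ.real (.outX i) ∧ τ.real (.outY i) = σ.real (.outY i))
    (.of_loopFree trivial le_rfl ?_) (by omega) ?_
  · refine ⟨hJ, fun i => ?_, fun i => ?_⟩
    · simp [Cmd.step, Memory.minimize, Memory.setReal, Memory.setBlock, hcell]
    · constructor <;> funext j <;>
        simp [Cmd.step, Memory.minimize, Memory.setReal, Memory.setBlock]
  · rintro τ - ⟨h1, h2, h3⟩
    refine (Runs.forEach (B := 2) (fun j τ' => ∀ i : Fin k,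
      (τ'.real (.outX i) = if (i : ℕ) < j then
        Function.update (σ.real (.outX i)) J (Ω (fun i => digit n c i) i 0)
        else σ.real (.outX i)) ∧
      (τ'.real (.outY i) = if (i : ℕ) < j then
        Function.update (σ.real (.outY i)) J (Ω (fun i => digit n c i) i 1)
        else σ.real (.outY i))) (by simpa using h3) ?_).mono (by simp)
      (fun τ' _ h i => by simpa using h i)
    intro j hj τ' hF hI
    have hv : τ'.nat vCount 0 = J := by
      rw [hF.nat _ (by simp [Cmd.block, Cmd.KeepsNat]), h1]
    have hX : τ'.real rX = τ.real rX := hF.real _ (by simp [Cmd.block, Cmd.KeepsReal])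
    have hY : τ'.real rY = τ.real rY := hF.real _ (by simp [Cmd.block, Cmd.KeepsReal])
    have hj' : j < k := by simpa using hj
    have h2' := h2 ⟨j, hj'⟩
    simp only at h2'
    refine .of_loopFree (by simp [Cmd.block, Cmd.LoopFree]) (by simp [Cmd.block, Cmd.cost]) ?_
    intro i
    by_cases hij : (i : ℕ) = j
    · obtain rfl : i = ⟨j, hj'⟩ := Fin.ext hij
      have hIj := hI ⟨j, hj'⟩
      simp [Cmd.block, Cmd.step, NatExpr.eval, Memory.real_setReal_of_ne, hv, hX, hY, h2', hIj]
    · have hne : i ≠ ⟨j, hj'⟩ := fun h => hij (by rw [h])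
      have hlt : (i : ℕ) < j + 1 ↔ (i : ℕ) < j := by omega
      simpa [Cmd.block, Cmd.step, NatExpr.eval, Memory.real_setReal_of_ne, hne, hlt] using hI i

theorem emitCell_runs (σ : Memory k) (n c J : ℕ) (hJ : σ.nat vCount 0 = J)
    (hc : ∀ i < k, σ.nat aTuple i = digit n c i) :
    Runs Ω emitCell σ (k + 1) (fun τ => ∀ i : Fin k,
      τ.nat (.outCell i) = Function.update (σ.nat (.outCell i)) J (digit n c i)) := by
  refine (Runs.forEach (B := 1) (fun j τ' => ∀ i : Fin k,
    τ'.nat (.outCell i) = if (i : ℕ) < j then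
        Function.update (σ.nat (.outCell i)) J (digit n c i) else σ.nat (.outCell i))
    (by simp) ?_).mono (by simp) (fun τ' _ h i => by simpa using h i)
  intro j hj τ' hF hI
  have hv : τ'.nat vCount 0 = J := by rw [hF.nat _ (by simp [Cmd.KeepsNat]), hJ]
  have hA : τ'.nat aTuple = σ.nat aTuple := hF.nat _ (by simp [Cmd.KeepsNat])
  have hj' : j < k := by simpa using hj
  refine .of_loopFree trivial le_rfl ?_
  intro i
  by_cases hij : (i : ℕ) = j
  · obtain rfl : i = ⟨j, hj'⟩ := Fin.ext hij
    have hIj := hI ⟨j, hj'⟩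
    simp [Cmd.step, NatExpr.eval, hv, hA, hIj, hc j hj']
  · have hne : i ≠ ⟨j, hj'⟩ := fun h => hij (by rw [h])
    have hlt : (i : ℕ) < j + 1 ↔ (i : ℕ) < j := by omega
    simpa [Cmd.step, NatExpr.eval, Memory.nat_setNat_of_ne, hne, hlt] using hI i

/-- Of two simplex numbers of agent `i`, the one with more proper faces. -/
def largerSimplex (σ : Memory k) (i : Fin k) (a b : ℕ) : ℕ :=
  if σ.nat (.faceCount i) a < σ.nat (.faceCount i) b then b else a

theorem enlargeCell_runs (σ τ : Memory k) (n c J : ℕ) (hJ : τ.nat vCount 0 = J)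
    (hin : ∀ i, τ.nat (.faceCount i) = σ.nat (.faceCount i))
    (hc : ∀ i < k, τ.nat aTuple i = digit n c i) :
    Runs Ω enlargeCell τ (2 * k + 1) (fun τ' => ∀ i : Fin k,
      τ'.nat (.outCell i) = Function.update (τ.nat (.outCell i)) J
        (largerSimplex σ i (τ.nat (.outCell i) J) (digit n c i))) := by
  refine (Runs.forEach (B := 2) (fun j τ' => ∀ i : Fin k,
    τ'.nat (.outCell i) = if (i : ℕ) < j then
        Function.update (τ.nat (.outCell i)) J
          (largerSimplex σ i (τ.nat (.outCell i) J) (digit n c i)) else τ.nat (.outCell i))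
    (by simp) ?_).mono (by simp) (fun τ' _ h i => by simpa using h i)
  intro j hj τ' hF hI
  have hv : τ'.nat vCount 0 = J := by rw [hF.nat _ (by simp [Cmd.KeepsNat]), hJ]
  have hA : τ'.nat aTuple = τ.nat aTuple := hF.nat _ (by simp [Cmd.KeepsNat])
  have hj' : j < k := by simpa using hj
  have hf : τ'.nat (.faceCount ⟨j, hj'⟩) = σ.nat (.faceCount ⟨j, hj'⟩) := by
    rw [hF.nat _ (by simp [Cmd.KeepsNat]), hin]
  have hIj := hI ⟨j, hj'⟩
  simp only [lt_irrefl, if_false] at hIj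
  refine .ite (B := 1) (fun hcond => .of_loopFree trivial le_rfl ?_)
    fun hcond => .of_loopFree trivial le_rfl ?_
  · simp [Cond.Holds, NatExpr.eval, hv, hA, hIj, hf, hc j hj'] at hcond
    intro i
    by_cases hij : (i : ℕ) = j
    · obtain rfl : i = ⟨j, hj'⟩ := Fin.ext hij
      simp [Cmd.step, NatExpr.eval, hv, hA, hIj, hc j hj', largerSimplex, hcond]
    · have hne : i ≠ ⟨j, hj'⟩ := fun h => hij (by rw [h])
      have hlt : (i : ℕ) < j + 1 ↔ (i : ℕ) < j := by omega
      simpa [Cmd.step, NatExpr.eval, Memory.nat_setNat_of_ne, hne, hlt] using hI i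
  · simp [Cond.Holds, NatExpr.eval, hv, hA, hIj, hf, hc j hj'] at hcond
    intro i
    by_cases hij : (i : ℕ) = j
    · obtain rfl : i = ⟨j, hj'⟩ := Fin.ext hij
      simp [Cmd.step, hIj, largerSimplex, hcond]
    · have hlt : (i : ℕ) < j + 1 ↔ (i : ℕ) < j := by omega
      simpa [Cmd.step, hlt] using hI i

/-- The first `J` segments of the output run through the cells with the codes `x 0, …, x J`. -/
structure OutputPrefix (Ω : CellSolver k) (σ : Memory k) (n : ℕ) (x : ℕ → ℕ) (J : ℕ)
    (τ : Memory k) : Prop where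
  point : ∀ j ≤ J, ∀ i : Fin k, τ.real (.outX i) j = Ω (fun i => digit n (x j) i) i 0 ∧
    τ.real (.outY i) j = Ω (fun i => digit n (x j) i) i 1
  cell : ∀ j < J, ∀ i : Fin k,
    τ.nat (.outCell i) j = largerSimplex σ i (digit n (x j) i) (digit n (x (j + 1)) i)

theorem emitSegment_keepsNat {a : NatArray k}
    (h : ∀ b ∈ [vNext, vAcc, aTuple, vCount, vFlag, vCell], a ≠ b) (h' : ∀ i, a ≠ .outCell i) :
    (emitSegment : Cmd k).KeepsNat a := by
  simp at h
  simp [emitSegment, loadDigits, emitCell, enlargeCell, emitPoint, Cmd.block, Cmd.KeepsNat, h, h']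

theorem emitSegment_runs (σ τ : Memory k) (n J g : ℕ) (x : ℕ → ℕ) (hT : Tables τ n)
    (hin : ∀ i, τ.nat (.faceCount i) = σ.nat (.faceCount i)) (hJ : τ.nat vCount 0 = J)
    (hg : τ.nat vGoal 0 = g) (hflag : τ.nat vFlag 0 = 0)
    (hcell : τ.nat vCell 0 = x J) (hx : τ.nat aPar (x J) = x (J + 1)) (h1 : x J ≤ n ^ k)
    (h2 : x (J + 1) ≤ n ^ k) (hO : OutputPrefix Ω σ n x J τ) :
    Runs Ω emitSegment τ (9 * k + 13) (fun τ' => τ'.nat vCount 0 = J + 1 ∧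
      τ'.nat vCell 0 = x (J + 1) ∧ OutputPrefix Ω σ n x (J + 1) τ' ∧
      τ'.nat vFlag 0 = if x (J + 1) = g then 1 else 0) := by
  refine Runs.seq (B₁ := 2) (B₂ := 9 * k + 11)
    (Q₁ := fun τ' => τ'.nat vNext 0 = x (J + 1) ∧ τ'.nat vAcc 0 = x J)
    (.of_loopFree (by simp [Cmd.block, Cmd.LoopFree]) (by simp [Cmd.block, Cmd.cost])
      (by simp [Cmd.block, Cmd.step, NatExpr.eval, Memory.nat_setNat_of_ne, hcell, hx]))
    (by omega) ?_
  rintro τ₁ hF₁ ⟨a1, a2⟩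
  have hk₁ : ∀ a, a ≠ vNext → a ≠ vAcc → τ₁.nat a = τ.nat a := fun a h h' =>
    hF₁.nat a (by simp [Cmd.block, Cmd.KeepsNat, h, h'])
  have hr₁ : τ₁.real = τ.real := by
    funext a; exact hF₁.real a (by simp [Cmd.block, Cmd.KeepsReal])
  have hT₁ := hT.congr (hk₁ _ (by simp) (by simp)) (hk₁ _ (by simp) (by simp))
    (hk₁ _ (by simp) (by simp))
  refine Runs.seq (B₂ := 7 * k + 10) (loadDigits_runs τ₁ n (x J) hT₁ h1 a2) (by omega) ?_
  intro τ₂ hF₂ b1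
  have hk₂ : ∀ a, a ≠ vAcc → a ≠ aTuple → τ₂.nat a = τ₁.nat a := fun a h h' =>
    hF₂.nat a (by simp [loadDigits, Cmd.block, Cmd.KeepsNat, h, h'])
  have hr₂ : τ₂.real = τ.real := by
    rw [← hr₁]
    funext a; exact hF₂.real a (by simp [loadDigits, Cmd.block, Cmd.KeepsReal])
  refine Runs.seq (B₂ := 6 * k + 9) (emitCell_runs τ₂ n (x J) J
    (by rw [hk₂ _ (by simp) (by simp), hk₁ _ (by simp) (by simp), hJ]) b1) (by omega) ?_
  intro τ₃ hF₃ c1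
  have hk₃ : ∀ a, (∀ i, a ≠ .outCell i) → τ₃.nat a = τ₂.nat a := fun a h =>
    hF₃.nat a (by simp [emitCell, Cmd.KeepsNat, h])
  have hr₃ : τ₃.real = τ.real := by
    rw [← hr₂]
    funext a; exact hF₃.real a (by simp [emitCell, Cmd.KeepsReal])
  refine Runs.seq (B₁ := 1) (B₂ := 6 * k + 8) (Q₁ := fun τ' => τ'.nat vAcc 0 = x (J + 1))
    (.of_loopFree trivial le_rfl ?_) (by omega) ?_
  · simp [Cmd.step, NatExpr.eval, hk₃ vNext (by simp), hk₂ vNext (by simp) (by simp), a1]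
  intro τ₄ hF₄ d1
  have hk₄ : ∀ a, a ≠ vAcc → τ₄.nat a = τ₃.nat a := fun a h => hF₄.nat a h
  have hr₄ : τ₄.real = τ.real := by
    rw [← hr₃]
    funext a; exact hF₄.real a trivial
  have hT₄ : Tables τ₄ n := by
    refine hT₁.congr ?_ ?_ ?_ <;>
      rw [hk₄ _ (by simp), hk₃ _ (by simp), hk₂ _ (by simp) (by simp)]
  refine Runs.seq (B₂ := 4 * k + 7) (loadDigits_runs τ₄ n (x (J + 1)) hT₄ h2 d1) (by omega) ?_
  intro τ₅ hF₅ e1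
  have hk₅ : ∀ a, a ≠ vAcc → a ≠ aTuple → τ₅.nat a = τ₄.nat a := fun a h h' =>
    hF₅.nat a (by simp [loadDigits, Cmd.block, Cmd.KeepsNat, h, h'])
  have hr₅ : τ₅.real = τ.real := by
    rw [← hr₄]
    funext a; exact hF₅.real a (by simp [loadDigits, Cmd.block, Cmd.KeepsReal])
  have hk₅' : ∀ a, a ≠ vNext → a ≠ vAcc → a ≠ aTuple → (∀ i, a ≠ .outCell i) →
      τ₅.nat a = τ.nat a := fun a h h' h'' h''' => by
    rw [hk₅ a h' h'', hk₄ a h', hk₃ a h''', hk₂ a h' h'', hk₁ a h h']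
  have hJ₅ : τ₅.nat vCount 0 = J := by
    rw [hk₅' _ (by simp) (by simp) (by simp) (by simp), hJ]
  refine Runs.seq (B₂ := 2 * k + 6) (enlargeCell_runs σ τ₅ n (x (J + 1)) J hJ₅ (fun i => by
    rw [hk₅' _ (by simp) (by simp) (by simp) (by simp), hin]) e1) (by omega) ?_
  intro τ₆ hF₆ f1
  have hk₆ : ∀ a, (∀ i, a ≠ .outCell i) → τ₆.nat a = τ₅.nat a := fun a h =>
    hF₆.nat a (by simp [enlargeCell, Cmd.KeepsNat, h])
  have hr₆ : τ₆.real = τ.real := by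
    rw [← hr₅]
    funext a; exact hF₆.real a (by simp [enlargeCell, Cmd.KeepsReal])
  have hcell₆ : ∀ j < J + 1, ∀ i : Fin k, τ₆.nat (.outCell i) j =
      largerSimplex σ i (digit n (x j) i) (digit n (x (j + 1)) i) := by
    intro j hj i
    have h3 : τ₅.nat (.outCell i) = Function.update (τ.nat (.outCell i)) J (digit n (x J) i) := by
      rw [hk₅ _ (by simp) (by simp), hk₄ _ (by simp), c1 i, hk₂ _ (by simp) (by simp),
        hk₁ _ (by simp) (by simp)]
    rw [f1 i, h3]
    rcases Nat.lt_or_eq_of_le (Nat.lt_succ_iff.1 hj) with hj | rfl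
    · rw [Function.update_of_ne hj.ne, Function.update_of_ne hj.ne, hO.cell j hj i]
    · simp
  refine Runs.seq (B₁ := 1) (B₂ := 2 * k + 5) (Q₁ := fun τ' => τ'.nat vCount 0 = J + 1)
    (.of_loopFree trivial le_rfl ?_) (by omega) ?_
  · simp [Cmd.step, NatExpr.eval, hk₆ vCount (by simp), hJ₅]
  intro τ₇ hF₇ g1
  have hk₇ : ∀ a, a ≠ vCount → τ₇.nat a = τ₆.nat a := fun a h => hF₇.nat a h
  have hr₇ : τ₇.real = τ.real := by
    rw [← hr₆]
    funext a; exact hF₇.real a trivial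
  refine Runs.seq (B₂ := 3) (emitPoint_runs τ₇ n (x (J + 1)) (J + 1) g1 fun i hi => ?_) (by omega) ?_
  · rw [hk₇ _ (by simp), hk₆ _ (by simp), e1 i hi]
  intro τ₈ hF₈ i1
  have hk₈ : τ₈.nat = τ₇.nat := by
    funext a; exact hF₈.nat a (by simp [emitPoint, Cmd.block, Cmd.KeepsNat])
  have hnext : τ₈.nat vNext 0 = x (J + 1) := by
    rw [hk₈, hk₇ _ (by simp), hk₆ _ (by simp), hk₅ _ (by simp) (by simp), hk₄ _ (by simp),
      hk₃ _ (by simp), hk₂ _ (by simp) (by simp), a1]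
  have hgoal : τ₈.nat vGoal 0 = g := by
    rw [hk₈, hk₇ _ (by simp), hk₆ _ (by simp), hk₅' _ (by simp) (by simp) (by simp) (by simp), hg]
  have hfl : τ₈.nat vFlag 0 = 0 := by
    rw [hk₈, hk₇ _ (by simp), hk₆ _ (by simp), hk₅' _ (by simp) (by simp) (by simp) (by simp),
      hflag]
  have hcount : τ₈.nat vCount 0 = J + 1 := by rw [hk₈, g1]
  have hout : OutputPrefix Ω σ n x (J + 1) τ₈ := by
    refine ⟨fun j hj i => ?_, fun j hj i => ?_⟩
    · rw [(i1 i).1, (i1 i).2, hr₇]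
      rcases Nat.lt_or_eq_of_le hj with hj | rfl
      · rw [Function.update_of_ne hj.ne, Function.update_of_ne hj.ne]
        exact hO.point j (by omega) i
      · simp
    · rw [hk₈, hk₇ _ (by simp)]
      exact hcell₆ j hj i
  refine Runs.seq (B₁ := 2) (B₂ := 1) (Q₁ := fun τ' => τ'.nat vCount 0 = J + 1 ∧
      τ'.nat vNext 0 = x (J + 1) ∧ OutputPrefix Ω σ n x (J + 1) τ' ∧
      τ'.nat vFlag 0 = if x (J + 1) = g then 1 else 0) ?_ (by omega) ?_
  · refine .ite (B := 1) (fun hc => .of_loopFree trivial le_rfl ?_)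
      fun hc => .of_loopFree trivial le_rfl ?_
    · simp only [Cond.Holds, NatExpr.eval, hnext, hgoal] at hc
      simp [Cmd.step, NatExpr.eval, Memory.nat_setNat_of_ne, hcount, hnext, hc]
      exact ⟨hout.point, fun j hj i => by
        rw [Memory.nat_setNat_of_ne _ (by simp)]; exact hout.cell j hj i⟩
    · simp only [Cond.Holds, NatExpr.eval, hnext, hgoal] at hc
      exact ⟨hcount, hnext, hout, by simp [Cmd.step, hc, hfl]⟩
  · rintro τ₉ - ⟨j1, j2, j3, j4⟩
    refine .of_loopFree trivial le_rfl ?_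
    refine ⟨?_, ?_, ⟨j3.point, fun j hj i => ?_⟩, ?_⟩
    · simp [Cmd.step, NatExpr.eval, Memory.nat_setNat_of_ne, j1]
    · simp [Cmd.step, NatExpr.eval, Memory.nat_setNat_of_ne, j2]
    · simp only [Cmd.step]
      rw [Memory.nat_setNat_of_ne _ (by simp)]; exact j3.cell j hj i
    · simp only [Cmd.step]
      rw [Memory.nat_setNat_of_ne _ (by simp)]; exact j4

/-- If the parents of the nodes in `X` lead to the goal `g`, then the output is the path of parents
from the parent of the auxiliary node. -/
theorem writePath_runs (σ τ : Memory k) (n g s₀ M : ℕ) (hT : Tables τ n)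
    (hin : ∀ i, τ.nat (.faceCount i) = σ.nat (.faceCount i)) (hN : τ.nat vTotal 0 = n ^ k)
    (hg : τ.nat vGoal 0 = g) (hs : τ.nat aPar (n ^ k) = s₀) (hgg : τ.nat aPar g = g)
    (rank : ℕ → ℕ) (X : Set ℕ) (hsX : s₀ ∈ X) (hgX : g ∈ X)
    (hX : ∀ x ∈ X, x ≤ n ^ k ∧ rank x ≤ M ∧
      (x = g ∨ τ.nat aPar x ∈ X ∧ rank (τ.nat aPar x) < rank x)) :
    Runs Ω writePath τ ((9 * k + 14) * (M + 1) + 4 * k + 9) (fun τ' => ∃ J, 1 ≤ J ∧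
      τ'.outLength = J ∧ (τ.nat aPar)^[J] s₀ = g ∧ (∀ j, (τ.nat aPar)^[j] s₀ ∈ X) ∧
      OutputPrefix Ω σ n (fun j => (τ.nat aPar)^[j] s₀) J τ') := by
  set par := τ.nat aPar with hpar
  let x : ℕ → ℕ := fun j => par^[j] s₀
  have hsucc : ∀ j, x (j + 1) = par (x j) := fun j => Function.iterate_succ_apply' _ _ _
  have hxX : ∀ j, x j ∈ X := by
    intro j
    induction j with
    | zero => exact hsX
    | succ j ih =>
      rw [hsucc]
      rcases (hX _ ih).2.2 with h | h
      · rwa [h, hgg]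
      · exact h.1
  refine Runs.seq (B₁ := 4) (B₂ := (9 * k + 14) * (M + 1) + 4 * k + 5)
    (Q₁ := fun τ' => τ'.nat vCell 0 = x 0 ∧ τ'.nat vAcc 0 = x 0 ∧ τ'.nat vCount 0 = 0 ∧
      τ'.nat vFlag 0 = 0)
    (.of_loopFree (by simp [Cmd.block, Cmd.LoopFree]) (by simp [Cmd.block, Cmd.cost])
      (by simp [Cmd.block, Cmd.step, NatExpr.eval, Memory.nat_setNat_of_ne, hN, ← hpar, hs, x]))
    (by omega) ?_
  rintro τ₁ hF₁ ⟨a1, a2, a3, a4⟩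
  have hk₁ : ∀ a, (∀ b ∈ [vCell, vAcc, vCount, vFlag], a ≠ b) → τ₁.nat a = τ.nat a := fun a h => by
    simp at h
    exact hF₁.nat a (by simp [Cmd.block, Cmd.KeepsNat, h])
  have hT₁ := hT.congr (hk₁ _ (by simp)) (hk₁ _ (by simp)) (hk₁ _ (by simp))
  refine Runs.seq (B₂ := (9 * k + 14) * (M + 1) + 2 * k + 4)
    (loadDigits_runs τ₁ n (x 0) hT₁ (hX _ (hxX 0)).1 a2) (by omega) ?_
  intro τ₂ hF₂ b1
  have hk₂ : ∀ a, a ≠ vAcc → a ≠ aTuple → τ₂.nat a = τ₁.nat a := fun a h h' =>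
    hF₂.nat a (by simp [loadDigits, Cmd.block, Cmd.KeepsNat, h, h'])
  refine Runs.seq (B₂ := (9 * k + 14) * (M + 1) + 2) (emitPoint_runs τ₂ n (x 0) 0
    (by rw [hk₂ _ (by simp) (by simp), a3]) b1) (by omega) ?_
  intro τ₃ hF₃ c1
  have hk₃ : τ₃.nat = τ₂.nat := by
    funext a; exact hF₃.nat a (by simp [emitPoint, Cmd.block, Cmd.KeepsNat])
  have hk₃' : ∀ a, (∀ b ∈ [vCell, vAcc, vCount, vFlag, aTuple], a ≠ b) → τ₃.nat a = τ.nat a :=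
    fun a h => by
      rw [hk₃, hk₂ a (h _ (by simp)) (h _ (by simp)), hk₁ a]
      intro b hb
      exact h b (by simp at hb ⊢; tauto)
  refine Runs.seq (B₁ := (9 * k + 14) * (M + 1) + 1) (B₂ := 1) (Q₁ := fun τ' => ∃ J, 1 ≤ J ∧
      τ'.nat vCount 0 = J ∧ x J = g ∧ OutputPrefix Ω σ n x J τ') ?_ (by omega) ?_
  · refine (Runs.while (Ω := Ω)
      (fun τ' => ∃ J, τ'.nat vCount 0 = J ∧ τ'.nat vCell 0 = x J ∧ OutputPrefix Ω σ n x J τ' ∧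
        (τ'.nat vFlag 0 ≠ 0 → 1 ≤ J ∧ x J = g))
      (fun τ' => if τ'.nat vFlag 0 = 0 then (9 * k + 14) * (rank (τ'.nat vCell 0) + 1) else 0)
      ⟨0, ?_, ?_, ⟨fun j hj i => ?_, by simp⟩, ?_⟩ ?_).mono ?_ ?_
    · rw [hk₃, hk₂ _ (by simp) (by simp), a3]
    · rw [hk₃, hk₂ _ (by simp) (by simp), a1]
    · obtain rfl : j = 0 := by omega
      rw [(c1 i).1, (c1 i).2]
      simp
    · rw [hk₃, hk₂ _ (by simp) (by simp), a4]
      simp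
    · rintro τ₄ hF₄ ⟨J, d1, d2, d3, d4⟩ hcond
      simp only [Cond.Holds, NatExpr.eval] at hcond
      have hk₄ : ∀ a, (∀ b ∈ [vNext, vAcc, aTuple, vCount, vFlag, vCell], a ≠ b) →
          (∀ i, a ≠ .outCell i) → τ₄.nat a = τ.nat a := fun a h h' => by
        rw [hF₄.nat a (emitSegment_keepsNat h h'), hk₃' a]
        intro b hb
        exact h b (by simp at hb ⊢; tauto)
      refine ⟨9 * k + 13, (emitSegment_runs σ τ₄ n J g x (hT.congr (hk₄ _ (by simp) (by simp))
        (hk₄ _ (by simp) (by simp)) (hk₄ _ (by simp) (by simp))) (fun i => ?_) d1 ?_ hcond d2 ?_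
        (hX _ (hxX J)).1 (hX _ (hxX (J + 1))).1 d3).mono le_rfl ?_⟩
      · rw [hk₄ _ (by simp) (by simp), hin]
      · rw [hk₄ _ (by simp) (by simp), hg]
      · rw [hk₄ _ (by simp) (by simp), hsucc]
      · rintro τ₅ - ⟨e1, e2, e3, e4⟩
        refine ⟨⟨J + 1, e1, e2, e3, fun h => ⟨by omega, ?_⟩⟩, ?_⟩
        · by_contra hne
          rw [if_neg hne] at e4
          exact h e4
        · rw [if_pos hcond, d2, e2, e4]
          by_cases hgJ : x (J + 1) = g
          · rw [if_pos hgJ]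
            simp only [one_ne_zero, if_false]
            nlinarith
          · rw [if_neg hgJ, if_pos rfl]
            rcases (hX _ (hxX J)).2.2 with h | h
            · rw [hsucc, h, hgg] at hgJ
              exact absurd rfl hgJ
            · rw [← hsucc] at h
              have := Nat.mul_le_mul_left (9 * k + 14) h.2
              rw [Nat.succ_eq_add_one] at this
              rw [Nat.mul_succ (9 * k + 14) (rank (x J))]
              omega
    · have h1 : τ₃.nat vFlag 0 = 0 := by rw [hk₃, hk₂ _ (by simp) (by simp), a4]
      have h2 : τ₃.nat vCell 0 = x 0 := by rw [hk₃, hk₂ _ (by simp) (by simp), a1]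
      simp only [h1, h2, if_true]
      have := (hX _ (hxX 0)).2.1
      gcongr
    · rintro τ₄ - ⟨⟨J, d1, d2, d3, d4⟩, hcond⟩
      simp only [Cond.Holds, NatExpr.eval] at hcond
      exact ⟨J, (d4 hcond).1, d1, (d4 hcond).2, d3⟩
  · rintro τ₄ - ⟨J, d1, d2, d3, d4⟩
    refine .of_loopFree trivial le_rfl ⟨J, d1, ?_, d3, hxX, ⟨d4.point, fun j hj i => ?_⟩⟩
    · simp [Memory.outLength, Cmd.step, NatExpr.eval, d2]
    · simp only [Cmd.step]
      rw [Memory.nat_setNat_of_ne _ (by simp)]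
      exact d4.cell j hj i

end Machine

section Machine

variable {k : ℕ} {Ω : CellSolver k}

/-! ### The whole program -/

/-- Writes a path of cells from the start to the target along which the largest minimum perimeter
is as small as possible. -/
def findMotion : Cmd k :=
  .seq buildGraph (.seq resetGraph (.seq bottleneckLoop (.seq
    (.assign vPivot (.get aAct (.const 0))) (.seq resetGraph (.seq searchActive writePath)))))

/-- In the tree of a search that reaches `s` from `t`, the parents of `s` lead to `t`. -/
theorem SearchResult.exists_rank {f g : ℕ → ℕ} {s t : ℕ} {all low : List ℕ} {lab par : ℕ → ℕ}
    (h : SearchResult f g s t all low lab par) (hsub : ∀ e ∈ low, e ∈ all)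
    (hst : Conn f g {e | e ∈ low} s t) :
    par t = t ∧ ∃ (rank : ℕ → ℕ) (X : Set ℕ), s ∈ X ∧ t ∈ X ∧ ∀ x ∈ X,
      rank x ≤ 4 * all.length + 2 ∧ (x = t ∨ par x ∈ X ∧ rank (par x) < rank x ∧
        EdgeRel f g {e | e ∈ low} (par x) x) := by
  obtain ⟨q, n, hn, hq0, hpt, hlt, hmem, hpar⟩ := h.forest
  let rank : ℕ → ℕ := fun x => sInf {i | q i = x}
  refine ⟨hpt, rank, {x | x ∈ rootList f g s t all ∧ Conn f g {e | e ∈ low} x t},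
    ⟨mem_rootList.2 (by simp), hst⟩, ⟨mem_rootList.2 (by simp), .refl _⟩, ?_⟩
  rintro x ⟨hx, hxt⟩
  obtain ⟨i₀, hi₀, hqi₀⟩ := hmem x hx
  have hne : {i | q i = x}.Nonempty := ⟨i₀, hqi₀⟩
  have hq : q (rank x) = x := Nat.sInf_mem hne
  have hle : rank x ≤ i₀ := Nat.sInf_le hqi₀
  refine ⟨by omega, ?_⟩
  rcases hpar (rank x) (by omega) with ⟨h1, h2⟩ | ⟨i', hi', h1, h2⟩
  · -- A root of the forest in the component of `t` has the label of `t`, and is thus `t`.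
    left
    rw [hq] at h1 h2
    have := (h.lab_eq_iff x hx t (mem_rootList.2 (by simp))).2 hxt
    omega
  · right
    rw [hq] at h1 h2
    have hp : q i' ∈ rootList f g s t all := by
      obtain ⟨e, he, h3⟩ := h2
      refine mem_rootList.2 (Or.inr (Or.inr ⟨e, hsub e he, ?_⟩))
      rcases h3 with h3 | h3
      · exact Or.inl h3.1.symm
      · exact Or.inr h3.2.symm
    rw [h1]
    exact ⟨⟨hp, (Conn.of_edge h2).trans hxt⟩, (Nat.sInf_le rfl : rank (q i') ≤ i').trans_lt hi', h2⟩

theorem IsCellEdge.fst {σ : Memory k} {n a b : ℕ} (hσ : InputBounds σ n)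
    (h : IsCellEdge σ n a b) : IsCellCode σ n a ∧ a < n ^ k := by
  obtain ⟨hb, ⟨i, r⟩, -, hr, rfl⟩ := h
  have hd : ∀ j < k, Function.update (digit n b) i (σ.nat (.face i) (6 * digit n b i + r)) j <
      σ.nat .size j := by
    intro j hj
    by_cases hji : j = i
    · subst hji
      simpa using hσ.face_lt i _ (hb i i.2) r hr
    · rw [Function.update_of_ne hji]
      exact hb j hj
  have hn : ∀ j < k, Function.update (digit n b) i (σ.nat (.face i) (6 * digit n b i + r)) j < n :=
    fun j hj => (hd j hj).trans_le (hσ.size_le hj)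
  refine ⟨fun j hj => ?_, code_lt hn⟩
  rw [digit_code hn hj]
  exact hd j hj

/-- Chains of edges of the cell graph, with lower ends that satisfy `B`. -/
def CellChain (R : ℕ → ℕ → Prop) (B : ℕ → Prop) : ℕ → ℕ → Prop :=
  Relation.ReflTransGen fun a b => (R a b ∧ B a) ∨ (R b a ∧ B b)

/-- A chain of cells from `s₀` that satisfies `B` is a walk in the list of edges; together with edge
`0`, it starts at the auxiliary node `f₀`. -/
theorem EdgeList.conn {n f₀ s₀ m t : ℕ} {R : ℕ → ℕ → Prop} {τ : Memory k} {B : ℕ → Prop}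
    (h : EdgeList Ω n f₀ s₀ R m τ) (hc : CellChain R B s₀ t) :
    Conn (τ.nat aFst) (τ.nat aSnd) {e | e < τ.nat vEdges 0 ∧ (e = 0 ∨ 1 ≤ e ∧ B (τ.nat aFst e))}
      f₀ t := by
  refine Conn.trans (v := s₀) (Conn.of_edge ?_) ?_
  · exact ⟨0, ⟨h.pos, Or.inl rfl⟩, Or.inl ⟨h.fst_zero, h.snd_zero⟩⟩
  have hstep : ∀ a b, (R a b ∧ B a) ∨ (R b a ∧ B b) → EdgeRel (τ.nat aFst) (τ.nat aSnd)
      {e | e < τ.nat vEdges 0 ∧ (e = 0 ∨ 1 ≤ e ∧ B (τ.nat aFst e))} a b := by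
    rintro a b (⟨hR, hB⟩ | ⟨hR, hB⟩)
    · obtain ⟨e, h1, h2, rfl, rfl⟩ := h.complete _ _ hR
      exact ⟨e, ⟨h2, Or.inr ⟨h1, hB⟩⟩, Or.inl ⟨rfl, rfl⟩⟩
    · obtain ⟨e, h1, h2, rfl, rfl⟩ := h.complete _ _ hR
      exact ⟨e, ⟨h2, Or.inr ⟨h1, hB⟩⟩, Or.inr ⟨rfl, rfl⟩⟩
  exact Relation.ReflTransGen.mono hstep _ _ hc

theorem bottleneckLoop_keepsNat {a : NatArray k}
    (h : ∀ b ∈ [aX, aZ, vI, vJ, vMid, vHi, vOut, vCount, vLen, vBlk, vHalf, vPivot,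
      vLow, vHigh, aLow, aHigh, vRoot, aRoot, aLab, aHead, aTail, aTip, aNext,
      vHalfEdges, vFront, vBack, vRootPos, vHalfEdge, aPar, aQueue, aAct, aSrc, aDst, vAct, vSrc,
      vDst], a ≠ b) : (bottleneckLoop : Cmd k).KeepsNat a := bottleneckRound_keepsNat h

theorem bottleneckLoop_keepsReal {a : RealArray k} : (bottleneckLoop : Cmd k).KeepsReal a :=
  bottleneckRound_keepsReal

theorem setOf_mem_seg_of_eq {act : ℕ → ℕ} {m : ℕ} (h : ∀ e < m, act e = e) :
    {e | e ∈ seg act m} = {e | e < m} := by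
  ext e
  simp only [mem_ofPred_eq, mem_seg]
  constructor
  · rintro ⟨i, hi, rfl⟩
    rwa [h i hi]
  · intro he
    exact ⟨e, he, h e he⟩

/-- Consecutive cells of the output are joined by an edge of the cell graph, unless they are equal,
which is the case at the end of the path. -/
def CellAdj (σ : Memory k) (n a b : ℕ) : Prop := a = b ∨ IsCellEdge σ n a b ∨ IsCellEdge σ n b a

set_option maxHeartbeats 1600000 in
/-- The output runs along the path of parents in the graph of the edges up to the bottleneck edge,
whose weight is `v`. No chain through edges of smaller weight joins the start to the target. The
auxiliary node makes the two nodes to be joined different, and since its only edge has the weight of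
the start cell, the weight of that cell is taken into account as well. -/
theorem findMotion_runs (σ : Memory k) (n : ℕ) (hσ : InputBounds σ n)
    (hmono : ∀ a b, b < n ^ k → IsCellEdge σ n a b → cellWeight Ω n b ≤ cellWeight Ω n a)
    (hconn : CellChain (fun a b => b < n ^ k ∧ IsCellEdge σ n a b) (fun _ => True)
      (code n k (σ.nat .start)) (code n k (σ.nat .target))) :
    Runs Ω findMotion σ ((3 * n + 4) * k + (6 * (k + 11) * k + 4 * k + 14) * n ^ k + 10 * k +
        (8210 + 4 * (9 * k + 14)) * (6 * k * n ^ k + 1) + 3 * (9 * k + 14) + 150)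
      (fun τ => ∃ (J : ℕ) (x : ℕ → ℕ) (v : ℝ), 1 ≤ J ∧ τ.outLength = J ∧
        x 0 = code n k (σ.nat .start) ∧ x J = code n k (σ.nat .target) ∧
        OutputPrefix Ω σ n x J τ ∧
        (∀ j, x j < n ^ k ∧ IsCellCode σ n (x j) ∧ cellWeight Ω n (x j) ≤ v) ∧
        (∀ j, CellAdj σ n (x j) (x (j + 1))) ∧
        ¬ (cellWeight Ω n (code n k (σ.nat .start)) < v ∧
          CellChain (fun a b => b < n ^ k ∧ IsCellEdge σ n a b) (fun a => cellWeight Ω n a < v)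
            (code n k (σ.nat .start)) (code n k (σ.nat .target)))) := by
  set s₀ := code n k (σ.nat .start) with hs₀
  set t₀ := code n k (σ.nat .target) with ht₀
  have hsn : ∀ i < k, σ.nat .start i < n := fun i hi => (hσ.start_lt i hi).trans_le (hσ.size_le hi)
  have htn : ∀ i < k, σ.nat .target i < n :=
    fun i hi => (hσ.target_lt i hi).trans_le (hσ.size_le hi)
  have hslt : s₀ < n ^ k := code_lt hsn
  have htlt : t₀ < n ^ k := code_lt htn
  have hscode : IsCellCode σ n s₀ := fun i hi => by
    rw [hs₀, digit_code hsn hi]; exact hσ.start_lt i hi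
  have htcode : IsCellCode σ n t₀ := fun i hi => by
    rw [ht₀, digit_code htn hi]; exact hσ.target_lt i hi
  refine Runs.seq (B₂ := (8210 + 4 * (9 * k + 14)) * (6 * k * n ^ k + 1) + 3 * (9 * k + 14) +
    4 * k + 126) (buildGraph_runs σ n hσ) (by omega) ?_
  intro τ₁ _ hG
  have hE := hG.edges
  set m := τ₁.nat vEdges 0 with hm
  have hmle : m ≤ 6 * k * n ^ k + 1 := hE.le
  set f := τ₁.nat aFst with hf
  set g := τ₁.nat aSnd with hg
  set W := τ₁.real rW with hW
  have hf0 : f 0 = n ^ k := hE.fst_zero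
  have hg0 : g 0 = s₀ := hE.snd_zero
  have hW0 : W 0 = cellWeight Ω n s₀ := hE.weight_zero
  suffices H : Runs Ω (.seq resetGraph (.seq bottleneckLoop (.seq
      (.assign vPivot (.get aAct (.const 0))) (.seq resetGraph (.seq searchActive writePath))))) τ₁
      ((8210 + 4 * (9 * k + 14)) * m + 3 * (9 * k + 14) + 4 * k + 126)
      (fun τ => ∃ (J : ℕ) (x : ℕ → ℕ) (v : ℝ), 1 ≤ J ∧ τ.outLength = J ∧
        x 0 = s₀ ∧ x J = t₀ ∧ OutputPrefix Ω σ n x J τ ∧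
        (∀ j, x j < n ^ k ∧ IsCellCode σ n (x j) ∧ cellWeight Ω n (x j) ≤ v) ∧
        (∀ j, CellAdj σ n (x j) (x (j + 1))) ∧
        ¬ (cellWeight Ω n s₀ < v ∧
          CellChain (fun a b => b < n ^ k ∧ IsCellEdge σ n a b) (fun a => cellWeight Ω n a < v)
            s₀ t₀)) by
    refine H.mono ?_ fun τ _ h => h
    have := Nat.mul_le_mul_left (8210 + 4 * (9 * k + 14)) hmle
    omega
  rw [add_mul]
  refine Runs.seq (B₂ := 8205 * m + 4 * (9 * k + 14) * m + 3 * (9 * k + 14) + 4 * k + 121)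
    (resetGraph_runs τ₁ m rfl) (by omega) ?_
  rintro τ₂ hF₂ ⟨⟨a1, a2, a3⟩, a4⟩
  rw [hG.total] at a2
  rw [hG.goal] at a3
  have hk₂ : ∀ a, (∀ b ∈ [vCount, aAct, aSrc, aDst, vAct, vSrc, vDst], a ≠ b) →
      τ₂.nat a = τ₁.nat a := fun a h => hF₂.nat a (resetGraph_keepsNat h)
  have hw₂ : τ₂.real rW = W := hF₂.real _ resetGraph_keepsReal
  have hset₂ := setOf_mem_seg_of_eq (m := m) fun e he => (a4 e he).1
  have hAG : ActiveGraph τ₂ m := by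
    refine ⟨a1, nodup_seg.2 fun i hi j hj hij => ?_, ?_, ?_⟩
    · rwa [(a4 i hi).1, (a4 j hj).1] at hij
    · rw [a2, a3]; omega
    · rw [hset₂, a2, a3]
      exact Conn.congr (fun e he => (a4 e he).2.1) (fun e he => (a4 e he).2.2)
        (Conn.mono (fun e he => he.1) (hE.conn hconn))
  refine Runs.seq (B₂ := 205 * m + 4 * (9 * k + 14) * m + 3 * (9 * k + 14) + 4 * k + 120)
    (bottleneckLoop_runs τ₂ m hAG) (by omega) ?_
  intro τ₃ hF₃ hB
  set p := τ₃.nat aAct 0 with hp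
  have hk₃ : ∀ a, (∀ b ∈ [aX, aZ, vI, vJ, vMid, vHi, vOut, vCount, vLen, vBlk, vHalf, vPivot,
      vLow, vHigh, aLow, aHigh, vRoot, aRoot, aLab, aHead, aTail, aTip, aNext,
      vHalfEdges, vFront, vBack, vRootPos, vHalfEdge, aPar, aQueue, aAct, aSrc, aDst, vAct, vSrc,
      vDst], a ≠ b) → τ₃.nat a = τ₁.nat a := fun a h => by
    rw [hF₃.nat a (bottleneckLoop_keepsNat h), hk₂ a fun b hb => h b ?_]
    simp at hb ⊢
    tauto
  have hw₃ : τ₃.real rW = W := by rw [hF₃.real _ bottleneckLoop_keepsReal, hw₂]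
  unfold ActiveBottleneck at hB
  rw [hset₂, hw₂, a2, a3] at hB
  obtain ⟨hB1, hB2, hB3⟩ := hB
  refine Runs.seq (B₁ := 1)
    (B₂ := 205 * m + 4 * (9 * k + 14) * m + 3 * (9 * k + 14) + 4 * k + 119)
    (Q₁ := fun τ => τ.nat vPivot 0 = p)
    (.of_loopFree trivial le_rfl (by simp [Cmd.step, NatExpr.eval, hp])) (by omega) ?_
  intro τ₄ hF₄ c1
  have hk₄ : ∀ a, a ≠ vPivot → τ₄.nat a = τ₃.nat a := fun a h => hF₄.nat a h
  have hw₄ : τ₄.real rW = W := by rw [hF₄.real _ trivial, hw₃]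
  refine Runs.seq (B₂ := 200 * m + 4 * (9 * k + 14) * m + 3 * (9 * k + 14) + 4 * k + 114)
    (resetGraph_runs τ₄ m (by rw [hk₄ _ (by simp), hk₃ _ (by simp)])) (by omega) ?_
  rintro τ₅ hF₅ ⟨⟨d1, d2, d3⟩, d4⟩
  have hk₅ : ∀ a, (∀ b ∈ [vCount, aAct, aSrc, aDst, vAct, vSrc, vDst], a ≠ b) →
      τ₅.nat a = τ₄.nat a := fun a h => hF₅.nat a (resetGraph_keepsNat h)
  have hw₅ : τ₅.real rW = W := by rw [hF₅.real _ resetGraph_keepsReal, hw₄]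
  rw [hk₄ _ (by simp), hk₃ _ (by simp), hG.total] at d2
  rw [hk₄ _ (by simp), hk₃ _ (by simp), hG.goal] at d3
  rw [hk₄ aFst (by simp), hk₃ aFst (by simp), hk₄ aSnd (by simp), hk₃ aSnd (by simp), ← hf, ← hg]
    at d4
  have hset₅ := setOf_mem_seg_of_eq (m := m) fun e he => (d4 e he).1
  refine Runs.seq (B₂ := 4 * (9 * k + 14) * m + 3 * (9 * k + 14) + 4 * k + 14)
    (searchActive_runs τ₅ m d1) (by omega) ?_
  rintro τ₆ hF₆ ⟨-, -, hS⟩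
  have hk₆ : ∀ a, (∀ b ∈ [vLow, vHigh, vCount, aLow, aHigh, vRoot, aRoot, aLab, aHead, aTail,
      aTip, aNext, vHalfEdges, vFront, vBack, vRootPos, vHalfEdge, aPar, aQueue], a ≠ b) →
      τ₆.nat a = τ₅.nat a := fun a ha => hF₆.nat a (searchActive_keepsNat ha)
  rw [hw₅, d2, d3, hk₅ vPivot (by simp), c1] at hS
  have hlow : {e | e ∈ lowPart W p (seg (τ₅.nat aAct) m)} = {e | e < m ∧ KeyLe W e p} := by
    ext e
    have := Set.ext_iff.1 hset₅ e
    simp only [mem_ofPred_eq] at this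
    simp only [mem_ofPred_eq, mem_lowPart, this]
  -- The contracted ends have been reset, so that the search takes place in the whole cell graph.
  have hcong : ∀ {u v}, EdgeRel (τ₅.nat aSrc) (τ₅.nat aDst)
      {e | e ∈ lowPart W p (seg (τ₅.nat aAct) m)} u v →
      EdgeRel f g {e | e < m ∧ KeyLe W e p} u v := by
    rintro u v ⟨e, he, h⟩
    rw [hlow] at he
    rw [(d4 e he.1).2.1, (d4 e he.1).2.2] at h
    exact ⟨e, he, h⟩
  have hst : Conn (τ₅.nat aSrc) (τ₅.nat aDst) {e | e ∈ lowPart W p (seg (τ₅.nat aAct) m)}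
      (n ^ k) t₀ := by
    rw [hlow]
    have h1 : Conn f g {e | e < m ∧ KeyLe W e p} (n ^ k) t₀ :=
      Conn.congr (E := {e | e < m ∧ KeyLe W e p}) (fun e he => ((a4 e he.1).2.1).symm)
        (fun e he => ((a4 e he.1).2.2).symm) hB2
    exact Conn.congr (fun e he => (d4 e he.1).2.1) (fun e he => (d4 e he.1).2.2) h1
  obtain ⟨hpart, rank, X, hNX, htX, hX⟩ := hS.exists_rank (fun e he => (mem_lowPart.1 he).1) hst
  rw [length_seg] at hX
  set par := τ₆.nat aPar with hpar
  have hNt : n ^ k ≠ t₀ := by omega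
  have hend : ∀ e, 1 ≤ e → e < m → (f e < n ^ k ∧ IsCellCode σ n (f e)) ∧
      (g e < n ^ k ∧ IsCellCode σ n (g e)) ∧ IsCellEdge σ n (f e) (g e) ∧
      W e = cellWeight Ω n (f e) := by
    intro e h1 h2
    obtain ⟨⟨h3, h4⟩, h5⟩ := hE.sound e h1 h2
    have h6 := IsCellEdge.fst hσ h4
    exact ⟨⟨h6.2, h6.1⟩, ⟨h3, h4.1⟩, h4, h5⟩
  obtain ⟨-, hN⟩ := hX _ hNX
  obtain ⟨hparX, hrankN, hedgeN⟩ := hN.resolve_left hNt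
  -- The only edge at the auxiliary node is the one with number `0`.
  obtain ⟨h0low, hparN⟩ : KeyLe W 0 p ∧ par (n ^ k) = s₀ := by
    obtain ⟨e, ⟨he, hep⟩, h⟩ := hcong hedgeN
    rcases Nat.eq_zero_or_pos e with rfl | he1
    · refine ⟨hep, ?_⟩
      rw [hf0, hg0] at h
      rcases h with h | h
      · omega
      · exact h.2.symm
    · obtain ⟨h1, h2, -⟩ := hend e he1 he
      rcases h with h | h <;> omega
  let X' : Set ℕ := {x | x ∈ X ∧ rank x < rank (n ^ k) ∧ x < n ^ k ∧ IsCellCode σ n x ∧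
    cellWeight Ω n x ≤ W p}
  have hstep : ∀ x ∈ X', x ≠ t₀ → par x ∈ X' ∧ rank (par x) < rank x ∧ CellAdj σ n x (par x) := by
    rintro x ⟨hx1, hx2, hx3, hx4, hx5⟩ hne
    obtain ⟨h1, h2, h3⟩ := (hX x hx1).2.resolve_left hne
    obtain ⟨e, ⟨he, hep⟩, h⟩ := hcong h3
    rcases Nat.eq_zero_or_pos e with rfl | he1
    · rw [hf0, hg0] at h
      rcases h with h | h
      · -- Ranks decrease, so that the path does not return to the auxiliary node.
        rw [← h.1] at h2
        omega
      · omega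
    · obtain ⟨⟨b1, b2⟩, ⟨b3, b4⟩, b5, b6⟩ := hend e he1 he
      have hWe : cellWeight Ω n (f e) ≤ W p := b6 ▸ hep.1
      have hWg : cellWeight Ω n (g e) ≤ W p := (hmono _ _ b3 b5).trans hWe
      rcases h with ⟨h4, h5⟩ | ⟨h4, h5⟩
      · rw [← h4] at h1 h2 ⊢
        exact ⟨⟨h1, by omega, b1, b2, hWe⟩, h2, Or.inr (Or.inr (h5 ▸ b5))⟩
      · rw [← h5] at h1 h2 ⊢
        exact ⟨⟨h1, by omega, b3, b4, hWg⟩, h2, Or.inr (Or.inl (h4 ▸ b5))⟩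
  have hsX' : s₀ ∈ X' := by
    rw [hparN] at hparX hrankN
    refine ⟨hparX, hrankN, hslt, hscode, ?_⟩
    rw [← hW0]
    exact h0low.1
  have hT₆ : Tables τ₆ n := by
    refine hG.tables.congr ?_ ?_ ?_ <;>
      rw [hk₆ _ (by simp), hk₅ _ (by simp), hk₄ _ (by simp), hk₃ _ (by simp)]
  -- The target belongs to the set, since the path of parents of the start ends there.
  have htX' : t₀ ∈ X' := by
    have key : ∀ r, ∀ x ∈ X', rank x ≤ r → t₀ ∈ X' := by
      intro r
      induction r with
      | zero =>
        intro x hx hr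
        by_cases hxt : x = t₀
        · exact hxt ▸ hx
        · have := (hstep x hx hxt).2.1
          omega
      | succ r ih =>
        intro x hx hr
        by_cases hxt : x = t₀
        · exact hxt ▸ hx
        · obtain ⟨h1, h2, -⟩ := hstep x hx hxt
          exact ih _ h1 (by omega)
    exact key _ s₀ hsX' le_rfl
  refine (writePath_runs σ τ₆ n t₀ s₀ (4 * m + 2) hT₆ (fun i => ?_) ?_ ?_ hparN hpart rank X' hsX'
    htX' ?_).mono ?_ ?_
  · rw [hk₆ _ (by simp), hk₅ _ (by simp), hk₄ _ (by simp), hk₃ _ (by simp), hG.input _ (by simp)]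
  · rw [hk₆ _ (by simp), hk₅ _ (by simp), hk₄ _ (by simp), hk₃ _ (by simp), hG.total]
  · rw [hk₆ _ (by simp), hk₅ _ (by simp), hk₄ _ (by simp), hk₃ _ (by simp), hG.goal]
  · intro x hx
    refine ⟨hx.2.2.1.le, (hX x hx.1).1, ?_⟩
    by_cases hxt : x = t₀
    · exact Or.inl hxt
    · exact Or.inr ⟨(hstep x hx hxt).1, (hstep x hx hxt).2.1⟩
  · ring_nf
    omega
  · rintro τ₇ - ⟨J, e1, e2, e3, e4, e5⟩
    refine ⟨J, fun j => par^[j] s₀, W p, e1, e2, rfl, e3, e5, fun j => ?_, fun j => ?_, ?_⟩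
    · obtain ⟨-, -, h1, h2, h3⟩ := e4 j
      exact ⟨h1, h2, h3⟩
    · simp only [Function.iterate_succ_apply']
      by_cases hxt : par^[j] s₀ = t₀
      · rw [hxt, hpart]
        exact Or.inl rfl
      · exact (hstep _ (e4 j) hxt).2.2
    · rintro ⟨h1, h2⟩
      refine hB3 (Conn.congr (fun e he => (a4 e he.1).2.1) (fun e he => (a4 e he.1).2.2)
        (Conn.mono ?_ (hE.conn h2)))
      rintro e ⟨he, h3⟩
      have hlt : W e < W p := by
        rcases h3 with rfl | ⟨h3, h4⟩
        · rw [hW0]; exact h1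
        · rw [show W e = _ from (hE.sound e h3 he).2]; exact h4
      exact ⟨he, ⟨hlt.le, fun h => absurd h.1 (not_le.2 hlt)⟩, fun h => by
        rw [h] at hlt; exact lt_irrefl _ hlt⟩

end Machine

section Encoding

/-! ### Cells and their codes -/

variable {k : ℕ} {C : Fin k → PlaneComplex} {num : SimplexNumbering C} {s t : Fin k → Plane}
  {σ : Memory k} {Ω : CellSolver k} {n : ℕ}

open scoped Classical in
/-- The cell with the code `c`; entries that are no numbers of simplices are replaced by the empty
set. -/
noncomputable def cellOf (num : SimplexNumbering C) (n c : ℕ) (i : Fin k) : Finset Plane :=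
  if h : digit n c i < (C i).size then (num i ⟨digit n c i, h⟩).1 else ∅

theorem cellOf_eq {c : ℕ} {i : Fin k} (h : digit n c i < (C i).size) :
    cellOf num n c i = (num i ⟨digit n c i, h⟩).1 := dif_pos h

/-- A simplex in the plane has at most six proper faces. -/
theorem faceCount_le (C : PlaneComplex) (num : Fin C.size ≃ C.faces) (j : Fin C.size) :
    {l | (num l).1 ⊂ (num j).1}.ncard ≤ 6 := by
  classical
  set Ψ := (num j).1 with hΨ
  have hind := C.indep Ψ (num j).2
  have hcard : Ψ.card ≤ 3 := by
    have h := hind.card_le_finrank_succ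
    have h' := Submodule.finrank_le (vectorSpan ℝ (Set.range ((↑) : Ψ → Plane)))
    simp only [finrank_euclideanSpace, Fintype.card_fin, Fintype.card_coe] at h h'
    omega
  have hne : Ψ.Nonempty := C.isRelLowerSet_faces.prop_of_mem (num j).2
  let Q := (Ψ.powerset.erase Ψ).erase ∅
  have hQ : Q.card ≤ 6 := by
    have h1 : Q.card = 2 ^ Ψ.card - 1 - 1 := by
      rw [Finset.card_erase_of_mem, Finset.card_erase_of_mem, Finset.card_powerset]
      · simp
      · simp [hne.ne_empty.symm]
    have h2 : 2 ^ Ψ.card ≤ 2 ^ 3 := Nat.pow_le_pow_right (by norm_num) hcard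
    omega
  refine le_trans ?_ hQ
  rw [← Set.ncard_coe_finset Q]
  refine Set.ncard_le_ncard_of_injOn (fun l => (num l).1) ?_ ?_ Q.finite_toSet
  · intro l hl
    have h1 : (num l).1.Nonempty := C.isRelLowerSet_faces.prop_of_mem (num l).2
    simp only [Q, Finset.coe_erase, mem_sdiff, Finset.mem_coe, Finset.mem_powerset,
      mem_singleton_iff]
    exact ⟨⟨hl.1, fun h => hl.2 (h ▸ subset_rfl)⟩, h1.ne_empty⟩
  · intro l _ l' _ h
    exact num.injective (Subtype.ext h)

/-- The list of the proper faces of a simplex contains nothing else, since it is as long as their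
number. -/
theorem Memory.HoldsInput.exists_face_eq (h : σ.HoldsInput C num s t) (i : Fin k)
    (j : Fin (C i).size) {r : ℕ} (hr : r < σ.nat (.faceCount i) j) :
    ∃ l : Fin (C i).size, (num i l).1 ⊂ (num i j).1 ∧ σ.nat (.face i) (6 * j + r) = l := by
  classical
  let A : Finset (Fin (C i).size) := Finset.univ.filter fun l => (num i l).1 ⊂ (num i j).1
  have hA : A.card = σ.nat (.faceCount i) j := by
    rw [h.faceCount i j, ← Set.ncard_coe_finset]
    congr 1
    ext l
    simp [A]
  have hsub : A.image (fun l : Fin (C i).size => (l : ℕ)) ⊆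
      (Finset.range (σ.nat (.faceCount i) j)).image fun r => σ.nat (.face i) (6 * j + r) := by
    intro y hy
    obtain ⟨l, hl, rfl⟩ := Finset.mem_image.1 hy
    obtain ⟨r, hr, hrl⟩ := (h.face i j l).1 (Finset.mem_filter.1 hl).2
    exact Finset.mem_image.2 ⟨r, Finset.mem_range.2 hr, hrl⟩
  have heq := Finset.eq_of_subset_of_card_le hsub (by
    rw [Finset.card_image_of_injective A Fin.val_injective, hA]
    exact Finset.card_image_le.trans (by simp))
  have hmem : σ.nat (.face i) (6 * j + r) ∈ A.image (fun l : Fin (C i).size => (l : ℕ)) := by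
    rw [heq]
    exact Finset.mem_image.2 ⟨r, Finset.mem_range.2 hr, rfl⟩
  obtain ⟨l, hl, hlr⟩ := Finset.mem_image.1 hmem
  exact ⟨l, (Finset.mem_filter.1 hl).2, hlr.symm⟩

theorem Memory.HoldsInput.inputBounds (h : σ.HoldsInput C num s t)
    (hn : n = Finset.univ.sup fun i => (C i).size) : InputBounds σ n := by
  refine ⟨?_, fun i x hx r hr => ?_, fun i hi => ?_, fun i hi => ?_⟩
  · rw [hn]
    refine le_antisymm (Finset.sup_le fun i hi => ?_) (Finset.sup_le fun i _ => ?_)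
    · rw [h.size ⟨i, Finset.mem_range.1 hi⟩]
      exact Finset.le_sup (f := fun i => (C i).size) (Finset.mem_univ _)
    · rw [← h.size i]
      exact Finset.le_sup (f := σ.nat .size) (Finset.mem_range.2 i.2)
  · rw [h.size] at hx ⊢
    obtain ⟨l, -, hl⟩ := h.exists_face_eq i ⟨x, hx⟩ hr
    have := l.2
    simp only at hl
    omega
  · obtain ⟨j, hj, -⟩ := h.start ⟨i, hi⟩
    simp only at hj
    rw [hj, h.size ⟨i, hi⟩]
    exact j.2
  · obtain ⟨j, hj, -⟩ := h.target ⟨i, hi⟩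
    simp only at hj
    rw [hj, h.size ⟨i, hi⟩]
    exact j.2

theorem IsCellCode.lt (h : σ.HoldsInput C num s t) {c : ℕ} (hc : IsCellCode σ n c) (i : Fin k) :
    digit n c i < (C i).size := by
  rw [← h.size i]
  exact hc i i.2

theorem IsCellCode.mem_faces (h : σ.HoldsInput C num s t) {c : ℕ} (hc : IsCellCode σ n c)
    (i : Fin k) : cellOf num n c i ∈ (C i).faces := by
  rw [cellOf_eq (hc.lt h i)]
  exact (num i _).2

theorem exists_cellOf_code (h : σ.HoldsInput C num s t) (hb : InputBounds σ n)
    (d : (i : Fin k) → Fin (C i).size) : ∃ c < n ^ k, IsCellCode σ n c ∧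
      (∀ i : Fin k, digit n c i = d i) ∧ ∀ i, cellOf num n c i = (num i (d i)).1 := by
  let d' : ℕ → ℕ := fun j => if h : j < k then d ⟨j, h⟩ else 0
  have hd' : ∀ i : Fin k, d' i = d i := fun i => dif_pos i.2
  have hlt : ∀ i < k, d' i < n := fun i hi => by
    have h1 := hb.size_le hi
    have h2 := h.size ⟨i, hi⟩
    have h3 := (d ⟨i, hi⟩).2
    have h4 := hd' ⟨i, hi⟩
    simp only at h2 h4
    omega
  have hdig : ∀ i : Fin k, digit n (code n k d') i = d i := fun i => by
    rw [digit_code hlt i.2, hd']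
  refine ⟨code n k d', code_lt hlt, fun i hi => ?_, hdig, fun i => ?_⟩
  · rw [hdig ⟨i, hi⟩, h.size ⟨i, hi⟩]
    exact (d ⟨i, hi⟩).2
  · rw [cellOf_eq (by rw [hdig]; exact (d i).2)]
    congr 2
    exact Fin.ext (hdig i)

theorem exists_cellOf_eq (h : σ.HoldsInput C num s t) (hb : InputBounds σ n)
    {a : Fin k → Finset Plane} (ha : ∀ i, a i ∈ (C i).faces) :
    ∃ c < n ^ k, IsCellCode σ n c ∧ cellOf num n c = a := by
  obtain ⟨c, h1, h2, -, h3⟩ := exists_cellOf_code h hb fun i => (num i).symm ⟨a i, ha i⟩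
  refine ⟨c, h1, h2, ?_⟩
  funext i
  rw [h3 i, Equiv.apply_symm_apply]

/-- The numbers of given vertices are the digits of the code of a cell. -/
theorem cellOf_code_vertices (h : σ.HoldsInput C num s t) (hb : InputBounds σ n) {d : ℕ → ℕ}
    {u : Fin k → Plane} (hd : ∀ i : Fin k, ∃ j, d i = j.val ∧ (num i j).1 = {u i}) :
    code n k d < n ^ k ∧ IsCellCode σ n (code n k d) ∧
      cellOf num n (code n k d) = fun i => {u i} := by
  choose j hj hju using hd
  obtain ⟨c, h1, h2, h3, h4⟩ := exists_cellOf_code h hb j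
  obtain rfl : code n k d = c := by
    rw [← code_digit h1]
    exact code_congr fun i hi => (hj ⟨i, hi⟩).trans (h3 ⟨i, hi⟩).symm
  exact ⟨h1, h2, funext fun i => (h4 i).trans (hju i)⟩

theorem cellOf_injective (h : σ.HoldsInput C num s t) {c c' : ℕ} (hc : c < n ^ k)
    (hc' : c' < n ^ k) (h1 : IsCellCode σ n c) (h2 : IsCellCode σ n c')
    (heq : cellOf num n c = cellOf num n c') : c = c' := by
  rw [← code_digit hc, ← code_digit hc']
  refine code_congr fun i hi => ?_
  have := congrFun heq ⟨i, hi⟩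
  rw [cellOf_eq (h1.lt h ⟨i, hi⟩), cellOf_eq (h2.lt h ⟨i, hi⟩)] at this
  exact congrArg Fin.val ((num ⟨i, hi⟩).injective (Subtype.ext this))

/-- Replacing a digit of a code replaces a simplex of the cell. -/
theorem cellOf_update (h : σ.HoldsInput C num s t) (hb : InputBounds σ n) {c : ℕ}
    (hc : IsCellCode σ n c) (i : Fin k) (l : Fin (C i).size) :
    cellOf num n (code n k (Function.update (digit n c) i l)) =
      Function.update (cellOf num n c) i (num i l).1 := by
  have hd : ∀ j : Fin k, Function.update (digit n c) i l j < (C j).size := by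
    intro j
    by_cases hji : j = i
    · subst hji; simp
    · rw [Function.update_of_ne (fun h => hji (Fin.ext h))]
      exact hc.lt h j
  have hn : ∀ j < k, Function.update (digit n c) i l j < n := fun j hj =>
    (hd ⟨j, hj⟩).trans_le ((h.size ⟨j, hj⟩).symm.le.trans (hb.size_le hj))
  funext j
  have e := digit_code hn j.2
  rw [cellOf_eq (by rw [e]; exact hd j)]
  by_cases hji : j = i
  · subst hji
    rw [Function.update_self] at e
    rw [show Function.update (cellOf num n c) j (num j l).1 j = _ from Function.update_self ..]
    congr 2
    exact Fin.ext e
  · rw [Function.update_of_ne (fun h => hji (Fin.ext h))] at e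
    rw [show Function.update (cellOf num n c) i (num i l).1 j = _ from
      Function.update_of_ne hji .., cellOf_eq (hc.lt h j)]
    congr 2
    exact Fin.ext e

/-- The edges of the cell graph join cells that differ in one simplex, which is replaced by a proper
face. -/
theorem isCellEdge_iff (h : σ.HoldsInput C num s t) (hb : InputBounds σ n) {a b : ℕ}
    (hbc : IsCellCode σ n b) :
    IsCellEdge σ n a b ↔ a < n ^ k ∧ IsCellCode σ n a ∧ ∃ i, ∃ Ψ ∈ (C i).faces,
      Ψ ⊂ cellOf num n b i ∧ cellOf num n a = Function.update (cellOf num n b) i Ψ := by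
  constructor
  · intro hab
    obtain ⟨h1, h2⟩ := IsCellEdge.fst hb hab
    obtain ⟨-, ⟨i, r⟩, -, hr, rfl⟩ := hab
    obtain ⟨l, hl, hlr⟩ := h.exists_face_eq i ⟨digit n b i, hbc.lt h i⟩ hr
    simp only at hlr
    refine ⟨h2, h1, i, _, (num i l).2, ?_, ?_⟩
    · rwa [cellOf_eq (hbc.lt h i)]
    · simp only [hlr]
      exact cellOf_update h hb hbc i l
  · rintro ⟨h1, h2, i, Ψ, hΨ, hss, heq⟩
    obtain ⟨l, hl⟩ := (num i).surjective ⟨Ψ, hΨ⟩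
    obtain rfl : (num i l).1 = Ψ := by rw [hl]
    rw [cellOf_eq (hbc.lt h i)] at hss
    obtain ⟨r, hr, hrl⟩ := (h.face i _ l).1 hss
    have hr6 : r < 6 := hr.trans_le ((h.faceCount i _).le.trans (faceCount_le (C i) (num i) _))
    refine ⟨hbc, (i, r), List.mem_product.2 ⟨by simp, by simpa using hr6⟩, hr, ?_⟩
    have hedge : IsCellEdge σ n (code n k (Function.update (digit n b) i
        (σ.nat (.face i) (6 * digit n b i + r)))) b :=
      ⟨hbc, (i, r), List.mem_product.2 ⟨by simp, by simpa using hr6⟩, hr, rfl⟩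
    obtain ⟨h3, h4⟩ := IsCellEdge.fst hb hedge
    refine cellOf_injective h h1 h4 h2 h3 ?_
    simp only at hrl
    rw [heq, hrl, cellOf_update h hb hbc i l]

/-- A chain of cells is a chain of codes in the cell graph. -/
theorem CellConn.cellChain (h : σ.HoldsInput C num s t) (hb : InputBounds σ n)
    {B : (Fin k → Finset Plane) → Prop} {a b : Fin k → Finset Plane} (hab : CellConn C B a b)
    {ca : ℕ} (hca : ca < n ^ k) (hca' : IsCellCode σ n ca) (ha : cellOf num n ca = a) :
    ∃ cb < n ^ k, IsCellCode σ n cb ∧ cellOf num n cb = b ∧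
      CellChain (fun a b => b < n ^ k ∧ IsCellEdge σ n a b) (fun c => B (cellOf num n c)) ca cb := by
  induction hab with
  | refl => exact ⟨ca, hca, hca', ha, .refl⟩
  | @tail b d _ hstep ih =>
    obtain ⟨cb, h1, h2, rfl, h4⟩ := ih
    rcases hstep with ⟨hf, hB, i, Ψ, hΨ, hss, heq⟩ | ⟨hf, hB, i, Ψ, hΨ, hss, heq⟩
    · obtain ⟨cd, h5, h6, rfl⟩ := exists_cellOf_eq (num := num) h hb hf
      exact ⟨cd, h5, h6, rfl, h4.tail (Or.inl ⟨⟨h5, (isCellEdge_iff h hb h6).2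
        ⟨h1, h2, i, Ψ, hΨ, hss, heq⟩⟩, hB⟩)⟩
    · have hd : ∀ j, d j ∈ (C j).faces := by
        intro j
        rw [heq]
        by_cases hji : j = i
        · subst hji; simpa using hΨ
        · rw [Function.update_of_ne hji]; exact hf j
      obtain ⟨cd, h5, h6, rfl⟩ := exists_cellOf_eq (num := num) h hb hd
      exact ⟨cd, h5, h6, rfl, h4.tail (Or.inr ⟨⟨h1, (isCellEdge_iff h hb h2).2
        ⟨h5, h6, i, Ψ, hΨ, hss, heq⟩⟩, hB⟩)⟩

theorem CellSolver.IsCorrect.isLeast (hΩ : Ω.IsCorrect C num) (h : σ.HoldsInput C num s t) {c : ℕ}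
    (hc : IsCellCode σ n c) :
    IsLeast (configPerimeter '' {p | ∀ i, p i ∈ convexHull ℝ (cellOf num n c i : Set Plane)})
      (cellWeight Ω n c) ∧
    ∀ i, Ω (fun i => digit n c i) i ∈ convexHull ℝ (cellOf num n c i : Set Plane) := by
  have := hΩ fun i => ⟨digit n c i, hc.lt h i⟩
  simp only [← cellOf_eq] at this
  exact this

theorem CellSolver.IsCorrect.cellBelow_iff (hΩ : Ω.IsCorrect C num) (h : σ.HoldsInput C num s t)
    {c : ℕ} (hc : IsCellCode σ n c) {v : ℝ} :
    CellBelow v (cellOf num n c) ↔ cellWeight Ω n c < v := by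
  obtain ⟨h1, h2⟩ := hΩ.isLeast h hc
  constructor
  · rintro ⟨p, hp, hv⟩
    exact (h1.2 ⟨p, hp, rfl⟩).trans_lt hv
  · intro hv
    exact ⟨_, h2, hv⟩

/-- Enlarging a cell does not increase its minimum perimeter. -/
theorem CellSolver.IsCorrect.cellWeight_anti (hΩ : Ω.IsCorrect C num)
    (h : σ.HoldsInput C num s t) {a b : ℕ} (ha : IsCellCode σ n a) (hb : IsCellCode σ n b)
    (hab : ∀ i, cellOf num n a i ⊆ cellOf num n b i) : cellWeight Ω n b ≤ cellWeight Ω n a :=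
  (hΩ.isLeast h hb).1.2 ⟨_, fun i =>
    convexHull_mono (by exact_mod_cast hab i) ((hΩ.isLeast h ha).2 i), rfl⟩

theorem cellOf_subset_of_isCellEdge (h : σ.HoldsInput C num s t) (hb : InputBounds σ n) {a b : ℕ}
    (hab : IsCellEdge σ n a b) (i : Fin k) :
    cellOf num n a i ⊆ cellOf num n b i := by
  obtain ⟨-, -, j, Ψ, -, hss, heq⟩ := (isCellEdge_iff h hb hab.1).1 hab
  rw [heq]
  by_cases hij : i = j
  · subst hij; simpa using hss.1
  · simp [hij]

/-- Of two nested simplices, the larger one has more proper faces. -/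
theorem largerSimplex_eq (h : σ.HoldsInput C num s t) {i : Fin k} {a b : Fin (C i).size}
    (hab : (num i a).1 ⊆ (num i b).1 ∨ (num i b).1 ⊆ (num i a).1) :
    ∃ l : Fin (C i).size, largerSimplex σ i a b = l ∧ (num i a).1 ⊆ (num i l).1 ∧
      (num i b).1 ⊆ (num i l).1 := by
  have key : ∀ a b : Fin (C i).size, (num i a).1 ⊂ (num i b).1 →
      σ.nat (.faceCount i) a < σ.nat (.faceCount i) b := by
    intro a b hss
    rw [h.faceCount, h.faceCount]
    refine Set.ncard_lt_ncard ⟨fun l hl => ?_, fun hsub => ?_⟩ (Set.toFinite _)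
    · exact ssubset_trans (show (num i l).1 ⊂ (num i a).1 from hl) hss
    · exact (hsub (show a ∈ {l | (num i l).1 ⊂ (num i b).1} from hss)).2 subset_rfl
  rw [largerSimplex]
  split_ifs with hlt
  · refine ⟨b, rfl, ?_, subset_rfl⟩
    rcases hab with hab | hab
    · exact hab
    · rcases hab.eq_or_ssubset with heq | hss
      · exact heq ▸ subset_rfl
      · exact absurd (key b a hss) (by omega)
  · refine ⟨a, rfl, subset_rfl, ?_⟩
    rcases hab with hab | hab
    · rcases hab.eq_or_ssubset with heq | hss
      · exact heq ▸ subset_rfl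
      · exact absurd (key a b hss) hlt
    · exact hab

/-- The running time is `O(n ^ k)`; if there are no cells at all, there is nothing to bound. -/
theorem findMotion_bound (k n : ℕ) (hn : 0 < n ^ k) :
    (3 * n + 4) * k + (6 * (k + 11) * k + 4 * k + 14) * n ^ k + 10 * k +
        (8210 + 4 * (9 * k + 14)) * (6 * k * n ^ k + 1) + 3 * (9 * k + 14) + 150 ≤
      (7 * k + (6 * (k + 11) * k + 4 * k + 14) + 10 * k +
        (8210 + 4 * (9 * k + 14)) * (6 * k + 1) + 3 * (9 * k + 14) + 150) * n ^ k := by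
  have h1 : (3 * n + 4) * k ≤ 7 * k * n ^ k := by
    rcases Nat.eq_zero_or_pos k with rfl | hk
    · simp
    · have h2 : n ≤ n ^ k := Nat.le_self_pow hk.ne' n
      calc (3 * n + 4) * k ≤ (7 * n ^ k) * k := Nat.mul_le_mul_right _ (by omega)
        _ = 7 * k * n ^ k := by ring
  have hN : ∀ A, A ≤ A * n ^ k := fun A => Nat.le_mul_of_pos_right A hn
  have h3 : (8210 + 4 * (9 * k + 14)) * (6 * k * n ^ k + 1) ≤
      (8210 + 4 * (9 * k + 14)) * (6 * k + 1) * n ^ k := by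
    rw [mul_assoc (8210 + _) (6 * k + 1), add_mul (6 * k), one_mul]
    exact Nat.mul_le_mul_left _ (by omega)
  have h4 := hN (10 * k)
  have h5 := hN (3 * (9 * k + 14))
  have h6 := hN 150
  linarith

end Encoding

theorem mainTheorem9 (k : ℕ) :
    ∃ (P : Program k) (K : ℕ),
      ∀ (C : Fin k → PlaneComplex) (s t : Fin k → Plane) (num : SimplexNumbering C)
        (Ω : CellSolver k) (σ : Memory k),
        (∀ i, (C i).IsConnected) →
        (∀ i, {s i} ∈ (C i).faces) → (∀ i, {t i} ∈ (C i).faces) →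
        Ω.IsCorrect C num →
        σ.HoldsInput C num s t →
        ∃ (T : ℕ) (σ' : Memory k),
          Exec Ω P.procs P.main σ T σ' ∧
          T ≤ K * (Finset.univ.sup fun i => (C i).size) ^ k ∧
          σ'.HoldsOptimalMotion C num s t := by
  refine ⟨⟨[], findMotion⟩, (7 * k + (6 * (k + 11) * k + 4 * k + 14) + 10 * k +
    (8210 + 4 * (9 * k + 14)) * (6 * k + 1) + 3 * (9 * k + 14) + 150), ?_⟩
  intro C s t num Ω σ hconn hs ht hΩ hin
  set n := Finset.univ.sup fun i => (C i).size with hn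
  have hb : InputBounds σ n := hin.inputBounds hn
  obtain ⟨hS, hS', hScell⟩ := cellOf_code_vertices hin hb hin.start
  obtain ⟨hT, hT', hTcell⟩ := cellOf_code_vertices hin hb hin.target
  obtain ⟨T, σ', hexec, hle, J, x, v, hJ, hlen, hx0, hxJ, hout, hx, hadj, hmin⟩ :=
    findMotion_runs (Ω := Ω) σ n hb
      (fun a b _ hab => hΩ.cellWeight_anti hin (IsCellEdge.fst hb hab).1 hab.1
        (cellOf_subset_of_isCellEdge hin hb hab))
      (by
        obtain ⟨c, h1, h2, h3, h4⟩ := (cellConn_of_isConnected hconn hs ht).cellChain (num := num)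
          hin hb hS hS' hScell
        rwa [cellOf_injective hin h1 hT h2 hT' (h3.trans hTcell.symm)] at h4)
  -- If there are no agents, then `n = 0`, but there still is one cell.
  refine ⟨T, σ', hexec, hle.trans (findMotion_bound k n (Nat.zero_lt_of_lt hS)), ?_⟩
  have hxl : ∀ j, cellOf num n (x j) = fun i => (num i ⟨digit n (x j) i, (hx j).2.1.lt hin i⟩).1 :=
    fun j => funext fun i => cellOf_eq _
  have hface : ∀ j i, cellOf num n (x j) i ∈ (C i).faces := fun j i => (hx j).2.1.mem_faces hin i
  have hnest : ∀ j i, cellOf num n (x j) i ⊆ cellOf num n (x (j + 1)) i ∨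
      cellOf num n (x (j + 1)) i ⊆ cellOf num n (x j) i := by
    intro j i
    rcases hadj j with h | h | h
    · exact Or.inl (h ▸ subset_rfl)
    · exact Or.inl (cellOf_subset_of_isCellEdge hin hb h i)
    · exact Or.inr (cellOf_subset_of_isCellEdge hin hb h i)
  have hcarry : ∀ j i, ∃ l : Fin (C i).size,
      largerSimplex σ i (digit n (x j) i) (digit n (x (j + 1)) i) = l ∧
      cellOf num n (x j) i ⊆ (num i l).1 ∧ cellOf num n (x (j + 1)) i ⊆ (num i l).1 := by
    intro j i
    have h := hnest j i
    rw [hxl, hxl] at h ⊢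
    exact largerSimplex_eq hin h
  -- The simplex that carries a segment is the larger one of the two at its ends.
  choose l hl hl1 hl2 using hcarry
  let p : Fin k → ℕ → Plane := fun i j => !₂[σ'.real (.outX i) j, σ'.real (.outY i) j]
  have hp : ∀ j ≤ J, ∀ i, p i j = Ω (fun i => digit n (x j) i) i := by
    intro j hj i
    obtain ⟨h1, h2⟩ := hout.point j hj i
    ext m
    fin_cases m
    · simpa [p] using h1
    · simpa [p] using h2
  have hpath : σ'.outPath = fun i => polyline J (p i) := by
    funext i
    rw [Memory.outPath, hlen]
  have hφ : ∀ i, ∃ φ, (C i).IsPath (s i) (t i) (polyline J (p i)) φ ∧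
      ∀ j < J, ∀ τ ∈ Icc ((j : ℝ) / J) ((j + 1) / J), φ τ ⊆ (num i (l j i)).1 := by
    intro i
    refine (C i).exists_isPath_polyline hJ (p i) (fun j => cellOf num n (x j) i)
      (fun j => (num i (l j i)).1) (fun j _ => hface j i) (fun j _ => (num i _).2)
      (fun j _ => hl1 j i) (fun j _ => hl2 j i) (fun j hj => ?_) ?_ ?_
    · rw [hp j hj i]
      exact (hΩ.isLeast hin (hx j).2.1).2 i
    · simp only [hx0, hScell]
    · simp only [hxJ, hTcell]
  choose φ hφ hφl using hφ
  refine ⟨φ, ⟨fun i => ⟨hpath ▸ hφ i, continuousOn_id, fun _ h => h, rfl, rfl⟩, ?_⟩,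
    fun i j hj => ⟨l j i, ?_, ?_⟩⟩
  · obtain ⟨j, hj, hgreat⟩ := exists_isGreatest_perimeterValues hJ p
    refine ⟨_, hpath ▸ hgreat, fun π' φ' ρ' hmotion => ?_⟩
    by_contra! hlt
    have hw : configPerimeter (fun i => p i j) = cellWeight Ω n (x j) := by
      rw [cellWeight]
      exact congrArg configPerimeter (funext (hp j hj))
    rw [hw] at hlt
    -- A better motion would pass through a chain of cells below `v`.
    obtain ⟨h1, h2⟩ := hmotion.cellConn fun w hw' => (hlt w hw').trans_le (hx j).2.2
    obtain ⟨c, h3, h4, h5, h6⟩ := h2.cellChain (num := num) hin hb hS hS' hScell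
    rw [cellOf_injective hin h3 hT h4 hT' (h5.trans hTcell.symm)] at h6
    refine hmin ⟨(hΩ.cellBelow_iff hin hS').1 (hScell ▸ h1), ?_⟩
    have hstep : ∀ a b, (b < n ^ k ∧ IsCellEdge σ n a b) ∧ CellBelow v (cellOf num n a) →
        (b < n ^ k ∧ IsCellEdge σ n a b) ∧ cellWeight Ω n a < v := fun a b h =>
      ⟨h.1, (hΩ.cellBelow_iff hin (IsCellEdge.fst hb h.1.2).1).1 h.2⟩
    have hstep' : ∀ a b, ((b < n ^ k ∧ IsCellEdge σ n a b) ∧ CellBelow v (cellOf num n a)) ∨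
          ((a < n ^ k ∧ IsCellEdge σ n b a) ∧ CellBelow v (cellOf num n b)) →
        ((b < n ^ k ∧ IsCellEdge σ n a b) ∧ cellWeight Ω n a < v) ∨
          ((a < n ^ k ∧ IsCellEdge σ n b a) ∧ cellWeight Ω n b < v) := fun a b h =>
      h.imp (hstep a b) (hstep b a)
    exact Relation.ReflTransGen.mono hstep' _ _ h6
  · rw [hlen] at hj
    rw [hout.cell j hj i, hl]
  · rw [hlen] at hj ⊢
    exact hφl i j hj
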